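/- **Setting.** For $n\in\mathbb N=\{1,2,\dots\}$ let $U=\{1,\dots,n\}$. A *2-color choice dictionary with robust iteration* with universe size $n$ maintains an initially empty *client set* $S\subseteq U$, and hence also its complement $\overline S=U\setminus S$, under the following operations, where $\ell\in U$ and $A$ stands for either of $S$ and $\overline S$. - $\mathit{insert}(\ell)$ replaces $S$ by $S\cup\{\ell\}$; $\mathit{delete}(\ell)$ replaces $S$ by $S\setminus\{\ell\}$; $\mathit{contains}(\ell)$ returns $1$ if $\ell\in S$ and $0$ otherwise. - $\mathit{choice}$ and $\overline{\mathit{choice}}$ return an arbitrary element of $S$ and of $\overline S$, respectively, and $0$ if that set is empty. - For each of $A=S$ and $A=\overline S$: $\mathit{iterate.init}$ starts a new iteration over $A$; and, once an iteration over $A$ has been started, $\mathit{iterate.next}$ returns (*enumerates*) an element of $A$ that remains to be enumerated, or $0$ if there is none, and $\mathit{iterate.more}$ returns $1$ if some element of $A$ remains to be enumerated, and $0$ otherwise. The iterations are *robust*: $S$ may change while they are in progress; every element that belongs to $A$ during the entire iteration is certain to be enumerated, and no element is enumerated more than once or at a time when it does not belong to $A$. An iteration over $S$ and one over $\overline S$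 may be in progress at the same time. The machine is a word RAM with word length $w\in\mathbb N$, whose memory is a sequence of $w$-bit words with arbitrary initial contents, and which has a constant number of one-word registers, comparisons, and constant-time addition, subtraction and multiplication modulo $2^w$, truncating division, left shift modulo $2^w$, right shift, bitwise AND, OR and XOR, and an instruction that loads an integer $\sigma(w)$ with $\alpha\sqrt w\le\sigma(w)\le\beta\sqrt w$ for fixed constants $\alpha,\beta>0$. It is assumed that $n\le 2^w$, that the tradeoff parameter $t\in\mathbb N$ fits in a constant number $\kappa$ of words (i.e., $t<2^{\kappa w}$), and that $w$ is large enough for all memory words in use to be addressed. Integers that do not fit in one word are passed to and from operations in a constant number of words. A data structure *occupies* $b$ bits if, between the executions of operations, it stores information only in the first $b$ bits of the memory; apart from a constant number of registers, its operations access only the $\lceil b/w\rceil$ words that contain these bits. It is *systematic* if, beginning in a bit position that depends only on $n$, these $b$ bits contain a sequence of $n$ bits $b_1,\dots,b_n$ such that between operations, for each $\ell\in U$, $b_\ell=1\Leftrightarrow\ell\in S$ once the data structure has stored a value in the memory word that contains $b_\ell$. **Theorem.** For every $\sigma$ and $\kappa$ as above there is a systematic 2-color choice dictionary with robust iteration (a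 single collection of programs, the same for all $w$, $n$ and $t$) that, for arbitrary $n,t\in\mathbb N$, can be initialized for universe size $n$ and tradeoff parameter $t$ in constant time and subsequently occupies $$n+\frac{n}{tw}+O\left(\frac{n}{(tw)^2}+\log_2(n+1)\right)$$ bits and executes each of $\mathit{insert}$, $\mathit{delete}$, $\mathit{contains}$, $\mathit{choice}$, $\overline{\mathit{choice}}$ and, for iteration over the client set and over its complement, $\mathit{iterate.init}$, $\mathit{iterate.next}$ and $\mathit{iterate.more}$ in $O(t)$ time. All constants, including those hidden in the $O$-notation, depend only on $\sigma$ and $\kappa$. -/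

import Mathlib

/-! ## The word RAM

A word RAM with word length `w`, with a structured programming language whose
primitive steps are the unit-time instructions of the machine. A program mentions finitely many
registers, each of which holds one `w`-bit word; these are its transient working space. -/

namespace WordRAM

/-- The binary instructions: addition, subtraction and multiplication modulo `2 ^ w`, division with
truncation, left shift modulo `2 ^ w`, right shift, and the bitwise Boolean operations. -/
inductive BinOp where
  | add | sub | mul | div | shl | shr | and | or | xor

/-- The value of a binary instruction on two words. A shift is by the natural number that the
second word represents. (Division by zero is given the value zero.) -/
def BinOp.eval {w : ℕ} : BinOp → BitVec w → BitVec w → BitVec w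
  | .add, x, y => x + y
  | .sub, x, y => x - y
  | .mul, x, y => x * y
  | .div, x, y => x / y
  | .shl, x, y => x <<< y
  | .shr, x, y => x >>> y
  | .and, x, y => x &&& y
  | .or, x, y => x ||| y
  | .xor, x, y => x ^^^ y

/-- Expressions over registers. `rootWord` loads the machine constant that approximates `√w`. -/
inductive Expr where
  | const (c : ℕ)
  | reg (i : ℕ)
  | rootWord
  | bin (o : BinOp) (e₁ e₂ : Expr)

/-- Comparisons of words, as unsigned integers. -/
inductive Test where
  | lt (e₁ e₂ : Expr)
  | eq (e₁ e₂ : Expr)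

/-- Programs. `load r e` reads the memory word with address `e` into register `r`, and
`store e₁ e₂` writes the word `e₂` to the memory word with address `e₁`. -/
inductive Prog where
  | skip
  | assign (r : ℕ) (e : Expr)
  | load (r : ℕ) (e : Expr)
  | store (e₁ e₂ : Expr)
  | seq (p q : Prog)
  | ite (b : Test) (p q : Prog)
  | loop (b : Test) (p : Prog)

/-- A state of the machine: registers, memory, and a record (which programs cannot inspect) of the
addresses of the memory words to which a value was stored. -/
structure State (w : ℕ) where
  reg : ℕ → BitVec w
  mem : ℕ → BitVec w
  written : Set ℕ

/-- The value of an expression. The function `σ` gives the machine constant `σ w` that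
`rootWord` loads. -/
def Expr.eval (σ : ℕ → ℕ) {w : ℕ} (s : State w) : Expr → BitVec w
  | .const c => BitVec.ofNat w c
  | .reg i => s.reg i
  | .rootWord => BitVec.ofNat w (σ w)
  | .bin o e₁ e₂ => o.eval (e₁.eval σ s) (e₂.eval σ s)

/-- The time to evaluate an expression: one unit for each node. -/
def Expr.cost : Expr → ℕ
  | .const _ => 1
  | .reg _ => 1
  | .rootWord => 1
  | .bin _ e₁ e₂ => 1 + e₁.cost + e₂.cost

def Test.Holds (σ : ℕ → ℕ) {w : ℕ} (s : State w) : Test → Prop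
  | .lt e₁ e₂ => (e₁.eval σ s).toNat < (e₂.eval σ s).toNat
  | .eq e₁ e₂ => e₁.eval σ s = e₂.eval σ s

def Test.cost : Test → ℕ
  | .lt e₁ e₂ => 1 + e₁.cost + e₂.cost
  | .eq e₁ e₂ => 1 + e₁.cost + e₂.cost

/-- `Exec σ m p s s' c`: on a machine whose memory consists of the `m` words with addresses
`0, …, m - 1`, the program `p`, started in the state `s`, halts in the state `s'` after `c` time
units. A program that accesses a memory word outside of the memory has no execution. -/
inductive Exec (σ : ℕ → ℕ) (m : ℕ) {w : ℕ} : Prog → State w → State w → ℕ → Prop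
  | skip (s : State w) : Exec σ m .skip s s 1
  | assign (s : State w) (r : ℕ) (e : Expr) :
      Exec σ m (.assign r e) s { s with reg := Function.update s.reg r (e.eval σ s) } (1 + e.cost)
  | load (s : State w) (r : ℕ) (e : Expr) (h : (e.eval σ s).toNat < m) :
      Exec σ m (.load r e) s
        { s with reg := Function.update s.reg r (s.mem (e.eval σ s).toNat) } (1 + e.cost)
  | store (s : State w) (e₁ e₂ : Expr) (h : (e₁.eval σ s).toNat < m) :
      Exec σ m (.store e₁ e₂) s
        { s with
          mem := Function.update s.mem (e₁.eval σ s).toNat (e₂.eval σ s)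
          written := insert (e₁.eval σ s).toNat s.written } (1 + e₁.cost + e₂.cost)
  | seq {p q : Prog} {s s₁ s₂ : State w} {c₁ c₂ : ℕ} :
      Exec σ m p s s₁ c₁ → Exec σ m q s₁ s₂ c₂ → Exec σ m (.seq p q) s s₂ (c₁ + c₂)
  | iteTrue {b : Test} {p q : Prog} {s s₁ : State w} {c : ℕ} :
      b.Holds σ s → Exec σ m p s s₁ c → Exec σ m (.ite b p q) s s₁ (b.cost + c)
  | iteFalse {b : Test} {p q : Prog} {s s₁ : State w} {c : ℕ} :
      ¬ b.Holds σ s → Exec σ m q s s₁ c → Exec σ m (.ite b p q) s s₁ (b.cost + c)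
  | loopDone {b : Test} {p : Prog} {s : State w} :
      ¬ b.Holds σ s → Exec σ m (.loop b p) s s b.cost
  | loopStep {b : Test} {p : Prog} {s s₁ s₂ : State w} {c₁ c₂ : ℕ} :
      b.Holds σ s → Exec σ m p s s₁ c₁ → Exec σ m (.loop b p) s₁ s₂ c₂ →
        Exec σ m (.loop b p) s s₂ (b.cost + c₁ + c₂)

/-- The `k` least significant digits of `x` in base `2 ^ w`, least significant digit first. -/
def words (w k x : ℕ) : List (BitVec w) :=
  (List.range k).map fun i => BitVec.ofNat w (x / 2 ^ (w * i))

/-- The state in which a program is called: the arguments are in the first registers, all other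
registers are zero. -/
def callState {w : ℕ} (args : List (BitVec w)) (mem : ℕ → BitVec w) (written : Set ℕ) : State w where
  reg := fun i => args.getD i 0
  mem := mem
  written := written

/-- The integer returned by a program, in registers `0` (low-order word) and `1`. -/
def State.result {w : ℕ} (s : State w) : ℕ := (s.reg 0).toNat + 2 ^ w * (s.reg 1).toNat

/-- The bit of the memory in position `p`: bit `p % w` of the word with address `p / w`. -/
def memBit {w : ℕ} (mem : ℕ → BitVec w) (p : ℕ) : Bool := (mem (p / w)).getLsbD (p % w)

end WordRAM

/-! ## The data type: a 2-color choice dictionary with robust iteration -/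

namespace ChoiceDict

open WordRAM

/-- The calls of operations. The color `true` stands for the client set and the color `false` for
its complement. -/
inductive Op where
  | insert (l : ℕ)
  | delete (l : ℕ)
  | contains (l : ℕ)
  | choice (j : Bool)
  | iterInit (j : Bool)
  | iterNext (j : Bool)
  | iterMore (j : Bool)

/-- The status of an iteration over a set that may change: the elements not yet enumerated that
belonged to the set throughout the iteration, the elements already enumerated, and the elements
that remain to be enumerated. -/
structure Iteration where
  certain : Set ℕ
  enumerated : Set ℕ
  pending : Set ℕ

/-- The client set and, for each color, the status of the most recently started iteration over the
set of that color, if any. -/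
structure AbsState where
  client : Set ℕ
  iter : Bool → Option Iteration

/-- The set of the elements of color `j`. -/
def AbsState.colorSet (n : ℕ) (a : AbsState) : Bool → Set ℕ
  | true => a.client
  | false => Set.Icc 1 n \ a.client

def AbsState.initial : AbsState where
  client := ∅
  iter := fun _ => none

/-- How an iteration may react when the set changes from `A` to `A'`: elements that enter the
set may, but need not, be enumerated. Every element present throughout must remain to be enumerated,
and only elements of the set that were not yet enumerated may remain to be enumerated. -/
def Iteration.Adapts (A A' : Set ℕ) (x x' : Iteration) : Prop :=
  if A' = A then x' = x
  else x'.certain = x.certain ∩ A' ∧ x'.enumerated = x.enumerated ∧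
    x'.certain ⊆ x'.pending ∧ x'.pending ⊆ A' \ x'.enumerated

/-- Both iterations react to a change of the client set. -/
def AbsState.Adapts (n : ℕ) (a a' : AbsState) : Prop :=
  ∀ j, Option.Rel (Iteration.Adapts (a.colorSet n j) (a'.colorSet n j)) (a.iter j) (a'.iter j)

/-- `Step n a o r a'`: for universe size `n`, the call `o` in the state `a` may return `r` and lead
to the state `a'`. (The return values of `insert`, `delete` and `iterInit` are irrelevant.) -/
def Step (n : ℕ) (a : AbsState) (o : Op) (r : ℕ) (a' : AbsState) : Prop :=
  match o with
  | .insert l => a'.client = a.client ∪ {l} ∧ a.Adapts n a'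
  | .delete l => a'.client = a.client \ {l} ∧ a.Adapts n a'
  | .contains l => a' = a ∧ (l ∈ a.client ∧ r = 1 ∨ l ∉ a.client ∧ r = 0)
  | .choice j => a' = a ∧ (r ∈ a.colorSet n j ∨ a.colorSet n j = ∅ ∧ r = 0)
  | .iterInit j =>
      a' = { a with
        iter := Function.update a.iter j (some ⟨a.colorSet n j, ∅, a.colorSet n j⟩) }
  | .iterNext j => ∃ x, a.iter j = some x ∧
      (r ∈ x.pending ∧
          a' = { a with
            iter := Function.update a.iter j
              (some ⟨x.certain \ {r}, x.enumerated ∪ {r}, x.pending \ {r}⟩) } ∨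
        x.pending = ∅ ∧ r = 0 ∧ a' = a)
  | .iterMore j => ∃ x, a.iter j = some x ∧ a' = a ∧
      (x.pending.Nonempty ∧ r = 1 ∨ x.pending = ∅ ∧ r = 0)

/-- `Behaves n h a`: the history `h` of calls and their return values, in chronological order, is
a correct behavior of a 2-color choice dictionary with universe size `n` and can lead to the
state `a`. -/
inductive Behaves (n : ℕ) : List (Op × ℕ) → AbsState → Prop
  | nil : Behaves n [] AbsState.initial
  | snoc {h : List (Op × ℕ)} {a a' : AbsState} {o : Op} {r : ℕ} :
      Behaves n h a → Step n a o r a' → Behaves n (h ++ [(o, r)]) a'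

/-- The preconditions of the calls: arguments belong to the universe, and `iterNext` and
`iterMore` are called only for iterations that were started. -/
def Legal (n : ℕ) (h : List (Op × ℕ)) : Op → Prop
  | .insert l => l ∈ Set.Icc 1 n
  | .delete l => l ∈ Set.Icc 1 n
  | .contains l => l ∈ Set.Icc 1 n
  | .choice _ => True
  | .iterInit _ => True
  | .iterNext j => ∃ r, (Op.iterInit j, r) ∈ h
  | .iterMore j => ∃ r, (Op.iterInit j, r) ∈ h

/-! ## Implementations on a word RAM -/

/-- A data structure: a program for the initialization and one for each operation. -/
structure Implementation where
  init : Prog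
  insert : Prog
  delete : Prog
  contains : Prog
  choice : Bool → Prog
  iterInit : Bool → Prog
  iterNext : Bool → Prog
  iterMore : Bool → Prog

/-- The program that executes a call. -/
def Implementation.code (D : Implementation) : Op → Prog
  | .insert _ => D.insert
  | .delete _ => D.delete
  | .contains _ => D.contains
  | .choice j => D.choice j
  | .iterInit j => D.iterInit j
  | .iterNext j => D.iterNext j
  | .iterMore j => D.iterMore j

/-- The argument of a call, if any, is an integer in `{1, …, 2 ^ w}` and is passed in two words. -/
def Op.args (w : ℕ) : Op → List (BitVec w)
  | .insert l => words w 2 l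
  | .delete l => words w 2 l
  | .contains l => words w 2 l
  | _ => []

/-- The parameters of the initialization: the universe size `n`, in two words, and the tradeoff
parameter `t`, in `κ` words. -/
def initArgs (w κ n t : ℕ) : List (BitVec w) := words w 2 n ++ words w κ t

/-- The least number of `w`-bit words that hold `b` bits. -/
def numWords (w b : ℕ) : ℕ := (b + w - 1) / w

/-- `Reach D σ w κ n t b mem written h`: after the initialization of `D`, in an arbitrary memory,
for universe size `n` and tradeoff parameter `t`, a sequence of legal calls with history `h` can
lead to a quiescent state with memory contents `mem` in which the words with addresses in
`written` are those to which values were stored. The data structure occupies the first `b` bits of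
the memory: between the executions of operations, registers are lost, and so are
the bits of the last memory word in positions `≥ b`. -/
inductive Reach (D : Implementation) (σ : ℕ → ℕ) (w κ n t b : ℕ) :
    (ℕ → BitVec w) → Set ℕ → List (Op × ℕ) → Prop
  | init {mem : ℕ → BitVec w} {s : State w} {c : ℕ} :
      Exec σ (numWords w b) D.init (callState (initArgs w κ n t) mem ∅) s c →
      Reach D σ w κ n t b s.mem s.written []
  | forget {mem mem' : ℕ → BitVec w} {written : Set ℕ} {h : List (Op × ℕ)} :
      Reach D σ w κ n t b mem written h → (∀ p < b, memBit mem' p = memBit mem p) →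
      Reach D σ w κ n t b mem' written h
  | call {mem : ℕ → BitVec w} {written : Set ℕ} {h : List (Op × ℕ)} {o : Op} {s : State w} {c : ℕ} :
      Reach D σ w κ n t b mem written h → Legal n h o →
      Exec σ (numWords w b) (D.code o) (callState (o.args w) mem written) s c →
      Reach D σ w κ n t b s.mem s.written (h ++ [(o, s.result)])

/-- With word length `w`, initialized for universe size `n` and tradeoff parameter `t`, the data
structure `D` is a systematic 2-color choice dictionary that occupies `b` bits, whose bit-vector
representation begins in position `pos`, whose initialization takes at most `c₀` time units, and
each of whose operations takes at most `c₁` time units. -/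
structure IsSystematic (D : Implementation) (σ : ℕ → ℕ) (w κ n t b pos c₀ c₁ : ℕ) : Prop where
  init_time : ∀ mem : ℕ → BitVec w, ∃ s c,
    Exec σ (numWords w b) D.init (callState (initArgs w κ n t) mem ∅) s c ∧ c ≤ c₀
  call_time : ∀ mem written h o, Reach D σ w κ n t b mem written h → Legal n h o → ∃ s c,
    Exec σ (numWords w b) (D.code o) (callState (o.args w) mem written) s c ∧ c ≤ c₁
  /-- The bits in positions `pos, …, pos + n - 1` belong to the data structure. -/
  fits : pos + n ≤ b
  /-- All behavior is correct, and at all times the bit of `l` tells whether `l` belongs to the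
  client set if a value was stored in the memory word that contains the bit. -/
  correct : ∀ mem written h, Reach D σ w κ n t b mem written h → ∃ a, Behaves n h a ∧
    ∀ l ∈ Set.Icc 1 n, (pos + (l - 1)) / w ∈ written →
      (memBit mem (pos + (l - 1)) = true ↔ l ∈ a.client)

end ChoiceDict

/-!
The client set is stored as `n` bits. These are divided into *blocks* of `32 * t` words, and `w`
blocks form a *chunk*. With `O(t)` time for an operation, a block can be searched word by word,
where the position of a bit within a word comes from a binary logarithm (`WordRAM.wp_size`, which
relies on fields of about `√w` bits, and `WordRAM.wp_scan`). A block has one flag for each color,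
where the two colors are the client set (`true`) and its complement (`false`), that tells whether
the block contains an element of the color. The `w` flags of a chunk for one color fill a word and
are searched in the same way. Finally, the chunks with an element of a given color form a doubly
linked list, whose pointers are in a record of eight words for each chunk. Flags and records take
fewer than `32` bits for each block, hence at most `n / (t * w)` bits altogether, up to a
logarithmic term (`space_le`).

Initialization in constant time is possible because chunks are *touched* only when necessary. The
set of the touched chunks is represented by an involution of the chunks (`Involution`): a chunk is
touched if its image is smaller than the number `T` of touched chunks, and pointers that were never
written can be told from valid ones because valid pointers point at each other across the border
`T`. An untouched chunk contains no clients, and neither does a block without a flag for clients;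
the bits of such a block, which may be arbitrary, are set to zero before the block is accessed
(`Ok.wp_prep`).

An iteration runs through the list of its color, with chunk `0` at the end, and in each chunk from
the last element to the first. It remembers its chunk and the last element that it enumerated. A
chunk that acquires its first element of the color while an iteration is in progress goes to the
start of the list, where the iteration no longer sees it; a chunk that loses its last one leaves the
list, and an iteration in that chunk proceeds to the next one. The elements *ahead* of an iteration
(`Ahead`) are those that remain to be enumerated. An update removes from them only elements that
change color and adds none (`Evol`), which is robustness.

Untouched chunks consist of elements of the complement, but are not in the list for the complement.
Touching a chunk appends it to that list (`Ok.touch_inv`), without a change of what is ahead of the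
iteration (`Ok.touch_quiet`). Each search touches one more chunk first (`Ok.wp_pull`). Thus the
iteration over the complement cannot come to the end of the list while there are untouched chunks
(`Ok.wp_seek`), and neither can `choice` find the list empty (`Ok.wp_any`).

The programs are verified with total-correctness triples `WordRAM.wp` that also bound the time, for
an invariant `Inv` that relates the memory to a ghost state. `Ok.reach` extends the invariant to all
reachable states. All of this requires that `w` exceeds a constant that depends on the machine
constant (`exists_wordOK`); smaller words are absorbed by the `O`-constant of the space bound.
-/

set_option linter.unusedSectionVars false

/-! ### Reasoning about programs -/

namespace WordRAM

instance : Add Expr := ⟨.bin .add⟩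
instance : Sub Expr := ⟨.bin .sub⟩
instance : Mul Expr := ⟨.bin .mul⟩
instance : Div Expr := ⟨.bin .div⟩
instance : Mod Expr := ⟨fun a b => a - a / b * b⟩
instance : HShiftLeft Expr Expr Expr := ⟨.bin .shl⟩
instance : HShiftRight Expr Expr Expr := ⟨.bin .shr⟩
instance : HAnd Expr Expr Expr := ⟨.bin .and⟩
instance : HOr Expr Expr Expr := ⟨.bin .or⟩
instance : HXor Expr Expr Expr := ⟨.bin .xor⟩

instance (n : ℕ) : OfNat Expr n := ⟨.const n⟩

/-- The expression that reads a register. -/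
abbrev Rg (i : ℕ) : Expr := .reg i

/-- The expression for a power of two. -/
def exp2 (e : Expr) : Expr := .bin .shl (.const 1) e

infixr:60 " ;; " => Prog.seq

variable {σ : ℕ → ℕ} {m N w : ℕ}

/-- The number held by a register. -/
def State.rg (s : State w) (i : ℕ) : ℕ := (s.reg i).toNat

/-- The state after `x` is written to register `r`. -/
def State.setR (s : State w) (r : ℕ) (x : BitVec w) : State w :=
  { s with reg := Function.update s.reg r x }

/-- The state after `x` is stored in memory word `a`. -/
def State.setM (s : State w) (a : ℕ) (x : BitVec w) : State w :=
  { s with mem := Function.update s.mem a x, written := insert a s.written }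

/-- The number denoted by an expression. -/
def val (σ : ℕ → ℕ) (s : State w) (e : Expr) : ℕ := (e.eval σ s).toNat

theorem State.rg_lt (s : State w) (i : ℕ) : s.rg i < 2 ^ w := (s.reg i).isLt

theorem val_lt (s : State w) (e : Expr) : val σ s e < 2 ^ w := (e.eval σ s).isLt

@[simp] theorem rg_setR (s : State w) (r : ℕ) (x : BitVec w) (i : ℕ) :
    (s.setR r x).rg i = if i = r then x.toNat else s.rg i := by
  unfold State.setR State.rg
  by_cases h : i = r <;> simp [Function.update, h]

@[simp] theorem mem_setR (s : State w) (r : ℕ) (x : BitVec w) : (s.setR r x).mem = s.mem := rfl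
@[simp] theorem written_setR (s : State w) (r : ℕ) (x : BitVec w) :
    (s.setR r x).written = s.written := rfl
@[simp] theorem rg_setM (s : State w) (a : ℕ) (x : BitVec w) (i : ℕ) :
    (s.setM a x).rg i = s.rg i := rfl
@[simp] theorem mem_setM (s : State w) (a : ℕ) (x : BitVec w) :
    (s.setM a x).mem = Function.update s.mem a x := rfl
@[simp] theorem written_setM (s : State w) (a : ℕ) (x : BitVec w) :
    (s.setM a x).written = insert a s.written := rfl

theorem val_reg (s : State w) (i : ℕ) : val σ s (.reg i) = s.rg i := rfl

theorem val_const (s : State w) (c : ℕ) : val σ s (.const c) = c % 2 ^ w := by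
  simp [val, Expr.eval]

theorem val_ofNat (s : State w) (c : ℕ) : val σ s (OfNat.ofNat c : Expr) = OfNat.ofNat c % 2 ^ w :=
  val_const s c

theorem val_root (s : State w) : val σ s .rootWord = σ w % 2 ^ w := by
  simp [val, Expr.eval]

theorem val_add (s : State w) (a b : Expr) :
    val σ s (a + b) = (val σ s a + val σ s b) % 2 ^ w := by
  show BitVec.toNat (a.eval σ s + b.eval σ s) = _
  simp [val]

theorem val_sub (s : State w) (a b : Expr) :
    val σ s (a - b) = (2 ^ w - val σ s b + val σ s a) % 2 ^ w := by
  show BitVec.toNat (a.eval σ s - b.eval σ s) = _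
  simp [val]

theorem val_sub_le (s : State w) (a b : Expr) (h : val σ s b ≤ val σ s a) :
    val σ s (a - b) = val σ s a - val σ s b := by
  have h1 := val_lt (σ := σ) s a
  rw [val_sub, show 2 ^ w - val σ s b + val σ s a = (val σ s a - val σ s b) + 2 ^ w by omega,
    Nat.add_mod_right, Nat.mod_eq_of_lt (by omega)]

theorem val_mul (s : State w) (a b : Expr) :
    val σ s (a * b) = (val σ s a * val σ s b) % 2 ^ w := by
  show BitVec.toNat (a.eval σ s * b.eval σ s) = _
  simp [val]

theorem val_add_of_lt (s : State w) (a b : Expr) {x y : ℕ} (ha : val σ s a = x)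
    (hb : val σ s b = y) (h : x + y < 2 ^ w) : val σ s (a + b) = x + y := by
  rw [val_add, ha, hb, Nat.mod_eq_of_lt h]

theorem val_mul_of_lt (s : State w) (a b : Expr) {x y : ℕ} (ha : val σ s a = x)
    (hb : val σ s b = y) (h : x * y < 2 ^ w) : val σ s (a * b) = x * y := by
  rw [val_mul, ha, hb, Nat.mod_eq_of_lt h]

theorem val_sub_of_le (s : State w) (a b : Expr) {x y : ℕ} (ha : val σ s a = x)
    (hb : val σ s b = y) (h : y ≤ x) : val σ s (a - b) = x - y := by
  rw [val_sub_le _ _ _ (by rw [ha, hb]; exact h), ha, hb]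

theorem val_div (s : State w) (a b : Expr) : val σ s (a / b) = val σ s a / val σ s b := by
  show BitVec.toNat (a.eval σ s / b.eval σ s) = _
  simp [val]

theorem val_mod (s : State w) (a b : Expr) : val σ s (a % b) = val σ s a % val σ s b := by
  have h1 := val_lt (σ := σ) s a
  have h2 := Nat.div_mul_le_self (val σ s a) (val σ s b)
  have h3 : val σ s (a / b * b) = val σ s a / val σ s b * val σ s b := by
    rw [val_mul, val_div, Nat.mod_eq_of_lt (by omega)]
  show val σ s (a - a / b * b) = _
  rw [val_sub_le _ _ _ (by omega), h3]
  have := Nat.div_add_mod (val σ s a) (val σ s b)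
  rw [Nat.mul_comm] at this
  omega

theorem val_shl (s : State w) (a b : Expr) :
    val σ s (a <<< b) = (val σ s a * 2 ^ val σ s b) % 2 ^ w := by
  show BitVec.toNat (a.eval σ s <<< b.eval σ s) = _
  rw [BitVec.shiftLeft_eq', BitVec.toNat_shiftLeft, Nat.shiftLeft_eq]; rfl

theorem val_shr (s : State w) (a b : Expr) :
    val σ s (a >>> b) = val σ s a / 2 ^ val σ s b := by
  show BitVec.toNat (a.eval σ s >>> b.eval σ s) = _
  rw [BitVec.ushiftRight_eq', BitVec.toNat_ushiftRight, Nat.shiftRight_eq_div_pow]; rfl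

theorem val_and (s : State w) (a b : Expr) : val σ s (a &&& b) = val σ s a &&& val σ s b := by
  show BitVec.toNat (a.eval σ s &&& b.eval σ s) = _
  simp [val]

theorem val_or (s : State w) (a b : Expr) : val σ s (a ||| b) = val σ s a ||| val σ s b := by
  show BitVec.toNat (a.eval σ s ||| b.eval σ s) = _
  simp [val]

theorem val_xor (s : State w) (a b : Expr) : val σ s (a ^^^ b) = val σ s a ^^^ val σ s b := by
  show BitVec.toNat (a.eval σ s ^^^ b.eval σ s) = _
  simp [val]

theorem val_const_of_lt (s : State w) (c : ℕ) (h : (OfNat.ofNat c : ℕ) < 2 ^ w) :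
    val σ s (OfNat.ofNat c : Expr) = OfNat.ofNat c := by
  rw [val_ofNat, Nat.mod_eq_of_lt h]

theorem val_exp2 (s : State w) (a : Expr) {x : ℕ} (ha : val σ s a = x) (h : x < w) :
    val σ s (exp2 a) = 2 ^ x := by
  have : 2 ^ 1 ≤ 2 ^ w := Nat.pow_le_pow_right (by omega) (by omega)
  rw [exp2, show Expr.bin .shl (.const 1) a = Expr.const 1 <<< a from rfl, val_shl, ha, val_const,
    Nat.mod_eq_of_lt (show 1 < 2 ^ w by omega), one_mul,
    Nat.mod_eq_of_lt (Nat.pow_lt_pow_right (by omega) h)]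

theorem holds_lt (s : State w) (a b : Expr) :
    (Test.lt a b).Holds σ s ↔ val σ s a < val σ s b := Iff.rfl

theorem holds_eq (s : State w) (a b : Expr) :
    (Test.eq a b).Holds σ s ↔ val σ s a = val σ s b := by
  simp only [Test.Holds, val, BitVec.toNat_inj]

/-! #### Determinism and running time -/

theorem Exec.det {p : Prog} {s s₁ s₂ : State w} {c₁ c₂ : ℕ} (h₁ : Exec σ m p s s₁ c₁)
    (h₂ : Exec σ m p s s₂ c₂) : s₁ = s₂ := by
  induction h₁ generalizing s₂ c₂ with
  | skip => cases h₂; rfl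
  | assign => cases h₂; rfl
  | load => cases h₂; rfl
  | store => cases h₂; rfl
  | seq _ _ ih₁ ih₂ =>
    cases h₂ with
    | seq a b => obtain rfl := ih₁ a; exact ih₂ b
  | iteTrue hb _ ih =>
    cases h₂ with
    | iteTrue _ a => exact ih a
    | iteFalse hn _ => exact absurd hb hn
  | iteFalse hb _ ih =>
    cases h₂ with
    | iteTrue hn _ => exact absurd hn hb
    | iteFalse _ a => exact ih a
  | loopDone hb =>
    cases h₂ with
    | loopDone _ => rfl
    | loopStep hn _ _ => exact absurd hn hb
  | loopStep hb _ _ ih₁ ih₂ =>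
    cases h₂ with
    | loopDone hn => exact absurd hb hn
    | loopStep _ a b => obtain rfl := ih₁ a; exact ih₂ b

/-- The time spent by a program outside of loop iterations (an upper bound that adds up both
branches of every conditional). -/
def Prog.c0 : Prog → ℕ
  | .skip => 1
  | .assign _ e => 1 + e.cost
  | .load _ e => 1 + e.cost
  | .store e₁ e₂ => 1 + e₁.cost + e₂.cost
  | .seq p q => p.c0 + q.c0
  | .ite b p q => b.cost + p.c0 + q.c0
  | .loop b _ => b.cost

/-- The time spent in one iteration of every loop, for a program without nested loops. -/
def Prog.c1 : Prog → ℕ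
  | .skip => 0
  | .assign _ _ => 0
  | .load _ _ => 0
  | .store _ _ => 0
  | .seq p q => p.c1 + q.c1
  | .ite _ p q => p.c1 + q.c1
  | .loop b p => b.cost + p.c0

/-- Total correctness: started in the state `s`, the program `p` halts in a state with the property
`Q`, within the time that it takes if each of its loops is iterated at most `N` times. The number
`m` of accessible memory words is part of `Exec`, so that `wp` also excludes accesses beyond them. -/
def wp (σ : ℕ → ℕ) (m N : ℕ) (p : Prog) (Q : State w → Prop) (s : State w) : Prop :=
  ∃ s' c, Exec σ m p s s' c ∧ c ≤ p.c0 + N * p.c1 ∧ Q s'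

theorem wp.mono {p : Prog} {Q Q' : State w → Prop} {s : State w} (h : wp σ m N p Q s)
    (hQ : ∀ s', Q s' → Q' s') : wp σ m N p Q' s := by
  obtain ⟨s', c, a, b, d⟩ := h
  exact ⟨s', c, a, b, hQ _ d⟩

theorem wp_skip {Q : State w → Prop} {s : State w} (h : Q s) : wp σ m N .skip Q s :=
  ⟨s, 1, .skip s, by simp [Prog.c0, Prog.c1], h⟩

theorem wp_seq {p q : Prog} {Q : State w → Prop} {s : State w}
    (h : wp σ m N p (wp σ m N q Q) s) : wp σ m N (p ;; q) Q s := by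
  obtain ⟨s', c, a, b, s'', c', a', b', d⟩ := h
  refine ⟨s'', c + c', .seq a a', ?_, d⟩
  simp only [Prog.c0, Prog.c1, Nat.mul_add]; omega

theorem wp_call {p q : Prog} {R Q : State w → Prop} {s : State w} (h : wp σ m N p R s)
    (k : ∀ s', R s' → wp σ m N q Q s') : wp σ m N (p ;; q) Q s :=
  wp_seq (h.mono k)

theorem wp_assign {r : ℕ} {e : Expr} {v : ℕ} {Q : State w → Prop} {s : State w}
    (hv : val σ s e = v) (h : ∀ x : BitVec w, x.toNat = v → Q (s.setR r x)) :
    wp σ m N (.assign r e) Q s :=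
  ⟨_, _, .assign s r e, by simp [Prog.c0, Prog.c1], h _ hv⟩

theorem wp_load {r : ℕ} {e : Expr} {a : ℕ} {Q : State w → Prop} {s : State w}
    (ha : val σ s e = a) (hm : a < m) (h : Q (s.setR r (s.mem a))) :
    wp σ m N (.load r e) Q s := by
  subst ha
  exact ⟨_, _, .load s r e hm, by simp [Prog.c0, Prog.c1], h⟩

theorem wp_store {e₁ e₂ : Expr} {a v : ℕ} {Q : State w → Prop} {s : State w}
    (ha : val σ s e₁ = a) (hv : val σ s e₂ = v) (hm : a < m)
    (h : ∀ x : BitVec w, x.toNat = v → Q (s.setM a x)) :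
    wp σ m N (.store e₁ e₂) Q s := by
  subst ha
  exact ⟨_, _, .store s e₁ e₂ hm, by simp [Prog.c0, Prog.c1], h _ hv⟩

theorem wp_assign_seq {r : ℕ} {e : Expr} {v : ℕ} {q : Prog} {Q : State w → Prop} {s : State w}
    (hv : val σ s e = v) (h : ∀ x : BitVec w, x.toNat = v → wp σ m N q Q (s.setR r x)) :
    wp σ m N (.assign r e ;; q) Q s :=
  wp_seq (wp_assign hv h)

theorem wp_load_seq {r : ℕ} {e : Expr} {a : ℕ} {q : Prog} {Q : State w → Prop} {s : State w}
    (ha : val σ s e = a) (hm : a < m) (h : wp σ m N q Q (s.setR r (s.mem a))) :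
    wp σ m N (.load r e ;; q) Q s :=
  wp_seq (wp_load ha hm h)

theorem wp_store_seq {e₁ e₂ : Expr} {a v : ℕ} {q : Prog} {Q : State w → Prop} {s : State w}
    (ha : val σ s e₁ = a) (hv : val σ s e₂ = v) (hm : a < m)
    (h : ∀ x : BitVec w, x.toNat = v → wp σ m N q Q (s.setM a x)) :
    wp σ m N (.store e₁ e₂ ;; q) Q s :=
  wp_seq (wp_store ha hv hm h)

theorem wp_ite {b : Test} {p q : Prog} {Q : State w → Prop} {s : State w}
    (h₁ : b.Holds σ s → wp σ m N p Q s) (h₂ : ¬ b.Holds σ s → wp σ m N q Q s) :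
    wp σ m N (.ite b p q) Q s := by
  by_cases hb : b.Holds σ s
  · obtain ⟨s', c, a, d, e⟩ := h₁ hb
    refine ⟨s', _, .iteTrue hb a, ?_, e⟩
    simp only [Prog.c0, Prog.c1, Nat.mul_add]; omega
  · obtain ⟨s', c, a, d, e⟩ := h₂ hb
    refine ⟨s', _, .iteFalse hb a, ?_, e⟩
    simp only [Prog.c0, Prog.c1, Nat.mul_add]; omega

/-- The rule for loops: an invariant that is indexed by a bound on the number of remaining
iterations. -/
theorem wp_loop {b : Test} {p : Prog} {Q : State w → Prop} {s : State w} (hp : p.c1 = 0)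
    (I : ℕ → State w → Prop)
    (step : ∀ k s, I k s → b.Holds σ s → ∃ k', k = k' + 1 ∧ wp σ m N p (I k') s)
    (done : ∀ k s, I k s → ¬ b.Holds σ s → Q s) (k : ℕ) (hk : k ≤ N) (h : I k s) :
    wp σ m N (.loop b p) Q s := by
  suffices H : ∀ k s, I k s →
      ∃ s' c, Exec σ m (.loop b p) s s' c ∧ c ≤ b.cost + k * (b.cost + p.c0) ∧ Q s' by
    obtain ⟨s', c, a, d, e⟩ := H k s h
    exact ⟨s', c, a, d.trans (by simp only [Prog.c0, Prog.c1]; gcongr), e⟩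
  intro k
  induction k with
  | zero =>
    intro s h
    by_cases hb : b.Holds σ s
    · obtain ⟨k', hk', _⟩ := step _ _ h hb
      omega
    · exact ⟨s, _, .loopDone hb, by simp, done _ _ h hb⟩
  | succ k ih =>
    intro s h
    by_cases hb : b.Holds σ s
    · obtain ⟨k', hk', s₁, c₁, x₁, d₁, i₁⟩ := step _ _ h hb
      obtain rfl : k = k' := by omega
      obtain ⟨s', c, a, d, e⟩ := ih s₁ i₁
      refine ⟨s', _, .loopStep hb x₁ a, ?_, e⟩
      rw [hp] at d₁
      rw [Nat.add_mul]; omega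
    · exact ⟨s, _, .loopDone hb, by simp, done _ _ h hb⟩

end WordRAM

/-! ### Fields of a word and the binary logarithm -/

namespace FieldSum

/-- The number whose `k` fields of width `b` hold `d 0, d 1, …`, lowest field first. -/
def dsum (b : ℕ) : ℕ → (ℕ → ℕ) → ℕ
  | 0, _ => 0
  | k + 1, d => d 0 + 2 ^ b * dsum b k (fun j => d (j + 1))

theorem dsum_lt {b : ℕ} : ∀ {k : ℕ} {d : ℕ → ℕ}, (∀ j < k, d j < 2 ^ b) → dsum b k d < 2 ^ (b * k)
  | 0, d, _ => by simp [dsum]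
  | k + 1, d, h => by
    have ih := dsum_lt (b := b) (k := k) (d := fun j => d (j + 1)) fun j hj => h _ (by omega)
    have h0 := h 0 (by omega)
    rw [dsum, Nat.mul_succ, pow_add]
    calc d 0 + 2 ^ b * dsum b k (fun j => d (j + 1))
        < 2 ^ b + 2 ^ b * dsum b k (fun j => d (j + 1)) := by omega
      _ = 2 ^ b * (dsum b k (fun j => d (j + 1)) + 1) := by ring
      _ ≤ 2 ^ b * 2 ^ (b * k) := Nat.mul_le_mul_left _ ih
      _ = _ := by ring

theorem dsum_congr {b : ℕ} : ∀ {k : ℕ} {d e : ℕ → ℕ}, (∀ j < k, d j = e j) →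
    dsum b k d = dsum b k e
  | 0, _, _, _ => rfl
  | k + 1, d, e, h => by
    rw [dsum, dsum, h 0 (by omega), dsum_congr (k := k) fun j hj => h (j + 1) (by omega)]

theorem and_field {b x y X Y : ℕ} (hx : x < 2 ^ b) (hy : y < 2 ^ b) :
    (x + 2 ^ b * X) &&& (y + 2 ^ b * Y) = (x &&& y) + 2 ^ b * (X &&& Y) := by
  have hxy : x &&& y < 2 ^ b := Nat.and_lt_two_pow _ hy
  rw [add_comm x, add_comm y, add_comm (x &&& y)]
  refine Nat.eq_of_testBit_eq fun i => ?_
  simp only [Nat.testBit_and, Nat.testBit_two_pow_mul_add _ hx, Nat.testBit_two_pow_mul_add _ hy,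
    Nat.testBit_two_pow_mul_add _ hxy]
  split <;> simp

theorem or_field {b x y X Y : ℕ} (hx : x < 2 ^ b) (hy : y < 2 ^ b) :
    (x + 2 ^ b * X) ||| (y + 2 ^ b * Y) = (x ||| y) + 2 ^ b * (X ||| Y) := by
  have hxy : x ||| y < 2 ^ b := Nat.or_lt_two_pow hx hy
  rw [add_comm x, add_comm y, add_comm (x ||| y)]
  refine Nat.eq_of_testBit_eq fun i => ?_
  simp only [Nat.testBit_or, Nat.testBit_two_pow_mul_add _ hx, Nat.testBit_two_pow_mul_add _ hy,
    Nat.testBit_two_pow_mul_add _ hxy]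
  split <;> simp

theorem dsum_and {b : ℕ} : ∀ {k : ℕ} {d e : ℕ → ℕ}, (∀ j < k, d j < 2 ^ b) →
    (∀ j < k, e j < 2 ^ b) → dsum b k d &&& dsum b k e = dsum b k fun j => d j &&& e j
  | 0, _, _, _, _ => by simp [dsum]
  | k + 1, d, e, h, h' => by
    rw [dsum, dsum, and_field (h 0 (by omega)) (h' 0 (by omega)),
      dsum_and (fun j hj => h (j + 1) (by omega)) (fun j hj => h' (j + 1) (by omega)), dsum]

theorem dsum_or {b : ℕ} : ∀ {k : ℕ} {d e : ℕ → ℕ}, (∀ j < k, d j < 2 ^ b) →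
    (∀ j < k, e j < 2 ^ b) → dsum b k d ||| dsum b k e = dsum b k fun j => d j ||| e j
  | 0, _, _, _, _ => by simp [dsum]
  | k + 1, d, e, h, h' => by
    rw [dsum, dsum, or_field (h 0 (by omega)) (h' 0 (by omega)),
      dsum_or (fun j hj => h (j + 1) (by omega)) (fun j hj => h' (j + 1) (by omega)), dsum]

theorem dsum_add {b : ℕ} : ∀ {k : ℕ} (d e : ℕ → ℕ),
    dsum b k d + dsum b k e = dsum b k fun j => d j + e j
  | 0, _, _ => rfl
  | k + 1, d, e => by
    rw [dsum, dsum, dsum, ← dsum_add]; ring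

theorem dsum_mul {b : ℕ} (c : ℕ) : ∀ {k : ℕ} (d : ℕ → ℕ),
    c * dsum b k d = dsum b k fun j => c * d j
  | 0, _ => by simp [dsum]
  | k + 1, d => by
    rw [dsum, dsum, ← dsum_mul c]; ring

theorem dsum_one_mul {b : ℕ} : ∀ k : ℕ, dsum b k (fun _ => 1) * (2 ^ b - 1) = 2 ^ (b * k) - 1
  | 0 => by simp [dsum]
  | k + 1 => by
    have ih := dsum_one_mul (b := b) k
    have h1 : 1 ≤ 2 ^ b := Nat.one_le_two_pow
    have h2 : 1 ≤ 2 ^ (b * k) := Nat.one_le_two_pow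
    rw [dsum, Nat.mul_succ, pow_add]
    zify [h1, h2, Nat.mul_pos h2 h1] at ih ⊢
    linear_combination (2 : ℤ) ^ b * ih

theorem dsum_one {b : ℕ} (hb : 1 ≤ b) (k : ℕ) :
    (2 ^ (b * k) - 1) / (2 ^ b - 1) = dsum b k fun _ => 1 := by
  have h1 : 2 ^ 1 ≤ 2 ^ b := Nat.pow_le_pow_right (by omega) hb
  rw [← dsum_one_mul, Nat.mul_div_cancel _ (by omega)]

theorem dsum_pow {b : ℕ} : ∀ k : ℕ, dsum b k (fun j => 2 ^ j) = dsum (b + 1) k fun _ => 1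
  | 0 => rfl
  | k + 1 => by
    rw [dsum, dsum, ← dsum_pow k]
    have : (fun j => 2 ^ (j + 1)) = fun j : ℕ => 2 * 2 ^ j := by funext j; ring
    rw [this, ← dsum_mul 2]; ring

theorem dsum_digits {b : ℕ} : ∀ {k x : ℕ}, x < 2 ^ (b * k) →
    dsum b k (fun j => x / 2 ^ (b * j) % 2 ^ b) = x
  | 0, x, h => by simp at h; simp [dsum, h]
  | k + 1, x, h => by
    have h' : x / 2 ^ b < 2 ^ (b * k) := by
      rw [Nat.div_lt_iff_lt_mul (by positivity), ← pow_add]; exact h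
    have ih := dsum_digits h'
    have : (fun j => x / 2 ^ (b * (j + 1)) % 2 ^ b) =
        fun j => x / 2 ^ b / 2 ^ (b * j) % 2 ^ b := by
      funext j; rw [Nat.div_div_eq_div_mul, ← pow_add, Nat.mul_succ, add_comm]
    rw [dsum, this, ih]
    simp [Nat.mod_add_div]

/-- Modulo a number for which the bases `2 ^ b` and `2 ^ b'` are congruent, a field sum may be
evaluated with either base. With `b' = 0` and modulus `2 ^ b - 1` this adds up the fields. -/
theorem dsum_modEq {b b' n : ℕ} (h : 2 ^ b ≡ 2 ^ b' [MOD n]) : ∀ (k : ℕ) (d : ℕ → ℕ),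
    dsum b k d ≡ dsum b' k d [MOD n]
  | 0, _ => rfl
  | k + 1, _ => (Nat.ModEq.refl _).add (h.mul (dsum_modEq h k _))

theorem dsum_zero (d : ℕ → ℕ) (k : ℕ) : dsum 0 k d = ∑ j ∈ Finset.range k, d j := by
  induction k generalizing d with
  | zero => rfl
  | succ k ih => rw [dsum, ih, Finset.sum_range_succ']; simp; ring

theorem pow_mod_pred (b : ℕ) : 2 ^ b ≡ 1 [MOD 2 ^ b - 1] := by
  have h : 1 ≤ 2 ^ b := Nat.one_le_two_pow
  exact ((Nat.modEq_iff_dvd' h).2 dvd_rfl).symm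

theorem two_pow_and (a d : ℕ) (h : d < 2 ^ (a + 1)) :
    d &&& 2 ^ a = if 2 ^ a ≤ d then 2 ^ a else 0 := by
  rw [Nat.and_two_pow]
  have : d.testBit a = decide (2 ^ a ≤ d) := by
    rw [Nat.testBit_eq_decide_div_mod_eq]
    have h1 : d / 2 ^ a < 2 := by
      rw [Nat.div_lt_iff_lt_mul (by positivity)]; rw [pow_succ] at h; omega
    congr 1
    rw [eq_iff_iff, Nat.mod_eq_of_lt h1]
    rw [← Nat.one_le_div_iff (b := 2 ^ a) (by positivity)]
    omega
  rw [this]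
  by_cases hd : 2 ^ a ≤ d <;> simp [hd]

/-- Parallel comparison of `z` with the first `k` powers of two. -/
theorem rank_eq {k z : ℕ} (hz : z < 2 ^ k) :
    ((z * dsum (k + 1) k (fun _ => 1) + 2 ^ k * dsum (k + 1) k (fun _ => 1)
        - dsum (k + 2) k (fun _ => 1)) &&& 2 ^ k * dsum (k + 1) k (fun _ => 1)) / 2 ^ k
      % (2 ^ (k + 1) - 1) = Nat.size z := by
  have e1 : z * dsum (k + 1) k (fun _ => 1) + 2 ^ k * dsum (k + 1) k (fun _ => 1)
        - dsum (k + 2) k (fun _ => 1) = dsum (k + 1) k fun j => z + (2 ^ k - 2 ^ j) := by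
    rw [← dsum_pow (b := k + 1), dsum_mul, dsum_mul, dsum_add, Nat.sub_eq_iff_eq_add, dsum_add]
    · refine dsum_congr fun j hj => ?_
      have : 2 ^ j ≤ 2 ^ k := Nat.pow_le_pow_right (by omega) hj.le
      omega
    · have : dsum (k + 1) k (fun j => z * 1 + 2 ^ k * 1) =
          dsum (k + 1) k (fun j => 2 ^ j) + dsum (k + 1) k (fun j => z + (2 ^ k - 2 ^ j)) := by
        rw [dsum_add]
        refine dsum_congr fun j hj => ?_
        have : 2 ^ j ≤ 2 ^ k := Nat.pow_le_pow_right (by omega) hj.le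
        omega
      omega
  have hs : Nat.size z ≤ k := Nat.size_le.2 hz
  rw [e1, dsum_mul, dsum_and]
  · have e2 : dsum (k + 1) k (fun j => z + (2 ^ k - 2 ^ j) &&& 2 ^ k * 1) =
        2 ^ k * dsum (k + 1) k fun j => if j < Nat.size z then 1 else 0 := by
      rw [dsum_mul]
      refine dsum_congr fun j hj => ?_
      have h1 : 2 ^ j ≤ 2 ^ k := Nat.pow_le_pow_right (by omega) hj.le
      have h3 : 1 ≤ 2 ^ j := Nat.one_le_two_pow
      have h2 : (2 ^ k ≤ z + (2 ^ k - 2 ^ j)) ↔ j < Nat.size z := by rw [Nat.lt_size]; omega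
      simp only [mul_one]
      rw [two_pow_and _ _ (by rw [pow_succ]; omega)]
      simp only [h2]; split <;> simp
    rw [e2, Nat.mul_div_cancel_left _ (by positivity)]
    have h0 : 2 ^ (k + 1) ≡ 2 ^ 0 [MOD 2 ^ (k + 1) - 1] := by simpa using pow_mod_pred (k + 1)
    rw [dsum_modEq h0, dsum_zero]
    have : (∑ j ∈ Finset.range k, if j < Nat.size z then 1 else 0) = Nat.size z := by
      rw [Finset.sum_ite, Finset.sum_const_zero, Finset.sum_const, smul_eq_mul, mul_one, add_zero]
      rw [show Finset.filter (fun j => j < Nat.size z) (Finset.range k) =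
        Finset.range (Nat.size z) by ext j; simp; omega, Finset.card_range]
    rw [this, Nat.mod_eq_of_lt]
    have : k < 2 ^ k := Nat.lt_two_pow_self
    rw [pow_succ]; omega
  · intro j hj
    have : 1 ≤ 2 ^ j := Nat.one_le_two_pow
    rw [pow_succ]; omega
  · intro j hj
    rw [pow_succ, mul_one]; have : 0 < 2 ^ k := by positivity
    omega

theorem size_div_pow {x i : ℕ} (h : 2 ^ i ≤ x) : Nat.size x = i + Nat.size (x / 2 ^ i) := by
  refine le_antisymm (Nat.size_le.2 ?_) ?_
  · have := Nat.lt_size_self (x / 2 ^ i)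
    rw [Nat.div_lt_iff_lt_mul (by positivity)] at this
    rwa [add_comm, pow_add]
  · have h1 : 0 < Nat.size (x / 2 ^ i) :=
      Nat.size_pos.2 (Nat.div_pos h (by positivity))
    obtain ⟨r, hr⟩ := Nat.exists_eq_succ_of_ne_zero h1.ne'
    have : 2 ^ r ≤ x / 2 ^ i := Nat.lt_size.1 (by omega)
    rw [Nat.le_div_iff_mul_le (by positivity), ← pow_add] at this
    have := Nat.lt_size.2 this
    omega

/-- The number whose bits tell which fields of `x` are nonzero. -/
def nonzeroFields (b k x : ℕ) : ℕ :=
  dsum 1 k fun j => if x / 2 ^ (b * j) % 2 ^ b = 0 then 0 else 1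

theorem nonzeroFields_succ (b k x : ℕ) : nonzeroFields b (k + 1) x =
    (if x % 2 ^ b = 0 then 0 else 1) + 2 * nonzeroFields b k (x / 2 ^ b) := by
  have : (fun j => if x / 2 ^ (b * (j + 1)) % 2 ^ b = 0 then 0 else 1) =
        fun j => if x / 2 ^ b / 2 ^ (b * j) % 2 ^ b = 0 then 0 else 1 := by
      funext j; rw [Nat.div_div_eq_div_mul, ← pow_add, Nat.mul_succ, add_comm b]
  unfold nonzeroFields
  rw [dsum, this]; simp

theorem nonzeroFields_eq_zero {b : ℕ} : ∀ {k x : ℕ}, x < 2 ^ (b * k) →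
    (nonzeroFields b k x = 0 ↔ x = 0)
  | 0, x, h => by simp at h; simp [h, nonzeroFields, dsum]
  | k + 1, x, h => by
    have h' : x / 2 ^ b < 2 ^ (b * k) := by
      rw [Nat.div_lt_iff_lt_mul (by positivity), ← pow_add]; exact h
    have ih := nonzeroFields_eq_zero h'
    have hm := Nat.div_add_mod x (2 ^ b)
    rw [nonzeroFields_succ]
    constructor
    · intro h0
      have : nonzeroFields b k (x / 2 ^ b) = 0 := by omega
      rw [ih] at this
      rw [this] at hm
      by_contra hx
      rw [if_neg (by omega)] at h0
      omega
    · rintro rfl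
      simp at ih ⊢; exact ih

theorem nonzeroFields_size {b : ℕ} : ∀ {k x : ℕ}, x < 2 ^ (b * k) → x ≠ 0 →
    2 ^ (b * (Nat.size (nonzeroFields b k x) - 1)) ≤ x ∧
      x < 2 ^ (b * Nat.size (nonzeroFields b k x))
  | 0, x, h, h0 => by simp at h; exact absurd h h0
  | k + 1, x, h, h0 => by
    have h' : x / 2 ^ b < 2 ^ (b * k) := by
      rw [Nat.div_lt_iff_lt_mul (by positivity), ← pow_add]; exact h
    have ih := nonzeroFields_size h'
    have hz := nonzeroFields_eq_zero h'
    rw [nonzeroFields_succ]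
    set z := nonzeroFields b k (x / 2 ^ b)
    by_cases hx : x / 2 ^ b = 0
    · rw [hz.2 hx]
      have hx' : x < 2 ^ b := by
        rcases Nat.div_eq_zero_iff.1 hx with h | h
        · exact absurd h (by positivity)
        · exact h
      rw [Nat.mod_eq_of_lt hx', if_neg h0]
      simp
      omega
    · obtain ⟨i1, i2⟩ := ih hx
      have hz0 : z ≠ 0 := fun h => hx (hz.1 h)
      have hs : Nat.size ((if x % 2 ^ b = 0 then 0 else 1) + 2 * z) = Nat.size z + 1 := by
        have : 2 ^ 1 ≤ (if x % 2 ^ b = 0 then 0 else 1) + 2 * z := by omega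
        rw [size_div_pow this, add_comm]
        congr 2
        split <;> omega
      have hzs : 0 < Nat.size z := Nat.size_pos.2 (by omega)
      rw [hs]
      rw [Nat.le_div_iff_mul_le (by positivity), ← pow_add] at i1
      rw [Nat.div_lt_iff_lt_mul (by positivity), ← pow_add] at i2
      refine ⟨?_, ?_⟩
      · convert i1 using 2
        have : Nat.size z + 1 - 1 = (Nat.size z - 1) + 1 := by omega
        rw [this]; ring
      · rwa [Nat.mul_succ]

theorem nonzeroFields_lt (b k x : ℕ) : nonzeroFields b k x < 2 ^ k := by
  have := dsum_lt (b := 1) (k := k) (d := fun j => if x / 2 ^ (b * j) % 2 ^ b = 0 then 0 else 1)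
    fun j _ => by split <;> simp
  simpa [nonzeroFields] using this

/-- Computation of the flags of all nonzero fields in parallel. -/
theorem flags_eq {b k x : ℕ} (hb : k + 2 ≤ b) (hx : x < 2 ^ (b * k)) :
    ((((x &&& (2 ^ (b - 1) - 1) * dsum b k (fun _ => 1)) +
      (2 ^ (b - 1) - 1) * dsum b k (fun _ => 1)) ||| x) &&&
        2 ^ (b - 1) * dsum b k (fun _ => 1)) / 2 ^ (b - 1) % (2 ^ (b - 1) - 1) =
      nonzeroFields b k x := by
  obtain ⟨a, rfl⟩ : ∃ a, b = a + 1 := ⟨b - 1, by omega⟩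
  simp only [Nat.add_sub_cancel]
  have hp : 0 < 2 ^ a := by positivity
  have hpp : 2 ^ (a + 1) = 2 ^ a + 2 ^ a := by rw [pow_succ]; omega
  have hxd := dsum_digits hx
  set d := fun j => x / 2 ^ ((a + 1) * j) % 2 ^ (a + 1) with hd
  have hdl : ∀ j, d j < 2 ^ (a + 1) := fun j => Nat.mod_lt _ (by positivity)
  have hm : ∀ j, d j &&& (2 ^ a - 1) = d j % 2 ^ a := fun j => Nat.and_two_pow_sub_one_eq_mod _ _
  have hml : ∀ j, d j % 2 ^ a < 2 ^ a := fun j => Nat.mod_lt _ hp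
  conv_lhs => rw [← hxd]
  rw [dsum_mul, dsum_mul, dsum_and (fun j _ => hdl j) (fun j _ => by omega), dsum_add,
    dsum_or _ (fun j _ => hdl j), dsum_and _ (fun j _ => by omega)]
  · have e2 : dsum (a + 1) k (fun j => ((d j &&& (2 ^ a - 1) * 1) + (2 ^ a - 1) * 1 ||| d j) &&&
        2 ^ a * 1) = 2 ^ a * dsum (a + 1) k fun j => if d j = 0 then 0 else 1 := by
      rw [dsum_mul]
      refine dsum_congr fun j _ => ?_
      simp only [mul_one, hm]
      have hm' := hml j
      have hl := hdl j
      have hdm := Nat.div_add_mod (d j) (2 ^ a)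
      rw [two_pow_and _ _ (Nat.or_lt_two_pow (by omega) hl)]
      by_cases h0 : d j = 0
      · simp only [h0]; simp
      · have h1 : 2 ^ a ≤ (d j % 2 ^ a + (2 ^ a - 1)) ||| d j := by
          by_cases h2 : d j % 2 ^ a = 0
          · refine le_trans ?_ Nat.right_le_or
            by_contra h3
            rw [Nat.mod_eq_of_lt (by omega)] at h2
            omega
          · exact le_trans (by omega) Nat.left_le_or
        simp [h0, h1]
    rw [e2, Nat.mul_div_cancel_left _ hp]
    have h0 : 2 ^ (a + 1) ≡ 2 ^ 1 [MOD 2 ^ a - 1] := by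
      have := (pow_mod_pred a).mul_right 2
      simpa [pow_succ] using this
    rw [dsum_modEq h0, Nat.mod_eq_of_lt]
    · rfl
    · refine lt_of_lt_of_le (nonzeroFields_lt (a + 1) k x) ?_
      have : 2 ^ (k + 1) ≤ 2 ^ a := Nat.pow_le_pow_right (by omega) (by omega)
      rw [pow_succ] at this
      have : 1 ≤ 2 ^ k := Nat.one_le_two_pow
      omega
  · intro j _
    refine Nat.or_lt_two_pow ?_ (hdl j)
    have := hml j
    simp only [mul_one, hm]; omega
  · intro j _
    have := hml j
    simp only [mul_one, hm]; omega

end FieldSum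

/-! ### The binary logarithm on the machine -/

namespace WordRAM

open FieldSum

variable {σ : ℕ → ℕ} {m N w : ℕ}

/-- Facts about a sufficiently large word length: with fields of `σ w / B` bits, the computation of
logarithms processes a word in at most `A` pieces. -/
structure WordOK (σ : ℕ → ℕ) (A B w : ℕ) : Prop where
  /-- The machine constant fits into a word. -/
  root_lt : σ w < 2 ^ w
  B_lt : B < 2 ^ w
  B_pos : 0 < B
  field_ge : 8 ≤ σ w / B
  /-- All distances of shifts over fields are smaller than the word length. -/
  field_le : (σ w / B) * (σ w / B + 2) < w
  /-- A word is covered by `A` pieces of `f - 2` fields of width `f`. -/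
  le_pieces : w ≤ A * ((σ w / B) * (σ w / B - 2))
  w_ge : 64 ≤ w

/-- The final state agrees with the initial one in memory and in the registers below `b`. -/
def Frame (b : ℕ) (s s' : State w) : Prop :=
  s'.mem = s.mem ∧ s'.written = s.written ∧ ∀ i < b, s'.rg i = s.rg i

theorem Frame.refl (b : ℕ) (s : State w) : Frame b s s := ⟨rfl, rfl, fun _ _ => rfl⟩

theorem Frame.trans {b : ℕ} {s₁ s₂ s₃ : State w} (h : Frame b s₁ s₂) (h' : Frame b s₂ s₃) :
    Frame b s₁ s₃ :=
  ⟨h'.1.trans h.1, h'.2.1.trans h.2.1, fun i hi => (h'.2.2 i hi).trans (h.2.2 i hi)⟩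

theorem Frame.setR {b r : ℕ} {s s' : State w} (h : Frame b s s') (hr : b ≤ r) (x : BitVec w) :
    Frame b s (s'.setR r x) :=
  ⟨h.1, h.2.1, fun i hi => by rw [rg_setR, if_neg (by omega), h.2.2 i hi]⟩

theorem Frame.weaken {b b' : ℕ} {s s' : State w} (h : Frame b s s') (hb : b' ≤ b) :
    Frame b' s s' :=
  ⟨h.1, h.2.1, fun i hi => h.2.2 i (by omega)⟩

/-- `k` fields of width `b` that hold `1`. -/
def onesE (b k : Expr) : Expr := (exp2 (b * k) - 1) / (exp2 b - 1)

theorem val_onesE (s : State w) (b k : Expr) {x y : ℕ} (hb : val σ s b = x) (hk : val σ s k = y)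
    (hx : 1 ≤ x) (hy : 1 ≤ y) (h : x * y < w) :
    val σ s (onesE b k) = dsum x y fun _ => 1 := by
  have hw : w < 2 ^ w := Nat.lt_two_pow_self
  have h1 : val σ s (1 : Expr) = 1 := val_const_of_lt _ _ (by omega)
  have hxw : x < w := by nlinarith
  have h2 := val_exp2 s _ (val_mul_of_lt s b k hb hk (by omega)) h
  have h3 := val_exp2 s b hb hxw
  rw [onesE, val_div, val_sub_of_le _ _ _ h2 h1 Nat.one_le_two_pow,
    val_sub_of_le _ _ _ h3 h1 Nat.one_le_two_pow, dsum_one hx]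

/-- The bit length of a number `z` of at most `k` bits, for small `k`: copies of `z` are compared
with all powers of two in parallel, and the outcomes are added up by a reduction modulo
`2 ^ (k + 1) - 1`. -/
def rankE (k z : Expr) : Expr :=
  (((z * onesE (k + 1) k + exp2 k * onesE (k + 1) k - onesE (k + 2) k) &&&
    exp2 k * onesE (k + 1) k) >>> k) % (exp2 (k + 1) - 1)

theorem val_rankE (s : State w) (k z : Expr) {x y : ℕ} (hk : val σ s k = x) (hz : val σ s z = y)
    (hx : 1 ≤ x) (h : x * (x + 2) < w) (hy : y < 2 ^ x) :
    val σ s (rankE k z) = Nat.size y := by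
  have hw : w < 2 ^ w := Nat.lt_two_pow_self
  have hxw : x + 2 < w := by nlinarith
  have h1 : val σ s (1 : Expr) = 1 := val_const_of_lt _ _ (by omega)
  have h2 : val σ s (2 : Expr) = 2 := val_const_of_lt _ _ (by omega)
  have hk1 := val_add_of_lt s k 1 hk h1 (by omega)
  have hk2 := val_add_of_lt s k 2 hk h2 (by omega)
  have ho1 := val_onesE s (k + 1) k hk1 hk (by omega) hx (by nlinarith)
  have ho2 := val_onesE s (k + 2) k hk2 hk (by omega) hx (by nlinarith)
  have hs := val_exp2 s k hk (by omega)
  have hs1 := val_exp2 s (k + 1) hk1 (by omega)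
  have hp : 0 < 2 ^ x := by positivity
  have hle : y * dsum (x + 1) x (fun _ => 1) + 2 ^ x * dsum (x + 1) x (fun _ => 1) < 2 ^ w := by
    rw [dsum_mul, dsum_mul, dsum_add]
    refine (dsum_lt fun j _ => ?_).trans (Nat.pow_lt_pow_right (by omega)
      (show (x + 1) * x < w by nlinarith))
    rw [pow_succ]; omega
  have e1 := val_mul_of_lt s z _ hz ho1 (by omega)
  have e2 := val_mul_of_lt s (exp2 k) _ hs ho1 (by omega)
  have e3 := val_add_of_lt s _ _ e1 e2 hle
  have hsub : dsum (x + 2) x (fun _ => 1) ≤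
      y * dsum (x + 1) x (fun _ => 1) + 2 ^ x * dsum (x + 1) x (fun _ => 1) := by
    rw [← dsum_pow (b := x + 1), dsum_mul, dsum_mul, dsum_add]
    have : dsum (x + 1) x (fun j => y * 1 + 2 ^ x * 1) =
        dsum (x + 1) x (fun j => 2 ^ j) + dsum (x + 1) x (fun j => y + (2 ^ x - 2 ^ j)) := by
      rw [dsum_add]
      refine dsum_congr fun j hj => ?_
      have : 2 ^ j ≤ 2 ^ x := Nat.pow_le_pow_right (by omega) hj.le
      omega
    omega
  have e4 := val_sub_of_le s _ _ e3 ho2 hsub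
  rw [rankE, val_mod, val_shr, val_and, e4, e2, hk, val_sub_of_le _ _ _ hs1 h1 Nat.one_le_two_pow,
    rank_eq hy]

/-- Flags for the nonzero ones of the `b - 2` fields of width `b` of a number, collected in
consecutive bits by a multiplication. -/
def flagsE (b x : Expr) : Expr :=
  (((((x &&& (exp2 (b - 1) - 1) * onesE b (b - 2)) + (exp2 (b - 1) - 1) * onesE b (b - 2)) ||| x)
    &&& exp2 (b - 1) * onesE b (b - 2)) >>> (b - 1)) % (exp2 (b - 1) - 1)

theorem val_flagsE (s : State w) (b x : Expr) {f y : ℕ} (hb : val σ s b = f) (hx : val σ s x = y)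
    (hf : 8 ≤ f) (h : f * f < w) (hy : y < 2 ^ (f * (f - 2))) :
    val σ s (flagsE b x) = nonzeroFields f (f - 2) y := by
  have hw : w < 2 ^ w := Nat.lt_two_pow_self
  have hxw : f < w := by nlinarith
  have hff : f * (f - 2) ≤ f * f := Nat.mul_le_mul_left _ (by omega)
  have h1 : val σ s (1 : Expr) = 1 := val_const_of_lt _ _ (by omega)
  have h2 : val σ s (2 : Expr) = 2 := val_const_of_lt _ _ (by omega)
  have hk1 := val_sub_of_le s b 1 hb h1 (by omega)
  have hk2 := val_sub_of_le s b 2 hb h2 (by omega)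
  have ho := val_onesE s b (b - 2) hb hk2 (by omega) (by omega) (by omega)
  have hs := val_exp2 s (b - 1) hk1 (by omega)
  have hs1 := val_sub_of_le s _ _ hs h1 Nat.one_le_two_pow
  have hp : 0 < 2 ^ (f - 1) := by positivity
  have hlt : ∀ c, c < 2 ^ f → c * dsum f (f - 2) (fun _ => 1) < 2 ^ (w - 1) := by
    intro c hc
    rw [dsum_mul]
    refine (dsum_lt fun j _ => ?_).trans_le (Nat.pow_le_pow_right (by omega)
      (show f * (f - 2) ≤ w - 1 by omega))
    omega
  have hpf : 2 ^ f = 2 ^ (f - 1) + 2 ^ (f - 1) := by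
    rw [← mul_two, ← pow_succ]; congr 1; omega
  have hpw : 2 ^ w = 2 ^ (w - 1) + 2 ^ (w - 1) := by
    rw [← mul_two, ← pow_succ]; congr 1; omega
  have l1 := hlt (2 ^ (f - 1) - 1) (by omega)
  have l2 := hlt (2 ^ (f - 1)) (by omega)
  have e1 := val_mul_of_lt s _ _ hs1 ho (by omega)
  have e2 := val_mul_of_lt s _ _ hs ho (by omega)
  have e3 : val σ s (x &&& (exp2 (b - 1) - 1) * onesE b (b - 2)) = _ := val_and s _ _
  rw [hx, e1] at e3
  have e4 := val_add_of_lt s _ _ e3 e1 (by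
    have := Nat.and_le_right (n := y) (m := (2 ^ (f - 1) - 1) * dsum f (f - 2) fun _ => 1)
    omega)
  rw [flagsE, val_mod, val_shr, val_and, val_or, e4, e2, hs1, hk1, hx]
  exact flags_eq (by omega) hy

/-- Replaces the number in register `100` by its bit length. -/
def sizeP (B : ℕ) : Prog :=
  .assign 101 (.rootWord / .const B) ;;
  .assign 102 0 ;;
  .loop (.lt 0 (Rg 100 >>> (Rg 101 * (Rg 101 - 2))))
    (.assign 100 (Rg 100 >>> (Rg 101 * (Rg 101 - 2))) ;;
      .assign 102 (Rg 102 + Rg 101 * (Rg 101 - 2))) ;;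
  .assign 103 (flagsE (Rg 101) (Rg 100)) ;;
  .ite (.eq (Rg 103) 0) (.assign 100 0)
    (.assign 103 (Rg 101 * (rankE (Rg 101) (Rg 103) - 1)) ;;
      .assign 100 (Rg 102 + (Rg 103 + rankE (Rg 101) (Rg 100 >>> Rg 103))))

theorem size_le_of_lt {x w : ℕ} (h : x < 2 ^ w) : Nat.size x ≤ w := Nat.size_le.2 h

theorem wp_size {A B : ℕ} (ok : WordOK σ A B w) (hN : A ≤ N) (s : State w) :
    wp σ m N (sizeP B) (fun s' => s'.rg 100 = Nat.size (s.rg 100) ∧ Frame 100 s s') s := by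
  obtain ⟨k1, k2, k3, k4, k5, k6, k7⟩ := ok
  set f := σ w / B with hf
  have hw : w < 2 ^ w := Nat.lt_two_pow_self
  have hff : f * (f + 2) = f * f + 2 * f := by ring
  have hfg : f * (f - 2) + 2 * f = f * f := by
    obtain ⟨r, hr⟩ : ∃ r, f = r + 2 := ⟨f - 2, by omega⟩
    rw [hr]; simp; ring
  refine wp_assign_seq (v := f) (by
    rw [val_div, val_root, val_const, Nat.mod_eq_of_lt k1, Nat.mod_eq_of_lt k2]) fun x hx => ?_
  refine wp_assign_seq (v := 0) (by rw [val_const_of_lt _ _ (by positivity)]) fun x' hx' => ?_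
  have hpc : ∀ t : State w, t.rg 101 = f →
      val σ t (Rg 101 * (Rg 101 - 2)) = f * (f - 2) := fun t ht =>
    val_mul_of_lt t _ _ ((val_reg t 101).trans ht)
      (val_sub_of_le t _ _ ((val_reg t 101).trans ht) (val_const_of_lt _ _ (by omega)) (by omega))
      (by omega)
  -- the loop cuts off pieces at the low end, so the bit length splits into a sum
  let I : ℕ → State w → Prop := fun k t =>
    t.rg 101 = f ∧ Frame 100 s t ∧ t.rg 100 < 2 ^ (k * (f * (f - 2))) ∧
      (t.rg 100 = 0 ↔ s.rg 100 = 0) ∧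
      (s.rg 100 ≠ 0 → t.rg 102 + Nat.size (t.rg 100) = Nat.size (s.rg 100))
  refine wp_call (R := fun t => ∃ k, I k t ∧ t.rg 100 < 2 ^ (f * (f - 2)))
    (wp_loop rfl I ?_ ?_ A hN ?_) ?_
  · rintro k t ⟨i1, i2, i3, i4, i5⟩ hb
    rw [holds_lt, val_shr, hpc t i1, val_reg, val_const_of_lt _ _ (by positivity)] at hb
    have hge : 2 ^ (f * (f - 2)) ≤ t.rg 100 := by
      by_contra hlt
      rw [Nat.div_eq_of_lt (by omega)] at hb
      omega
    obtain ⟨k', rfl⟩ : ∃ k', k = k' + 1 := by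
      rcases k with _ | k
      · simp at i3
        have : 0 < 2 ^ (f * (f - 2)) := by positivity
        omega
      · exact ⟨k, rfl⟩
    refine ⟨k', rfl, wp_assign_seq rfl fun y hy => wp_assign rfl fun z hz => ?_⟩
    rw [val_shr, hpc t i1, val_reg] at hy
    have hs := size_div_pow hge
    have h102 : s.rg 100 ≠ 0 → t.rg 102 + f * (f - 2) < 2 ^ w := fun h0 => by
      have := i5 h0
      have := size_le_of_lt (s.rg_lt 100)
      omega
    rw [val_add, hpc _ (by simpa using i1), val_reg] at hz
    simp only [rg_setR] at hz
    norm_num at hz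
    refine ⟨by simpa using i1, (i2.setR (by omega) _).setR (by omega) _, ?_, ?_, ?_⟩
    · simp [hy, Nat.div_lt_iff_lt_mul (show 0 < 2 ^ (f * (f - 2)) by positivity)]
      rwa [← pow_add, ← Nat.succ_mul]
    · rw [← i4]
      simp only [rg_setR, if_true]
      norm_num
      rw [hy]
      exact ⟨fun h => absurd h hb.ne', fun h => by simp [h]⟩
    · intro h0
      simp [hy, hz, Nat.mod_eq_of_lt (h102 h0)]
      have := i5 h0
      omega
  · rintro k t hI hb
    refine ⟨k, hI, ?_⟩
    rw [holds_lt, val_shr, hpc t hI.1, val_reg, val_const_of_lt _ _ (by positivity)] at hb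
    exact Nat.lt_of_div_eq_zero (by positivity) (Nat.eq_zero_of_not_pos hb)
  · refine ⟨by simp [hx], (((Frame.refl _ s).setR (by omega) _).setR (by omega) _), ?_, ?_, ?_⟩
    · simpa using (s.rg_lt 100).trans_le (Nat.pow_le_pow_right (by omega) k6)
    · simp
    · simp [hx']
  · rintro t ⟨k, ⟨i1, i2, -, i4, i5⟩, hlt⟩
    have hfl := val_flagsE (σ := σ) t (Rg 101) (Rg 100) ((val_reg t 101).trans i1) (val_reg t 100)
      k4 (by omega) hlt
    refine wp_assign_seq hfl fun y hy => ?_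
    refine wp_ite (fun hb => ?_) fun hb => ?_
    · rw [holds_eq, val_reg, val_const_of_lt _ _ (by positivity)] at hb
      simp only [rg_setR, if_true, hy] at hb
      rw [nonzeroFields_eq_zero hlt] at hb
      have h0 : s.rg 100 = 0 := i4.1 hb
      refine wp_assign (val_const_of_lt _ _ (by positivity)) fun z hz => ?_
      exact ⟨by simp [hz, h0], (i2.setR (by omega) _).setR (by omega) _⟩
    · rw [holds_eq, val_reg, val_const_of_lt _ _ (by positivity)] at hb
      simp only [rg_setR, if_true, hy] at hb
      have hx0 : t.rg 100 ≠ 0 := fun h => hb ((nonzeroFields_eq_zero hlt).2 h)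
      obtain ⟨z1, z2⟩ := nonzeroFields_size hlt hx0
      set q := Nat.size (nonzeroFields f (f - 2) (t.rg 100)) with hq
      have hq1 : 0 < q := Nat.size_pos.2 (Nat.pos_of_ne_zero hb)
      have hq2 : q ≤ f - 2 := Nat.size_le.2 (nonzeroFields_lt _ _ _)
      have hfq : f * (q - 1) ≤ f * (f - 2) := Nat.mul_le_mul_left _ (by omega)
      have h5 := i5 fun h => hx0 (i4.2 h)
      have hsz := size_div_pow z1
      have hsw := size_le_of_lt (s.rg_lt 100)
      have h1 : ∀ t : State w, val σ t (1 : Expr) = 1 := fun t => val_const_of_lt _ _ (by omega)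
      have v1 := val_rankE (σ := σ) (t.setR 103 y) (Rg 101) (Rg 103) (x := f)
        (y := nonzeroFields f (f - 2) (t.rg 100))
        (by simp [val_reg, i1]) (by simp [val_reg, hy]) (by omega) k5
        ((nonzeroFields_lt _ _ _).trans_le (Nat.pow_le_pow_right (by omega) (by omega)))
      rw [← hq] at v1
      have v2 := val_mul_of_lt (σ := σ) (t.setR 103 y) (Rg 101) _ (by simp [val_reg]; exact i1)
        (val_sub_of_le _ _ _ v1 (h1 _) hq1) (by omega)
      refine wp_assign_seq v2 fun z hz => ?_
      have hlow : t.rg 100 / 2 ^ (f * (q - 1)) < 2 ^ f := by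
        rw [Nat.div_lt_iff_lt_mul (by positivity), ← pow_add]
        convert z2 using 2
        conv_rhs => rw [show q = (q - 1) + 1 by omega]
        ring
      have v3 := val_rankE (σ := σ) ((t.setR 103 y).setR 103 z) (Rg 101) (Rg 100 >>> Rg 103)
        (x := f) (y := t.rg 100 / 2 ^ (f * (q - 1)))
        (by simp [val_reg, i1]) (by simp [val_shr, val_reg, hz]) (by omega) k5 hlow
      refine wp_assign (val_add_of_lt _ _ _ (x := t.rg 102) (by simp [val_reg])
        (val_add_of_lt _ _ _ (x := f * (q - 1)) (by simp [val_reg, hz]) v3 (by omega))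
          (by omega)) fun v hv => ?_
      refine ⟨?_, ((i2.setR (by omega) _).setR (by omega) _).setR (by omega) _⟩
      simp [hv]; omega

end WordRAM

/-! ### Searching the memory for a bit -/

namespace WordRAM

variable {σ : ℕ → ℕ} {m N w : ℕ}

theorem memBit_eq (mem : ℕ → BitVec w) {a i : ℕ} (hi : i < w) :
    memBit mem (a * w + i) = (mem a).toNat.testBit i := by
  unfold memBit
  rw [Nat.mul_comm, Nat.mul_add_div (by omega), Nat.div_eq_of_lt hi, Nat.mul_add_mod,
    Nat.mod_eq_of_lt hi]
  simp [BitVec.testBit_toNat]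

theorem memBit_update_ne (mem : ℕ → BitVec w) {a p : ℕ} (x : BitVec w) (h : p / w ≠ a) :
    memBit (Function.update mem a x) p = memBit mem p := by
  unfold memBit; rw [Function.update_of_ne h]

theorem testBit_clear (y o i : ℕ) :
    (y / 2 ^ o * 2 ^ o).testBit i = (decide (o ≤ i) && y.testBit i) := by
  rw [Nat.testBit_mul_two_pow, Nat.testBit_div_two_pow]
  by_cases h : o ≤ i
  · simp [h]
  · simp [h]

/-- The word `0` or `2 ^ w - 1` that turns bits equal to `v` into ones by bitwise `xor`. -/
def colorMask (w : ℕ) (v : Bool) : ℕ := if v then 0 else 2 ^ w - 1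

theorem testBit_xor_colorMask {x : ℕ} (hx : x < 2 ^ w) (v : Bool) (i : ℕ) :
    (x ^^^ colorMask w v).testBit i = true ↔ i < w ∧ x.testBit i = v := by
  have hi : w ≤ i → x.testBit i = false := fun h =>
    Nat.testBit_eq_false_of_lt (hx.trans_le (Nat.pow_le_pow_right (by omega) h))
  rw [Nat.testBit_xor]
  cases v
  · simp only [colorMask, Bool.false_eq_true, if_false, Nat.testBit_two_pow_sub_one]
    by_cases h : i < w
    · simp [h]
    · simp [h, hi (by omega)]
  · simp only [colorMask, if_true, Nat.zero_testBit]
    by_cases h : i < w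
    · simp [h]
    · simp [h, hi (by omega)]

theorem size_sub_one_testBit {y : ℕ} (hy : y ≠ 0) : y.testBit (Nat.size y - 1) = true := by
  have h1 : 0 < Nat.size y := Nat.size_pos.2 (Nat.pos_of_ne_zero hy)
  have h2 : 2 ^ (Nat.size y - 1) ≤ y := Nat.lt_size.1 (by omega)
  have h3 := Nat.lt_size_self y
  rw [Nat.testBit_eq_decide_div_mod_eq]
  have : y / 2 ^ (Nat.size y - 1) = 1 := by
    refine Nat.div_eq_of_lt_le (by omega) ?_
    rw [← pow_succ']
    simpa [show Nat.size y - 1 + 1 = Nat.size y by omega] using h3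
  simp [this]

theorem testBit_of_size_le {y i : ℕ} (h : Nat.size y ≤ i) : y.testBit i = false :=
  Nat.testBit_eq_false_of_lt (Nat.size_le.1 h)

/-- `y` marks the positions in word `a` of the bits with value `v` in the range from `p₀`
(inclusive) to `p₁` (exclusive). -/
def Marks (mem : ℕ → BitVec w) (v : Bool) (p₀ p₁ a y : ℕ) : Prop :=
  ∀ i, y.testBit i = true ↔
    i < w ∧ memBit mem (a * w + i) = v ∧ p₀ ≤ a * w + i ∧ a * w + i < p₁

theorem Marks.eq_zero {mem : ℕ → BitVec w} {v : Bool} {p₀ p₁ a : ℕ} (hw : 0 < w)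
    (h : Marks mem v p₀ p₁ a 0) {p : ℕ} (hp : p / w = a) (h0 : p₀ ≤ p) (h1 : p < p₁) :
    memBit mem p ≠ v := by
  intro hv
  have e : a * w + p % w = p := by rw [← hp, Nat.mul_comm]; exact Nat.div_add_mod p w
  have := (h (p % w)).2 ⟨Nat.mod_lt _ hw, by rw [e]; exact hv, by omega, by omega⟩
  simp at this

/-- Searches for the last position of a bit with a given value in a range. The range is from bit
`reg 82` of word `reg 81` (inclusive) to bit `reg 84` of word `reg 83` (exclusive), and `reg 80` is
the color mask. The success is reported in `reg 80` and the position in `reg 81` and `reg 82`. -/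
def scanP (B : ℕ) : Prog :=
  let clear : Prog := .ite (.eq (Rg 83) (Rg 81)) (.assign 85 ((Rg 85 >>> Rg 82) <<< Rg 82)) .skip
  let go : Prog := .assign 86 0 ;;
    .ite (.eq (Rg 85) 0) (.ite (.lt (Rg 81) (Rg 83)) (.assign 86 1) .skip) .skip
  .assign 85 0 ;;
  .ite (.lt 0 (Rg 84))
    (.load 85 (Rg 83) ;; .assign 85 ((Rg 85 ^^^ Rg 80) &&& (exp2 (Rg 84) - 1)) ;; clear) .skip ;;
  go ;;
  .loop (.eq (Rg 86) 1)
    (.assign 83 (Rg 83 - 1) ;; .load 85 (Rg 83) ;; .assign 85 (Rg 85 ^^^ Rg 80) ;; clear ;; go) ;;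
  .ite (.eq (Rg 85) 0) (.assign 80 0)
    (.assign 100 (Rg 85) ;; sizeP B ;; .assign 81 (Rg 83) ;; .assign 82 (Rg 100 - 1) ;;
      .assign 80 1)

theorem wp_scan {A B : ℕ} (ok : WordOK σ A B w) (hA : A ≤ N) (s : State w) (v : Bool)
    {a₀ o₀ a₁ o₁ : ℕ} (h80 : s.rg 80 = colorMask w v) (h81 : s.rg 81 = a₀) (h82 : s.rg 82 = o₀)
    (h83 : s.rg 83 = a₁) (h84 : s.rg 84 = o₁) (ho₀ : o₀ < w) (ho₁ : o₁ < w) (ha : a₀ ≤ a₁)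
    (hN : a₁ - a₀ ≤ N) (hm : ∀ a, a₀ ≤ a → a * w < a₁ * w + o₁ → a < m) :
    wp σ m N (scanP B) (fun s' => Frame 80 s s' ∧
      ((s'.rg 80 = 0 ∧ ∀ p, a₀ * w + o₀ ≤ p → p < a₁ * w + o₁ → memBit s.mem p ≠ v) ∨
       (s'.rg 80 = 1 ∧ s'.rg 82 < w ∧ a₀ * w + o₀ ≤ s'.rg 81 * w + s'.rg 82 ∧
          s'.rg 81 * w + s'.rg 82 < a₁ * w + o₁ ∧
          memBit s.mem (s'.rg 81 * w + s'.rg 82) = v ∧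
          ∀ p, s'.rg 81 * w + s'.rg 82 < p → p < a₁ * w + o₁ → memBit s.mem p ≠ v))) s := by
  have hw0 : 0 < w := by omega
  have hw : w < 2 ^ w := Nat.lt_two_pow_self
  have h1 : ∀ t : State w, val σ t (1 : Expr) = 1 := fun t =>
    val_const_of_lt _ _ (show 1 < 2 ^ w by omega)
  have h0 : ∀ t : State w, val σ t (0 : Expr) = 0 := fun t =>
    val_const_of_lt _ _ (show 0 < 2 ^ w by omega)
  set p₀ := a₀ * w + o₀ with hp₀
  set p₁ := a₁ * w + o₁ with hp₁
  -- registers that stay fixed during the search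
  let F : State w → Prop := fun t =>
    Frame 80 s t ∧ t.rg 80 = colorMask w v ∧ t.rg 81 = a₀ ∧ t.rg 82 = o₀
  have hF : ∀ t r x, F t → 83 ≤ r → F (t.setR r x) := fun t r x ⟨f1, f2, f3, f4⟩ hr =>
    ⟨f1.setR (by omega) x, by simp; rw [if_neg (by omega), f2], by simp; rw [if_neg (by omega), f3],
      by simp; rw [if_neg (by omega), f4]⟩
  let J : State w → Prop := fun t => F t ∧ a₀ ≤ t.rg 83 ∧ t.rg 83 ≤ a₁ ∧
    Marks s.mem v p₀ p₁ (t.rg 83) (t.rg 85) ∧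
    ∀ p, (t.rg 83 + 1) * w ≤ p → p < p₁ → memBit s.mem p ≠ v
  have go : ∀ t, J t → wp σ m N (.assign 86 0 ;;
      .ite (.eq (Rg 85) 0) (.ite (.lt (Rg 81) (Rg 83)) (.assign 86 1) .skip) .skip)
      (fun t' => J t' ∧ t'.rg 83 = t.rg 83 ∧ (t'.rg 86 = 1 ↔ t'.rg 85 = 0 ∧ a₀ < t'.rg 83)) t := by
    rintro t ⟨j1, j2, j3, j4, j5⟩
    refine wp_assign_seq (h0 t) fun x hx => ?_
    have hJ : J (t.setR 86 x) := ⟨hF _ _ _ j1 (by omega), by simpa, by simpa, by simpa, by simpa⟩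
    refine wp_ite (fun hb => wp_ite (fun hb' => ?_) fun hb' => ?_) fun hb => ?_
    · simp [holds_eq, holds_lt, val_reg, h0] at hb hb'
      refine wp_assign (h1 _) fun y hy => ⟨?_, ?_, ?_⟩
      · exact ⟨hF _ _ _ hJ.1 (by omega), by simpa, by simpa, by simpa, by simpa⟩
      · simp
      · simp [hy, hb]; rw [← j1.2.2.1]; exact hb'
    · simp [holds_eq, holds_lt, val_reg, h0] at hb hb'
      refine wp_skip ⟨hJ, by simp, ?_⟩
      simp [hx]; intro; rw [← j1.2.2.1]; exact hb'
    · simp [holds_eq, val_reg, h0] at hb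
      refine wp_skip ⟨hJ, by simp, ?_⟩
      simp [hx, hb]
  -- the step that clears the bits before the range
  have clear : ∀ t, F t → a₀ ≤ t.rg 83 →
      (∀ i, (t.rg 85).testBit i = true ↔ i < w ∧ memBit s.mem (t.rg 83 * w + i) = v ∧
        t.rg 83 * w + i < p₁) →
      wp σ m N (.ite (.eq (Rg 83) (Rg 81)) (.assign 85 ((Rg 85 >>> Rg 82) <<< Rg 82)) .skip)
        (fun t' => F t' ∧ t'.rg 83 = t.rg 83 ∧ Marks s.mem v p₀ p₁ (t.rg 83) (t'.rg 85)) t := by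
    intro t hFt hge ht
    refine wp_ite (fun hb => ?_) fun hb => ?_
    · rw [holds_eq, val_reg, val_reg] at hb
      refine wp_assign rfl fun x hx => ⟨hF _ _ _ hFt (by omega), by simp, ?_⟩
      have hle := Nat.div_mul_le_self (t.rg 85) (2 ^ o₀)
      have hlt := t.rg_lt 85
      rw [val_shl, val_shr, val_reg, val_reg, hFt.2.2.2, Nat.mod_eq_of_lt (by omega)] at hx
      intro i
      simp only [rg_setR, if_true, hx, testBit_clear, Bool.and_eq_true, decide_eq_true_eq, ht]
      have : p₀ ≤ t.rg 83 * w + i ↔ o₀ ≤ i := by rw [hb, hFt.2.2.1]; omega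
      rw [this]; tauto
    · rw [holds_eq, val_reg, val_reg, hFt.2.2.1] at hb
      refine wp_skip ⟨hFt, rfl, fun i => ?_⟩
      rw [ht]
      have : (a₀ + 1) * w ≤ t.rg 83 * w := Nat.mul_le_mul_right _ (by omega)
      have : p₀ ≤ t.rg 83 * w + i := by rw [Nat.add_mul] at this; omega
      tauto
  have loopdone : ∀ t, J t → ¬ (t.rg 85 = 0 ∧ a₀ < t.rg 83) → wp σ m N
      (.ite (.eq (Rg 85) 0) (.assign 80 0)
        (.assign 100 (Rg 85) ;; sizeP B ;; .assign 81 (Rg 83) ;; .assign 82 (Rg 100 - 1) ;;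
        .assign 80 1)) (fun s' => Frame 80 s s' ∧
      ((s'.rg 80 = 0 ∧ ∀ p, p₀ ≤ p → p < p₁ → memBit s.mem p ≠ v) ∨
       (s'.rg 80 = 1 ∧ s'.rg 82 < w ∧ p₀ ≤ s'.rg 81 * w + s'.rg 82 ∧
          s'.rg 81 * w + s'.rg 82 < p₁ ∧
          memBit s.mem (s'.rg 81 * w + s'.rg 82) = v ∧
          ∀ p, s'.rg 81 * w + s'.rg 82 < p → p < p₁ → memBit s.mem p ≠ v))) t := by
    rintro t ⟨j1, j2, j3, j4, j5⟩ hd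
    refine wp_ite (fun hb => ?_) fun hb => ?_
    · rw [holds_eq, val_reg, h0] at hb
      refine wp_assign (h0 _) fun x hx => ⟨j1.1.setR (by omega) _, Or.inl ⟨by simp [hx], ?_⟩⟩
      have h83' : t.rg 83 = a₀ := by omega
      rw [hb, h83'] at j4
      rw [h83'] at j5
      intro p hp hp'
      by_cases hc : p / w = a₀
      · exact j4.eq_zero hw0 hc hp hp'
      · refine j5 p ?_ hp'
        have h3 : a₀ ≤ p / w := by rw [Nat.le_div_iff_mul_le hw0]; omega
        exact (Nat.mul_le_mul_right w (show a₀ + 1 ≤ p / w by omega)).trans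
          (Nat.div_mul_le_self p w)
    · rw [holds_eq, val_reg, h0] at hb
      refine wp_assign_seq (val_reg _ _) fun x hx => ?_
      refine wp_call (wp_size ok hA _) ?_
      rintro t' ⟨e1, e2⟩
      have e83 : t'.rg 83 = t.rg 83 := by rw [e2.2.2 83 (by omega)]; simp
      simp only [rg_setR, if_true, hx] at e1
      have hpos : 0 < Nat.size (t.rg 85) := Nat.size_pos.2 (Nat.pos_of_ne_zero hb)
      refine wp_assign_seq (val_reg _ _) fun y hy => ?_
      refine wp_assign_seq (val_sub_of_le _ _ _ (x := Nat.size (t.rg 85)) (by simp [val_reg, e1])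
        (h1 _) hpos) fun z hz => ?_
      refine wp_assign (h1 _) fun z' hz' => ?_
      refine ⟨((((j1.1.setR (by omega) x).trans (e2.weaken (by omega))).setR (by omega) _).setR
        (by omega) _).setR (by omega) _, Or.inr ?_⟩
      obtain ⟨k1, k2, k3, k4⟩ := (j4 _).1 (size_sub_one_testBit hb)
      simp [hy, hz, hz', e83]
      refine ⟨k1, k3, k4, k2, fun p hp hp' => ?_⟩
      by_cases hc : p < (t.rg 83 + 1) * w
      · intro hv
        have e : t.rg 83 * w + (p - t.rg 83 * w) = p := by omega
        have := (j4 (p - t.rg 83 * w)).2 ⟨by rw [Nat.add_mul] at hc; omega, by rw [e]; exact hv,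
          by omega, by omega⟩
        rw [testBit_of_size_le (by omega)] at this
        exact absurd this (by simp)
      · exact j5 p (by omega) hp'
  have marks : ∀ t : State w, t.mem = s.mem → ∀ a i, ((t.mem a).toNat ^^^ colorMask w v).testBit i =
      true ↔ i < w ∧ memBit s.mem (a * w + i) = v := by
    intro t ht a i
    rw [testBit_xor_colorMask (t.mem a).isLt, ht]
    constructor
    · rintro ⟨q1, q2⟩; exact ⟨q1, by rw [memBit_eq _ q1]; exact q2⟩
    · rintro ⟨q1, q2⟩; exact ⟨q1, by rw [memBit_eq _ q1] at q2; exact q2⟩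
  refine wp_assign_seq (h0 s) fun x hx => ?_
  have hFs : F (s.setR 85 x) := hF _ _ _ ⟨Frame.refl _ _, h80, h81, h82⟩ (by omega)
  refine wp_call (R := J) ?_ ?_
  · refine wp_ite (fun hb => ?_) fun hb => ?_
    · simp [holds_lt, h0, val_reg, h84] at hb
      refine wp_load_seq (a := a₁) (by simp [val_reg, h83])
        (hm a₁ ha (by omega)) ?_
      refine wp_assign_seq rfl fun y hy => ?_
      rw [val_and, val_xor, val_sub_of_le _ _ _
        (val_exp2 (x := o₁) _ _ (by simp [val_reg, h84]) ho₁) (h1 _) Nat.one_le_two_pow] at hy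
      simp [val_reg, h80] at hy
      refine (clear _ (hF _ _ _ (hF _ _ _ hFs (by omega)) (by omega)) (by simp [h83, ha]) ?_).mono ?_
      · intro i
        simp only [rg_setR, if_true, hy, Nat.reduceEqDiff, if_false, h83]
        rw [Nat.testBit_mod_two_pow, Bool.and_eq_true, decide_eq_true_eq, marks s rfl]
        have : a₁ * w + i < p₁ ↔ i < o₁ := by omega
        rw [this]; tauto
      · rintro t ⟨f1, f2, f3⟩
        simp [h83] at f2 f3
        refine ⟨f1, by omega, by omega, by rw [f2]; exact f3, fun p hp hp' => ?_⟩
        rw [f2, Nat.add_mul] at hp; omega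
    · simp [holds_lt, h0, val_reg, h84] at hb
      refine wp_skip ⟨hFs, by simp [h83, ha], by simp [h83], fun i => ?_, fun p hp hp' => ?_⟩
      · simp [hx, h83]; omega
      · simp [h83, Nat.add_mul] at hp; omega
  · intro t hJ
    refine wp_call (go t hJ) ?_
    rintro t ⟨hJ, -, hgo⟩
    refine wp_call (R := fun t => J t ∧ ¬ (t.rg 85 = 0 ∧ a₀ < t.rg 83))
      (wp_loop rfl (fun k t => J t ∧ (t.rg 86 = 1 ↔ t.rg 85 = 0 ∧ a₀ < t.rg 83) ∧ t.rg 83 - a₀ = k)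
      ?_ ?_ (t.rg 83 - a₀) (by have := hJ.2.2.1; omega) ⟨hJ, hgo, rfl⟩)
      fun t ht => loopdone t ht.1 ht.2
    · rintro k t ⟨⟨j1, j2, j3, j4, j5⟩, hgo, hk⟩ hb
      rw [holds_eq, val_reg, h1] at hb
      obtain ⟨g1, g2⟩ := hgo.1 hb
      refine ⟨k - 1, by omega, ?_⟩
      refine wp_assign_seq (val_sub_of_le _ _ _ (val_reg t 83) (h1 _) (by omega)) fun x hx => ?_
      have hle : (t.rg 83 - 1 + 1) * w ≤ a₁ * w := Nat.mul_le_mul_right _ (by omega)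
      rw [Nat.add_mul, one_mul] at hle
      refine wp_load_seq (a := t.rg 83 - 1) (by simp [val_reg, hx])
        (hm _ (by omega) (by omega)) ?_
      refine wp_assign_seq rfl fun y hy => ?_
      simp [val_xor, val_reg, j1.2.1] at hy
      refine wp_call (clear _ (hF _ _ _ (hF _ _ _ (hF _ _ _ j1 (by omega)) (by omega)) (by omega))
        (by simp [hx]; omega) ?_) ?_
      · intro i
        simp only [rg_setR, if_true, hy, hx, Nat.reduceEqDiff, if_false]
        rw [marks t j1.1.1]
        constructor
        · rintro ⟨q1, q2⟩; exact ⟨q1, q2, by omega⟩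
        · rintro ⟨q1, q2, -⟩; exact ⟨q1, q2⟩
      · rintro t' ⟨f1, f2, f3⟩
        simp [hx] at f2 f3
        refine (go t' ⟨f1, by omega, by omega, by rw [f2]; exact f3, fun p hp hp' => ?_⟩).mono ?_
        · rw [f2] at hp
          by_cases hc : p < (t.rg 83 + 1) * w
          · rw [g1] at j4
            refine j4.eq_zero hw0 (Nat.div_eq_of_lt_le ?_ hc) ?_ hp'
            · rwa [show t.rg 83 - 1 + 1 = t.rg 83 by omega] at hp
            · have : (a₀ + 1) * w ≤ (t.rg 83 - 1 + 1) * w := Nat.mul_le_mul_right _ (by omega)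
              rw [Nat.add_mul a₀, one_mul] at this; omega
          · exact j5 p (by omega) hp'
        · rintro t'' ⟨q1, q2, q3⟩
          exact ⟨q1, q3, by rw [q2, f2]; omega⟩
    · rintro k t ⟨hJ, hgo, -⟩ hb
      rw [holds_eq, val_reg, h1] at hb
      exact ⟨hJ, fun h => hb (hgo.2 h)⟩

end WordRAM

/-! ### The memory layout -/

namespace ChoiceDict

open WordRAM

/-- The parameters of the data structure: the word length, the universe size, and a number `t` that
determines the block length, namely the tradeoff parameter, but at most `(n - 1) / w + 1`. -/
structure Par where
  w : ℕ
  n : ℕ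
  t : ℕ

namespace Par

variable (p : Par)

/-- The width of the header fields, which hold numbers below `n` and leave a bit for a marker. -/
def l1 : ℕ := Nat.size (p.n - 1) + 1

/-- The position of the first client bit. The space in front of it suffices for the header both if
the header is packed into one word and if it takes ten words. -/
def pos : ℕ := 128 * p.l1

/-- The address of the word with the first client bit. -/
def h : ℕ := p.pos / p.w

/-- The offset of the first client bit in its word. -/
def ph : ℕ := p.pos % p.w

/-- The position after the last client bit. -/
def P : ℕ := p.pos + p.n

/-- The address of the word with the position after the last client bit. -/
def pw : ℕ := p.P / p.w

/-- The offset in its word of the position after the last client bit. -/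
def po : ℕ := p.P % p.w

/-- The number of words of a block. -/
def u : ℕ := 32 * p.t

/-- The block that contains the client bit with index `e`. -/
def sub (e : ℕ) : ℕ := (p.ph + e) / p.w / p.u

/-- The number of blocks. -/
def M : ℕ := p.sub (p.n - 1) + 1

/-- The number of blocks in the first chunk. -/
def M0 : ℕ := min p.M p.w

/-- The number of chunks. A chunk consists of `w` blocks, except that the last one may be smaller. -/
def K : ℕ := (p.M - 1) / p.w + 1

/-- The chunk that contains the client bit with index `e`. -/
def chk (e : ℕ) : ℕ := p.sub e / p.w

/-- The address of the first record. The words before it hold the flags of the first chunk. -/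
def Q : ℕ := p.pw + 3

/-- The number of bits of the data structure. There are records of eight words each only if there is
more than one chunk. -/
def b : ℕ := if p.K = 1 then p.P + 2 * p.M else p.w * (p.Q + 8 * p.K)

/-- The position of the flag of block `s` for color `j`. The flags of the first chunk follow the
client bits, those of another chunk are the first two words of its record. -/
def flagPos (j : Bool) (s : ℕ) : ℕ :=
  if s / p.w = 0 then p.P + (if j then 0 else p.M0) + s
  else p.w * (p.Q + 8 * (s / p.w) + if j then 0 else 1) + s % p.w

/-- The standing assumptions on the parameters; `m` is the number of memory words. -/
structure Ok (σ : ℕ → ℕ) (A B m : ℕ) : Prop where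
  word : WordOK σ A B p.w
  n_pos : 1 ≤ p.n
  n_le : p.n ≤ 2 ^ p.w
  t_pos : 1 ≤ p.t
  t_le : p.t ≤ (p.n - 1) / p.w + 1
  m_eq : m = numWords p.w p.b
  b_le : p.b ≤ p.w * 2 ^ p.w

theorem pow_ge {w : ℕ} (hw : 64 ≤ w) : 4096 * (w * w) ≤ 2 ^ w := by
  induction w, hw using Nat.le_induction with
  | base => norm_num
  | succ w hw ih =>
    rw [pow_succ]
    nlinarith

variable {p} {σ : ℕ → ℕ} {A B m : ℕ}

section
variable (ok : p.Ok σ A B m)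
include ok

theorem Ok.w_ge : 64 ≤ p.w := ok.word.w_ge

theorem Ok.pow_ge : 4096 * (p.w * p.w) ≤ 2 ^ p.w := Par.pow_ge ok.w_ge

theorem Ok.lt_m {a : ℕ} (h : a * p.w < p.b) : a < m := by
  have := ok.w_ge
  rw [ok.m_eq, numWords, Nat.lt_iff_add_one_le, Nat.le_div_iff_mul_le (by omega), Nat.add_mul]
  omega

theorem Ok.w_pos : 0 < p.w := by have := ok.w_ge; omega

theorem Ok.pos_eq : p.pos = p.h * p.w + p.ph := by
  rw [Nat.mul_comm]; exact (Nat.div_add_mod _ _).symm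

theorem Ok.P_eq : p.P = p.pw * p.w + p.po := by
  rw [Nat.mul_comm]; exact (Nat.div_add_mod _ _).symm

theorem Ok.ph_lt : p.ph < p.w := Nat.mod_lt _ ok.w_pos

theorem Ok.po_lt : p.po < p.w := Nat.mod_lt _ ok.w_pos

theorem Ok.u_pos : 0 < p.u := by have := ok.t_pos; unfold u; omega

theorem Ok.n_le_l1 : p.n ≤ 2 ^ (p.l1 - 1) := by
  have := Nat.lt_size_self (p.n - 1)
  simp only [l1, Nat.add_sub_cancel]; omega

theorem Ok.l1_le : p.l1 ≤ p.w + 1 := by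
  have h1 := ok.n_le
  have h2 : 0 < 2 ^ p.w := by positivity
  have : Nat.size (p.n - 1) ≤ p.w := Nat.size_le.2 (by have := ok.n_pos; omega)
  unfold l1; omega

theorem Ok.pos_le : p.pos ≤ 128 * (p.w + 1) := by
  have := ok.l1_le; unfold pos; omega

theorem Ok.sub_le {e : ℕ} (he : e < p.n) : p.sub e ≤ p.M - 1 := by
  simp only [M, Nat.add_sub_cancel, sub]
  exact Nat.div_le_div_right (Nat.div_le_div_right (by omega))

theorem Ok.sub_lt {e : ℕ} (he : e < p.n) : p.sub e < p.M := by
  have := ok.sub_le he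
  have : 0 < p.M := by unfold M; omega
  omega

theorem Ok.M_pos : 0 < p.M := by unfold M; omega

theorem Ok.K_pos : 0 < p.K := Nat.succ_pos _

theorem Ok.div_lt_K {s : ℕ} (hs : s < p.M) : s / p.w < p.K := by
  unfold K
  exact Nat.lt_succ_of_le (Nat.div_le_div_right (by omega))

theorem Ok.chk_lt {e : ℕ} (he : e < p.n) : p.chk e < p.K := ok.div_lt_K (ok.sub_lt he)

theorem Ok.word_split (e : ℕ) : (p.ph + e) / p.w = e / p.w + (p.ph + e % p.w) / p.w ∧
    (p.ph + e) % p.w = (p.ph + e % p.w) % p.w := by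
  have h := Nat.div_add_mod e p.w
  have h' : p.ph + e = p.ph + e % p.w + p.w * (e / p.w) := by omega
  rw [h', Nat.add_mul_div_left _ _ ok.w_pos, Nat.add_mul_mod_self_left]
  exact ⟨by omega, rfl⟩

theorem Ok.client_eq (e : ℕ) :
    p.pos + e = (p.h + (p.ph + e) / p.w) * p.w + (p.ph + e) % p.w := by
  have := Nat.div_add_mod (p.ph + e) p.w
  rw [ok.pos_eq, Nat.add_mul, Nat.mul_comm ((p.ph + e) / p.w)]; omega

theorem Ok.client_div (e : ℕ) : (p.pos + e) / p.w = p.h + (p.ph + e) / p.w := by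
  rw [ok.client_eq]
  exact Nat.div_eq_of_lt_le (by omega) (by
    have := Nat.mod_lt (p.ph + e) ok.w_pos
    rw [Nat.add_mul _ 1]; omega)

theorem Ok.bounds : ∃ Y, 64 * Y ≤ 2 ^ p.w ∧ 64 * (p.w * p.w) ≤ Y ∧ p.u ≤ 32 * (Y + 1) ∧
    p.h ≤ 130 ∧ p.pw ≤ Y + 132 ∧ p.M ≤ Y + 2 ∧ (p.M - 1) * p.u ≤ Y + 1 ∧ (p.n - 1) / p.w ≤ Y ∧
    p.K ≤ p.M ∧ (p.ph + (p.n - 1)) / p.w ≤ Y + 1 := by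
  have hw := ok.w_ge
  have hX := ok.pow_ge
  have hn := ok.n_le
  have hn1 := ok.n_pos
  have hpos := ok.pos_le
  have hph := ok.ph_lt
  have hY : p.n / p.w ≤ 2 ^ p.w / 64 :=
    (Nat.div_le_div_right hn).trans (Nat.div_le_div_left hw (by omega))
  have hY' : (p.n - 1) / p.w ≤ p.n / p.w := Nat.div_le_div_right (by omega)
  have hA : (p.ph + (p.n - 1)) / p.w ≤ 2 ^ p.w / 64 + 1 := by
    rw [(ok.word_split _).1]
    have : (p.ph + (p.n - 1) % p.w) / p.w < 2 := by
      rw [Nat.div_lt_iff_lt_mul ok.w_pos]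
      have := Nat.mod_lt (p.n - 1) ok.w_pos
      omega
    omega
  have hh : p.h ≤ 130 := by
    unfold h
    exact Nat.lt_succ_iff.1 ((Nat.div_lt_iff_lt_mul ok.w_pos).2 (by omega))
  have hM : p.M = (p.ph + (p.n - 1)) / p.w / p.u + 1 := rfl
  have hd := Nat.div_le_self ((p.ph + (p.n - 1)) / p.w) p.u
  refine ⟨2 ^ p.w / 64, by omega, by omega, ?_, hh, ?_, by omega, ?_, by omega, ?_, hA⟩
  · have := ok.t_le; unfold u; omega
  · have e1 : p.P = p.pos + (p.n - 1) + 1 := by unfold P; omega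
    have e2 := ok.client_div (p.n - 1)
    have e3 : p.P / p.w ≤ (p.pos + (p.n - 1)) / p.w + 1 := by
      rw [e1]
      refine (Nat.div_le_div_right (c := p.w)
        (show p.pos + (p.n - 1) + 1 ≤ p.pos + (p.n - 1) + p.w by omega)).trans ?_
      rw [Nat.add_div_right _ ok.w_pos]
    unfold pw; omega
  · rw [hM, Nat.add_sub_cancel]
    exact (Nat.div_mul_le_self _ _).trans hA
  · unfold K
    have := Nat.div_le_self (p.M - 1) p.w
    have := ok.M_pos
    omega

/-- The blocks are ranges of memory words, cut off at the ends of the client bits. -/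
theorem Ok.sub_eq_iff {e s : ℕ} (he : e < p.n) : p.sub e = s ↔
    (p.h + s * p.u) * p.w + (if s = 0 then p.ph else 0) ≤ p.pos + e ∧
    p.pos + e < (if s + 1 = p.M then p.pw else p.h + (s + 1) * p.u) * p.w +
      if s + 1 = p.M then p.po else 0 := by
  have h0 := ok.pos_eq
  have h1 := ok.u_pos
  have h2 := ok.w_pos
  have hP := ok.P_eq
  have hle := ok.sub_le he
  have e1 : s ≤ p.sub e ↔ s * p.u * p.w ≤ p.ph + e := by
    rw [sub, Nat.le_div_iff_mul_le h1, Nat.le_div_iff_mul_le h2]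
  have e2 : p.sub e < s + 1 ↔ p.ph + e < (s + 1) * p.u * p.w := by
    rw [sub, Nat.div_lt_iff_lt_mul h1, Nat.div_lt_iff_lt_mul h2]
  have e3 : (p.h + s * p.u) * p.w + (if s = 0 then p.ph else 0) ≤ p.pos + e ↔ s ≤ p.sub e := by
    rw [e1, Nat.add_mul]
    by_cases hs0 : s = 0
    · simp [hs0]; omega
    · simp [hs0]; omega
  have e4 : p.pos + e < (if s + 1 = p.M then p.pw else p.h + (s + 1) * p.u) * p.w +
      (if s + 1 = p.M then p.po else 0) ↔ p.sub e < s + 1 := by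
    by_cases hsM : s + 1 = p.M
    · rw [if_pos hsM, if_pos hsM, ← hP, P]; omega
    · rw [if_neg hsM, if_neg hsM, e2, Nat.add_mul]; omega
  rw [e3, e4]; omega

theorem Ok.sub_words_le {s : ℕ} (_hs : s < p.M) :
    p.h + s * p.u ≤ (if s + 1 = p.M then p.pw else p.h + (s + 1) * p.u) ∧
    (if s + 1 = p.M then p.pw else p.h + (s + 1) * p.u) ≤ p.h + s * p.u + p.u := by
  have h0 := ok.pos_eq
  have hP : p.P = p.pos + (p.n - 1) + 1 := by have := ok.n_pos; unfold P; omega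
  split
  · rename_i hsM
    have hs' : s = p.M - 1 := by omega
    have h1 : p.sub (p.n - 1) = s := by rw [hs']; rfl
    have h2 := (ok.sub_eq_iff (by have := ok.n_pos; omega)).1 h1
    rw [if_pos hsM, if_pos hsM] at h2
    unfold pw
    constructor
    · rw [Nat.le_div_iff_mul_le ok.w_pos]; omega
    · have h3 : s + 1 > (p.ph + (p.n - 1)) / p.w / p.u := by rw [← h1]; exact Nat.lt_succ_self _
      rw [gt_iff_lt, Nat.div_lt_iff_lt_mul ok.u_pos] at h3
      rw [Nat.div_le_iff_le_mul_add_pred ok.w_pos]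
      have h4 : (p.ph + (p.n - 1)) < (s + 1) * p.u * p.w := by
        rwa [Nat.div_lt_iff_lt_mul ok.w_pos] at h3
      have : p.w * (p.h + s * p.u + p.u) = p.h * p.w + (s + 1) * p.u * p.w := by ring
      omega
  · rw [Nat.add_mul]; omega

theorem Ok.P_le_b : p.P + 2 * p.M0 ≤ p.b := by
  have h1 := ok.P_eq
  have h2 := ok.po_lt
  have h3 : p.M0 ≤ p.M := min_le_left _ _
  have h4 : p.M0 ≤ p.w := min_le_right _ _
  unfold b
  split
  · omega
  · rw [Q, show p.w * (p.pw + 3 + 8 * p.K) = p.pw * p.w + 3 * p.w + 8 * (p.w * p.K) by ring]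
    omega

theorem Ok.flagPos_zero {s : ℕ} (hs : s < p.M0) (j : Bool) :
    p.flagPos j s = p.P + (if j then 0 else p.M0) + s := by
  have h4 : p.M0 ≤ p.w := min_le_right _ _
  rw [flagPos, if_pos (Nat.div_eq_of_lt (by omega))]

theorem Ok.lt_M0 {s : ℕ} (hs : s < p.M) : s / p.w = 0 ↔ s < p.M0 := by
  rw [Nat.div_eq_zero_iff, M0, lt_min_iff]
  have := ok.w_pos
  omega

theorem Ok.flagPos_ge (j : Bool) (s : ℕ) : p.P ≤ p.flagPos j s := by
  have h1 := ok.P_eq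
  have h2 := ok.po_lt
  unfold flagPos
  split
  · omega
  · have : p.w * (p.Q + 8 * (s / p.w) + if j then 0 else 1) =
      p.pw * p.w + 3 * p.w + p.w * (8 * (s / p.w) + if j then 0 else 1) := by unfold Q; ring
    rw [this]; omega

theorem Ok.flagPos_div_zero {s : ℕ} (hs : s < p.M0) (j : Bool) : p.flagPos j s / p.w < p.Q := by
  have h1 := ok.P_eq
  have h2 := ok.po_lt
  have h4 : p.M0 ≤ p.w := min_le_right _ _
  rw [ok.flagPos_zero hs, Nat.div_lt_iff_lt_mul ok.w_pos, Q, Nat.add_mul]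
  split <;> omega

theorem Ok.flagPos_div_pos {s : ℕ} (hs : s / p.w ≠ 0) (j : Bool) :
    p.flagPos j s / p.w = p.Q + 8 * (s / p.w) + (if j then 0 else 1) ∧
    p.flagPos j s % p.w = s % p.w := by
  rw [flagPos, if_neg hs, Nat.mul_add_div ok.w_pos, Nat.mul_add_mod, Nat.mod_mod,
    Nat.div_eq_of_lt (Nat.mod_lt _ ok.w_pos)]
  exact ⟨by omega, rfl⟩

theorem Ok.flagPos_inj {j j' : Bool} {s s' : ℕ} (hs : s < p.M) (hs' : s' < p.M)
    (h : p.flagPos j s = p.flagPos j' s') : j = j' ∧ s = s' := by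
  by_cases h1 : s / p.w = 0
  · have h1' := (ok.lt_M0 hs).1 h1
    by_cases h2 : s' / p.w = 0
    · have h2' := (ok.lt_M0 hs').1 h2
      rw [ok.flagPos_zero h1', ok.flagPos_zero h2'] at h
      cases j <;> cases j' <;> simp at h ⊢ <;> omega
    · have h3 := ok.flagPos_div_zero h1' j
      have h4 := (ok.flagPos_div_pos h2 j').1
      rw [h] at h3; omega
  · by_cases h2 : s' / p.w = 0
    · have h3 := ok.flagPos_div_zero ((ok.lt_M0 hs').1 h2) j'
      have h4 := (ok.flagPos_div_pos h1 j).1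
      rw [← h] at h3; omega
    · have h3 := ok.flagPos_div_pos h1 j
      have h4 := ok.flagPos_div_pos h2 j'
      have h5 : s / p.w = s' / p.w ∧ j = j' := by
        have := h3.1.symm.trans ((congrArg (· / p.w) h).trans h4.1)
        cases j <;> cases j' <;> simp at this ⊢ <;> omega
      refine ⟨h5.2, ?_⟩
      rw [← Nat.div_add_mod s p.w, ← Nat.div_add_mod s' p.w, h5.1, ← h3.2, ← h4.2, h]

theorem Ok.flagPos_ne_rec {j : Bool} {s c k : ℕ} (hs : s < p.M) (hk : 2 ≤ k) (hk' : k < 8) :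
    p.flagPos j s / p.w ≠ p.Q + 8 * c + k := by
  by_cases h1 : s / p.w = 0
  · have := ok.flagPos_div_zero ((ok.lt_M0 hs).1 h1) j
    omega
  · have := (ok.flagPos_div_pos h1 j).1
    rw [this]; split <;> omega

theorem Ok.rec_lt {c k : ℕ} (hK : 1 < p.K) (hc : c < p.K) (hk : k < 8) :
    (p.Q + 8 * c + k + 1) * p.w ≤ p.b := by
  rw [b, if_neg (by omega), Nat.mul_comm]
  exact Nat.mul_le_mul_left _ (by omega)

theorem Ok.flagPos_lt {j : Bool} {s : ℕ} (hs : s < p.M) : p.flagPos j s < p.b := by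
  by_cases h1 : s / p.w = 0
  · have h2 := (ok.lt_M0 hs).1 h1
    have := ok.P_le_b
    rw [ok.flagPos_zero h2]
    split <;> omega
  · have hK : 1 < p.K := by
      have := ok.div_lt_K hs; have := Nat.zero_le (s / p.w); omega
    have := ok.rec_lt hK (ok.div_lt_K hs) (k := if j then 0 else 1) (by split <;> omega)
    rw [← (ok.flagPos_div_pos h1 j).1] at this
    have := Nat.lt_div_mul_add (a := p.flagPos j s) ok.w_pos
    rw [Nat.add_mul] at *
    omega

theorem Ok.client_lt {e : ℕ} (he : e < p.n) : p.pos + e < p.P := by unfold P; omega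

theorem Ok.client_lt_b {e : ℕ} (he : e < p.n) : p.pos + e < p.b := by
  have := ok.client_lt he; have := ok.P_le_b; omega

theorem Ok.addr_lt {a : ℕ} (h : a * p.w < p.b) : a < 2 ^ p.w := by
  have := ok.b_le
  rw [Nat.mul_comm p.w] at this
  exact lt_of_mul_lt_mul_right (h.trans_le this) (by omega)

theorem Ok.client_word_lt {e : ℕ} (he : e < p.n) : (p.pos + e) / p.w ≤ p.pw :=
  Nat.div_le_div_right (ok.client_lt he).le

end

end Par
end ChoiceDict

/-! ### The components of the memory -/

namespace ChoiceDict

open WordRAM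

/-- The components of the memory outside of the header: the client bits, the flags of the blocks,
the record words, and the set of the client bits in words to which a value was stored. Entries
outside of the index ranges are fixed, so that equality of views is meaningful. -/
@[ext] structure View where
  cb : ℕ → Bool
  fl : Bool → ℕ → Bool
  rc : ℕ → ℕ → ℕ
  cw : ℕ → Prop

namespace Par

variable {p : Par}

/-- The components of a memory, where `wr` is the set of the addresses to which a value was stored.
The flags of a chunk are read through `fl` only, hence the restriction to `2 ≤ k` for `rc`. -/
def view (p : Par) (mem : ℕ → BitVec p.w) (wr : Set ℕ) : View where
  cb e := decide (e < p.n) && memBit mem (p.pos + e)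
  fl j s := decide (s < p.M) && memBit mem (p.flagPos j s)
  rc k c := if 2 ≤ k ∧ k < 8 ∧ c < p.K ∧ 1 < p.K then (mem (p.Q + 8 * c + k)).toNat else 0
  cw e := e < p.n ∧ (p.pos + e) / p.w ∈ wr

/-- The words that hold client bits together with other bits have been written. -/
def Bd (p : Par) (wr : Set ℕ) : Prop := p.pw ∈ wr ∧ ∀ a ≤ p.h, a ∈ wr

theorem Bd.insert {wr : Set ℕ} (h : p.Bd wr) (a : ℕ) : p.Bd (insert a wr) :=
  ⟨Or.inr h.1, fun a ha => Or.inr (h.2 a ha)⟩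

variable {σ : ℕ → ℕ} {A B m : ℕ} (ok : p.Ok σ A B m)
include ok

theorem Ok.view_congr {mem mem' : ℕ → BitVec p.w} {wr wr' : Set ℕ}
    (h : ∀ q, p.pos ≤ q → q < p.b → memBit mem' q = memBit mem q)
    (hw : ∀ e < p.n, (p.pos + e) / p.w ∈ wr' ↔ (p.pos + e) / p.w ∈ wr) :
    p.view mem' wr' = p.view mem wr := by
  ext1
  · funext e
    simp only [view]
    by_cases he : e < p.n
    · simp [he, h _ (Nat.le_add_right _ _) (ok.client_lt_b he)]
    · simp [he]
  · funext j s
    simp only [view]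
    by_cases hs : s < p.M
    · have : p.pos ≤ p.P := Nat.le_add_right _ _
      rw [h _ (this.trans (ok.flagPos_ge j s)) (ok.flagPos_lt hs)]
    · simp [hs]
  · funext k c
    simp only [view]
    split
    · rename_i hk
      have hr := ok.rec_lt hk.2.2.2 hk.2.2.1 hk.2.1
      have hP := ok.P_eq
      have hpo := ok.po_lt
      rw [Nat.add_mul _ 1, one_mul] at hr
      congr 1
      refine BitVec.eq_of_getLsbD_eq fun i hi => ?_
      have hq : p.pos ≤ (p.Q + 8 * c + k) * p.w + i := by
        have : p.pos ≤ p.P := Nat.le_add_right _ _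
        have : (p.pw + 1) * p.w ≤ (p.Q + 8 * c + k) * p.w :=
          Nat.mul_le_mul_right _ (by unfold Q; omega)
        rw [Nat.add_mul, one_mul] at this
        omega
      have := h _ hq (by omega)
      rw [memBit_eq _ hi, memBit_eq _ hi] at this
      simpa [BitVec.testBit_toNat] using this
    · rfl
  · funext e
    simp only [view]
    by_cases he : e < p.n
    · simp [he, hw e he]
    · simp [he]

theorem Ok.memBit_flip {mem : ℕ → BitVec p.w} {a o : ℕ} {x : BitVec p.w} (ho : o < p.w)
    (hx : x.toNat = (mem a).toNat ^^^ 2 ^ o) (q : ℕ) :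
    memBit (Function.update mem a x) q =
      if q = a * p.w + o then !memBit mem q else memBit mem q := by
  have hq := Nat.div_add_mod q p.w
  by_cases ha : q / p.w = a
  · have hm := Nat.mod_lt q ok.w_pos
    have e : q = a * p.w + q % p.w := by rw [← ha, Nat.mul_comm]; exact hq.symm
    rw [e, memBit_eq _ hm, memBit_eq _ hm, Function.update_self, hx, Nat.testBit_xor,
      Nat.testBit_two_pow]
    by_cases h : q % p.w = o
    · simp [h]
    · simp [h, Ne.symm h]
  · rw [memBit_update_ne _ _ ha, if_neg]
    rintro rfl
    exact ha (Nat.div_eq_of_lt_le (by omega) (by rw [Nat.add_mul]; omega))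

/-- Client bits share words with other components only at the boundary. -/
theorem Ok.insert_iff {wr : Set ℕ} (hB : p.Bd wr) {a : ℕ} (ha : p.pw ≤ a) {e : ℕ}
    (he : e < p.n) : (p.pos + e) / p.w ∈ insert a wr ↔ (p.pos + e) / p.w ∈ wr := by
  refine ⟨fun h => h.elim (fun h => ?_) id, Or.inr⟩
  have := ok.client_word_lt he
  rw [show (p.pos + e) / p.w = p.pw by omega]
  exact hB.1

theorem Ok.view_flip_client {mem : ℕ → BitVec p.w} {wr : Set ℕ} {e₀ a o : ℕ} {x : BitVec p.w}
    (he₀ : e₀ < p.n) (ho : o < p.w) (h : p.pos + e₀ = a * p.w + o)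
    (hx : x.toNat = (mem a).toNat ^^^ 2 ^ o) :
    p.view (Function.update mem a x) (insert a wr) =
      { p.view mem wr with
        cb := fun e => if e = e₀ then !(p.view mem wr).cb e else (p.view mem wr).cb e
        cw := fun e => (p.view mem wr).cw e ∨ e < p.n ∧ (p.pos + e) / p.w = (p.pos + e₀) / p.w } := by
  have ha : (p.pos + e₀) / p.w = a := by
    rw [h]; exact Nat.div_eq_of_lt_le (by omega) (by rw [Nat.add_mul]; omega)
  have hcl := ok.client_lt he₀
  have hapw := ok.client_word_lt he₀
  ext1
  · funext e
    simp only [view, ok.memBit_flip ho hx]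
    by_cases he : e = e₀
    · simp [he, he₀, h]
    · rw [if_neg he, if_neg (by omega)]
  · funext j s
    simp only [view, ok.memBit_flip ho hx]
    rw [if_neg]
    have := ok.flagPos_ge j s
    omega
  · funext k c
    simp only [view]
    split
    · rw [Function.update_of_ne]; unfold Q; omega
    · rfl
  · funext e
    simp only [view, ha, Set.mem_insert_iff, eq_iff_iff]
    tauto

theorem Ok.view_flip_flag {mem : ℕ → BitVec p.w} {wr : Set ℕ} (hB : p.Bd wr) {j₀ : Bool}
    {s₀ a o : ℕ} {x : BitVec p.w} (hs₀ : s₀ < p.M) (ho : o < p.w)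
    (h : p.flagPos j₀ s₀ = a * p.w + o) (hx : x.toNat = (mem a).toNat ^^^ 2 ^ o) :
    p.view (Function.update mem a x) (insert a wr) =
      { p.view mem wr with
        fl := fun j s => if j = j₀ ∧ s = s₀ then !(p.view mem wr).fl j s
          else (p.view mem wr).fl j s } := by
  have ha : p.flagPos j₀ s₀ / p.w = a := by
    rw [h]; exact Nat.div_eq_of_lt_le (by omega) (by rw [Nat.add_mul]; omega)
  have hge := ok.flagPos_ge j₀ s₀
  have hapw : p.pw ≤ a := ha ▸ Nat.div_le_div_right hge
  ext1
  · funext e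
    simp only [view, ok.memBit_flip ho hx]
    by_cases he : e < p.n
    · have := ok.client_lt he
      rw [if_neg (by omega)]
    · simp [he]
  · funext j s
    simp only [view, ok.memBit_flip ho hx, ← h]
    by_cases hs : s < p.M
    · by_cases hjs : j = j₀ ∧ s = s₀
      · simp [hjs, hs₀]
      · rw [if_neg hjs, if_neg fun h' => hjs (ok.flagPos_inj hs hs₀ h')]
    · rw [if_neg (show ¬ (j = j₀ ∧ s = s₀) by rintro ⟨-, h⟩; omega)]
      simp [hs]
  · funext k c
    simp only [view]
    split
    · rename_i hk
      rw [Function.update_of_ne]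
      rw [← ha]; exact (ok.flagPos_ne_rec hs₀ hk.1 hk.2.1).symm
    · rfl
  · funext e
    simp only [view, eq_iff_iff]
    exact and_congr_right fun he => ok.insert_iff hB hapw he

theorem Ok.view_store_rec {mem : ℕ → BitVec p.w} {wr : Set ℕ} (hB : p.Bd wr) {c₀ k₀ : ℕ}
    (hK : 1 < p.K) (hc : c₀ < p.K) (hk : 2 ≤ k₀) (hk' : k₀ < 8) (x : BitVec p.w) :
    p.view (Function.update mem (p.Q + 8 * c₀ + k₀) x) (insert (p.Q + 8 * c₀ + k₀) wr) =
      { p.view mem wr with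
        rc := fun k c => if k = k₀ ∧ c = c₀ then x.toNat else (p.view mem wr).rc k c } := by
  have hapw : p.pw ≤ p.Q + 8 * c₀ + k₀ := by unfold Q; omega
  ext1
  · funext e
    simp only [view]
    by_cases he : e < p.n
    · have := ok.client_word_lt he
      rw [memBit_update_ne _ _ (by unfold Q; omega)]
    · simp [he]
  · funext j s
    simp only [view]
    by_cases hs : s < p.M
    · rw [memBit_update_ne _ _ (ok.flagPos_ne_rec hs hk hk')]
    · simp [hs]
  · funext k c
    simp only [view]
    by_cases h : k = k₀ ∧ c = c₀
    · obtain ⟨rfl, rfl⟩ := h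
      simp [hk, hk', hK, hc]
    · rw [if_neg h]
      split
      · rw [Function.update_of_ne (by omega)]
      · rfl
  · funext e
    simp only [view, eq_iff_iff]
    exact and_congr_right fun he => ok.insert_iff hB hapw he

theorem Ok.view_clear_flags {mem : ℕ → BitVec p.w} {wr : Set ℕ} (hB : p.Bd wr) {c₀ : ℕ}
    (hc : c₀ ≠ 0) (j₀ : Bool) :
    p.view (Function.update mem (p.Q + 8 * c₀ + if j₀ then 0 else 1) 0)
        (insert (p.Q + 8 * c₀ + if j₀ then 0 else 1) wr) =
      { p.view mem wr with
        fl := fun j s => if j = j₀ ∧ s / p.w = c₀ then false else (p.view mem wr).fl j s } := by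
  have hapw : p.pw < p.Q + 8 * c₀ + if j₀ then 0 else 1 := by unfold Q; omega
  ext1
  · funext e
    simp only [view]
    by_cases he : e < p.n
    · have := ok.client_word_lt he
      rw [memBit_update_ne _ _ (by omega)]
    · simp [he]
  · funext j s
    simp only [view]
    by_cases hs : s < p.M
    · by_cases hjs : j = j₀ ∧ s / p.w = c₀
      · rw [if_pos hjs]
        have := (ok.flagPos_div_pos (s := s) (by omega) j).1
        rw [hjs.2, hjs.1] at this
        unfold memBit
        rw [hjs.1, this, Function.update_self]
        simp
      · rw [if_neg hjs, memBit_update_ne]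
        by_cases h0 : s / p.w = 0
        · have := ok.flagPos_div_zero ((ok.lt_M0 hs).1 h0) j
          omega
        · rw [(ok.flagPos_div_pos h0 j).1]
          intro h
          apply hjs
          cases j <;> cases j₀ <;> simp at h ⊢ <;> omega
    · simp [hs]
  · funext k c
    simp only [view]
    split
    · rename_i hk
      rw [Function.update_of_ne]
      split <;> omega
    · rfl
  · funext e
    simp only [view, eq_iff_iff]
    exact and_congr_right fun he => ok.insert_iff hB hapw.le he

end Par
end ChoiceDict

/-! ### The header and the derived parameters -/

namespace FieldSum

theorem dsum_digit {b : ℕ} : ∀ {k : ℕ} {d : ℕ → ℕ}, (∀ j < k, d j < 2 ^ b) → ∀ {j : ℕ}, j < k →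
    dsum b k d / 2 ^ (b * j) % 2 ^ b = d j
  | 0, _, _, _, hj => by omega
  | k + 1, d, h, 0, _ => by
    simp [dsum, Nat.mod_eq_of_lt (h 0 (by omega))]
  | k + 1, d, h, j + 1, hj => by
    have e : dsum b (k + 1) d / 2 ^ b = dsum b k fun j => d (j + 1) := by
      rw [dsum, Nat.add_mul_div_left _ _ (by positivity), Nat.div_eq_of_lt (h 0 (by omega)),
        zero_add]
    rw [Nat.mul_succ, Nat.add_comm (b * j), pow_add, ← Nat.div_div_eq_div_mul, e]
    exact dsum_digit (d := fun j => d (j + 1)) (fun i hi => h _ (by omega)) (by omega)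

theorem mod_digit {x b j E : ℕ} (h : b * j + b ≤ E) :
    x % 2 ^ E / 2 ^ (b * j) % 2 ^ b = x / 2 ^ (b * j) % 2 ^ b := by
  refine Nat.eq_of_testBit_eq fun i => ?_
  simp only [Nat.testBit_mod_two_pow, Nat.testBit_div_two_pow]
  by_cases hi : i < b
  · simp [hi, show i + b * j < E by omega]
  · simp [hi]

theorem xor_pred {x a : ℕ} (h : x % 2 ^ (a + 1) = 2 ^ a) :
    (x ^^^ (x - 1)) = 2 ^ (a + 1) - 1 := by
  have hx := Nat.div_add_mod x (2 ^ (a + 1))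
  have hp : 0 < 2 ^ a := by positivity
  have hpp : 2 ^ (a + 1) = 2 ^ a + 2 ^ a := by rw [pow_succ]; omega
  set y := x / 2 ^ (a + 1)
  have e1 : x = 2 ^ (a + 1) * y + 2 ^ a := by omega
  have e2 : x - 1 = 2 ^ (a + 1) * y + (2 ^ a - 1) := by omega
  rw [e2, e1]
  refine Nat.eq_of_testBit_eq fun i => ?_
  rw [Nat.testBit_xor, Nat.testBit_two_pow_mul_add _ (by omega),
    Nat.testBit_two_pow_mul_add _ (by omega), Nat.testBit_two_pow_sub_one,
    Nat.testBit_two_pow_sub_one, Nat.testBit_two_pow]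
  by_cases hi : i < a + 1
  · by_cases hia : i = a
    · simp [hia]
    · simp [hi, Ne.symm hia]; omega
  · simp [hi]

end FieldSum

namespace ChoiceDict

open WordRAM FieldSum

/-- The variable part of the header: the number `T` of touched chunks and, for each color, the state
of the iteration, namely the current chunk `cur`, the element `x` last enumerated, and a flag `g`
that is `1` if the iteration is at the start of the current chunk, so that `x` is irrelevant. -/
structure Hd where
  T : ℕ
  cur : Bool → ℕ
  x : Bool → ℕ
  g : Bool → ℕ

namespace Par

/-- The assignment of registers to the header fields and the derived parameters. -/
def rv (p : Par) (H : Hd) : ℕ → ℕ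
  | 2 => p.n - 1
  | 3 => p.t - 1
  | 4 => H.T
  | 5 => H.cur true
  | 6 => H.x true
  | 7 => H.g true
  | 8 => H.cur false
  | 9 => H.x false
  | 10 => H.g false
  | 11 => p.w
  | 12 => p.h
  | 13 => p.ph
  | 14 => p.pw
  | 15 => p.po
  | 16 => p.u
  | 17 => p.M
  | 18 => p.M0
  | 19 => p.K
  | 20 => p.Q
  | 21 => p.l1
  | _ => 0

/-- The registers from `2` to `21` hold the header fields and the derived parameters. -/
def St (p : Par) (H : Hd) (s : State p.w) : Prop := ∀ i, 2 ≤ i → i ≤ 21 → s.rg i = p.rv H i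

variable {p : Par}

theorem St.frame {H : Hd} {s s' : State p.w} (h : p.St H s) {b : ℕ} (hf : Frame b s s')
    (hb : 22 ≤ b) : p.St H s' :=
  fun i h1 h2 => by rw [hf.2.2 i (by omega), h i h1 h2]

theorem St.setR {H : Hd} {s : State p.w} (h : p.St H s) {r : ℕ} (hr : 22 ≤ r) (x : BitVec p.w) :
    p.St H (s.setR r x) :=
  fun i h1 h2 => by rw [rg_setR, if_neg (by omega), h i h1 h2]

theorem St.setM {H : Hd} {s : State p.w} (h : p.St H s) (a : ℕ) (x : BitVec p.w) :
    p.St H (s.setM a x) := fun i h1 h2 => by rw [rg_setM, h i h1 h2]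

/-- The packed header: the marker and nine fields. -/
def enc (p : Par) (H : Hd) : ℕ :=
  dsum p.l1 10 fun k => if k = 0 then 2 ^ (p.l1 - 1) else p.rv H (k + 1)

/-- The memory holds the header: packed into the first word if it fits there, and otherwise, after
a word of zeros, one field to a word. The marker below the packed fields reveals their width. -/
def HdOk (p : Par) (H : Hd) (mem : ℕ → BitVec p.w) : Prop :=
  if 10 * p.l1 < p.w then (mem 0).toNat % 2 ^ (10 * p.l1) = p.enc H
  else (mem 0).toNat = 0 ∧ ∀ k, 1 ≤ k → k ≤ 9 → (mem k).toNat = p.rv H (k + 1)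

end Par

/-- Reads the `k` words from address `a` into the registers from `a + 1`. -/
def loadFields : ℕ → ℕ → Prog
  | _, 0 => .skip
  | a, k + 1 => .load (a + 1) (.const a) ;; loadFields (a + 1) k

/-- Stores the `k` registers from `a + 1` in the words from address `a`. -/
def storeFields : ℕ → ℕ → Prog
  | _, 0 => .skip
  | a, k + 1 => .store (.const a) (Rg (a + 1)) ;; storeFields (a + 1) k

/-- Splits the number in `reg 60`, without its lowest field, into `k` fields with base `reg 61`. -/
def unpack : ℕ → ℕ → Prog
  | _, 0 => .skip
  | r, k + 1 => .assign 60 (Rg 60 / Rg 61) ;; .assign r (Rg 60 % Rg 61) ;; unpack (r + 1) k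

/-- The number whose fields of width `l` are the values of the registers `r, …, r + k - 1`. -/
def packE (l : Expr) : ℕ → ℕ → Expr
  | _, 0 => .const 0
  | r, k + 1 => Rg r + exp2 l * packE l (r + 1) k

/-- Loads the header. If the first word is nonzero, its lowest nonzero bit is the marker, which
reveals the field width `l1` even before `n` is known. -/
def loadHdr : Prog :=
  .load 60 (.const 0) ;;
  .ite (.eq (Rg 60) 0) (loadFields 1 9)
    (.assign 61 ((Rg 60 ^^^ (Rg 60 - 1)) + 1) ;; unpack 2 9)

/-- Stores the header. If it is packed, the client bits in the first word do not change. -/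
def storeHdr : Prog :=
  .ite (.lt (.const 10 * Rg 21) (Rg 11))
    (.load 60 (.const 0) ;;
      .store (.const 0) (((Rg 60 >>> (.const 10 * Rg 21)) <<< (.const 10 * Rg 21)) +
        (exp2 (Rg 21 - 1) + exp2 (Rg 21) * packE (Rg 21) 2 9)))
    (.store (.const 0) (.const 0) ;; storeFields 1 9)

/-- Computes the word length and the field width. -/
def envA (B : ℕ) : Prog :=
  .assign 100 (.const 0 - 1) ;; sizeP B ;; .assign 11 (Rg 100) ;;
  .assign 100 (Rg 2) ;; sizeP B ;; .assign 21 (Rg 100 + 1)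

/-- Computes the other derived parameters. -/
def envB : Prog :=
  .assign 60 (.const 128 * Rg 21) ;; .assign 12 (Rg 60 / Rg 11) ;; .assign 13 (Rg 60 % Rg 11) ;;
  .assign 61 (Rg 13 + Rg 2 % Rg 11) ;;
  .assign 14 (Rg 12 + Rg 2 / Rg 11 + (Rg 61 + 1) / Rg 11) ;; .assign 15 ((Rg 61 + 1) % Rg 11) ;;
  .assign 16 (.const 32 * (Rg 3 + 1)) ;;
  .assign 17 ((Rg 2 / Rg 11 + Rg 61 / Rg 11) / Rg 16 + 1) ;;
  .ite (.lt (Rg 17) (Rg 11)) (.assign 18 (Rg 17)) (.assign 18 (Rg 11)) ;;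
  .assign 19 ((Rg 17 - 1) / Rg 11 + 1) ;; .assign 20 (Rg 14 + .const 3)

variable {σ : ℕ → ℕ} {m N w : ℕ}

theorem wp_loadFields : ∀ (k a : ℕ) (s : State w), a + k ≤ m → a + k ≤ 2 ^ w →
    wp σ m N (loadFields a k) (fun s' => s'.mem = s.mem ∧ s'.written = s.written ∧
      ∀ i, s'.rg i = if a + 1 ≤ i ∧ i < a + 1 + k then (s.mem (i - 1)).toNat else s.rg i) s
  | 0, a, s, _, _ => wp_skip ⟨rfl, rfl, fun i => by rw [if_neg (by omega)]⟩
  | k + 1, a, s, h1, h2 => by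
    refine wp_load_seq (a := a) (by rw [val_const, Nat.mod_eq_of_lt (by omega)]) (by omega) ?_
    refine (wp_loadFields k (a + 1) _ (by omega) (by omega)).mono ?_
    rintro s' ⟨e1, e2, e3⟩
    refine ⟨e1, e2, fun i => ?_⟩
    rw [e3, rg_setR, mem_setR]
    by_cases hi : i = a + 1
    · subst hi; simp
    · rw [if_neg hi]
      by_cases h : a + 1 + 1 ≤ i ∧ i < a + 1 + 1 + k
      · rw [if_pos h, if_pos (by omega)]
      · rw [if_neg h, if_neg (by omega)]

theorem wp_storeFields : ∀ (k a : ℕ) (s : State w), a + k ≤ m → a + k ≤ 2 ^ w →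
    wp σ m N (storeFields a k) (fun s' => (∀ i, s'.rg i = s.rg i) ∧
      (∀ i, if a ≤ i ∧ i < a + k then (s'.mem i).toNat = s.rg (i + 1) else s'.mem i = s.mem i) ∧
      s'.written = s.written ∪ {i | a ≤ i ∧ i < a + k}) s
  | 0, a, s, _, _ => wp_skip ⟨fun _ => rfl, fun i => by rw [if_neg (by omega)], by
      rw [show {i | a ≤ i ∧ i < a + 0} = (∅ : Set ℕ) by ext; simp, Set.union_empty]⟩
  | k + 1, a, s, h1, h2 => by
    refine wp_store_seq (a := a) (by rw [val_const, Nat.mod_eq_of_lt (by omega)]) (val_reg _ _)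
      (by omega) fun x hx => ?_
    refine (wp_storeFields k (a + 1) _ (by omega) (by omega)).mono ?_
    rintro s' ⟨e1, e2, e3⟩
    refine ⟨fun i => by rw [e1, rg_setM], fun i => ?_, ?_⟩
    · have := e2 i
      by_cases hi : i = a
      · subst hi
        rw [if_neg (by omega)] at this
        rw [if_pos (by omega), this, mem_setM, Function.update_self, hx]
      · by_cases h : a + 1 ≤ i ∧ i < a + 1 + k
        · rw [if_pos h] at this
          rw [if_pos (by omega), this, rg_setM]
        · rw [if_neg h, mem_setM, Function.update_of_ne hi] at this
          rwa [if_neg (by omega)]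
    · rw [e3, written_setM]
      ext i; simp only [Set.mem_union, Set.mem_insert_iff, Set.mem_ofPred_eq]
      constructor
      · rintro ((h | h) | h)
        · right; omega
        · exact Or.inl h
        · right; omega
      · rintro (h | h)
        · exact Or.inl (Or.inr h)
        · by_cases hi : i = a
          · exact Or.inl (Or.inl hi)
          · right; omega

theorem wp_unpack {l : ℕ} : ∀ (k r : ℕ) (s : State w), r + k ≤ 60 → s.rg 61 = 2 ^ l →
    wp σ m N (unpack r k) (fun s' => s'.mem = s.mem ∧ s'.written = s.written ∧
      ∀ i < 60, s'.rg i = if r ≤ i ∧ i < r + k then s.rg 60 / 2 ^ (l * (i - r + 1)) % 2 ^ l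
        else s.rg i) s
  | 0, r, s, _, _ => wp_skip ⟨rfl, rfl, fun i _ => by rw [if_neg (by omega)]⟩
  | k + 1, r, s, h1, h2 => by
    refine wp_assign_seq (by rw [val_div, val_reg, val_reg, h2]) fun x hx => ?_
    refine wp_assign_seq (v := x.toNat % 2 ^ l) (by rw [val_mod, val_reg, val_reg]; simp [h2])
      fun y hy => ?_
    refine (wp_unpack (l := l) k (r + 1) _ (by omega) (by simp; rw [if_neg (by omega), h2])).mono ?_
    rintro s' ⟨e1, e2, e3⟩
    refine ⟨e1, e2, fun i hi => ?_⟩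
    have e4 := e3 i hi
    simp only [rg_setR, if_neg (show ¬ (60 = r) by omega), if_true,
      if_neg (show ¬ (i = 60) by omega)] at e4
    rw [e4]
    by_cases hir : i = r
    · subst hir
      simp [hy, hx]
    · rw [if_neg hir]
      by_cases h : r + 1 ≤ i ∧ i < r + 1 + k
      · rw [if_pos h, if_pos (by omega), hx, Nat.div_div_eq_div_mul, ← pow_add,
          show i - r + 1 = (i - (r + 1) + 1) + 1 by omega]
        congr 3; ring
      · rw [if_neg h, if_neg (by omega)]

theorem val_packE {l : ℕ} (e : Expr) (s : State w) (he : val σ s e = l) : ∀ (k r : ℕ),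
    (∀ i, r ≤ i → i < r + k → s.rg i < 2 ^ l) → l * k < w → (k ≠ 0 → l < w) →
      val σ s (packE e r k) = dsum l k fun i => s.rg (r + i)
  | 0, r, _, _, _ => by
    simp [packE, dsum, val_const]
  | k + 1, r, h, h2, h3 => by
    have ih := val_packE e s he k (r + 1) (fun i h1 h2 => h i (by omega) (by omega))
      (by rw [Nat.mul_succ] at h2; omega) (fun _ => h3 (by omega))
    have hlt := dsum_lt (b := l) (k := k + 1) (d := fun i => s.rg (r + i))
      fun i hi => h _ (by omega) (by omega)
    have hlt2 := hlt.trans (Nat.pow_lt_pow_right (by omega) h2)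
    have e2 : (fun i => s.rg (r + (i + 1))) = fun i => s.rg (r + 1 + i) := by
      funext i; congr 1; omega
    rw [dsum] at hlt2 ⊢
    simp only [e2, add_zero] at hlt2 ⊢
    rw [packE]
    exact val_add_of_lt _ _ _ (val_reg _ _)
      (val_mul_of_lt _ _ _ (val_exp2 _ _ he (h3 (by omega))) ih (by omega)) hlt2

namespace Par

variable {p : Par} {A B : ℕ} (ok : p.Ok σ A B m)
include ok

theorem Ok.l1_pos : 1 ≤ p.l1 := by unfold l1; omega

theorem Ok.enc_digit {H : Hd} (hH : ∀ i, 2 ≤ i → i ≤ 10 → p.rv H i ≤ p.n) :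
    ∀ j < 10, (if j = 0 then 2 ^ (p.l1 - 1) else p.rv H (j + 1)) < 2 ^ p.l1 := by
  intro j hj
  have h1 := ok.n_le_l1
  have h2 : 2 ^ (p.l1 - 1) < 2 ^ p.l1 := Nat.pow_lt_pow_right (by omega) (by
    have := ok.l1_pos; omega)
  split
  · exact h2
  · have := hH (j + 1) (by omega) (by omega)
    omega

theorem Ok.m_gt {a : ℕ} (h : 10 * p.l1 < p.w ∧ a = 0 ∨ ¬ 10 * p.l1 < p.w ∧ a ≤ 9) :
    a < m ∧ a ≤ p.h ∧ a < 2 ^ p.w := by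
  have hw : p.w < 2 ^ p.w := Nat.lt_two_pow_self
  have h64 := ok.w_ge
  have hP := ok.P_le_b
  have hn := ok.n_pos
  have hpos : p.pos = 128 * p.l1 := rfl
  have hPP : p.P = p.pos + p.n := rfl
  have hl := ok.l1_pos
  rcases h with ⟨h, rfl⟩ | ⟨h, ha⟩
  · exact ⟨ok.lt_m (by omega), by omega, by omega⟩
  · have : a * p.w ≤ 9 * p.w := Nat.mul_le_mul_right _ ha
    refine ⟨ok.lt_m (by omega), ?_, by omega⟩
    unfold Par.h
    rw [Nat.le_div_iff_mul_le ok.w_pos]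
    omega

theorem Ok.wp_loadHdr {H : Hd} (hH : ∀ i, 2 ≤ i → i ≤ 10 → p.rv H i ≤ p.n) (s : State p.w)
    (h : p.HdOk H s.mem) :
    wp σ m N loadHdr (fun s' => s'.mem = s.mem ∧ s'.written = s.written ∧
      ∀ i < 60, s'.rg i = if 2 ≤ i ∧ i ≤ 10 then p.rv H i else s.rg i) s := by
  have hw : p.w < 2 ^ p.w := Nat.lt_two_pow_self
  have h64 := ok.w_ge
  have h1 : ∀ t : State p.w, val σ t (1 : Expr) = 1 := fun t =>
    val_const_of_lt _ _ (show 1 < 2 ^ p.w by omega)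
  have h0 : ∀ t : State p.w, val σ t (0 : Expr) = 0 := fun t =>
    val_const_of_lt _ _ (show 0 < 2 ^ p.w by omega)
  have hl := ok.l1_pos
  refine wp_load_seq (a := 0) (by rw [val_const, Nat.zero_mod])
    (ok.m_gt (by omega)).1 ?_
  unfold HdOk at h
  by_cases hp : 10 * p.l1 < p.w
  · rw [if_pos hp] at h
    have hd := ok.enc_digit hH
    set x := (s.mem 0).toNat with hx
    have hdig : ∀ j < 10, x / 2 ^ (p.l1 * j) % 2 ^ p.l1 =
        if j = 0 then 2 ^ (p.l1 - 1) else p.rv H (j + 1) := by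
      intro j hj
      rw [← mod_digit (E := 10 * p.l1) (by
        have : p.l1 * (j + 1) ≤ p.l1 * 10 := Nat.mul_le_mul_left _ (by omega)
        rw [Nat.mul_succ] at this; omega), h]
      exact dsum_digit hd hj
    have hx0 := hdig 0 (by omega)
    simp only [Nat.mul_zero, pow_zero, Nat.div_one, if_true] at hx0
    obtain ⟨a, ha⟩ : ∃ a, p.l1 = a + 1 := ⟨p.l1 - 1, by omega⟩
    have hpa : 0 < 2 ^ a := by positivity
    have hpa2 : 2 ^ p.l1 < 2 ^ p.w := Nat.pow_lt_pow_right (by omega) (by omega)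
    rw [ha, Nat.add_sub_cancel] at hx0
    have hxne : x ≠ 0 := by rintro h; rw [h] at hx0; simp at hx0; omega
    refine wp_ite (fun hb => ?_) fun hb => ?_
    · rw [holds_eq, val_reg, h0] at hb
      simp at hb
      exact absurd (by simp [hx, hb]) hxne
    · refine wp_assign_seq (v := 2 ^ p.l1) ?_ fun y hy => ?_
      · have e1 := val_sub_of_le (σ := σ) (s.setR 60 (s.mem 0)) (Rg 60) 1 (x := x) (y := 1)
          (by simp [val_reg, hx]) (h1 _) (by omega)
        have e2 : val σ (s.setR 60 (s.mem 0)) (Rg 60 ^^^ (Rg 60 - 1)) = 2 ^ p.l1 - 1 := by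
          rw [val_xor, e1, ha, ← xor_pred hx0]; simp [val_reg, hx]
        have : 1 ≤ 2 ^ p.l1 := Nat.one_le_two_pow
        rw [val_add_of_lt _ _ _ e2 (h1 _) (by omega)]; omega
      · refine (wp_unpack (l := p.l1) 9 2 _ (by omega) (by simp [hy])).mono ?_
        rintro s' ⟨e1, e2, e3⟩
        refine ⟨e1, e2, fun i hi => ?_⟩
        rw [e3 i hi]
        by_cases h2 : 2 ≤ i ∧ i ≤ 10
        · rw [if_pos (by omega), if_pos h2]
          have := hdig (i - 2 + 1) (by omega)
          rw [if_neg (by omega), show i - 2 + 1 + 1 = i by omega] at this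
          simpa using this
        · rw [if_neg (by omega), if_neg h2]
          simp; rw [if_neg (by omega), if_neg (by omega)]
  · rw [if_neg hp] at h
    refine wp_ite (fun hb => ?_) fun hb => ?_
    · refine (wp_loadFields 9 1 _ ?_ (by omega)).mono ?_
      · have := (ok.m_gt (a := 9) (by omega)).1; omega
      · rintro s' ⟨e1, e2, e3⟩
        refine ⟨e1, e2, fun i hi => ?_⟩
        rw [e3 i]
        by_cases h2 : 2 ≤ i ∧ i ≤ 10
        · rw [if_pos (by omega), if_pos h2, mem_setR, h.2 (i - 1) (by omega) (by omega)]
          congr 1; omega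
        · rw [if_neg (by omega), if_neg h2]
          rw [rg_setR, if_neg (by omega)]
    · rw [holds_eq, val_reg, h0] at hb
      simp [h.1] at hb

theorem Ok.val_packed {H : Hd} (hH : ∀ i, 2 ≤ i → i ≤ 10 → p.rv H i ≤ p.n) (t : State p.w)
    (hs : p.St H t) (hb : 10 * p.l1 < p.w) :
    val σ t (((Rg 60 >>> (.const 10 * Rg 21)) <<< (.const 10 * Rg 21)) +
        (exp2 (Rg 21 - 1) + exp2 (Rg 21) * packE (Rg 21) 2 9)) =
      2 ^ (10 * p.l1) * (t.rg 60 / 2 ^ (10 * p.l1)) + p.enc H ∧ p.enc H < 2 ^ (10 * p.l1) := by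
  have hw : p.w < 2 ^ p.w := Nat.lt_two_pow_self
  have h64 := ok.w_ge
  have hl := ok.l1_pos
  have hd := ok.enc_digit hH
  have t21 : val σ t (Rg 21) = p.l1 := (val_reg _ _).trans (hs 21 (by omega) (by omega))
  have h1 : val σ t (1 : Expr) = 1 := val_const_of_lt _ _ (show 1 < 2 ^ p.w by omega)
  have h10 : val σ t (.const 10 * Rg 21) = 10 * p.l1 :=
    val_mul_of_lt _ _ _ (by rw [val_const, Nat.mod_eq_of_lt (by omega)]) t21 (by omega)
  have hE : p.enc H < 2 ^ (10 * p.l1) := by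
    have := dsum_lt hd
    rwa [Nat.mul_comm] at this
  have hxlt : t.rg 60 < 2 ^ p.w := (t.reg 60).isLt
  have hle : 2 ^ (10 * p.l1) * (t.rg 60 / 2 ^ (10 * p.l1)) + 2 ^ (10 * p.l1) ≤ 2 ^ p.w := by
    have : t.rg 60 / 2 ^ (10 * p.l1) < 2 ^ (p.w - 10 * p.l1) := by
      rw [Nat.div_lt_iff_lt_mul (by positivity), ← pow_add]
      rwa [show p.w - 10 * p.l1 + 10 * p.l1 = p.w by omega]
    have := Nat.mul_le_mul_left (2 ^ (10 * p.l1)) (Nat.succ_le_of_lt this)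
    rw [← pow_add, show 10 * p.l1 + (p.w - 10 * p.l1) = p.w by omega, Nat.mul_succ] at this
    exact this
  have e2 : val σ t (packE (Rg 21) 2 9) = dsum p.l1 9 fun i => p.rv H (i + 2) := by
    rw [val_packE (l := p.l1) _ t t21 9 2 (fun i hi hi' => by
      rw [hs i hi (by omega)]
      have := hd (i - 1) (by omega)
      rwa [if_neg (by omega), show i - 1 + 1 = i by omega] at this) (by omega) (by omega)]
    exact dsum_congr fun i hi => by rw [hs _ (by omega) (by omega), add_comm]
  have e3 : p.enc H = 2 ^ (p.l1 - 1) + 2 ^ p.l1 * dsum p.l1 9 fun i => p.rv H (i + 2) := by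
    unfold enc
    rw [dsum]
    simp
  refine ⟨?_, hE⟩
  rw [e3] at hE ⊢
  generalize (dsum p.l1 9 fun i => p.rv H (i + 2)) = d at *
  generalize hZ : 2 ^ (10 * p.l1) * (t.rg 60 / 2 ^ (10 * p.l1)) = Z at *
  have e4 : val σ t (exp2 (Rg 21 - 1)) = 2 ^ (p.l1 - 1) :=
    val_exp2 t _ (val_sub_of_le _ _ _ t21 h1 hl) (by omega)
  have e5 : val σ t (exp2 (Rg 21)) = 2 ^ p.l1 := val_exp2 t _ t21 (by omega)
  have e6 : val σ t (exp2 (Rg 21) * packE (Rg 21) 2 9) = 2 ^ p.l1 * d :=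
    val_mul_of_lt _ _ _ e5 e2 (by omega)
  generalize 2 ^ p.l1 * d = Y at *
  generalize hX : 2 ^ (10 * p.l1) = X at *
  refine val_add_of_lt _ _ _ ?_ (val_add_of_lt _ _ _ e4 e6 (by omega)) (by omega)
  rw [val_shl, val_shr, h10, val_reg, hX, Nat.mul_comm, hZ, Nat.mod_eq_of_lt (by omega)]

theorem Ok.store_packed {H : Hd} (s : State p.w) (hb : 10 * p.l1 < p.w) (hB : p.Bd s.written)
    (y : BitVec p.w) (hy : y.toNat = 2 ^ (10 * p.l1) * ((s.mem 0).toNat / 2 ^ (10 * p.l1)) + p.enc H)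
    (hE : p.enc H < 2 ^ (10 * p.l1)) :
    p.HdOk H (Function.update s.mem 0 y) ∧ p.Bd (insert 0 s.written) ∧
      p.view (Function.update s.mem 0 y) (insert 0 s.written) = p.view s.mem s.written := by
  have hposE : p.pos = 128 * p.l1 := rfl
  refine ⟨?_, hB.insert 0, ok.view_congr ?_ ?_⟩
  · unfold HdOk
    rw [if_pos hb, Function.update_self, hy, Nat.mul_add_mod, Nat.mod_eq_of_lt hE]
  · intro q hq _
    by_cases hq0 : q / p.w = 0
    · have hqw : q < p.w := by
        rcases Nat.div_eq_zero_iff.1 hq0 with h | h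
        · have := ok.w_pos; omega
        · exact h
      have h1 := memBit_eq s.mem (a := 0) hqw
      have h2 := memBit_eq (Function.update s.mem 0 y) (a := 0) hqw
      rw [Nat.zero_mul, Nat.zero_add] at h1 h2
      rw [h1, h2, Function.update_self, hy, Nat.testBit_two_pow_mul_add _ hE,
        if_neg (by omega), Nat.testBit_div_two_pow]
      congr 1; omega
    · rw [memBit_update_ne _ _ hq0]
  · intro e he
    refine ⟨fun h => h.elim (fun h => ?_) id, Or.inr⟩
    rw [h]; exact hB.2 0 (by omega)

theorem Ok.wp_storeHdr {H : Hd} (hH : ∀ i, 2 ≤ i → i ≤ 10 → p.rv H i ≤ p.n) (s : State p.w)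
    (hs : p.St H s) (hB : p.Bd s.written) :
    wp σ m N storeHdr (fun s' => (∀ i < 60, s'.rg i = s.rg i) ∧ p.HdOk H s'.mem ∧
      p.Bd s'.written ∧ p.view s'.mem s'.written = p.view s.mem s.written) s := by
  have hw : p.w < 2 ^ p.w := Nat.lt_two_pow_self
  have h64 := ok.w_ge
  have hl' := ok.l1_le
  have h11 : s.rg 11 = p.w := hs 11 (by omega) (by omega)
  have h21 : s.rg 21 = p.l1 := hs 21 (by omega) (by omega)
  have hpow := ok.pow_ge
  have hposE : p.pos = 128 * p.l1 := rfl
  have h10 : val σ s (.const 10 * Rg 21) = 10 * p.l1 := val_mul_of_lt _ _ _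
      (by rw [val_const, Nat.mod_eq_of_lt (by omega)]) ((val_reg _ _).trans h21) (by nlinarith)
  refine wp_ite (fun hb => ?_) fun hb => ?_
  · rw [holds_lt, h10, val_reg, h11] at hb
    refine wp_load_seq (a := 0) (by rw [val_const, Nat.zero_mod]) (ok.m_gt (by omega)).1 ?_
    obtain ⟨e5, hE⟩ := ok.val_packed hH _ (hs.setR (r := 60) (by omega) (s.mem 0)) hb
    refine wp_store (a := 0) (by rw [val_const, Nat.zero_mod]) e5 (ok.m_gt (by omega)).1
      fun y hy => ?_
    rw [rg_setR, if_pos rfl] at hy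
    obtain ⟨r1, r2, r3⟩ := ok.store_packed s hb hB y hy hE
    refine ⟨fun i hi => by rw [rg_setM, rg_setR, if_neg (by omega)], ?_, ?_, ?_⟩
    · rw [mem_setM, mem_setR]; exact r1
    · rw [written_setM, written_setR]; exact r2
    · rw [mem_setM, mem_setR, written_setM, written_setR]; exact r3
  · rw [holds_lt, h10, val_reg, h11] at hb
    refine wp_store_seq (a := 0) (v := 0) (by rw [val_const, Nat.zero_mod])
      (by rw [val_const, Nat.zero_mod]) (ok.m_gt (by omega)).1 fun y hy => ?_
    have h9 := ok.m_gt (a := 9) (by omega)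
    refine (wp_storeFields 9 1 _ (by omega) (by omega)).mono ?_
    rintro s' ⟨e1, e2, e3⟩
    have e2' : ∀ i, 10 ≤ i → s'.mem i = s.mem i := fun i hi => by
      have := e2 i
      rw [if_neg (by omega), mem_setM, Function.update_of_ne (by omega)] at this
      exact this
    have hh9 : 10 * p.w ≤ p.pos := by omega
    have hh9' : 9 ≤ p.h := h9.2.1
    refine ⟨fun i hi => by rw [e1, rg_setM], ?_, ?_, ok.view_congr ?_ ?_⟩
    · unfold HdOk
      rw [if_neg hb]
      refine ⟨?_, fun k hk hk' => ?_⟩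
      · have := e2 0
        rw [if_neg (by omega), mem_setM, Function.update_self] at this
        rw [this, hy]
      · have := e2 k
        rw [if_pos (by omega), rg_setM, hs _ (by omega) (by omega)] at this
        exact this
    · rw [e3]
      exact ⟨Or.inl (Or.inr hB.1), fun a ha => Or.inl (Or.inr (hB.2 a ha))⟩
    · intro q hq _
      have : 10 ≤ q / p.w := by rw [Nat.le_div_iff_mul_le ok.w_pos]; omega
      unfold memBit
      rw [e2' _ this]
    · intro e he
      rw [e3, written_setM]
      refine ⟨fun h => ?_, fun h => Or.inl (Or.inr h)⟩
      rcases h with (h | h) | h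
      · rw [h]; exact hB.2 0 (by omega)
      · exact h
      · exact hB.2 _ (by have := h.2; omega)

theorem Ok.wp_envA (hA : A ≤ N) (s : State p.w) (h2 : s.rg 2 = p.n - 1) :
    wp σ m N (envA B) (fun s' => s'.mem = s.mem ∧ s'.written = s.written ∧
      s'.rg 11 = p.w ∧ s'.rg 21 = p.l1 ∧
      ∀ i < 60, i ≠ 11 → i ≠ 21 → s'.rg i = s.rg i) s := by
  have hw : p.w < 2 ^ p.w := Nat.lt_two_pow_self
  have h64 := ok.w_ge
  have h1 : ∀ t : State p.w, val σ t (1 : Expr) = 1 := fun t =>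
    val_const_of_lt _ _ (show 1 < 2 ^ p.w by omega)
  refine wp_assign_seq (v := 2 ^ p.w - 1) ?_ fun x hx => ?_
  · rw [val_sub, h1, val_const, Nat.zero_mod, Nat.add_zero, Nat.mod_eq_of_lt (by omega)]
  refine wp_call (wp_size ok.word hA _) ?_
  rintro t ⟨e1, f1⟩
  rw [rg_setR, if_pos rfl, hx] at e1
  have hsz : Nat.size (2 ^ p.w - 1) = p.w := by
    refine le_antisymm (Nat.size_le.2 (by omega)) ?_
    have : p.w - 1 < Nat.size (2 ^ p.w - 1) := by
      rw [Nat.lt_size]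
      have : 2 ^ p.w = 2 ^ (p.w - 1) + 2 ^ (p.w - 1) := by
        rw [← mul_two, ← pow_succ]; congr 1; omega
      have : 0 < 2 ^ (p.w - 1) := by positivity
      omega
    omega
  rw [hsz] at e1
  refine wp_assign_seq (v := p.w) (by rw [val_reg, e1]) fun y hy => ?_
  refine wp_assign_seq (v := p.n - 1) (by simp [val_reg, f1.2.2, h2]) fun z hz => ?_
  refine wp_call (wp_size ok.word hA _) ?_
  rintro t' ⟨e2, f2⟩
  rw [rg_setR, if_pos rfl, hz] at e2
  have hl : p.l1 < 2 ^ p.w := by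
    have := ok.l1_le; have := ok.pow_ge; nlinarith
  refine wp_assign (v := p.l1) (val_add_of_lt _ _ _ ((val_reg _ _).trans e2) (h1 _) hl)
    fun v hv => ?_
  refine ⟨?_, ?_, ?_, by simp [hv], fun i hi h11 h21 => ?_⟩
  · simp [f2.1, f1.1]
  · simp [f2.2.1, f1.2.1]
  · simp [f2.2.2, hy]
  · rw [rg_setR, if_neg h21, f2.2.2 i (by omega), rg_setR, if_neg (by omega), rg_setR,
      if_neg h11, f1.2.2 i (by omega), rg_setR, if_neg (by omega)]

theorem Ok.wp_envB {H : Hd} (s : State p.w) (h2 : s.rg 2 = p.n - 1) (h3 : s.rg 3 = p.t - 1)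
    (h11 : s.rg 11 = p.w) (h21 : s.rg 21 = p.l1) :
    wp σ m N envB (fun s' => s'.mem = s.mem ∧ s'.written = s.written ∧
      (∀ i, 12 ≤ i → i ≤ 20 → s'.rg i = p.rv H i) ∧
      ∀ i < 60, i < 12 ∨ 21 ≤ i → s'.rg i = s.rg i) s := by
  obtain ⟨Y, b1, b2, b3, b4, b5, b6, b7, b8, b9, b10⟩ := ok.bounds
  have hw : p.w < 2 ^ p.w := Nat.lt_two_pow_self
  have h64 := ok.w_ge
  have hY : 64 * (64 * p.w) ≤ Y := le_trans (by nlinarith) b2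
  have hl' := ok.l1_le
  have hn := ok.n_pos
  have ht := ok.t_pos
  have hph := ok.ph_lt
  have h1 : ∀ t : State p.w, val σ t (1 : Expr) = 1 := fun t =>
    val_const_of_lt _ _ (show 1 < 2 ^ p.w by omega)
  have hc : ∀ (t : State p.w) c, c ≤ 128 → val σ t (.const c) = c := fun t c hc => by
    rw [val_const, Nat.mod_eq_of_lt (by omega)]
  have hmod := Nat.mod_lt (p.n - 1) ok.w_pos
  obtain ⟨w1, -⟩ := ok.word_split (p.n - 1)
  have hP : p.P = p.h * p.w + (p.n - 1) / p.w * p.w + (p.ph + (p.n - 1) % p.w + 1) := by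
    have := ok.pos_eq
    have := Nat.div_add_mod (p.n - 1) p.w
    rw [Nat.mul_comm] at this
    unfold P; omega
  have hpw : p.pw = p.h + (p.n - 1) / p.w + (p.ph + (p.n - 1) % p.w + 1) / p.w := by
    rw [pw, hP, ← Nat.add_mul, Nat.add_comm, Nat.add_mul_div_right _ _ ok.w_pos, Nat.add_comm]
  have hpo : p.po = (p.ph + (p.n - 1) % p.w + 1) % p.w := by
    rw [po, hP, ← Nat.add_mul, Nat.add_comm, Nat.add_mul_mod_self_right]
  have hM : p.M = ((p.n - 1) / p.w + (p.ph + (p.n - 1) % p.w) / p.w) / p.u + 1 := by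
    rw [← w1]; rfl
  refine wp_assign_seq (v := p.pos) (val_mul_of_lt _ _ _ (hc _ _ le_rfl) ((val_reg _ _).trans h21)
    (by omega)) fun x60 e60 => ?_
  refine wp_assign_seq (v := p.h) (by simp [val_div, val_reg, e60, h11]; rfl) fun x12 e12 => ?_
  refine wp_assign_seq (v := p.ph) (by simp [val_mod, val_reg, e60, h11]; rfl) fun x13 e13 => ?_
  refine wp_assign_seq (v := p.ph + (p.n - 1) % p.w) (val_add_of_lt _ _ _
    (by simp [val_reg, e13]) (by simp [val_mod, val_reg, h11, h2]) (by omega)) fun x61 e61 => ?_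
  have a1 : ∀ t : State p.w, t.rg 61 = p.ph + (p.n - 1) % p.w →
      val σ t (Rg 61 + 1) = p.ph + (p.n - 1) % p.w + 1 := fun t ht =>
    val_add_of_lt _ _ _ ((val_reg _ _).trans ht) (h1 _) (by omega)
  refine wp_assign_seq (v := p.pw) ?_ fun x14 e14 => ?_
  · rw [hpw]
    refine val_add_of_lt _ _ _ (val_add_of_lt _ _ _ (by simp [val_reg, e12])
      (by simp [val_reg, val_div, h2, h11]) (by omega)) ?_ (by omega)
    rw [val_div, a1 _ (by simp [e61])]
    simp [val_reg, h11]
  refine wp_assign_seq (v := p.po) ?_ fun x15 e15 => ?_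
  · rw [hpo, val_mod, a1 _ (by simp [e61])]
    simp [val_reg, h11]
  refine wp_assign_seq (v := p.u) ?_ fun x16 e16 => ?_
  · rw [u]
    refine val_mul_of_lt _ _ _ (hc _ _ (by omega)) ((val_add_of_lt _ _ _ (x := p.t - 1)
      (by simp [val_reg, h3]) (h1 _) ?_).trans (by omega)) ?_
    · unfold u at b3; omega
    · unfold u at b3; omega
  refine wp_assign_seq (v := p.M) ?_ fun x17 e17 => ?_
  · rw [hM]
    refine val_add_of_lt _ _ _ ?_ (h1 _) (by omega)
    rw [val_div, val_add_of_lt (x := (p.n - 1) / p.w) (y := (p.ph + (p.n - 1) % p.w) / p.w)]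
    · simp [val_reg, e16]
    · simp [val_reg, val_div, h2, h11]
    · simp [val_reg, val_div, e61, h11]
    · omega
  refine wp_call (R := fun t => t.mem = s.mem ∧ t.written = s.written ∧
    (∀ i, 12 ≤ i → i ≤ 18 → t.rg i = p.rv H i) ∧
      ∀ i < 60, i < 12 ∨ 19 ≤ i → t.rg i = s.rg i) ?_ ?_
  · have fin : ∀ x18 : BitVec p.w, x18.toNat = p.M0 → ∀ i, 12 ≤ i → i ≤ 18 →
        ((((((((((s.setR 60 x60).setR 12 x12).setR 13 x13).setR 61 x61).setR 14 x14).setR 15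
          x15).setR 16 x16).setR 17 x17)).setR 18 x18).rg i = p.rv H i := by
      intro x18 e18 i hi hi'
      interval_cases i <;> simp [rv, e12, e13, e14, e15, e16, e17, e18]
    have fr : ∀ x18 : BitVec p.w, ∀ i < 60, i < 12 ∨ 19 ≤ i →
        ((((((((((s.setR 60 x60).setR 12 x12).setR 13 x13).setR 61 x61).setR 14 x14).setR 15
          x15).setR 16 x16).setR 17 x17)).setR 18 x18).rg i = s.rg i := by
      intro x18 i hi hi'
      simp only [rg_setR]
      repeat rw [if_neg (by omega)]
    refine wp_ite (fun hb => ?_) fun hb => ?_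
    · simp [holds_lt, val_reg, e17, h11] at hb
      refine wp_assign (v := p.M0) (by simp [val_reg, e17]; unfold M0; omega) fun x18 e18 => ?_
      exact ⟨rfl, rfl, fin _ e18, fr _⟩
    · simp [holds_lt, val_reg, e17, h11] at hb
      refine wp_assign (v := p.M0) (by simp [val_reg, h11]; unfold M0; omega) fun x18 e18 => ?_
      exact ⟨rfl, rfl, fin _ e18, fr _⟩
  · rintro t ⟨m1, m2, r1, r2⟩
    have t17 : t.rg 17 = p.M := r1 17 (by omega) (by omega)
    have t11 : t.rg 11 = p.w := by rw [r2 11 (by omega) (by omega), h11]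
    have t14 : t.rg 14 = p.pw := r1 14 (by omega) (by omega)
    refine wp_assign_seq (v := p.K) (val_add_of_lt _ _ _ (x := (p.M - 1) / p.w) ?_ (h1 _) ?_)
      fun x19 e19 => ?_
    · rw [val_div, val_sub_of_le _ _ _ ((val_reg _ _).trans t17) (h1 _) ok.M_pos, val_reg, t11]
    · unfold K at b9; omega
    refine wp_assign (v := p.Q) (val_add_of_lt _ _ _ (by simp [val_reg, t14])
      (hc _ 3 (by omega)) (by omega)) fun x20 e20 => ?_
    refine ⟨m1, m2, fun i hi hi' => ?_, fun i hi hi' => ?_⟩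
    · by_cases hi18 : i ≤ 18
      · rw [rg_setR, if_neg (by omega), rg_setR, if_neg (by omega), r1 i hi hi18]
      · interval_cases i <;> simp [rv, e19, e20]
    · rw [rg_setR, if_neg (by omega), rg_setR, if_neg (by omega), r2 i hi (by omega)]

end Par
end ChoiceDict

/-! ### Access to the components of the memory -/

namespace ChoiceDict

open WordRAM FieldSum

namespace Par

/-- The state during the execution of an operation: the header fields and parameters are in their
registers, the memory has the view `v`, and `F` gives the values of the local variables. -/
structure At (p : Par) (H : Hd) (v : View) (F : ℕ → ℕ) (s : State p.w) : Prop where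
  st : p.St H s
  bd : p.Bd s.written
  vw : p.view s.mem s.written = v
  loc : ∀ i, 22 ≤ i → i < 60 → s.rg i = F i

variable {σ : ℕ → ℕ} {m N : ℕ} {p : Par} {A B : ℕ} {H : Hd} {v : View} {F : ℕ → ℕ} {s : State p.w}

theorem At.frame {s' : State p.w} (h : p.At H v F s) {b : ℕ} (hf : Frame b s s') (hb : 60 ≤ b) :
    p.At H v F s' :=
  ⟨h.st.frame hf (by omega), by rw [hf.2.1]; exact h.bd, by rw [hf.1, hf.2.1]; exact h.vw,
    fun i h1 h2 => by rw [hf.2.2 i (by omega), h.loc i h1 h2]⟩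

theorem At.setR (h : p.At H v F s) {r : ℕ} (hr : 60 ≤ r) (x : BitVec p.w) :
    p.At H v F (s.setR r x) :=
  h.frame ((Frame.refl 60 s).setR hr x) le_rfl

theorem At.assign (h : p.At H v F s) {r : ℕ} {e : Expr} {x : ℕ}
    (hx : val σ s e = x) (h1 : 22 ≤ r) :
    wp σ m N (.assign r e) (p.At H v (Function.update F r x)) s := by
  refine wp_assign hx fun y hy => ⟨h.st.setR h1 y, h.bd, h.vw, fun i hi hi' => ?_⟩
  rw [rg_setR, Function.update_apply, hy, h.loc i hi hi']

theorem At.reg (h : p.At H v F s) {i : ℕ} (h1 : 22 ≤ i) (h2 : i < 60) : val σ s (Rg i) = F i :=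
  (val_reg _ _).trans (h.loc i h1 h2)

theorem At.setHdr (h : p.At H v F s) {H' : Hd} {r : ℕ} {e : Expr} {x : ℕ} (hx : val σ s e = x)
    (hr : r < 22) (hH : ∀ i, 2 ≤ i → i ≤ 21 → p.rv H' i = if i = r then x else p.rv H i) :
    wp σ m N (.assign r e) (p.At H' v F) s := by
  refine wp_assign hx fun y hy => ⟨fun i h1 h2 => ?_, h.bd, h.vw, fun i h1 h2 => ?_⟩
  · rw [rg_setR, hH i h1 h2, hy, h.st i h1 h2]
  · rw [rg_setR, if_neg (by omega), h.loc i h1 h2]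

theorem At.setT (h : p.At H v F s) {e : Expr} {x : ℕ} (hx : val σ s e = x) :
    wp σ m N (.assign 4 e) (p.At { H with T := x } v F) s :=
  h.setHdr hx (by omega) fun i _ _ => by interval_cases i <;> simp [rv]

theorem At.setCur (h : p.At H v F s) (j : Bool) {e : Expr} {x : ℕ} (hx : val σ s e = x) :
    wp σ m N (.assign (if j then 5 else 8) e)
      (p.At { H with cur := Function.update H.cur j x } v F) s :=
  h.setHdr hx (by split <;> omega) fun i _ _ => by interval_cases i <;> cases j <;> simp [rv]

theorem At.setX (h : p.At H v F s) (j : Bool) {e : Expr} {x : ℕ} (hx : val σ s e = x) :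
    wp σ m N (.assign (if j then 6 else 9) e)
      (p.At { H with x := Function.update H.x j x } v F) s :=
  h.setHdr hx (by split <;> omega) fun i _ _ => by interval_cases i <;> cases j <;> simp [rv]

theorem At.setG (h : p.At H v F s) (j : Bool) {e : Expr} {x : ℕ} (hx : val σ s e = x) :
    wp σ m N (.assign (if j then 7 else 10) e)
      (p.At { H with g := Function.update H.g j x } v F) s :=
  h.setHdr hx (by split <;> omega) fun i _ _ => by interval_cases i <;> cases j <;> simp [rv]

theorem At.par (h : p.At H v F s) {i : ℕ} (h1 : 2 ≤ i) (h2 : i ≤ 21) :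
    val σ s (Rg i) = p.rv H i :=
  (val_reg _ _).trans (h.st i h1 h2)

end Par

/-- Locates the client bit with index `reg 60`: its address in `reg 61`, its offset in `reg 62` and
its block in `reg 63`. -/
def locC : Prog :=
  .assign 62 (Rg 13 + Rg 60 % Rg 11) ;; .assign 61 (Rg 60 / Rg 11 + Rg 62 / Rg 11) ;;
  .assign 63 (Rg 61 / Rg 16) ;; .assign 61 (Rg 12 + Rg 61) ;; .assign 62 (Rg 62 % Rg 11)

/-- Locates the flag of block `reg 60` for color `j`: its address in `reg 61` and its offset in
`reg 62`. -/
def locF (j : Bool) : Prog :=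
  .ite (.lt (Rg 60) (Rg 11))
    (.assign 63 (Rg 15 + (if j then .const 0 else Rg 18) + Rg 60) ;;
      .assign 61 (Rg 14 + Rg 63 / Rg 11) ;; .assign 62 (Rg 63 % Rg 11))
    (.assign 61 (Rg 20 + .const 8 * (Rg 60 / Rg 11) + (if j then .const 0 else .const 1)) ;;
      .assign 62 (Rg 60 % Rg 11))

/-- Reads into `reg 63` the bit with address `reg 61` and offset `reg 62`. -/
def getBit : Prog := .load 63 (Rg 61) ;; .assign 63 ((Rg 63 >>> Rg 62) % .const 2)

/-- Flips the bit with address `reg 61` and offset `reg 62`. -/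
def flipBit : Prog := .load 63 (Rg 61) ;; .store (Rg 61) (Rg 63 ^^^ exp2 (Rg 62))

/-- Locates the client bit with index `e`. -/
def blk (e : Expr) : Prog := .assign 60 e ;; locC

/-- Reads the client bit with index `e`. -/
def getC (e : Expr) : Prog := blk e ;; getBit

/-- Flips the client bit with index `e`. -/
def flipC (e : Expr) : Prog := blk e ;; flipBit

/-- Locates the flag of block `e` for color `j`. -/
def flg (j : Bool) (e : Expr) : Prog := .assign 60 e ;; locF j

/-- Reads the flag of block `e` for color `j`. -/
def getF (j : Bool) (e : Expr) : Prog := flg j e ;; getBit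

/-- Flips the flag of block `e` for color `j`. -/
def flipF (j : Bool) (e : Expr) : Prog := flg j e ;; flipBit

/-- The word with index `k` of the record of the chunk `e`. -/
def recE (k : ℕ) (e : Expr) : Expr := Rg 20 + .const 8 * e + .const k

/-- The view after flipping the client bit with index `e₀`. -/
def View.flipC (p : Par) (v : View) (e₀ : ℕ) : View :=
  { v with
    cb := fun e => if e = e₀ then !v.cb e else v.cb e
    cw := fun e => v.cw e ∨ e < p.n ∧ (p.pos + e) / p.w = (p.pos + e₀) / p.w }

/-- The view after flipping a flag. -/
def View.flipF (v : View) (j₀ : Bool) (s₀ : ℕ) : View :=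
  { v with fl := fun j s => if j = j₀ ∧ s = s₀ then !v.fl j s else v.fl j s }

/-- The view after storing in a record. -/
def View.setRec (v : View) (k₀ c₀ x : ℕ) : View :=
  { v with rc := fun k c => if k = k₀ ∧ c = c₀ then x else v.rc k c }

/-- The view after clearing the flags of a chunk for one color. -/
def View.clearF (p : Par) (v : View) (j₀ : Bool) (c₀ : ℕ) : View :=
  { v with fl := fun j s => if j = j₀ ∧ s / p.w = c₀ then false else v.fl j s }

namespace Par

variable {σ : ℕ → ℕ} {m N : ℕ} {p : Par} {A B : ℕ} {H : Hd} {v : View} {F : ℕ → ℕ} {s : State p.w}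
  (ok : p.Ok σ A B m)
include ok

theorem Ok.val_small {c : ℕ} (s : State p.w) (hc : c ≤ 4096) : val σ s (.const c) = c := by
  rw [val_const, Nat.mod_eq_of_lt]
  have := ok.pow_ge
  have := ok.w_ge
  nlinarith

theorem Ok.wp_blk (h : p.At H v F s) {e : Expr} {x : ℕ} (he : val σ s e = x) (hx : x < p.n) :
    wp σ m N (blk e) (fun s' => Frame 60 s s' ∧ s'.rg 60 = x ∧ s'.rg 61 = p.h + (p.ph + x) / p.w ∧
      s'.rg 62 = (p.ph + x) % p.w ∧ s'.rg 63 = p.sub x) s := by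
  obtain ⟨Y, b1, b2, b3, b4, b5, b6, b7, b8, b9, b10⟩ := ok.bounds
  have h64 := ok.w_ge
  have hY : 64 * (64 * p.w) ≤ Y := le_trans (by nlinarith) b2
  obtain ⟨w1, w2⟩ := ok.word_split x
  have hph := ok.ph_lt
  have hmod := Nat.mod_lt x ok.w_pos
  have hle : (p.ph + x) / p.w ≤ (p.ph + (p.n - 1)) / p.w := Nat.div_le_div_right (by omega)
  have r11 := h.st 11 (by omega) (by omega)
  have r12 := h.st 12 (by omega) (by omega)
  have r13 := h.st 13 (by omega) (by omega)
  have r16 := h.st 16 (by omega) (by omega)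
  simp only [rv] at r11 r12 r13 r16
  refine wp_assign_seq he fun x60 e60 => ?_
  refine wp_assign_seq (v := p.ph + x % p.w) (val_add_of_lt _ _ _
    (by simp [val_reg, r13]) (by simp [val_mod, val_reg, r11, e60]) (by omega)) fun x62 e62 => ?_
  refine wp_assign_seq (v := (p.ph + x) / p.w) (by
    rw [w1]
    exact val_add_of_lt _ _ _ (by simp [val_div, val_reg, r11, e60])
      (by simp [val_div, val_reg, r11, e62]) (by omega)) fun x61 e61 => ?_
  refine wp_assign_seq (v := p.sub x) (by simp [val_div, val_reg, r16, e61]; rfl) fun x63 e63 => ?_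
  refine wp_assign_seq (v := p.h + (p.ph + x) / p.w) (val_add_of_lt _ _ _
    (by simp [val_reg, r12]) (by simp [val_reg, e61]) (by omega)) fun x61' e61' => ?_
  refine wp_assign (v := (p.ph + x) % p.w) (by rw [w2]; simp [val_mod, val_reg, r11, e62])
    fun x62' e62' => ?_
  refine ⟨⟨rfl, rfl, fun i hi => ?_⟩, ?_, ?_, ?_, ?_⟩
  · simp only [rg_setR]
    repeat rw [if_neg (by omega)]
  · simp [e60]
  · simp [e61']
  · simp [e62']
  · simp [e63]

theorem Ok.wp_flg (h : p.At H v F s) (j : Bool) {e : Expr} {x : ℕ} (he : val σ s e = x)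
    (hx : x < p.M) :
    wp σ m N (flg j e) (fun s' => Frame 60 s s' ∧ s'.rg 60 = x ∧
      p.flagPos j x = s'.rg 61 * p.w + s'.rg 62 ∧ s'.rg 62 < p.w) s := by
  obtain ⟨Y, b1, b2, b3, b4, b5, b6, b7, b8, b9, b10⟩ := ok.bounds
  have h64 := ok.w_ge
  have hY : 64 * (64 * p.w) ≤ Y := le_trans (by nlinarith) b2
  have hM0 : p.M0 ≤ p.w := min_le_right _ _
  have hpo := ok.po_lt
  have r11 := h.st 11 (by omega) (by omega)
  have r14 := h.st 14 (by omega) (by omega)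
  have r15 := h.st 15 (by omega) (by omega)
  have r18 := h.st 18 (by omega) (by omega)
  have r20 := h.st 20 (by omega) (by omega)
  simp only [rv] at r11 r14 r15 r18 r20
  refine wp_assign_seq he fun x60 e60 => ?_
  refine wp_ite (fun hb => ?_) fun hb => ?_
  · simp [holds_lt, val_reg, r11, e60] at hb
    have hxM := (ok.lt_M0 hx).1 (Nat.div_eq_of_lt hb)
    refine wp_assign_seq (v := p.po + (if j then 0 else p.M0) + x) (val_add_of_lt _ _ _
      (val_add_of_lt _ _ _ (by simp [val_reg, r15]) (y := if j then 0 else p.M0)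
        (by cases j <;> simp [val_reg, r18, val_const]) (by split <;> omega))
      (by simp [val_reg, e60]) (by split <;> omega)) fun x63 e63 => ?_
    have hd : (p.po + (if j then 0 else p.M0) + x) / p.w < 3 := by
      rw [Nat.div_lt_iff_lt_mul ok.w_pos]; split <;> omega
    refine wp_assign_seq (v := p.pw + (p.po + (if j then 0 else p.M0) + x) / p.w)
      (val_add_of_lt _ _ _ (by simp [val_reg, r14]) (by simp [val_div, val_reg, r11, e63])
        (by omega)) fun x61 e61 => ?_
    refine wp_assign (v := (p.po + (if j then 0 else p.M0) + x) % p.w)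
      (by simp [val_mod, val_reg, r11, e63]) fun x62 e62 => ?_
    refine ⟨⟨rfl, rfl, fun i hi => ?_⟩, by simp [e60], ?_, ?_⟩
    · simp only [rg_setR]
      rw [if_neg (by omega), if_neg (by omega), if_neg (by omega), if_neg (by omega)]
    · simp [e61, e62]
      rw [ok.flagPos_zero hxM, ok.P_eq, Nat.add_mul]
      have := Nat.div_add_mod (p.po + (if j then 0 else p.M0) + x) p.w
      rw [Nat.mul_comm] at this
      omega
    · simp [e62, Nat.mod_lt _ ok.w_pos]
  · simp [holds_lt, val_reg, r11, e60] at hb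
    have h1 : x / p.w ≠ 0 := by rw [Ne, Nat.div_eq_zero_iff]; omega
    have hd : x / p.w * p.w ≤ x := Nat.div_mul_le_self _ _
    have hd' : 64 * (x / p.w) ≤ x := (Nat.mul_comm _ _).trans_le
      ((Nat.mul_le_mul_left _ h64).trans hd)
    have hQ : p.Q = p.pw + 3 := rfl
    refine wp_assign_seq (v := p.Q + 8 * (x / p.w) + (if j then 0 else 1)) (val_add_of_lt _ _ _
      (val_add_of_lt _ _ _ (by simp [val_reg, r20]) (val_mul_of_lt _ _ _
        (ok.val_small _ (by omega)) (by simp [val_div, val_reg, r11, e60]) (by omega)) (by omega))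
      (by split <;> exact ok.val_small _ (by omega)) (by split <;> omega)) fun x61 e61 => ?_
    refine wp_assign (v := x % p.w) (by simp [val_mod, val_reg, r11, e60]) fun x62 e62 => ?_
    refine ⟨⟨rfl, rfl, fun i hi => ?_⟩, by simp [e60], ?_, ?_⟩
    · simp only [rg_setR]
      rw [if_neg (by omega), if_neg (by omega), if_neg (by omega)]
    · simp [e61, e62]
      rw [flagPos, if_neg h1, Nat.mul_comm]
    · simp [e62, Nat.mod_lt _ ok.w_pos]

theorem Ok.wp_getBit {a o : ℕ} (h1 : s.rg 61 = a) (h2 : s.rg 62 = o) (ho : o < p.w)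
    (hb : a * p.w + o < p.b) :
    wp σ m N getBit (fun s' => Frame 60 s s' ∧ s'.rg 60 = s.rg 60 ∧
      s'.rg 63 = (memBit s.mem (a * p.w + o)).toNat) s := by
  refine wp_load_seq (a := a) ((val_reg _ _).trans h1) (ok.lt_m (by omega)) ?_
  refine wp_assign (v := (memBit s.mem (a * p.w + o)).toNat) ?_ fun x hx => ?_
  · rw [val_mod, ok.val_small _ (by omega), val_shr, memBit_eq _ ho, Nat.toNat_testBit]
    simp [val_reg, h2]
  · refine ⟨⟨rfl, rfl, fun i hi => ?_⟩, by simp, by simp [hx]⟩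
    simp only [rg_setR]
    rw [if_neg (by omega), if_neg (by omega)]

theorem Ok.wp_flipBit {a o : ℕ} (h1 : s.rg 61 = a) (h2 : s.rg 62 = o) (ho : o < p.w)
    (hb : a * p.w + o < p.b) :
    wp σ m N flipBit (fun s' => (∀ i < 60, s'.rg i = s.rg i) ∧ ∃ x : BitVec p.w,
      x.toNat = (s.mem a).toNat ^^^ 2 ^ o ∧ s'.mem = Function.update s.mem a x ∧
      s'.written = insert a s.written) s := by
  refine wp_load_seq (a := a) ((val_reg _ _).trans h1) (ok.lt_m (by omega)) ?_
  refine wp_store (a := a) (v := (s.mem a).toNat ^^^ 2 ^ o) (by simp [val_reg, h1]) ?_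
    (ok.lt_m (by omega)) fun x hx => ?_
  · rw [val_xor, val_exp2 (x := o) _ _ (by simp [val_reg, h2]) ho]
    simp [val_reg]
  · exact ⟨fun i hi => by rw [rg_setM, rg_setR, if_neg (by omega)], x, hx, rfl, rfl⟩

theorem Ok.wp_getC (h : p.At H v F s) {e : Expr} {x : ℕ} (he : val σ s e = x) (hx : x < p.n) :
    wp σ m N (getC e) (fun s' => Frame 60 s s' ∧ s'.rg 63 = (v.cb x).toNat) s := by
  refine wp_call (ok.wp_blk h he hx) ?_
  rintro s' ⟨f, -, e1, e2, -⟩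
  have e3 := ok.client_eq x
  have := ok.client_lt_b hx
  refine (ok.wp_getBit e1 e2 (Nat.mod_lt _ ok.w_pos) (by omega)).mono ?_
  rintro s'' ⟨f', -, e4⟩
  refine ⟨f.trans f', ?_⟩
  rw [e4, ← e3, f.1, ← h.vw]
  simp [view, hx]

theorem Ok.wp_getF (h : p.At H v F s) (j : Bool) {e : Expr} {x : ℕ} (he : val σ s e = x)
    (hx : x < p.M) :
    wp σ m N (getF j e) (fun s' => Frame 60 s s' ∧ s'.rg 60 = x ∧ s'.rg 63 = (v.fl j x).toNat) s := by
  refine wp_call (ok.wp_flg h j he hx) ?_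
  rintro s' ⟨f, e1, e2, e3⟩
  have := ok.flagPos_lt (j := j) hx
  refine (ok.wp_getBit rfl rfl e3 (by omega)).mono ?_
  rintro s'' ⟨f', e5, e4⟩
  refine ⟨f.trans f', e5.trans e1, ?_⟩
  rw [e4, ← e2, f.1, ← h.vw]
  simp [view, hx]

theorem Ok.wp_flipC (h : p.At H v F s) {e : Expr} {x : ℕ} (he : val σ s e = x) (hx : x < p.n) :
    wp σ m N (flipC e) (fun s' => p.At H (v.flipC p x) F s') s := by
  refine wp_call (ok.wp_blk h he hx) ?_
  rintro s' ⟨f, -, e1, e2, -⟩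
  have e3 := ok.client_eq x
  have := ok.client_lt_b hx
  have h' := h.frame f le_rfl
  have ho := Nat.mod_lt (p.ph + x) ok.w_pos
  refine (ok.wp_flipBit e1 e2 ho (by omega)).mono ?_
  rintro s'' ⟨f', y, hy, m1, m2⟩
  refine ⟨fun i h1 h2 => by rw [f' _ (by omega), h'.st i h1 h2], by rw [m2]; exact h'.bd.insert _,
    ?_, fun i h1 h2 => by rw [f' _ h2, h'.loc i h1 h2]⟩
  rw [m1, m2, ok.view_flip_client hx ho e3 hy, h'.vw]
  rfl

theorem Ok.wp_flipF (h : p.At H v F s) (j : Bool) {e : Expr} {x : ℕ} (he : val σ s e = x)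
    (hx : x < p.M) :
    wp σ m N (flipF j e) (fun s' => p.At H (v.flipF j x) F s') s := by
  refine wp_call (ok.wp_flg h j he hx) ?_
  rintro s' ⟨f, e1, e2, e3⟩
  have := ok.flagPos_lt (j := j) hx
  have h' := h.frame f le_rfl
  refine (ok.wp_flipBit rfl rfl e3 (by omega)).mono ?_
  rintro s'' ⟨f', y, hy, m1, m2⟩
  refine ⟨fun i h1 h2 => by rw [f' _ (by omega), h'.st i h1 h2], by rw [m2]; exact h'.bd.insert _,
    ?_, fun i h1 h2 => by rw [f' _ h2, h'.loc i h1 h2]⟩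
  rw [m1, m2, ok.view_flip_flag h'.bd hx e3 e2 hy, h'.vw]
  rfl

theorem Ok.val_recE (h : p.At H v F s) {e : Expr} {c k : ℕ} (hK : 1 < p.K) (hc : c < p.K)
    (hk : k < 8) (he : val σ s e = c) : val σ s (recE k e) = p.Q + 8 * c + k ∧
      p.Q + 8 * c + k < m := by
  have hr := ok.rec_lt hK hc hk
  have hw := ok.w_pos
  have h1 : (p.Q + 8 * c + k) * p.w < p.b := by rw [Nat.add_mul _ 1] at hr; omega
  have h2 := ok.addr_lt h1
  have r20 : val σ s (Rg 20) = p.Q := h.par (by omega) (by omega)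
  exact ⟨val_add_of_lt _ _ _ (val_add_of_lt _ _ _ r20
    (val_mul_of_lt _ _ _ (ok.val_small _ (by omega)) he (by omega)) (by omega))
    (ok.val_small _ (by omega)) (by omega), ok.lt_m h1⟩

theorem Ok.load_rec (h : p.At H v F s) {e : Expr} {c k r : ℕ}
    (hK : 1 < p.K) (hc : c < p.K) (hk : 2 ≤ k) (hk' : k < 8) (he : val σ s e = c)
    (h1 : 22 ≤ r) :
    wp σ m N (.load r (recE k e)) (p.At H v (Function.update F r (v.rc k c))) s := by
  obtain ⟨e1, e2⟩ := ok.val_recE h hK hc hk' he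
  refine wp_load e1 e2 ⟨h.st.setR h1 _, h.bd, h.vw, fun i hi hi' => ?_⟩
  rw [rg_setR, Function.update_apply, h.loc i hi hi', ← h.vw]
  simp only [view]
  rw [if_pos (⟨hk, hk', hc, hK⟩ : 2 ≤ k ∧ k < 8 ∧ c < p.K ∧ 1 < p.K)]

theorem Ok.store_rec (h : p.At H v F s) {e₁ e₂ : Expr} {c k x : ℕ} (hK : 1 < p.K) (hc : c < p.K)
    (hk : 2 ≤ k) (hk' : k < 8)
    (he₁ : val σ s e₁ = c) (he₂ : val σ s e₂ = x) :
    wp σ m N (.store (recE k e₁) e₂) (p.At H (v.setRec k c x) F) s := by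
  obtain ⟨e1, e2⟩ := ok.val_recE h hK hc hk' he₁
  refine wp_store e1 he₂ e2 fun y hy =>
    ⟨h.st.setM _ _, h.bd.insert _, ?_, fun i h1 h2 => by rw [rg_setM, h.loc i h1 h2]⟩
  rw [mem_setM, written_setM, ok.view_store_rec h.bd hK hc hk hk', h.vw, hy]
  rfl

theorem Ok.clear_flags (h : p.At H v F s) (j : Bool) {e : Expr} {c : ℕ} (hK : 1 < p.K)
    (hc : c < p.K) (hc0 : c ≠ 0) (he : val σ s e = c) :
    wp σ m N (.store (recE (if j then 0 else 1) e) (.const 0)) (p.At H (v.clearF p j c) F) s := by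
  obtain ⟨e1, e2⟩ := ok.val_recE h hK hc (k := if j then 0 else 1) (by split <;> omega) he
  refine wp_store e1 (ok.val_small _ (by omega)) e2 fun y hy =>
    ⟨h.st.setM _ _, h.bd.insert _, ?_, fun i h1 h2 => by rw [rg_setM, h.loc i h1 h2]⟩
  obtain rfl : y = 0 := BitVec.eq_of_toNat_eq (by simp [hy])
  rw [mem_setM, written_setM, ok.view_clear_flags h.bd hc0, h.vw]
  rfl

end Par
end ChoiceDict

/-! ### Preparing and searching blocks -/

namespace ChoiceDict

open WordRAM FieldSum

/-- Sets `reg 61` to the address of the first word of block `reg 60`. -/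
def lowP : Prog := .assign 61 (Rg 12 + Rg 60 * Rg 16)

/-- Sets `reg a` and `reg o` to the address and offset of the end of block `reg 60`. -/
def highP (a o : ℕ) : Prog :=
  .ite (.eq (Rg 60 + .const 1) (Rg 17)) (.assign a (Rg 14) ;; .assign o (Rg 15))
    (.assign a (Rg 12 + (Rg 60 + .const 1) * Rg 16) ;; .assign o (.const 0))

/-- If block `e` has no element of the client set according to its flag, fills its words with
zeros, except those that it shares with other components. -/
def prep (e : Expr) : Prog :=
  getF true e ;;
  .ite (.eq (Rg 63) (.const 0))
    (lowP ;; .ite (.eq (Rg 60) (.const 0)) (.assign 61 (Rg 61 + .const 1)) .skip ;;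
      highP 62 64 ;;
      .loop (.lt (Rg 61) (Rg 62)) (.store (Rg 61) (.const 0) ;; .assign 61 (Rg 61 + .const 1)))
    .skip

/-- Converts the position found by a search into the index of a client bit, in `reg 61`. -/
def elemP (B : ℕ) : Prog :=
  scanP B ;; .assign 60 (Rg 80) ;; .assign 61 ((Rg 81 - Rg 12) * Rg 11 + Rg 82 - Rg 13)

/-- Sets `reg 80` to the color mask for `j`. -/
def maskP (j : Bool) : Prog :=
  if j then .assign 80 (.const 0) else .assign 80 (.const 0 - .const 1)

/-- Prepares a search for color `j` that starts in the first bit of block `reg 60`. -/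
def startP (j : Bool) : Prog :=
  maskP j ;; lowP ;; .assign 81 (Rg 61) ;;
  .ite (.eq (Rg 60) (.const 0)) (.assign 82 (Rg 13)) (.assign 82 (.const 0))

/-- Searches block `e` for its last element of color `j`. -/
def scanC (B : ℕ) (j : Bool) (e : Expr) : Prog :=
  .assign 60 e ;; startP j ;; highP 83 84 ;; elemP B

/-- Searches the block that contains the client bit `e` for the last element of color `j` before
`e`. -/
def scanCx (B : ℕ) (j : Bool) (e : Expr) : Prog :=
  blk e ;; .assign 83 (Rg 61) ;; .assign 84 (Rg 62) ;; .assign 60 (Rg 63) ;;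
  startP j ;; elemP B

/-- Searches the first `reg 61` flags for color `j` in chunk `reg 60` for the last that signals an
element. -/
def scanFlagsP (B : ℕ) (j : Bool) : Prog :=
  maskP j ;;
  .ite (.eq (Rg 60) (.const 0))
    (.assign 62 (Rg 14) ;; .assign 63 (Rg 15 + (if j then .const 0 else Rg 18)))
    (.assign 62 (recE (if j then 0 else 1) (Rg 60)) ;; .assign 63 (.const 0)) ;;
  .assign 81 (Rg 62 + Rg 63 / Rg 11) ;; .assign 82 (Rg 63 % Rg 11) ;;
  .assign 83 (Rg 62 + (Rg 63 + Rg 61) / Rg 11) ;; .assign 84 ((Rg 63 + Rg 61) % Rg 11) ;;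
  scanP B ;;
  .assign 61 (Rg 60 * Rg 11 + ((Rg 81 - Rg 62) * Rg 11 + Rg 82 - Rg 63)) ;; .assign 60 (Rg 80)

/-- Searches chunk `e` for its last block that contains an element of color `j`. -/
def scanF (B : ℕ) (j : Bool) (e : Expr) : Prog :=
  .assign 60 e ;; .assign 61 (Rg 17 - Rg 60 * Rg 11) ;;
  .ite (.lt (Rg 61) (Rg 11)) .skip (.assign 61 (Rg 11)) ;; scanFlagsP B j

/-- Searches the chunk of block `e` for the last block before `e` that contains an element of
color `j`. -/
def scanFx (B : ℕ) (j : Bool) (e : Expr) : Prog :=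
  .assign 60 e ;; .assign 61 (Rg 60 % Rg 11) ;; .assign 60 (Rg 60 / Rg 11) ;; scanFlagsP B j

/-- The view after preparing a block. -/
def View.prep (p : Par) (v : View) (s : ℕ) : View :=
  { v with
    cb := fun e => v.cb e && !(decide (p.sub e = s) && !v.fl true s)
    cw := fun e => v.cw e ∨ e < p.n ∧ p.sub e = s ∧ v.fl true s = false }

namespace Par

variable {σ : ℕ → ℕ} {m N : ℕ} {p : Par} {A B : ℕ} {H : Hd} {v : View} {F : ℕ → ℕ} {s : State p.w}
  (ok : p.Ok σ A B m)
include ok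

/-- The address and the offset of the first bit of block `k`, and the address and the offset of the
bit after its last. -/
theorem Ok.wp_lowP (h : p.At H v F s) {k : ℕ} (hk : k < p.M) (h60 : s.rg 60 = k) :
    wp σ m N lowP (fun s' => Frame 61 s s' ∧ s'.rg 61 = p.h + k * p.u ∧
      (∀ i, 62 ≤ i → s'.rg i = s.rg i)) s := by
  obtain ⟨Y, b1, b2, b3, b4, b5, b6, b7, b8, b9, b10⟩ := ok.bounds
  have h64 := ok.w_ge
  have hY : 64 * (64 * p.w) ≤ Y := le_trans (by nlinarith) b2
  have r12 : val σ s (Rg 12) = p.h := h.par (by omega) (by omega)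
  have r16 : val σ s (Rg 16) = p.u := h.par (by omega) (by omega)
  have hku : k * p.u ≤ (p.M - 1) * p.u := Nat.mul_le_mul_right _ (by omega)
  refine wp_assign (v := p.h + k * p.u) (val_add_of_lt _ _ _ r12
    (val_mul_of_lt _ _ _ ((val_reg _ _).trans h60) r16 (by omega)) (by omega)) fun x hx => ?_
  exact ⟨(Frame.refl _ _).setR le_rfl x, by simp [hx], fun i hi => by
    rw [rg_setR, if_neg (by omega)]⟩

theorem Ok.wp_highP (h : p.At H v F s) {k a o : ℕ} (hk : k < p.M) (h60 : s.rg 60 = k)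
    (ha : 61 ≤ a) (hao : a < o) :
    wp σ m N (highP a o) (fun s' => Frame 61 s s' ∧
      s'.rg a = (if k + 1 = p.M then p.pw else p.h + (k + 1) * p.u) ∧
      s'.rg o = (if k + 1 = p.M then p.po else 0) ∧
      (∀ i, i ≠ a → i ≠ o → s'.rg i = s.rg i)) s := by
  obtain ⟨Y, b1, b2, b3, b4, b5, b6, b7, b8, b9, b10⟩ := ok.bounds
  have h64 := ok.w_ge
  have hY : 64 * (64 * p.w) ≤ Y := le_trans (by nlinarith) b2
  have r12 : val σ s (Rg 12) = p.h := h.par (by omega) (by omega)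
  have r14 : val σ s (Rg 14) = p.pw := h.par (by omega) (by omega)
  have r15 : s.rg 15 = p.po := h.st _ (by omega) (by omega)
  have r16 : val σ s (Rg 16) = p.u := h.par (by omega) (by omega)
  have r17 : val σ s (Rg 17) = p.M := h.par (by omega) (by omega)
  have e1 : val σ s (Rg 60 + .const 1) = k + 1 := val_add_of_lt _ _ _ ((val_reg _ _).trans h60)
    (ok.val_small _ (by omega)) (by omega)
  refine wp_ite (fun hb => ?_) fun hb => ?_
  · rw [holds_eq, e1, r17] at hb
    refine wp_assign_seq r14 fun x hx => ?_
    refine wp_assign (v := p.po) (by rw [val_reg, rg_setR, if_neg (by omega), r15]) fun y hy => ?_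
    rw [if_pos hb, if_pos hb]
    refine ⟨((Frame.refl _ _).setR ha x).setR (by omega) y, ?_, by simp [hy], fun i h1 h2 => ?_⟩
    · rw [rg_setR, if_neg (by omega), rg_setR, if_pos rfl, hx]
    · rw [rg_setR, if_neg h2, rg_setR, if_neg h1]
  · rw [holds_eq, e1, r17] at hb
    have hku : (k + 1) * p.u ≤ (p.M - 1) * p.u := Nat.mul_le_mul_right _ (by omega)
    refine wp_assign_seq (val_add_of_lt _ _ _ r12 (val_mul_of_lt _ _ _ e1 r16 (by omega))
      (by omega)) fun x hx => ?_
    refine wp_assign (ok.val_small _ (by omega)) fun y hy => ?_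
    rw [if_neg hb, if_neg hb]
    refine ⟨((Frame.refl _ _).setR ha x).setR (by omega) y, ?_, by simp [hy], fun i h1 h2 => ?_⟩
    · rw [rg_setR, if_neg (by omega), rg_setR, if_pos rfl, hx]
    · rw [rg_setR, if_neg h2, rg_setR, if_neg h1]

/-- The effect on the view of filling with zeros the words of a block up to the address `a`. -/
theorem Ok.view_zero {k a : ℕ} (hk : k < p.M) (h1 : p.h + k * p.u ≤ a) (h2 : p.h < a)
    (h3 : a < if k + 1 = p.M then p.pw else p.h + (k + 1) * p.u) (mem : ℕ → BitVec p.w)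
    (wr : Set ℕ) :
    p.view (Function.update mem a 0) (insert a wr) =
      { p.view mem wr with
        cb := fun e => (p.view mem wr).cb e && !decide ((p.pos + e) / p.w = a)
        cw := fun e => (p.view mem wr).cw e ∨ e < p.n ∧ (p.pos + e) / p.w = a } ∧
    ∀ e < p.n, (p.pos + e) / p.w = a → p.sub e = k := by
  have hapw : a < p.pw := by
    split at h3
    · exact h3
    · refine h3.trans_le ?_
      have := (ok.sub_words_le (s := k + 1) (by omega)).1
      have := (ok.sub_words_le (s := p.M - 1) (by have := ok.M_pos; omega)).1
      rw [if_pos (by omega)] at this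
      have : (k + 1) * p.u ≤ (p.M - 1) * p.u := Nat.mul_le_mul_right _ (by omega)
      omega
  have hfl : ∀ q, p.P ≤ q → q / p.w ≠ a := by
    intro q hq
    have : p.pw ≤ q / p.w := Nat.div_le_div_right hq
    omega
  refine ⟨?_, fun e he hea => ?_⟩
  · ext1
    · funext e
      simp only [view]
      by_cases hea : (p.pos + e) / p.w = a
      · unfold memBit
        rw [hea, Function.update_self]
        simp
      · rw [memBit_update_ne _ _ hea]
        simp [hea]
    · funext j t
      simp only [view]
      rw [memBit_update_ne _ _ (hfl _ (ok.flagPos_ge j t))]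
    · funext q c
      simp only [view]
      split
      · rw [Function.update_of_ne]; unfold Q; omega
      · rfl
    · funext e
      simp only [view, Set.mem_insert_iff, eq_iff_iff]
      tauto
  · have hd := Nat.div_add_mod (p.pos + e) p.w
    have hm := Nat.mod_lt (p.pos + e) ok.w_pos
    rw [hea, Nat.mul_comm] at hd
    have hph := ok.ph_lt
    rw [ok.sub_eq_iff he]
    constructor
    · split
      · have := Nat.mul_le_mul_right p.w (show p.h + k * p.u + 1 ≤ a by subst k; omega)
        rw [Nat.add_mul _ 1] at this
        omega
      · have := Nat.mul_le_mul_right p.w h1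
        omega
    · have := Nat.mul_le_mul_right p.w (Nat.succ_le_of_lt h3)
      rw [Nat.succ_mul] at this
      omega

/-- The bits of a block outside of the words that belong to the block alone are in words that have
been written. -/
theorem Ok.cw_boundary {mem : ℕ → BitVec p.w} {wr : Set ℕ} (hB : p.Bd wr) {k e : ℕ} (he : e < p.n)
    (hek : p.sub e = k)
    (h : ¬ (p.h + k * p.u + (if k = 0 then 1 else 0) ≤ (p.pos + e) / p.w ∧
      (p.pos + e) / p.w < if k + 1 = p.M then p.pw else p.h + (k + 1) * p.u)) :
    (p.view mem wr).cw e := by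
  refine ⟨he, ?_⟩
  obtain ⟨h1, h2⟩ := (ok.sub_eq_iff he).1 hek
  have hd := Nat.div_add_mod (p.pos + e) p.w
  have hm := Nat.mod_lt (p.pos + e) ok.w_pos
  rw [Nat.mul_comm] at hd
  have hph := ok.ph_lt
  have hpo := ok.po_lt
  have h3 : p.h + k * p.u ≤ (p.pos + e) / p.w := by
    rw [Nat.le_div_iff_mul_le ok.w_pos]; omega
  have h4 : (p.pos + e) / p.w ≤ if k + 1 = p.M then p.pw else p.h + (k + 1) * p.u := by
    rw [← Nat.lt_add_one_iff, Nat.div_lt_iff_lt_mul ok.w_pos, Nat.add_mul _ 1]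
    split at h2
    · rw [if_pos (by assumption)]; omega
    · rw [if_neg (by assumption)]; omega
  by_cases hk : (p.pos + e) / p.w ≤ p.h
  · exact hB.2 _ hk
  · have h5 : (p.pos + e) / p.w = if k + 1 = p.M then p.pw else p.h + (k + 1) * p.u := by
      by_contra hne
      refine h ⟨?_, by omega⟩
      split
      · rename_i h0
        have : k * p.u = 0 := by rw [h0, zero_mul]
        omega
      · omega
    split at h5
    · rw [h5]; exact hB.1
    · rw [if_neg (by assumption), if_neg (by assumption)] at h2
      rw [h5] at hd
      omega

theorem Ok.wp_prep (h : p.At H v F s) (hN : p.u ≤ N) {e : Expr} {k : ℕ} (he : val σ s e = k)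
    (hk : k < p.M)
    (hz : v.fl true k = false → ∀ e < p.n, p.sub e = k → v.cw e → v.cb e = false) :
    wp σ m N (prep e) (fun s' => p.At H (v.prep p k) F s') s := by
  obtain ⟨Y, b1, b2, b3, b4, b5, b6, b7, b8, b9, b10⟩ := ok.bounds
  have h64 := ok.w_ge
  have hY : 64 * (64 * p.w) ≤ Y := le_trans (by nlinarith) b2
  refine wp_call (ok.wp_getF h true he hk) ?_
  rintro s₁ ⟨f₁, e60, e63⟩
  replace h := h.frame f₁ le_rfl
  clear f₁ he
  have c0 : ∀ t : State p.w, val σ t (.const 0) = 0 := fun t => ok.val_small _ (by omega)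
  have c1 : ∀ t : State p.w, val σ t (.const 1) = 1 := fun t => ok.val_small _ (by omega)
  refine wp_ite (fun hb => ?_) fun hb => ?_
  swap
  · rw [holds_eq, val_reg, e63, c0] at hb
    have hf : v.fl true k = true := by cases hf : v.fl true k <;> simp [hf] at hb ⊢
    have : v.prep p k = v := by
      ext1
      · funext e
        simp only [View.prep]
        by_cases hs : p.sub e = k
        · simp [hs, hf]
        · simp [hs]
      · rfl
      · rfl
      · funext e
        simp [View.prep, hf]
    rw [this]
    exact wp_skip h
  rw [holds_eq, val_reg, e63, c0] at hb
  have hf : v.fl true k = false := by cases hf : v.fl true k <;> simp [hf] at hb ⊢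
  obtain ⟨a₀, ha₀⟩ : ∃ a, a = p.h + k * p.u + (if k = 0 then 1 else 0) := ⟨_, rfl⟩
  obtain ⟨a₁, ha₁⟩ : ∃ a, a = if k + 1 = p.M then p.pw else p.h + (k + 1) * p.u := ⟨_, rfl⟩
  have hsw := ok.sub_words_le hk
  rw [← ha₁] at hsw
  have hku : k * p.u ≤ (p.M - 1) * p.u := Nat.mul_le_mul_right _ (by omega)
  refine wp_call (ok.wp_lowP h hk e60) ?_
  rintro s₂ ⟨f₂, e61, g₂⟩
  replace h := h.frame (f₂.weaken (by omega)) le_rfl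
  have e60' : s₂.rg 60 = k := (f₂.2.2 60 (by omega)).trans e60
  refine wp_call (R := fun s' => Frame 61 s₂ s' ∧ s'.rg 61 = a₀) ?_ ?_
  · refine wp_ite (fun hb => ?_) fun hb => ?_
    · rw [holds_eq, val_reg, e60', c0] at hb
      rw [if_pos hb] at ha₀
      refine wp_assign (v := a₀) ?_ fun x hx => ⟨(Frame.refl _ _).setR le_rfl x, by simp [hx]⟩
      rw [ha₀]
      exact val_add_of_lt _ _ _ ((val_reg _ _).trans e61) (c1 _) (by omega)
    · rw [holds_eq, val_reg, e60', c0] at hb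
      rw [if_neg hb] at ha₀
      exact wp_skip ⟨Frame.refl _ _, by omega⟩
  rintro s₃ ⟨f₃, e61'⟩
  replace h := h.frame (f₃.weaken (by omega)) le_rfl
  refine wp_call (ok.wp_highP h hk ((f₃.2.2 60 (by omega)).trans e60') (a := 62) (o := 64)
    (by omega) (by omega)) ?_
  rintro s₄ ⟨f₄, e62, -, g₄⟩
  replace h := h.frame (f₄.weaken (by omega)) le_rfl
  rw [← ha₁] at e62
  have e61'' : s₄.rg 61 = a₀ := (g₄ 61 (by omega) (by omega)).trans e61'
  let Z : ℕ → View := fun a => { v with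
    cb := fun e => v.cb e && !decide (a₀ ≤ (p.pos + e) / p.w ∧ (p.pos + e) / p.w < a)
    cw := fun e => v.cw e ∨ e < p.n ∧ a₀ ≤ (p.pos + e) / p.w ∧ (p.pos + e) / p.w < a }
  have hlow : ∀ a, a₀ ≤ a → p.h + k * p.u ≤ a ∧ p.h < a := by
    intro a ha
    split at ha₀
    · omega
    · have := ok.u_pos
      have := Nat.mul_le_mul_right p.u (show 1 ≤ k by omega)
      omega
  have hin : ∀ e < p.n, a₀ ≤ (p.pos + e) / p.w → (p.pos + e) / p.w < a₁ → p.sub e = k := by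
    intro e he h1 h2
    exact (ok.view_zero hk (hlow _ h1).1 (hlow _ h1).2 (ha₁ ▸ h2) s₄.mem s₄.written).2 e he rfl
  refine wp_loop rfl (fun i t => p.At H (Z (t.rg 61)) F t ∧ t.rg 62 = a₁ ∧ a₀ ≤ t.rg 61 ∧
    (t.rg 61 ≤ a₁ ∨ t.rg 61 = a₀) ∧ i = a₁ - t.rg 61) ?_ ?_ (a₁ - a₀) ?_ ?_
  · rintro i t ⟨j1, j2, j3, j4, j5⟩ hb
    rw [holds_lt, val_reg, val_reg, j2] at hb
    have hapw : a₁ ≤ p.pw := by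
      rw [ha₁]
      split
      · exact le_rfl
      · have := (ok.sub_words_le (s := p.M - 1) (by omega)).1
        rw [if_pos (by omega)] at this
        have : (k + 1) * p.u ≤ (p.M - 1) * p.u := Nat.mul_le_mul_right _ (by omega)
        omega
    refine ⟨i - 1, by omega, ?_⟩
    have hPb := ok.P_le_b
    have hPe := ok.P_eq
    have hlt : t.rg 61 * p.w + p.w ≤ p.pw * p.w := by
      rw [← Nat.succ_mul]; exact Nat.mul_le_mul_right _ (by omega)
    refine wp_store_seq (val_reg _ _) (c0 _) (ok.lt_m (by omega)) fun x hx => ?_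
    obtain rfl : x = 0 := BitVec.eq_of_toNat_eq (by simp [hx])
    refine wp_assign (v := t.rg 61 + 1) (val_add_of_lt _ _ _ (by simp [val_reg]) (c1 _) (by omega))
      fun y hy => ?_
    refine ⟨⟨(j1.st.setM _ _).setR (by omega) y, j1.bd.insert _, ?_, fun i h1 h2 => ?_⟩, by simp [j2],
      by simp [hy]; omega, by simp [hy]; omega, by simp [hy]; omega⟩
    · rw [mem_setR, written_setR, mem_setM, written_setM, (ok.view_zero hk (hlow _ j3).1 (hlow _ j3).2
        (ha₁ ▸ hb) _ _).1, j1.vw]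
      simp only [rg_setR, if_true, hy, Z]
      ext1
      · funext e
        dsimp only
        rw [Bool.and_assoc, ← Bool.not_or, ← Bool.decide_or]
        congr 2
        rw [decide_eq_decide]
        omega
      · rfl
      · rfl
      · funext e
        dsimp only
        rw [eq_iff_iff, or_assoc, ← and_or_left]
        refine or_congr_right (and_congr_right fun _ => ?_)
        omega
    · rw [rg_setR, if_neg (by omega), rg_setM, j1.loc i h1 h2]
  · rintro i t ⟨j1, j2, j3, j4, j5⟩ hb
    rw [holds_lt, val_reg, val_reg, j2] at hb
    have hcw : ∀ e < p.n, p.sub e = k → ¬ (a₀ ≤ (p.pos + e) / p.w ∧ (p.pos + e) / p.w < t.rg 61) →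
        v.cw e := by
      intro e he hs h'
      rw [← h.vw]
      refine ok.cw_boundary h.bd he hs ?_
      rw [← ha₀, ← ha₁]
      omega
    have hin' : ∀ e < p.n, a₀ ≤ (p.pos + e) / p.w → (p.pos + e) / p.w < t.rg 61 → p.sub e = k := by
      intro e he h1 h2
      exact hin e he h1 (by omega)
    have : v.prep p k = Z (t.rg 61) := by
      ext1
      · funext e
        simp only [View.prep, Z, hf, Bool.not_false, Bool.and_true]
        by_cases hcb : v.cb e = false
        · simp [hcb]
        have he : e < p.n := by
          by_contra hne
          apply hcb
          rw [← h.vw]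
          simp [view, hne]
        congr 2
        rw [decide_eq_decide]
        refine ⟨fun hs => ?_, fun h' => hin' e he h'.1 h'.2⟩
        by_contra h'
        exact hcb (hz hf e he hs (hcw e he hs h'))
      · rfl
      · rfl
      · funext e
        simp only [View.prep, Z, hf, eq_iff_iff]
        constructor
        · rintro (h' | ⟨he, hs, -⟩)
          · exact Or.inl h'
          · by_cases h' : a₀ ≤ (p.pos + e) / p.w ∧ (p.pos + e) / p.w < t.rg 61
            · exact Or.inr ⟨he, h'⟩
            · exact Or.inl (hcw e he hs h')
        · rintro (h' | ⟨he, h1, h2⟩)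
          · exact Or.inl h'
          · exact Or.inr ⟨he, hin' e he h1 h2, trivial⟩
    rw [this]
    exact j1
  · split at ha₀ <;> omega
  · have : Z a₀ = v := by
      ext1
      · funext e
        simp only [Z]
        rw [decide_eq_false (by omega)]; simp
      · rfl
      · rfl
      · funext e
        simp only [Z, eq_iff_iff]
        exact or_iff_left (by omega)
    refine ⟨by rw [e61'', this]; exact h, e62, by omega, by omega, by omega⟩

theorem Ok.val_elem {a o e : ℕ} (s : State p.w) (r12 : s.rg 12 = p.h) (r11 : s.rg 11 = p.w)
    (r13 : s.rg 13 = p.ph) (r81 : s.rg 81 = a) (r82 : s.rg 82 = o) (he : e < p.n) (hw : o < p.w)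
    (h : a * p.w + o = p.pos + e) :
    val σ s ((Rg 81 - Rg 12) * Rg 11 + Rg 82 - Rg 13) = e := by
  have hn := ok.n_le
  have hp := ok.pos_eq
  have hph := ok.ph_lt
  have hww : p.w < 2 ^ p.w := Nat.lt_two_pow_self
  have hle : p.h ≤ a := by
    by_contra hc
    have := Nat.mul_le_mul_right p.w (show a + 1 ≤ p.h by omega)
    rw [Nat.succ_mul] at this
    omega
  have e1 : val σ s (Rg 81 - Rg 12) = a - p.h := val_sub_of_le _ _ _ r81 r12 hle
  have e2 : (a - p.h) * p.w + o = e + p.ph := by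
    rw [Nat.sub_mul]
    have := Nat.mul_le_mul_right p.w hle
    omega
  rw [val_sub, val_add, val_mul, e1, val_reg, val_reg, val_reg, r11, r13, r82, Nat.mod_add_mod, e2]
  by_cases hc : e + p.ph < 2 ^ p.w
  · rw [Nat.mod_eq_of_lt hc, show 2 ^ p.w - p.ph + (e + p.ph) = e + 2 ^ p.w by omega,
      Nat.add_mod_right, Nat.mod_eq_of_lt (by omega)]
  · rw [Nat.mod_eq_sub_mod (a := e + p.ph) (by omega),
      Nat.mod_eq_of_lt (show e + p.ph - 2 ^ p.w < 2 ^ p.w by omega),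
      show 2 ^ p.w - p.ph + (e + p.ph - 2 ^ p.w) = e by omega, Nat.mod_eq_of_lt (by omega)]

theorem Ok.wp_elem (hA : A ≤ N) (h : p.At H v F s) (j : Bool) {a₀ o₀ a₁ o₁ : ℕ}
    (h80 : s.rg 80 = colorMask p.w j) (h81 : s.rg 81 = a₀) (h82 : s.rg 82 = o₀)
    (h83 : s.rg 83 = a₁) (h84 : s.rg 84 = o₁) (ho₀ : o₀ < p.w) (ho₁ : o₁ < p.w) (ha : a₀ ≤ a₁)
    (hN : a₁ - a₀ ≤ N) (hlo : p.pos ≤ a₀ * p.w + o₀) (hhi : a₁ * p.w + o₁ ≤ p.P) :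
    wp σ m N (elemP B) (fun s' => Frame 60 s s' ∧
      ((s'.rg 60 = 0 ∧
          ∀ e < p.n, a₀ * p.w + o₀ ≤ p.pos + e → p.pos + e < a₁ * p.w + o₁ → v.cb e ≠ j) ∨
        (s'.rg 60 = 1 ∧ ∃ e < p.n, s'.rg 61 = e ∧ a₀ * p.w + o₀ ≤ p.pos + e ∧
          p.pos + e < a₁ * p.w + o₁ ∧ v.cb e = j ∧
          ∀ e' < p.n, e < e' → p.pos + e' < a₁ * p.w + o₁ → v.cb e' ≠ j))) s := by
  have hb := ok.P_le_b
  have hcb : ∀ e < p.n, v.cb e = memBit s.mem (p.pos + e) := fun e he => by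
    rw [← h.vw]; simp [view, he]
  refine wp_call (wp_scan ok.word hA s j h80 h81 h82 h83 h84 ho₀ ho₁ ha hN
    fun a _ h2 => ok.lt_m (by omega)) ?_
  rintro t ⟨f, ht⟩
  refine wp_assign_seq rfl fun x hx => ?_
  refine wp_assign rfl fun y hy => ?_
  refine ⟨((f.weaken (by omega)).setR le_rfl x).setR (by omega) y, ?_⟩
  rw [val_reg] at hx
  rcases ht with ⟨r1, r2⟩ | ⟨r1, r2, r3, r4, r5, r6⟩
  · left
    refine ⟨by simp [hx, r1], fun e he h1 h2 => ?_⟩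
    rw [hcb e he]
    exact r2 _ h1 h2
  · right
    obtain ⟨e, he⟩ : ∃ e, t.rg 81 * p.w + t.rg 82 = p.pos + e := ⟨_, (Nat.add_sub_of_le
      (hlo.trans r3)).symm⟩
    rw [he] at r3 r4 r5 r6
    have hPP : p.P = p.pos + p.n := rfl
    have hen : e < p.n := by omega
    have hr : ∀ i, i < 60 → (t.setR 60 x).rg i = s.rg i := fun i hi => by
      rw [rg_setR, if_neg (by omega), f.2.2 i (by omega)]
    rw [ok.val_elem (a := t.rg 81) (o := t.rg 82) (e := e) _
      ((hr 12 (by omega)).trans (h.st 12 (by omega) (by omega)))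
      ((hr 11 (by omega)).trans (h.st 11 (by omega) (by omega)))
      ((hr 13 (by omega)).trans (h.st 13 (by omega) (by omega)))
      (by simp) (by simp) hen r2 he] at hy
    refine ⟨by simp [hx, r1], e, hen, by simp [hy], r3, r4, by rw [hcb e hen]; exact r5, ?_⟩
    intro e' he' h1 h2
    rw [hcb e' he']
    exact r6 _ (by omega) h2

/-- The bounds of block `k`. -/
theorem Ok.block_range {k : ℕ} (hk : k < p.M) :
    p.pos ≤ (p.h + k * p.u) * p.w + (if k = 0 then p.ph else 0) ∧
    (if k + 1 = p.M then p.pw else p.h + (k + 1) * p.u) * p.w +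
      (if k + 1 = p.M then p.po else 0) ≤ p.P := by
  have h1 := ok.pos_eq
  have h2 := ok.P_eq
  have h3 := ok.ph_lt
  constructor
  · split
    · rename_i h; rw [h, Nat.zero_mul, Nat.add_zero]; omega
    · have := ok.u_pos
      have : 1 * 1 ≤ k * p.u := Nat.mul_le_mul (by omega) this
      have := Nat.mul_le_mul_right p.w (show p.h + 1 ≤ p.h + k * p.u by omega)
      rw [Nat.add_mul] at this
      omega
  · split
    · omega
    · have := (ok.sub_words_le (s := p.M - 1) (by omega)).1
      rw [if_pos (by omega)] at this
      have : (k + 1) * p.u ≤ (p.M - 1) * p.u := Nat.mul_le_mul_right _ (by omega)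
      have := Nat.mul_le_mul_right p.w (show p.h + (k + 1) * p.u ≤ p.pw by omega)
      omega

/-- The outcome of the search for the last element of color `j` with the property `R`. -/
def _root_.ChoiceDict.Last (v : View) (j : Bool) (R : ℕ → Prop) (found e : ℕ) : Prop :=
  (found = 0 ∧ ∀ e, R e → v.cb e ≠ j) ∨
    (found = 1 ∧ R e ∧ v.cb e = j ∧ ∀ e', R e' → e < e' → v.cb e' ≠ j)

theorem Ok.wp_startP (h : p.At H v F s) (j : Bool) {k : ℕ} (hk : k < p.M) (h60 : s.rg 60 = k) :
    wp σ m N (startP j) (fun s' => Frame 61 s s' ∧ s'.rg 80 = colorMask p.w j ∧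
      s'.rg 81 = p.h + k * p.u ∧ s'.rg 82 = (if k = 0 then p.ph else 0) ∧
      s'.rg 83 = s.rg 83 ∧ s'.rg 84 = s.rg 84) s := by
  refine wp_call (R := fun s' => Frame 61 s s' ∧ s'.rg 80 = colorMask p.w j ∧
    s'.rg 83 = s.rg 83 ∧ s'.rg 84 = s.rg 84) ?_ ?_
  · cases j
    · refine wp_assign (v := colorMask p.w false) ?_ fun x hx =>
        ⟨(Frame.refl _ _).setR (by omega) x, by simp [hx], by simp, by simp⟩
      rw [val_sub, ok.val_small _ (by omega), ok.val_small _ (by omega), colorMask,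
        if_neg (by simp)]
      have : 0 < 2 ^ p.w := by positivity
      rw [Nat.mod_eq_of_lt (by omega)]; omega
    · exact wp_assign (v := colorMask p.w true) (ok.val_small _ (by omega)) fun x hx =>
        ⟨(Frame.refl _ _).setR (by omega) x, by simp [hx], by simp, by simp⟩
  rintro s₁ ⟨g₁, e80, e83, e84⟩
  have e60 : s₁.rg 60 = k := by rw [g₁.2.2 60 (by omega), h60]
  refine wp_call (ok.wp_lowP (h.frame g₁ (by omega)) hk e60) ?_
  rintro s₂ ⟨f₂, e61, i₂⟩
  have g₂ := g₁.trans f₂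
  refine wp_assign_seq ((val_reg _ _).trans e61) fun x81 e81 => ?_
  have g₃ := g₂.setR (r := 81) (by omega) x81
  have e60' : (s₂.setR 81 x81).rg 60 = k := by
    rw [rg_setR, if_neg (by omega), f₂.2.2 60 (by omega), e60]
  have hr : ∀ y r, r = 80 ∨ r = 83 ∨ r = 84 → ((s₂.setR 81 x81).setR 82 y).rg r = s₁.rg r := by
    intro y r hr
    rw [rg_setR, if_neg (by omega), rg_setR, if_neg (by omega), i₂ r (by omega)]
  refine wp_ite (fun hb => ?_) fun hb => ?_
  · rw [holds_eq, val_reg, e60', ok.val_small _ (by omega)] at hb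
    refine wp_assign ((h.frame g₃ (by omega)).par (by omega) (by omega)) fun y hy => ?_
    exact ⟨g₃.setR (by omega) y, (hr _ _ (by simp)).trans e80, by simp [e81],
      by simp [hy, hb, rv], (hr _ _ (by simp)).trans e83, (hr _ _ (by simp)).trans e84⟩
  · rw [holds_eq, val_reg, e60', ok.val_small _ (by omega)] at hb
    refine wp_assign (ok.val_small _ (by omega)) fun y hy => ?_
    exact ⟨g₃.setR (by omega) y, (hr _ _ (by simp)).trans e80, by simp [e81],
      by simp [hy, hb], (hr _ _ (by simp)).trans e83, (hr _ _ (by simp)).trans e84⟩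

theorem Ok.wp_scanC (hA : A ≤ N) (hN : p.u ≤ N) (h : p.At H v F s) (j : Bool) {e : Expr} {k : ℕ}
    (he : val σ s e = k) (hk : k < p.M) :
    wp σ m N (scanC B j e) (fun s' => Frame 60 s s' ∧
      Last v j (fun e => e < p.n ∧ p.sub e = k) (s'.rg 60) (s'.rg 61)) s := by
  have hsw := ok.sub_words_le hk
  have hbr := ok.block_range hk
  have hph := ok.ph_lt
  have hpo := ok.po_lt
  refine wp_assign_seq he fun x hx => ?_
  have g₁ := (Frame.refl 60 s).setR le_rfl x
  refine wp_call (ok.wp_startP (h.frame g₁ le_rfl) j hk (by simp [hx])) ?_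
  rintro s₂ ⟨f₂, e80, e81, e82, -⟩
  have g₂ := g₁.trans (f₂.weaken (by omega))
  refine wp_call (ok.wp_highP (h.frame g₂ le_rfl) hk (a := 83) (o := 84)
    (by rw [f₂.2.2 60 (by omega)]; simp [hx]) (by omega) (by omega)) ?_
  rintro s₅ ⟨f₅, q83, q84, i₅⟩
  have g₅ := g₂.trans (f₅.weaken (show 60 ≤ 61 by omega))
  refine (ok.wp_elem hA (h.frame g₅ le_rfl) j ((i₅ 80 (by omega) (by omega)).trans e80)
    ((i₅ 81 (by omega) (by omega)).trans e81) ((i₅ 82 (by omega) (by omega)).trans e82) q83 q84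
    (by split <;> omega) (by split <;> omega) hsw.1 (by omega) hbr.1 hbr.2).mono ?_
  rintro s' ⟨f, hs'⟩
  refine ⟨g₅.trans f, ?_⟩
  rcases hs' with ⟨r1, r2⟩ | ⟨r1, e, r2, r3, r4, r5, r6, r7⟩
  · refine Or.inl ⟨r1, fun e ⟨he, hek⟩ => ?_⟩
    obtain ⟨q1, q2⟩ := (ok.sub_eq_iff he).1 hek
    exact r2 e he q1 q2
  · rw [r3]
    refine Or.inr ⟨r1, ⟨r2, (ok.sub_eq_iff r2).2 ⟨r4, r5⟩⟩, r6, fun e' ⟨he', hek⟩ hlt => ?_⟩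
    exact r7 e' he' hlt ((ok.sub_eq_iff he').1 hek).2

theorem Ok.wp_scanCx (hA : A ≤ N) (hN : p.u ≤ N) (h : p.At H v F s) (j : Bool) {e : Expr} {x : ℕ}
    (he : val σ s e = x) (hx : x < p.n) :
    wp σ m N (scanCx B j e) (fun s' => Frame 60 s s' ∧
      Last v j (fun e => e < x ∧ p.sub e = p.sub x) (s'.rg 60) (s'.rg 61)) s := by
  have hk := ok.sub_lt hx
  have hsw := ok.sub_words_le hk
  have hbr := ok.block_range hk
  have hce := ok.client_eq x
  have hsx := (ok.sub_eq_iff hx).1 rfl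
  have hmod := Nat.mod_lt (p.ph + x) ok.w_pos
  have hph := ok.ph_lt
  have hpo := ok.po_lt
  have hcx := ok.client_lt hx
  have hal : p.h + p.sub x * p.u ≤ p.h + (p.ph + x) / p.w := by
    have : p.h + p.sub x * p.u < p.h + (p.ph + x) / p.w + 1 := by
      refine Nat.lt_of_mul_lt_mul_right (a := p.w) ?_
      rw [Nat.add_mul _ 1]; omega
    omega
  have hah : p.h + (p.ph + x) / p.w ≤
      if p.sub x + 1 = p.M then p.pw else p.h + (p.sub x + 1) * p.u := by
    rw [← Nat.lt_add_one_iff]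
    refine Nat.lt_of_mul_lt_mul_right (a := p.w) ?_
    rw [Nat.add_mul _ 1]
    have : (if p.sub x + 1 = p.M then p.po else 0) < p.w := by split <;> omega
    omega
  refine wp_call (ok.wp_blk h he hx) ?_
  rintro s₀ ⟨g₀, -, d61, d62, d63⟩
  refine wp_assign_seq ((val_reg _ _).trans d61) fun y83 hy83 => ?_
  refine wp_assign_seq (v := (p.ph + x) % p.w) (by simp [val_reg, d62]) fun y84 hy84 => ?_
  refine wp_assign_seq (v := p.sub x) (by simp [val_reg, d63]) fun y60 hy60 => ?_
  have g₁ := ((g₀.setR (r := 83) (by omega) y83).setR (r := 84) (by omega) y84).setR le_rfl y60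
  refine wp_call (ok.wp_startP (h.frame g₁ le_rfl) j hk (by simp [hy60])) ?_
  rintro s₂ ⟨f₂, e80, e81, e82, e83, e84⟩
  have g₂ := g₁.trans (f₂.weaken (by omega))
  refine (ok.wp_elem hA (h.frame g₂ le_rfl) j e80 e81 e82 (a₁ := p.h + (p.ph + x) / p.w)
    (o₁ := (p.ph + x) % p.w) (e83.trans (by simp [hy83]))
    (e84.trans (by simp [hy84])) (by split <;> omega) hmod hal (by omega) hbr.1 (by omega)).mono ?_
  rw [← hce]
  rintro s' ⟨f, hs'⟩
  refine ⟨g₂.trans f, ?_⟩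
  rcases hs' with ⟨r1, r2⟩ | ⟨r1, e, r2, r3, r4, r5, r6, r7⟩
  · refine Or.inl ⟨r1, fun e ⟨he, hek⟩ => ?_⟩
    exact r2 e (by omega) ((ok.sub_eq_iff (by omega)).1 hek).1 (by omega)
  · rw [r3]
    refine Or.inr ⟨r1, ⟨by omega, (ok.sub_eq_iff r2).2 ⟨r4, by omega⟩⟩, r6,
      fun e' ⟨he', hek⟩ hlt => ?_⟩
    exact r7 e' (by omega) hlt (by omega)

end Par
end ChoiceDict

namespace ChoiceDict

open WordRAM FieldSum

/-- The outcome of the search for the last block with the property `R` that contains an element of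
color `j` according to its flag. -/
def LastF (v : View) (j : Bool) (R : ℕ → Prop) (found s : ℕ) : Prop :=
  (found = 0 ∧ ∀ s, R s → v.fl j s ≠ j) ∨
    (found = 1 ∧ R s ∧ v.fl j s = j ∧ ∀ s', R s' → s < s' → v.fl j s' ≠ j)

namespace Par

variable {σ : ℕ → ℕ} {m N : ℕ} {p : Par} {A B : ℕ} {H : Hd} {v : View} {F : ℕ → ℕ} {s : State p.w}
  (ok : p.Ok σ A B m)
include ok

/-- The flags of a chunk for one color are consecutive. -/
theorem Ok.flag_range {c lim : ℕ} (hc : c < p.K) (hl : lim ≤ p.w) (hM : c * p.w + lim ≤ p.M)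
    (j : Bool) :
    let a := if c = 0 then p.pw else p.Q + 8 * c + (if j then 0 else 1)
    let o := if c = 0 then p.po + (if j then 0 else p.M0) else 0
    o + lim < 4 * p.w ∧ a * p.w + o + lim ≤ p.b ∧
      ∀ i < lim, p.flagPos j (c * p.w + i) = a * p.w + o + i := by
  have hw := ok.w_pos
  have hpo := ok.po_lt
  have hPe := ok.P_eq
  have hM0w : p.M0 ≤ p.w := min_le_right _ _
  by_cases h0 : c = 0
  · subst h0
    rw [Nat.zero_mul, Nat.zero_add] at hM
    have hM0 : lim ≤ p.M0 := le_min hM hl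
    have hPb := ok.P_le_b
    simp only [if_true]
    refine ⟨by split <;> omega, by split <;> omega, fun i hi => ?_⟩
    rw [Nat.zero_mul, Nat.zero_add, ok.flagPos_zero (by omega)]
    omega
  · simp only [if_neg h0]
    have hr := ok.rec_lt (c := c) (k := if j then 0 else 1) (by omega) hc (by split <;> omega)
    rw [Nat.add_mul _ 1] at hr
    refine ⟨by omega, by omega, fun i hi => ?_⟩
    have e1 : (c * p.w + i) / p.w = c := by
      rw [Nat.mul_comm, Nat.mul_add_div hw, Nat.div_eq_of_lt (by omega), Nat.add_zero]
    have e2 : (c * p.w + i) % p.w = i := by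
      rw [Nat.mul_comm, Nat.mul_add_mod, Nat.mod_eq_of_lt (by omega)]
    rw [flagPos, e1, e2, if_neg h0, Nat.mul_comm, Nat.add_zero]

theorem Ok.wp_scanFlagsP (hA : A ≤ N) (hN : p.u ≤ N) (h : p.At H v F s) (j : Bool) {c lim : ℕ}
    (h60 : s.rg 60 = c) (h61 : s.rg 61 = lim) (hc : c < p.K) (hl : lim ≤ p.w)
    (hM : c * p.w + lim ≤ p.M) :
    wp σ m N (scanFlagsP B j) (fun s' => Frame 60 s s' ∧
      LastF v j (fun s => c * p.w ≤ s ∧ s < c * p.w + lim) (s'.rg 60) (s'.rg 61)) s := by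
  obtain ⟨Y, b1, b2, b3, b4, b5, b6, b7, b8, b9, b10⟩ := ok.bounds
  have h64 := ok.w_ge
  have hY : 64 * (64 * p.w) ≤ Y := le_trans (by nlinarith) b2
  have hM0w : p.M0 ≤ p.w := min_le_right _ _
  have hpo := ok.po_lt
  have hr := ok.flag_range hc hl hM j
  have hQ : p.Q = p.pw + 3 := rfl
  obtain ⟨a, ha⟩ : ∃ a, a = if c = 0 then p.pw else p.Q + 8 * c + (if j then 0 else 1) := ⟨_, rfl⟩
  obtain ⟨o, ho⟩ : ∃ o, o = if c = 0 then p.po + (if j then 0 else p.M0) else 0 := ⟨_, rfl⟩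
  rw [← ha, ← ho] at hr
  dsimp only at hr
  obtain ⟨hr1, hr2, hr3⟩ := hr
  have hcw : c * 64 ≤ c * p.w := Nat.mul_le_mul_left _ h64
  have hasm : a ≤ 2 * Y := by rw [ha]; split <;> (try split) <;> omega
  have c0 : ∀ t : State p.w, val σ t (.const 0) = 0 := fun t => ok.val_small _ (by omega)
  refine wp_call (R := fun s' => Frame 62 s s' ∧ s'.rg 80 = colorMask p.w j) ?_ ?_
  · cases j
    · refine wp_assign (v := colorMask p.w false) ?_ fun x hx =>
        ⟨(Frame.refl _ _).setR (by omega) x, by simp [hx]⟩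
      rw [val_sub, ok.val_small _ (by omega), ok.val_small _ (by omega), colorMask,
        if_neg (by simp)]
      have : 0 < 2 ^ p.w := by positivity
      rw [Nat.mod_eq_of_lt (by omega)]; omega
    · exact wp_assign (v := colorMask p.w true) (c0 _) fun x hx =>
        ⟨(Frame.refl _ _).setR (by omega) x, by simp [hx]⟩
  rintro s₁ ⟨g₁, q80⟩
  have h₁ := h.frame (g₁.weaken (b' := 60) (by omega)) le_rfl
  have q60 : s₁.rg 60 = c := (g₁.2.2 _ (by omega)).trans h60
  have r11 : s₁.rg 11 = p.w := h₁.st 11 (by omega) (by omega)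
  have r14 : s₁.rg 14 = p.pw := h₁.st 14 (by omega) (by omega)
  have r15 : s₁.rg 15 = p.po := h₁.st 15 (by omega) (by omega)
  have r18 : s₁.rg 18 = p.M0 := h₁.st 18 (by omega) (by omega)
  have r20 : s₁.rg 20 = p.Q := h₁.st 20 (by omega) (by omega)
  refine wp_call (R := fun s' => Frame 62 s s' ∧ s'.rg 80 = colorMask p.w j ∧ s'.rg 62 = a ∧
    s'.rg 63 = o) ?_ ?_
  · refine wp_ite (fun hb => ?_) fun hb => ?_
    · rw [holds_eq, val_reg, q60, c0] at hb
      rw [if_pos hb] at ha ho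
      refine wp_assign_seq ((val_reg _ _).trans r14) fun x hx => ?_
      refine wp_assign (v := o) ?_ fun y hy => ?_
      · rw [ho]
        refine val_add_of_lt _ _ _ (by simp [val_reg, r15]) ?_ (by split <;> omega)
        cases j
        · simp [val_reg, r18]
        · simp [c0]
      · exact ⟨(g₁.setR le_rfl x).setR (by omega) y, by simp [q80], by simp [hx, ha], by simp [hy]⟩
    · rw [holds_eq, val_reg, q60, c0] at hb
      rw [if_neg hb] at ha ho
      have hK : 1 < p.K := by omega
      refine wp_assign_seq (ok.val_recE h₁ hK hc (k := if j then 0 else 1) (by split <;> omega)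
        ((val_reg _ _).trans q60)).1 fun x hx => ?_
      refine wp_assign (c0 _) fun y hy => ?_
      exact ⟨(g₁.setR le_rfl x).setR (by omega) y, by simp [q80], by simp [hx, ha], by simp [hy, ho]⟩
  clear h₁ g₁ q80 q60 r11 r14 r15 r18 r20 s₁
  rintro t ⟨g, q80, q62, q63⟩
  have hod : o / p.w ≤ 3 := by
    rw [← Nat.lt_add_one_iff, Nat.div_lt_iff_lt_mul ok.w_pos]; omega
  have hod' : (o + lim) / p.w ≤ 3 := by
    rw [← Nat.lt_add_one_iff, Nat.div_lt_iff_lt_mul ok.w_pos]; omega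
  have r11 : t.rg 11 = p.w := by rw [g.2.2 _ (by omega)]; exact h.st 11 (by omega) (by omega)
  have q61 : t.rg 61 = lim := (g.2.2 _ (by omega)).trans h61
  have q60 : t.rg 60 = c := (g.2.2 _ (by omega)).trans h60
  refine wp_assign_seq (v := a + o / p.w) (val_add_of_lt _ _ _ ((val_reg _ _).trans q62)
    (by simp [val_div, val_reg, q63, r11]) (by omega)) fun x81 e81 => ?_
  refine wp_assign_seq (v := o % p.w) (by simp [val_mod, val_reg, q63, r11]) fun x82 e82 => ?_
  have e1 : ∀ x81 x82 : BitVec p.w, val σ ((t.setR 81 x81).setR 82 x82) (Rg 63 + Rg 61) = o + lim :=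
    fun _ _ => val_add_of_lt _ _ _ (by simp [val_reg, q63]) (by simp [val_reg, q61]) (by omega)
  have e1' : ∀ x81 x82 x83 : BitVec p.w,
      val σ (((t.setR 81 x81).setR 82 x82).setR 83 x83) (Rg 63 + Rg 61) = o + lim :=
    fun _ _ _ => val_add_of_lt _ _ _ (by simp [val_reg, q63]) (by simp [val_reg, q61]) (by omega)
  refine wp_assign_seq (v := a + (o + lim) / p.w) (val_add_of_lt _ _ _ (by simp [val_reg, q62])
    (by rw [val_div, e1, val_reg]; simp [r11]) (by omega)) fun x83 e83 => ?_
  refine wp_assign_seq (v := (o + lim) % p.w) (by rw [val_mod, e1', val_reg]; simp [r11])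
    fun x84 e84 => ?_
  have hd1 := Nat.div_add_mod o p.w
  have hd2 := Nat.div_add_mod (o + lim) p.w
  rw [Nat.mul_comm] at hd1 hd2
  have hp0 : (a + o / p.w) * p.w + o % p.w = a * p.w + o := by rw [Nat.add_mul]; omega
  have hp1 : (a + (o + lim) / p.w) * p.w + (o + lim) % p.w = a * p.w + o + lim := by
    rw [Nat.add_mul]; omega
  have hu : 32 ≤ p.u := by have := ok.t_pos; unfold u; omega
  have hge := Nat.zero_le (o / p.w)
  refine wp_call (wp_scan ok.word hA _ j (a₀ := a + o / p.w) (o₀ := o % p.w)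
    (a₁ := a + (o + lim) / p.w) (o₁ := (o + lim) % p.w) (by simp [q80]) (by simp [e81])
    (by simp [e82]) (by simp [e83]) (by simp [e84]) (Nat.mod_lt _ ok.w_pos) (Nat.mod_lt _ ok.w_pos)
    (Nat.add_le_add_left (Nat.div_le_div_right (by omega)) _) (by omega)
    fun x _ h2 => ok.lt_m (by omega)) ?_
  rw [hp0, hp1]
  rintro s₂ ⟨f₂, hs₂⟩
  have g₂ : Frame 62 s s₂ := ((((g.setR (r := 81) (by omega) x81).setR (r := 82) (by omega)
    x82).setR (r := 83) (by omega) x83).setR (r := 84) (by omega) x84).trans (f₂.weaken (by omega))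
  have p60 : s₂.rg 60 = c := by rw [f₂.2.2 _ (by omega)]; simp [q60]
  have p62 : s₂.rg 62 = a := by rw [f₂.2.2 _ (by omega)]; simp [q62]
  have p63 : s₂.rg 63 = o := by rw [f₂.2.2 _ (by omega)]; simp [q63]
  have p11 : s₂.rg 11 = p.w := by rw [f₂.2.2 _ (by omega)]; simp [r11]
  refine wp_assign_seq rfl fun x hx => ?_
  refine wp_assign rfl fun y hy => ?_
  refine ⟨((g₂.weaken (by omega)).setR (by omega) x).setR le_rfl y, ?_⟩
  have hy' : y.toNat = s₂.rg 80 := by rw [hy]; simp [val_reg]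
  have e60 : ((s₂.setR 61 x).setR 60 y).rg 60 = s₂.rg 80 := by simp [hy']
  have e61 : ((s₂.setR 61 x).setR 60 y).rg 61 = x.toNat := by simp
  rw [e60, e61]
  have hmem : ∀ q, memBit ((((t.setR 81 x81).setR 82 x82).setR 83 x83).setR 84 x84).mem q =
      memBit s.mem q := fun q => by simp [g.1]
  simp only [hmem] at hs₂
  have hfl : ∀ i < lim, v.fl j (c * p.w + i) = memBit s.mem (a * p.w + o + i) := fun i hi => by
    rw [← h.vw, ← hr3 i hi]
    simp only [view]
    rw [decide_eq_true (by omega), Bool.true_and]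
  rcases hs₂ with ⟨z1, z2⟩ | ⟨z1, z2, z3, z4, z5, z6⟩
  · refine Or.inl ⟨z1, fun s' ⟨k1, k2⟩ => ?_⟩
    rw [show s' = c * p.w + (s' - c * p.w) by omega, hfl _ (by omega)]
    exact z2 _ (by omega) (by omega)
  · obtain ⟨i, hi⟩ : ∃ i, s₂.rg 81 * p.w + s₂.rg 82 = a * p.w + o + i :=
      ⟨_, (Nat.add_sub_of_le z3).symm⟩
    rw [hi] at z3 z4 z5 z6
    have hil : i < lim := by omega
    have hle : a ≤ s₂.rg 81 := by
      by_contra hc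
      have := Nat.mul_le_mul_right p.w (show s₂.rg 81 + 1 ≤ a by omega)
      rw [Nat.succ_mul] at this
      omega
    have e2 : (s₂.rg 81 - a) * p.w + s₂.rg 82 = o + i := by
      rw [Nat.sub_mul]
      have := Nat.mul_le_mul_right p.w hle
      omega
    have e3 : val σ s₂ ((Rg 81 - Rg 62) * Rg 11 + Rg 82 - Rg 63) = i := by
      have := val_sub_of_le s₂ ((Rg 81 - Rg 62) * Rg 11 + Rg 82) (Rg 63) (σ := σ)
        (val_add_of_lt _ _ _ (val_mul_of_lt _ _ _ (val_sub_of_le _ _ _ rfl p62 hle)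
          ((val_reg _ _).trans p11) (by rw [val_reg]; omega)) (val_reg _ _)
          (by rw [val_reg]; omega)) ((val_reg _ _).trans p63) (by rw [val_reg]; omega)
      rw [this, val_reg]; omega
    have hx' : x.toNat = c * p.w + i := by
      rw [hx]
      exact val_add_of_lt _ _ _ (val_mul_of_lt _ _ _ ((val_reg _ _).trans p60)
        ((val_reg _ _).trans p11) (by omega)) e3 (by omega)
    rw [hx']
    refine Or.inr ⟨z1, ⟨by omega, by omega⟩, by rw [hfl i hil]; exact z5, fun s' ⟨k1, k2⟩ k3 => ?_⟩
    rw [show s' = c * p.w + (s' - c * p.w) by omega, hfl _ (by omega)]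
    exact z6 _ (by omega) (by omega)

theorem Ok.wp_scanF (hA : A ≤ N) (hN : p.u ≤ N) (h : p.At H v F s) (j : Bool) {e : Expr} {c : ℕ}
    (he : val σ s e = c) (hc : c < p.K) :
    wp σ m N (scanF B j e) (fun s' => Frame 60 s s' ∧
      LastF v j (fun s => s < p.M ∧ s / p.w = c) (s'.rg 60) (s'.rg 61)) s := by
  obtain ⟨Y, b1, b2, b3, b4, b5, b6, b7, b8, b9, b10⟩ := ok.bounds
  have r11 : s.rg 11 = p.w := h.st 11 (by omega) (by omega)
  have h64 := ok.w_ge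
  have hY : 64 * (64 * p.w) ≤ Y := le_trans (by nlinarith) b2
  have r17 : s.rg 17 = p.M := h.st 17 (by omega) (by omega)
  have hcM : c * p.w < p.M := by
    have h1 : c ≤ (p.M - 1) / p.w := by unfold K at hc; omega
    have h2 := (Nat.le_div_iff_mul_le ok.w_pos).1 h1
    have := ok.M_pos
    omega
  refine wp_assign_seq he fun x hx => ?_
  refine wp_assign_seq (v := p.M - c * p.w) (val_sub_of_le _ _ _ (by simp [val_reg, r17])
    (val_mul_of_lt _ _ _ (x := c) (y := p.w) (by simp [val_reg, hx]) (by simp [val_reg, r11])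
      (by omega)) (by omega)) fun y hy => ?_
  have g₁ := ((Frame.refl 60 s).setR le_rfl x).setR (r := 61) (by omega) y
  refine wp_call (R := fun t => Frame 60 s t ∧ t.rg 60 = c ∧ t.rg 61 = min (p.M - c * p.w) p.w)
    ?_ ?_
  · refine wp_ite (fun hb => ?_) fun hb => ?_
    · simp [holds_lt, val_reg, r11, hy] at hb
      exact wp_skip ⟨g₁, by simp [hx], by simp [hy]; omega⟩
    · simp [holds_lt, val_reg, r11, hy] at hb
      exact wp_assign (v := p.w) (by simp [val_reg, r11]) fun z hz =>
        ⟨g₁.setR (by omega) z, by simp [hx], by simp [hz]; omega⟩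
  rintro t ⟨g, e1, e2⟩
  refine (ok.wp_scanFlagsP hA hN (h.frame g le_rfl) j e1 e2 hc (by omega) (by omega)).mono ?_
  rintro s' ⟨f, hs'⟩
  refine ⟨g.trans f, ?_⟩
  have : (fun s => c * p.w ≤ s ∧ s < c * p.w + min (p.M - c * p.w) p.w) =
      fun s => s < p.M ∧ s / p.w = c := by
    funext s
    rw [eq_iff_iff, Nat.div_eq_iff ok.w_pos]
    have := ok.w_pos
    omega
  rwa [this] at hs'

theorem Ok.wp_scanFx (hA : A ≤ N) (hN : p.u ≤ N) (h : p.At H v F s) (j : Bool) {e : Expr} {k : ℕ}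
    (he : val σ s e = k) (hk : k < p.M) :
    wp σ m N (scanFx B j e) (fun s' => Frame 60 s s' ∧
      LastF v j (fun s => s < k ∧ s / p.w = k / p.w) (s'.rg 60) (s'.rg 61)) s := by
  have r11 : s.rg 11 = p.w := h.st 11 (by omega) (by omega)
  have hd := Nat.div_add_mod k p.w
  rw [Nat.mul_comm] at hd
  have hm := Nat.mod_lt k ok.w_pos
  refine wp_assign_seq he fun x hx => ?_
  refine wp_assign_seq (v := k % p.w) (by simp [val_mod, val_reg, hx, r11]) fun y hy => ?_
  refine wp_assign_seq (v := k / p.w) (by simp [val_div, val_reg, hx, r11]) fun z hz => ?_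
  have g := (((Frame.refl 60 s).setR le_rfl x).setR (r := 61) (by omega) y).setR le_rfl z
  refine (ok.wp_scanFlagsP hA hN (h.frame g le_rfl) j (c := k / p.w) (lim := k % p.w) (by simp [hz])
    (by simp [hy]) (ok.div_lt_K hk) hm.le (by omega)).mono ?_
  rintro s' ⟨f, hs'⟩
  refine ⟨g.trans f, ?_⟩
  have : (fun s => k / p.w * p.w ≤ s ∧ s < k / p.w * p.w + k % p.w) =
      fun s => s < k ∧ s / p.w = k / p.w := by
    funext s
    rw [eq_iff_iff, Nat.div_eq_iff ok.w_pos]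
    have := ok.w_pos
    omega
  rwa [this] at hs'

end Par
end ChoiceDict

/-! ### An involution that represents a set -/

namespace ChoiceDict

/-- An involution `f` of `{0, …, K - 1}` without a cycle inside of `{0, …, T - 1}` or its complement
represents the set of the numbers `x` with `f x < T`. This set has `T` elements. Only the values
`f x` with `x < T` or `f x < T` need to be stored: an entry for another `x` is recognized as
meaningless because it does not point to a number below `T` that points back. -/
structure Involution (T K : ℕ) (f : ℕ → ℕ) : Prop where
  inv : ∀ x, f (f x) = x
  cross : ∀ x, f x ≠ x → (x < T ↔ T ≤ f x)
  fix : ∀ x, K ≤ x → f x = x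

/-- The involution after the insertion of `i` in the set that it represents. -/
def join (f : ℕ → ℕ) (T i x : ℕ) : ℕ :=
  if f T ≠ i ∧ x = f i then f T
  else if f T ≠ i ∧ x = f T then f i
  else if x = i then i
  else if x = T then T else f x

theorem Involution.join {T K i : ℕ} {f : ℕ → ℕ} (h : Involution T K f) (hi : T ≤ f i)
    (hiK : i < K) (hTK : T ≤ K) :
    T < K ∧ Involution (T + 1) K (join f T i) ∧ ∀ x, join f T i x < T + 1 ↔ f x < T ∨ x = i := by
  obtain ⟨h1, h2, h3⟩ := h
  have hT : T < K := by
    by_contra hc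
    have := h3 (f i) (by omega)
    rw [h1] at this
    omega
  have a1 := h1 T
  have a2 := h1 i
  have a3 := h2 T
  have a4 := h2 i
  refine ⟨hT, ⟨fun x => ?_, fun x => ?_, fun x hx => ?_⟩, fun x => ?_⟩
  · have b1 := h1 x
    generalize hy : ChoiceDict.join f T i x = y
    unfold ChoiceDict.join at hy ⊢
    split_ifs at hy <;> grind (splits := 20)
  · have b1 := h1 x
    have b2 := h2 x
    unfold ChoiceDict.join
    grind
  · have b1 := h1 x
    have b3 := h3 x hx
    have b4 := h3 (f i)
    have b5 := h3 (f T)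
    unfold ChoiceDict.join
    grind
  · have b1 := h1 x
    have b2 := h2 x
    unfold ChoiceDict.join
    grind

/-! ### Doubly linked lists -/

/-- Starting from `a`, the function `f` runs through the list `l`. -/
def Seg (f : ℕ → ℕ) : ℕ → List ℕ → Prop
  | _, [] => True
  | a, b :: l => f a = b ∧ Seg f b l

theorem Seg.congr {f g : ℕ → ℕ} : ∀ {l : List ℕ} {a b : ℕ}, Seg f a (l ++ [b]) →
    (∀ x, x = a ∨ x ∈ l → g x = f x) → Seg g a (l ++ [b])
  | [], _, _, h, hx => ⟨(hx _ (Or.inl rfl)).trans h.1, trivial⟩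
  | c :: l, _, _, h, hx => ⟨(hx _ (Or.inl rfl)).trans h.1, h.2.congr fun x hx' => hx x (by
      rcases hx' with rfl | h <;> simp [*])⟩

theorem Seg.append {f : ℕ → ℕ} : ∀ {l l' : List ℕ} {a b : ℕ},
    Seg f a (l ++ b :: l') ↔ Seg f a (l ++ [b]) ∧ Seg f b l'
  | [], l', a, b => by simp [Seg]
  | c :: l, l', a, b => by
    have := Seg.append (f := f) (l := l) (l' := l') (a := c) (b := b)
    simp only [List.cons_append, Seg, this, and_assoc]

/-- A doubly linked list with sentinel `0`. -/
structure Ring (nx pv : ℕ → ℕ) (l : List ℕ) : Prop where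
  nx : Seg nx 0 (l ++ [0])
  pv : Seg pv 0 (l.reverse ++ [0])
  nodup : l.Nodup
  zero : 0 ∉ l

theorem Ring.swap {nx pv : ℕ → ℕ} {l : List ℕ} (h : Ring nx pv l) : Ring pv nx l.reverse :=
  ⟨h.pv, by rw [List.reverse_reverse]; exact h.nx, List.nodup_reverse.2 h.nodup,
    by simpa using h.zero⟩

theorem Ring.nx_zero {nx pv : ℕ → ℕ} {l : List ℕ} (h : Ring nx pv l) : nx 0 = l.headD 0 := by
  cases l <;> exact h.nx.1

theorem Ring.nx_mem {nx pv : ℕ → ℕ} {l₁ l₂ : List ℕ} {i : ℕ} (h : Ring nx pv (l₁ ++ i :: l₂)) :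
    nx i = l₂.headD 0 := by
  have := h.nx
  rw [List.append_assoc, List.cons_append, Seg.append] at this
  cases l₂ <;> exact this.2.1

theorem Ring.pv_mem {nx pv : ℕ → ℕ} {l₁ l₂ : List ℕ} {i : ℕ} (h : Ring nx pv (l₁ ++ i :: l₂)) :
    pv i = l₁.getLastD 0 := by
  have := h.swap
  rw [List.reverse_append, List.reverse_cons, List.append_assoc, List.singleton_append] at this
  rw [this.nx_mem]
  cases l₁ using List.reverseRec <;> simp

theorem Seg.insert {f g : ℕ → ℕ} {l₁ l₂ : List ℕ} {a b i z : ℕ} (h : Seg f a (l₁ ++ l₂ ++ [b]))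
    (hn : (a :: (l₁ ++ l₂)).Nodup) (hi : i ∉ a :: (l₁ ++ l₂)) (hz : l₁.getLastD a = z)
    (hg : ∀ x, g x = if x = i then f z else if x = z then i else f x) :
    Seg g a (l₁ ++ i :: l₂ ++ [b]) := by
  induction l₁ generalizing a with
  | nil =>
    obtain rfl : a = z := hz
    simp only [List.nil_append, List.mem_cons, List.nodup_cons, not_or] at *
    refine ⟨by rw [hg, if_neg (Ne.symm hi.1), if_pos rfl], ?_⟩
    cases l₂ with
    | nil => exact ⟨by rw [hg, if_pos rfl]; exact h.1, trivial⟩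
    | cons c l =>
      refine ⟨by rw [hg, if_pos rfl]; exact h.1, h.2.congr fun x hx => ?_⟩
      have hx : x ∈ c :: l := by rcases hx with rfl | h <;> simp [*]
      rw [hg, if_neg, if_neg]
      · rintro rfl; exact hn.1 hx
      · rintro rfl; exact hi.2 hx
  | cons c l ih =>
    have hl : (c :: l).getLastD a = l.getLastD c := by cases l <;> rfl
    rw [hl] at hz
    have hmem := (List.getLastD_mem_cons : l.getLastD c ∈ c :: l)
    rw [hz] at hmem
    simp only [List.cons_append, List.mem_cons, List.nodup_cons, not_or] at *
    refine ⟨?_, ih h.2 hn.2 ⟨hi.2.1, hi.2.2⟩ hz⟩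
    rw [hg, if_neg (Ne.symm hi.1), if_neg]
    · exact h.1
    · intro hc
      rw [← hc] at hmem
      rcases hmem with h | h
      · exact hn.1.1 h
      · exact hn.1.2 (by simp [h])

theorem Seg.remove {f g : ℕ → ℕ} {l₁ l₂ : List ℕ} {a b i z : ℕ}
    (h : Seg f a (l₁ ++ i :: l₂ ++ [b])) (hn : (a :: (l₁ ++ i :: l₂)).Nodup)
    (hz : l₁.getLastD a = z) (hg : ∀ x, x ≠ i → g x = if x = z then f i else f x) :
    Seg g a (l₁ ++ l₂ ++ [b]) := by
  induction l₁ generalizing a with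
  | nil =>
    obtain rfl : a = z := hz
    simp only [List.nil_append, List.mem_cons, List.nodup_cons, not_or] at *
    have e : g a = f i := by rw [hg a hn.1.1, if_pos rfl]
    cases l₂ with
    | nil => exact ⟨e.trans h.2.1, trivial⟩
    | cons c l =>
      refine ⟨e.trans h.2.1, h.2.2.congr fun x hx => ?_⟩
      have hx : x ∈ c :: l := by rcases hx with rfl | h <;> simp [*]
      rw [hg, if_neg]
      · rintro rfl; exact hn.1.2 hx
      · rintro rfl; exact hn.2.1 hx
  | cons c l ih =>
    have hl : (c :: l).getLastD a = l.getLastD c := by cases l <;> rfl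
    rw [hl] at hz
    have hmem := (List.getLastD_mem_cons : l.getLastD c ∈ c :: l)
    rw [hz] at hmem
    simp only [List.cons_append, List.mem_cons, List.nodup_cons, not_or] at *
    refine ⟨?_, ih h.2 hn.2 hz⟩
    rw [hg, if_neg]
    · exact h.1
    · intro hc
      rw [← hc] at hmem
      rcases hmem with h | h
      · exact hn.1.1 h
      · exact hn.1.2 (by simp [h])
    · rintro rfl
      exact hn.1.2 (by simp)

theorem Ring.insertHead {nx pv nx' pv' : ℕ → ℕ} {l : List ℕ} {i : ℕ} (h : Ring nx pv l)
    (h0 : i ≠ 0) (hi : i ∉ l)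
    (hnx : ∀ x, nx' x = if x = i then nx 0 else if x = 0 then i else nx x)
    (hpv : ∀ x, pv' x = if x = i then 0 else if x = nx 0 then i else pv x) :
    Ring nx' pv' (i :: l) := by
  refine ⟨?_, ?_, List.nodup_cons.2 ⟨hi, h.nodup⟩, by simp [h.zero, Ne.symm h0]⟩
  · exact Seg.insert (l₁ := []) (l₂ := l) (i := i) h.nx (by simp [h.nodup, h.zero])
      (by simp [h0, hi]) rfl hnx
  · have e : l.reverse.getLastD 0 = nx 0 := by
      rw [h.nx_zero]; cases l <;> simp
    have e' : pv (nx 0) = 0 := by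
      rw [h.nx_zero]
      cases l with
      | nil => exact h.pv.1
      | cons c l => exact h.pv_mem (l₁ := [])
    have := Seg.insert (l₁ := l.reverse) (l₂ := []) (i := i) (g := pv') (a := 0) (b := 0)
      (f := pv) (by simpa using h.pv) (by simp [h.nodup, h.zero]) (by simp [h0, hi])
      e (by rw [e']; exact hpv)
    simpa using this

theorem Ring.append {nx pv nx' pv' : ℕ → ℕ} {l : List ℕ} {i : ℕ} (h : Ring nx pv l)
    (h0 : i ≠ 0) (hi : i ∉ l)
    (hpv : ∀ x, pv' x = if x = i then pv 0 else if x = 0 then i else pv x)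
    (hnx : ∀ x, nx' x = if x = i then 0 else if x = pv 0 then i else nx x) :
    Ring nx' pv' (l ++ [i]) := by
  have := (h.swap.insertHead h0 (by simpa using hi) hpv hnx).swap
  simpa using this

theorem Ring.remove {nx pv nx' pv' : ℕ → ℕ} {l₁ l₂ : List ℕ} {i : ℕ}
    (h : Ring nx pv (l₁ ++ i :: l₂))
    (hnx : ∀ x, x ≠ i → nx' x = if x = pv i then nx i else nx x)
    (hpv : ∀ x, x ≠ i → pv' x = if x = nx i then pv i else pv x) : Ring nx' pv' (l₁ ++ l₂) := by
  have hn := h.nodup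
  have h0 := h.zero
  refine ⟨h.nx.remove (List.nodup_cons.2 ⟨h0, hn⟩) h.pv_mem.symm hnx, ?_, ?_, ?_⟩
  · have e : nx i = l₂.reverse.getLastD 0 := by
      rw [h.nx_mem]; cases l₂ <;> simp
    have h1 := List.nodup_cons.2 ⟨h.swap.zero, h.swap.nodup⟩
    have h2 := h.pv
    have e' : (l₁ ++ i :: l₂).reverse = l₂.reverse ++ i :: l₁.reverse := by simp
    rw [e'] at h1 h2
    have := h2.remove h1 e.symm hpv
    simpa using this
  · refine hn.sublist ?_
    simp
  · simp at h0 ⊢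
    tauto

end ChoiceDict

/-! ### The invariant -/

namespace ChoiceDict

open WordRAM

/-- The ghost state: the client set, the involution that represents the set of the touched chunks,
and, for each color, the list of the touched chunks, other than chunk `0`, with an element of the
color. The list consists of a part `fr` that is not ahead of the iteration, because the iteration
has passed it or it was put there later, and a part `bk` that starts with the current chunk of the
iteration. Chunk `0` comes after all others and is not in the list. -/
structure Gh where
  X : ℕ → Prop
  perm : ℕ → ℕ
  fr : Bool → List ℕ
  bk : Bool → List ℕ

/-- The client bit `e` has color `j`. -/
def Gh.Col (G : Gh) (j : Bool) (e : ℕ) : Prop := G.X e ↔ j = true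

/-- The index of the record word with the successor in the list of color `j`. -/
def kn (j : Bool) : ℕ := if j then 2 else 4

/-- The index of the record word with the predecessor in the list of color `j`. -/
def kp (j : Bool) : ℕ := if j then 3 else 5

/-- The part of the invariant that does not concern the list of the chunks with elements of a color
or the meaning of the flags. -/
structure Base (p : Par) (H : Hd) (v : View) (G : Gh) : Prop where
  T_pos : 1 ≤ H.T
  T_le : H.T ≤ p.K
  invol : Involution H.T p.K G.perm
  zero : G.perm 0 < H.T
  /-- The pointers that are needed for the evaluation of the involution are stored. -/
  ptr : ∀ x < p.K, x < H.T ∨ G.perm x < H.T → v.rc 6 x = G.perm x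
  /-- Untouched chunks contain no clients. -/
  unt : ∀ e < p.n, H.T ≤ G.perm (p.chk e) → ¬ G.X e
  /-- A client bit is correct if a value was stored in its word or its block is marked as containing
  clients. In every other case the bit may be arbitrary, and the element is not a client. -/
  honest : ∀ e < p.n, v.cw e ∨ G.perm (p.chk e) < H.T ∧ v.fl true (p.sub e) = true →
    (v.cb e = true ↔ G.X e)
  cur : ∀ j, H.cur j = (G.bk j).headD 0
  g_le : ∀ j, H.g j ≤ 1
  x_lt : ∀ j, H.x j < p.n
  x_chk : ∀ j, H.g j = 0 → p.chk (H.x j) = H.cur j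
  /-- While there are untouched chunks, the iteration over the complement is at chunk `0` only if
  nothing of that chunk was enumerated. -/
  fresh : H.T < p.K → G.bk false = [] → H.g false = 1

/-- The part of the invariant that concerns the flags and the list of chunks for color `j`. A flag for
color `j` has the value `j` if its block contains an element of color `j`, so that zeros are the
correct flags of a chunk without clients. -/
structure Colr (p : Par) (H : Hd) (v : View) (G : Gh) (j : Bool) : Prop where
  flags : ∀ s < p.M, G.perm (s / p.w) < H.T →
    (v.fl j s = j ↔ ∃ e < p.n, p.sub e = s ∧ G.Col j e)
  ring : Ring (v.rc (kn j)) (v.rc (kp j)) (G.fr j ++ G.bk j)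
  mem : ∀ c, c ∈ G.fr j ++ G.bk j ↔
    c ≠ 0 ∧ c < p.K ∧ G.perm c < H.T ∧ ∃ e < p.n, p.chk e = c ∧ G.Col j e

/-- The invariant, which holds also while an operation is in progress. -/
structure Inv (p : Par) (H : Hd) (v : View) (G : Gh) : Prop where
  base : Base p H v G
  colr : ∀ j, Colr p H v G j

/-- The bits of block `s` are correct. -/
def BlockOk (p : Par) (v : View) (G : Gh) (s : ℕ) : Prop :=
  ∀ e < p.n, p.sub e = s → (v.cb e = true ↔ G.X e)

/-- The client bit `e` is still to be considered by the iteration over color `j`: its chunk comes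
after the current one or is untouched, or `e` is in the rest of the current chunk. Within a chunk
the elements are enumerated in decreasing order. -/
def Ahead (p : Par) (H : Hd) (G : Gh) (j : Bool) (e : ℕ) : Prop :=
  p.chk e ∈ (G.bk j ++ [0]).tail ∨ p.chk e = H.cur j ∧ (H.g j = 1 ∨ e < H.x j) ∨
    H.T ≤ G.perm (p.chk e)

/-- The iterations lose only elements that do not have their color before and after the change, and
gain none. -/
def Evol (p : Par) (H : Hd) (G : Gh) (H' : Hd) (G' : Gh) : Prop :=
  ∀ j, ∀ e < p.n, (Ahead p H' G' j e → Ahead p H G j e) ∧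
    (G.Col j e → G'.Col j e → Ahead p H G j e → Ahead p H' G' j e)

/-- The client set does not change, and the iterations do not advance. -/
def Quiet (p : Par) (H : Hd) (G : Gh) (H' : Hd) (G' : Gh) : Prop :=
  G'.X = G.X ∧ Evol p H G H' G'

theorem Quiet.refl (p : Par) (H : Hd) (G : Gh) : Quiet p H G H G :=
  ⟨rfl, fun _ _ _ => ⟨id, fun _ _ => id⟩⟩

theorem Quiet.col {p : Par} {H H' : Hd} {G G' : Gh} (h : Quiet p H G H' G') (j : Bool) (e : ℕ) :
    G'.Col j e ↔ G.Col j e := by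
  unfold Gh.Col; rw [h.1]

theorem Quiet.evol {p : Par} {H H' H'' : Hd} {G G' G'' : Gh} (h : Quiet p H G H' G')
    (h' : Evol p H' G' H'' G'') : Evol p H G H'' G'' := fun j e he =>
  ⟨fun a => (h.2 j e he).1 ((h' j e he).1 a), fun c c' a =>
    (h' j e he).2 ((h.col j e).2 c) c' ((h.2 j e he).2 c ((h.col j e).2 c) a)⟩

theorem Quiet.trans {p : Par} {H H' H'' : Hd} {G G' G'' : Gh} (h : Quiet p H G H' G')
    (h' : Quiet p H' G' H'' G'') : Quiet p H G H'' G'' :=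
  ⟨h'.1.trans h.1, h.evol h'.2⟩

theorem Gh.col_not (G : Gh) (j : Bool) (e : ℕ) : G.Col (!j) e ↔ ¬ G.Col j e := by
  unfold Gh.Col; cases j <;> simp

namespace Par

variable {σ : ℕ → ℕ} {m N : ℕ} {p : Par} {A B : ℕ} {H : Hd} {v : View} {G : Gh}
  (ok : p.Ok σ A B m)
include ok

theorem Ok.sub_mono {e e' : ℕ} (h : e ≤ e') : p.sub e ≤ p.sub e' :=
  Nat.div_le_div_right (Nat.div_le_div_right (by omega))

theorem Ok.sub_surj {s : ℕ} (hs : s < p.M) : ∃ e < p.n, p.sub e = s := by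
  have hw := ok.w_pos
  have hu := ok.u_pos
  have hn := ok.n_pos
  have hph := ok.ph_lt
  have h1 : s ≤ (p.ph + (p.n - 1)) / p.w / p.u := by unfold M sub at hs; omega
  rw [Nat.le_div_iff_mul_le hu, Nat.le_div_iff_mul_le hw] at h1
  by_cases h0 : s = 0
  · refine ⟨0, hn, ?_⟩
    rw [sub, Nat.add_zero, Nat.div_eq_of_lt hph, Nat.zero_div, h0]
  · have h2 : p.w ≤ s * p.u * p.w := Nat.le_mul_of_pos_left _ (Nat.mul_pos (by omega) hu)
    refine ⟨s * p.u * p.w - p.ph, by omega, ?_⟩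
    rw [sub, Nat.add_sub_of_le (by omega), Nat.mul_div_cancel _ hw, Nat.mul_div_cancel _ hu]

theorem Ok.chk_surj {c : ℕ} (hc : c < p.K) : ∃ e < p.n, p.chk e = c := by
  have h1 : c ≤ (p.M - 1) / p.w := by unfold K at hc; omega
  rw [Nat.le_div_iff_mul_le ok.w_pos] at h1
  have := ok.M_pos
  obtain ⟨e, he, hs⟩ := ok.sub_surj (s := c * p.w) (by omega)
  exact ⟨e, he, by rw [chk, hs, Nat.mul_div_cancel _ ok.w_pos]⟩

theorem Ok.K_le_n : p.K ≤ p.n := by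
  have hw := ok.w_ge
  obtain ⟨Y, b1, b2, b3, b4, b5, b6, b7, b8, b9, b10⟩ := ok.bounds
  have hn := ok.n_pos
  have hph := ok.ph_lt
  have h1 : (p.ph + (p.n - 1)) / p.w ≤ p.n - 1 := by
    rw [← Nat.lt_add_one_iff, Nat.div_lt_iff_lt_mul (by omega)]
    have := Nat.mul_le_mul_left (p.n - 1 + 1) hw
    by_cases h : p.n = 1
    · rw [h]; simp; omega
    · have := Nat.mul_le_mul_right p.w (show 1 ≤ p.n - 1 by omega)
      have := Nat.mul_le_mul_left (p.n - 1) (show 1 ≤ p.w by omega)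
      rw [Nat.add_mul]; omega
  have h2 : p.M ≤ p.n := by
    have := (Nat.div_le_self ((p.ph + (p.n - 1)) / p.w) p.u).trans h1
    unfold M sub; omega
  omega

/-- The header fields fit into their space. -/
theorem Ok.rv_le (h : Base p H v G) (hcur : ∀ j, H.cur j < p.K) :
    ∀ i, 2 ≤ i → i ≤ 10 → p.rv H i ≤ p.n := by
  have hn := ok.n_pos
  have hK := ok.K_le_n
  have ht := ok.t_le
  have h1 := h.T_le
  have hd := Nat.div_le_self (p.n - 1) p.w
  have hc1 := hcur true
  have hc2 := hcur false
  have hg1 := h.g_le true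
  have hg2 := h.g_le false
  have hx1 := h.x_lt true
  have hx2 := h.x_lt false
  intro i hi hi'
  interval_cases i <;> simp only [rv] <;> omega

theorem Ok.cur_lt (h : Inv p H v G) (j : Bool) : H.cur j < p.K ∧ G.perm (H.cur j) < H.T := by
  rw [h.base.cur j]
  cases hb : G.bk j with
  | nil => exact ⟨ok.K_pos, h.base.zero⟩
  | cons c l =>
    have := (((h.colr j).mem c).1 (by simp [hb])).2
    exact ⟨this.1, this.2.1⟩

theorem Ok.prep_ok (h : Inv p H v G) {s : ℕ} (hs : s < p.M) (ht : G.perm (s / p.w) < H.T) :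
    (v.fl true s = false → ∀ e < p.n, p.sub e = s → v.cw e → v.cb e = false) ∧
      Inv p H (v.prep p s) G ∧ BlockOk p (v.prep p s) G s := by
  have hX : v.fl true s = false → ∀ e < p.n, p.sub e = s → ¬ G.X e := by
    intro hf e he hes hXe
    have := ((h.colr true).flags s hs ht).2 ⟨e, he, hes, by simp [Gh.Col, hXe]⟩
    rw [hf] at this
    exact absurd this (by simp)
  have hz : v.fl true s = false → ∀ e < p.n, p.sub e = s → v.cw e → v.cb e = false := by
    intro hf e he hes hcw
    have := h.base.honest e he (Or.inl hcw)
    have := hX hf e he hes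
    cases hcb : v.cb e <;> simp_all
  refine ⟨hz, ⟨?_, fun j => ⟨(h.colr j).flags, (h.colr j).ring, (h.colr j).mem⟩⟩, ?_⟩
  · refine { h.base with honest := fun e he hh => ?_ }
    simp only [View.prep] at hh ⊢
    by_cases hf : p.sub e = s ∧ v.fl true s = false
    · simp [hf.1, hf.2, hX hf.2 e he hf.1]
    · have : (v.cb e && !(decide (p.sub e = s) && !v.fl true s)) = v.cb e := by
        by_cases h1 : p.sub e = s <;> simp_all
      rw [this]
      refine h.base.honest e he (hh.imp_left fun h' => h'.resolve_right fun h'' => hf ?_)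
      exact ⟨h''.2.1, h''.2.2⟩
  · intro e he hes
    simp only [View.prep]
    cases hf : v.fl true s
    · simp [hes, hX hf e he hes]
    · rw [decide_eq_true hes]
      simp only [Bool.true_and, Bool.not_true, Bool.not_false, Bool.and_true]
      exact h.base.honest e he (Or.inr ⟨by rw [chk, hes]; exact ht, by rw [hes]; exact hf⟩)

end Par

/-- The header after chunk `i` was touched. -/
def Hd.touch (H : Hd) (i : ℕ) : Hd :=
  { H with
    T := H.T + 1
    cur := if H.cur false = 0 then Function.update H.cur false i else H.cur }

/-- The ghost state after chunk `i` was touched. The chunk is put at the end of the list for the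
complement, because all of its elements are still to be enumerated there. -/
def Gh.touch (G : Gh) (T i : ℕ) : Gh :=
  { G with
    perm := join G.perm T i
    bk := Function.update G.bk false (G.bk false ++ [i]) }

namespace Par

variable {σ : ℕ → ℕ} {m N : ℕ} {p : Par} {A B : ℕ} {H : Hd} {v v' : View} {G : Gh}
  (ok : p.Ok σ A B m)
include ok

theorem Ok.touch_mem (h : Inv p H v G) {i : ℕ} (hiK : i < p.K) (hi : H.T ≤ G.perm i) :
    i ≠ 0 ∧ 1 < p.K ∧ (∀ j, i ∉ G.fr j ++ G.bk j) ∧ ∀ e < p.n, p.chk e = i → ¬ G.X e := by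
  have h0 : i ≠ 0 := by rintro rfl; have := h.base.zero; omega
  refine ⟨h0, by omega, fun j hj => ?_, fun e he hc => h.base.unt e he (hc ▸ hi)⟩
  have := (((h.colr j).mem i).1 hj).2.2.1
  omega

/-- Touching a chunk preserves the invariant. -/
theorem Ok.touch_inv (h : Inv p H v G) {i : ℕ} (hiK : i < p.K) (hi : H.T ≤ G.perm i)
    (hcb : v'.cb = v.cb) (hcw : v'.cw = v.cw)
    (hfl : ∀ j s, v'.fl j s = if s / p.w = i then false else v.fl j s)
    (h6 : ∀ x, v'.rc 6 x = if G.perm H.T ≠ i ∧ x = G.perm i then G.perm H.T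
      else if G.perm H.T ≠ i ∧ x = G.perm H.T then G.perm i
      else if x = i then i else if x = H.T then H.T else v.rc 6 x)
    (h2 : v'.rc 2 = v.rc 2) (h3 : v'.rc 3 = v.rc 3)
    (h4 : ∀ x, v'.rc 4 x = if x = i then 0 else if x = v.rc 5 0 then i else v.rc 4 x)
    (h5 : ∀ x, v'.rc 5 x = if x = i then v.rc 5 0 else if x = 0 then i else v.rc 5 x) :
    Inv p (H.touch i) v' (G.touch H.T i) := by
  obtain ⟨h0, hK, hnm, hX⟩ := ok.touch_mem h hiK hi
  obtain ⟨hT, inv', hj⟩ := h.base.invol.join hi hiK h.base.T_le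
  have hbk : ∀ j, ((G.touch H.T i).bk j) = G.bk j ++ if j then [] else [i] := by
    intro j; cases j <;> simp [Gh.touch]
  have hcur : ∀ j, (H.touch i).cur j = ((G.touch H.T i).bk j).headD 0 := by
    intro j
    rw [hbk]
    have h1 := h.base.cur j
    cases j
    · cases hb : G.bk false with
      | nil => simp [Hd.touch, h.base.cur, hb]
      | cons c l =>
        have : c ≠ 0 := (((h.colr false).mem c).1 (by simp [hb])).1
        simp [Hd.touch, h.base.cur, hb, this]
    · simp only [Hd.touch, if_true, List.append_nil]
      rw [← h1]
      split <;> simp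
  have hcol : ∀ j e, (G.touch H.T i).Col j e ↔ G.Col j e := fun j e => Iff.rfl
  refine ⟨⟨by simp [Hd.touch], ?_, inv', ?_, ?_, ?_, ?_, hcur, h.base.g_le, h.base.x_lt, ?_, ?_⟩,
    fun j => ⟨?_, ?_, ?_⟩⟩
  · show H.T + 1 ≤ p.K; omega
  · exact (hj 0).2 (Or.inl h.base.zero)
  · intro x hx hxT
    have hp := h.base.ptr x hx
    have c1 := h.base.invol.cross x
    have c2 := h.base.invol.inv x
    rw [h6]
    simp only [Hd.touch, Gh.touch] at hxT ⊢
    rw [hj] at hxT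
    unfold join
    split_ifs
    · rfl
    · rfl
    · rfl
    · rfl
    · exact hp (by omega)
  · intro e he hT'
    refine h.base.unt e he ?_
    simp only [Hd.touch, Gh.touch] at hT'
    have := (hj (p.chk e)).not.1 (by omega)
    omega
  · intro e he hh
    rw [hcb]
    refine h.base.honest e he ?_
    rw [hcw, hfl] at hh
    refine hh.imp_right fun ⟨h1, h2⟩ => ?_
    by_cases hc : p.sub e / p.w = i
    · simp [hc] at h2
    · rw [if_neg hc] at h2
      exact ⟨((hj _).1 h1).resolve_right hc, h2⟩
  · intro j hg
    have h1 := h.base.x_chk j hg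
    show p.chk (H.x j) = _
    rw [h1]
    simp only [Hd.touch]
    split
    · rename_i hc
      cases j
      · exfalso
        have : G.bk false = [] := by
          rw [h.base.cur] at hc
          cases hb : G.bk false with
          | nil => rfl
          | cons c l =>
            rw [hb] at hc
            exact absurd hc (((h.colr false).mem c).1 (by simp [hb])).1
        have := h.base.fresh hT this
        simp only [Hd.touch] at hg
        omega
      · simp
    · rfl
  · intro _ hb
    simp [hbk] at hb
  · intro s hs hsT
    rw [hfl]
    by_cases hc : s / p.w = i
    · rw [if_pos hc]
      obtain ⟨e, he, hes⟩ := ok.sub_surj hs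
      have hnX : ∀ e < p.n, p.sub e = s → ¬ G.X e := fun e he hes => hX e he (by rw [chk, hes, hc])
      cases j
      · simp only [true_iff]
        exact ⟨e, he, hes, (hcol _ _).2 (by simp [Gh.Col, hnX e he hes])⟩
      · simp only [Bool.false_eq_true, false_iff]
        rintro ⟨e', he', hes', hc'⟩
        exact hnX e' he' hes' (by simpa [Gh.Col] using (hcol _ _).1 hc')
    · rw [if_neg hc]
      exact (h.colr j).flags s hs (((hj _).1 hsT).resolve_right hc)
  · rw [hbk]
    have hr := (h.colr j).ring
    cases j
    · simp only [kn, kp, Bool.false_eq_true, if_false] at hr ⊢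
      have := hr.append h0 (hnm false) h5 h4
      rwa [List.append_assoc] at this
    · simp only [kn, kp, if_true, List.append_nil] at hr ⊢
      rw [h2, h3]
      exact hr
  · intro c
    rw [hbk]
    have hm := (h.colr j).mem c
    have hj' := hj c
    show _ ↔ c ≠ 0 ∧ c < p.K ∧ join G.perm H.T i c < H.T + 1 ∧ _
    rw [hj']
    simp only [hcol]
    cases j
    · simp only [Bool.false_eq_true, if_false]
      show c ∈ G.fr false ++ (G.bk false ++ [i]) ↔ _
      rw [← List.append_assoc, List.mem_append, hm, List.mem_singleton]
      constructor
      · rintro (⟨a, b, c, d⟩ | rfl)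
        · exact ⟨a, b, Or.inl c, d⟩
        · obtain ⟨e, he, hc⟩ := ok.chk_surj hiK
          exact ⟨h0, hiK, Or.inr rfl, e, he, hc, by simp [Gh.Col, hX e he hc]⟩
      · rintro ⟨a, b, c | c, d⟩
        · exact Or.inl ⟨a, b, c, d⟩
        · exact Or.inr c
    · simp only [if_true, List.append_nil]
      show c ∈ G.fr true ++ G.bk true ↔ _
      rw [hm]
      constructor
      · rintro ⟨a, b, c, d⟩
        exact ⟨a, b, Or.inl c, d⟩
      · rintro ⟨a, b, c | c, d⟩
        · exact ⟨a, b, c, d⟩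
        · obtain ⟨e, he, hc, hd⟩ := d
          exact absurd (by simpa [Gh.Col] using hd) (hX e he (hc.trans c))

theorem Ok.touch_quiet (h : Inv p H v G) {i : ℕ} (hiK : i < p.K) (hi : H.T ≤ G.perm i) :
    Quiet p H G (H.touch i) (G.touch H.T i) := by
  obtain ⟨h0, hK, hnm, hX⟩ := ok.touch_mem h hiK hi
  obtain ⟨hT, inv', hj⟩ := h.base.invol.join hi hiK h.base.T_le
  refine ⟨rfl, fun j e he => ?_⟩
  have hje := hj (p.chk e)
  have hun : (H.touch i).T ≤ (G.touch H.T i).perm (p.chk e) ↔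
      H.T ≤ G.perm (p.chk e) ∧ p.chk e ≠ i := by
    show H.T + 1 ≤ join G.perm H.T i (p.chk e) ↔ _
    omega
  unfold Ahead
  rw [hun]
  cases j
  · have hbk : (G.touch H.T i).bk false = G.bk false ++ [i] := by simp [Gh.touch]
    rw [hbk]
    suffices hh : (p.chk e ∈ (G.bk false ++ [i] ++ [0]).tail ∨
        p.chk e = (H.touch i).cur false ∧ ((H.touch i).g false = 1 ∨ e < (H.touch i).x false) ∨
        H.T ≤ G.perm (p.chk e) ∧ p.chk e ≠ i) ↔ (p.chk e ∈ (G.bk false ++ [0]).tail ∨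
        p.chk e = H.cur false ∧ (H.g false = 1 ∨ e < H.x false) ∨ H.T ≤ G.perm (p.chk e)) from
      ⟨hh.1, fun _ _ => hh.2⟩
    have hcur := h.base.cur false
    have hii : p.chk e = i → H.T ≤ G.perm (p.chk e) := fun h => h ▸ hi
    cases hb : G.bk false with
    | nil =>
      -- the iteration returns from the start of chunk `0` to the start of chunk `i`
      have hg := h.base.fresh hT hb
      rw [hb] at hcur
      simp only [Hd.touch, hcur, List.headD_nil, if_true, hg, List.nil_append, List.singleton_append,
        List.tail_cons, List.mem_singleton, Function.update_self, true_or, and_true,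
        List.not_mem_nil, false_or]
      by_cases hi' : p.chk e = i
      · simp [hi', hi]
      · simp [hi']
    | cons c l =>
      have : c ≠ 0 := (((h.colr false).mem c).1 (by simp [hb])).1
      rw [hb] at hcur
      simp only [Hd.touch, hcur, List.headD_cons, if_neg this, List.cons_append, List.tail_cons,
        List.append_assoc, List.mem_append, List.mem_cons, List.not_mem_nil, or_false,
        List.nil_append]
      by_cases hi' : p.chk e = i
      · simp [hi', hi]
      · simp [hi']
  · have hbk : (G.touch H.T i).bk true = G.bk true := by simp [Gh.touch]
    have hcur : (H.touch i).cur true = H.cur true := by simp only [Hd.touch]; split <;> simp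
    rw [hbk, hcur]
    refine ⟨by tauto, fun hc _ => ?_⟩
    have hc : G.X e := by simpa [Gh.Col] using hc
    have := mt (h.base.unt e he) (not_not.2 hc)
    tauto

end Par
end ChoiceDict

/-! ### Touching chunks -/

namespace ChoiceDict

open WordRAM

/-- Evaluates the involution at `e`, in `reg r`. The stored pointer counts only if it crosses the
border `T` and, for `e` beyond the border, is confirmed by the pointer in the opposite direction. -/
def piP (r : ℕ) (e : Expr) : Prog :=
  .load r (recE 6 e) ;;
  .ite (.lt e (Rg 4)) .skip
    (.ite (.lt (Rg r) (Rg 4))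
      (.load (r + 1) (recE 6 (Rg r)) ;; .ite (.eq (Rg (r + 1)) e) .skip (.assign r e))
      (.assign r e))

/-- Inserts the untouched chunk `reg i` in the set of the touched chunks. -/
def touchP (i : ℕ) : Prog :=
  piP 40 (Rg 4) ;; piP 42 (Rg i) ;;
  .store (recE 6 (Rg 4)) (Rg 4) ;; .store (recE 6 (Rg i)) (Rg i) ;;
  .ite (.eq (Rg 40) (Rg i)) .skip
    (.store (recE 6 (Rg 40)) (Rg 42) ;; .store (recE 6 (Rg 42)) (Rg 40)) ;;
  .store (recE 0 (Rg i)) (.const 0) ;; .store (recE 1 (Rg i)) (.const 0) ;;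
  .load 44 (recE 5 (.const 0)) ;;
  .store (recE 4 (Rg 44)) (Rg i) ;; .store (recE 4 (Rg i)) (.const 0) ;;
  .store (recE 5 (Rg i)) (Rg 44) ;; .store (recE 5 (.const 0)) (Rg i) ;;
  .assign 4 (Rg 4 + .const 1) ;;
  .ite (.eq (Rg 8) (.const 0)) (.assign 8 (Rg i)) .skip

/-- Touches chunk `reg i` if it is untouched. -/
def ensureP (i : ℕ) : Prog :=
  .ite (.eq (Rg i) (.const 0)) .skip
    (piP 40 (Rg i) ;; .ite (.lt (Rg 40) (Rg 4)) .skip (touchP i))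

/-- Touches an untouched chunk, if there is one, namely the image under the involution of the first
number beyond the border. -/
def pullP : Prog :=
  .ite (.lt (Rg 4) (Rg 19)) (piP 40 (Rg 4) ;; .assign 38 (Rg 40) ;; touchP 38) .skip

/-- Unless all chunks are touched, the part `bk` of the list for the complement contains a chunk from
which the iteration has enumerated nothing. -/
def Ready (p : Par) (H : Hd) (G : Gh) : Prop :=
  H.T = p.K ∨ 2 ≤ (G.bk false).length ∨ (G.bk false).length = 1 ∧ H.g false = 1

namespace Par

variable {σ : ℕ → ℕ} {m N : ℕ} {p : Par} {A B : ℕ} {H : Hd} {v : View} {G : Gh} {F : ℕ → ℕ}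
  {s : State p.w} (ok : p.Ok σ A B m)
include ok

theorem Ok.wp_piP (h : p.At H v F s) (hB : Base p H v G) (hK : 1 < p.K) {r x : ℕ} {e : Expr}
    (hr : 22 ≤ r) (hr' : r + 1 < 60) (hx : x < p.K)
    (he : ∀ F' s', p.At H v F' s' → (∀ i, i ≠ r → i ≠ r + 1 → F' i = F i) → val σ s' e = x) :
    wp σ m N (piP r e) (fun s' => ∃ F', p.At H v F' s' ∧ F' r = G.perm x ∧
      ∀ i, i ≠ r → i ≠ r + 1 → F' i = F i) s := by
  have c1 := hB.invol.cross x
  have c2 := hB.invol.inv x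
  have hp := hB.ptr x hx
  refine wp_call (ok.load_rec h hK hx (by omega) (by omega) (he F s h fun _ _ _ => rfl) hr) ?_
  intro s₁ h₁
  have a₁ : ∀ i, i ≠ r → i ≠ r + 1 → Function.update F r (v.rc 6 x) i = F i := fun i h1 h2 => by
    rw [Function.update_of_ne h1]
  have e1 := he _ _ h₁ a₁
  have eT : ∀ F' s', p.At H v F' s' → val σ s' (Rg 4) = H.T := fun F' s' h' =>
    h'.par (by omega) (by omega)
  have er : val σ s₁ (Rg r) = v.rc 6 x := by
    rw [h₁.reg hr (by omega), Function.update_self]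
  have fin : ∀ F' s', p.At H v F' s' → (∀ i, i ≠ r → i ≠ r + 1 → F' i = F i) → G.perm x = x →
      wp σ m N (.assign r e) (fun s' => ∃ F', p.At H v F' s' ∧ F' r = G.perm x ∧
        ∀ i, i ≠ r → i ≠ r + 1 → F' i = F i) s' := by
    intro F' s' h' a' hpx
    refine (h'.assign (he _ _ h' a') hr).mono fun s'' h'' => ⟨_, h'', ?_, fun i h1 h2 => ?_⟩
    · rw [Function.update_self, hpx]
    · rw [Function.update_of_ne h1, a' i h1 h2]
  refine wp_ite (fun hb => ?_) fun hb => ?_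
  · rw [holds_lt, e1, eT _ _ h₁] at hb
    exact wp_skip ⟨_, h₁, by rw [Function.update_self, hp (Or.inl hb)], a₁⟩
  · rw [holds_lt, e1, eT _ _ h₁] at hb
    refine wp_ite (fun hb' => ?_) fun hb' => ?_
    · rw [holds_lt, er, eT _ _ h₁] at hb'
      have hyK : v.rc 6 x < p.K := hb'.trans_le hB.T_le
      have hy := hB.ptr _ hyK (Or.inl hb')
      refine wp_call (ok.load_rec h₁ hK hyK (by omega) (by omega) er (by omega)) ?_
      intro s₂ h₂
      have a₂ : ∀ i, i ≠ r → i ≠ r + 1 → Function.update (Function.update F r (v.rc 6 x)) (r + 1)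
          (v.rc 6 (v.rc 6 x)) i = F i := fun i h1 h2 => by
        rw [Function.update_of_ne h2, Function.update_of_ne h1]
      have e2 := he _ _ h₂ a₂
      have er2 : val σ s₂ (Rg (r + 1)) = v.rc 6 (v.rc 6 x) := by
        rw [h₂.reg (by omega) (by omega), Function.update_self]
      refine wp_ite (fun hb'' => ?_) fun hb'' => ?_
      · rw [holds_eq, er2, e2, hy] at hb''
        refine wp_skip ⟨_, h₂, ?_, a₂⟩
        rw [Function.update_of_ne (by omega), Function.update_self]
        have := hB.invol.inv (v.rc 6 x)
        rw [hb''] at this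
        exact this.symm
      · rw [holds_eq, er2, e2, hy] at hb''
        refine fin _ _ h₂ a₂ ?_
        by_contra hne
        rw [hp (Or.inr (by have := c1 hne; omega)), c2] at hb''
        exact hb'' rfl
    · rw [holds_lt, er, eT _ _ h₁] at hb'
      refine fin _ _ h₁ a₁ ?_
      by_contra hne
      have := c1 hne
      rw [hp (Or.inr (by omega))] at hb'
      omega

theorem Ok.wp_touch (h : p.At H v F s) (hI : Inv p H v G) {r i : ℕ} (hr : 22 ≤ r) (hr' : r < 40)
    (hF : F r = i) (hiK : i < p.K) (hi : H.T ≤ G.perm i) :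
    wp σ m N (touchP r) (fun s' => ∃ v' F', p.At (H.touch i) v' F' s' ∧ (∀ k < 40, F' k = F k) ∧
      Inv p (H.touch i) v' (G.touch H.T i)) s := by
  obtain ⟨h0, hK, hnm, hX⟩ := ok.touch_mem hI hiK hi
  obtain ⟨hT, -, -⟩ := hI.base.invol.join hi hiK hI.base.T_le
  have c0 : ∀ t : State p.w, val σ t (.const 0) = 0 := fun t => ok.val_small _ (by omega)
  have hpK : ∀ x < p.K, G.perm x < p.K := by
    intro x hx
    by_contra hc
    have := hI.base.invol.fix (G.perm x) (by omega)
    rw [hI.base.invol.inv] at this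
    omega
  refine wp_call (ok.wp_piP h hI.base hK (by omega) (by omega) hT
    fun F' s' h' _ => h'.par (by omega) (by omega)) ?_
  rintro s₁ ⟨F₁, h₁, q40, a₁⟩
  refine wp_call (ok.wp_piP h₁ hI.base hK (by omega) (by omega) hiK fun F' s' h' a' => by
    rw [h'.reg hr (by omega), a' _ (by omega) (by omega), a₁ _ (by omega) (by omega), hF]) ?_
  rintro s₂ ⟨F₂, h₂, q42, a₂⟩
  have b40 : F₂ 40 = G.perm H.T := by rw [a₂ _ (by omega) (by omega), q40]
  have br : F₂ r = i := by rw [a₂ _ (by omega) (by omega), a₁ _ (by omega) (by omega), hF]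
  have bF : ∀ k < 40, F₂ k = F k := fun k hk => by
    rw [a₂ _ (by omega) (by omega), a₁ _ (by omega) (by omega)]
  clear a₂ q40 a₁ h h₁
  have vr : ∀ {v' s'}, p.At H v' F₂ s' → val σ s' (Rg r) = i := fun h' => by
    rw [h'.reg hr (by omega), br]
  have v40 : ∀ {v' s'}, p.At H v' F₂ s' → val σ s' (Rg 40) = G.perm H.T := fun h' => by
    rw [h'.reg (by omega) (by omega), b40]
  have v42 : ∀ {v' s'}, p.At H v' F₂ s' → val σ s' (Rg 42) = G.perm i := fun h' => by
    rw [h'.reg (by omega) (by omega), q42]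
  have vT : ∀ {v' s'}, p.At H v' F₂ s' → val σ s' (Rg 4) = H.T := fun h' =>
    h'.par (by omega) (by omega)
  refine wp_call (ok.store_rec h₂ hK hT (by omega) (by omega) (vT h₂) (vT h₂)) fun s₃ h₃ => ?_
  refine wp_call (ok.store_rec h₃ hK hiK (by omega) (by omega) (vr h₃) (vr h₃)) fun s₄ h₄ => ?_
  refine wp_call (R := fun s' => ∃ v', p.At H v' F₂ s' ∧ v'.cb = v.cb ∧ v'.cw = v.cw ∧ v'.fl = v.fl ∧
    (∀ k ≠ 6, v'.rc k = v.rc k) ∧ ∀ x, v'.rc 6 x = if G.perm H.T ≠ i ∧ x = G.perm i then G.perm H.T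
      else if G.perm H.T ≠ i ∧ x = G.perm H.T then G.perm i
      else if x = i then i else if x = H.T then H.T else v.rc 6 x) ?_ ?_
  · refine wp_ite (fun hb => ?_) fun hb => ?_
    · rw [holds_eq, v40 h₄, vr h₄] at hb
      exact wp_skip ⟨_, h₄, rfl, rfl, rfl, fun k hk => by simp [View.setRec, hk], fun x => by
        simp [View.setRec, hb]⟩
    · rw [holds_eq, v40 h₄, vr h₄] at hb
      refine wp_call (ok.store_rec h₄ hK (hpK _ hT) (by omega) (by omega) (v40 h₄) (v42 h₄))
        fun s₅ h₅ => ?_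
      refine (ok.store_rec h₅ hK (hpK _ hiK) (by omega) (by omega) (v42 h₅) (v40 h₅)).mono
        fun s₆ h₆ => ?_
      exact ⟨_, h₆, rfl, rfl, rfl, fun k hk => by simp [View.setRec, hk], fun x => by
        simp [View.setRec, hb]⟩
  clear h₂ h₃ h₄
  rintro s₅ ⟨w, h₅, wcb, wcw, wfl, wk, w6⟩
  refine wp_call (ok.clear_flags h₅ true hK hiK h0 (vr h₅)) fun s₆ h₆ => ?_
  refine wp_call (ok.clear_flags h₆ false hK hiK h0 (vr h₆)) fun s₇ h₇ => ?_
  clear h₅ h₆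
  have hz : v.rc 5 0 < p.K ∧ v.rc 5 0 ≠ i := by
    have h1 := (hI.colr false).ring
    have h2 := h1.swap.nx_zero
    have h3 : v.rc 5 0 = (G.fr false ++ G.bk false).reverse.headD 0 := h2
    rw [h3]
    cases hl : (G.fr false ++ G.bk false).reverse with
    | nil => exact ⟨by simp; omega, by simpa using h0.symm⟩
    | cons c l =>
      have hc : c ∈ G.fr false ++ G.bk false := by
        rw [← List.mem_reverse, hl]; simp
      exact ⟨(((hI.colr false).mem c).1 hc).2.1, by
        rintro rfl; exact hnm false (by simpa using hc)⟩
  refine wp_call (ok.load_rec h₇ hK (by omega) (by omega) (by omega) (c0 _) (by omega)) fun s₈ h₈ => ?_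
  have e5 : ((w.clearF p true i).clearF p false i).rc 5 0 = v.rc 5 0 := by
    simp [View.clearF, wk]
  rw [e5] at h₈
  clear h₇
  generalize hF₃ : Function.update F₂ 44 (v.rc 5 0) = F₃ at h₈
  have b44 : F₃ 44 = v.rc 5 0 := by rw [← hF₃, Function.update_self]
  have br' : F₃ r = i := by rw [← hF₃, Function.update_of_ne (by omega), br]
  have vr' : ∀ {H' v' s'}, p.At H' v' F₃ s' → val σ s' (Rg r) = i := fun h' => by
    rw [h'.reg hr (by omega), br']
  have v44 : ∀ {v' s'}, p.At H v' F₃ s' → val σ s' (Rg 44) = v.rc 5 0 := fun h' => by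
    rw [h'.reg (by omega) (by omega), b44]
  refine wp_call (ok.store_rec h₈ hK hz.1 (by omega) (by omega) (v44 h₈) (vr' h₈)) fun s₉ h₉ => ?_
  refine wp_call (ok.store_rec h₉ hK hiK (by omega) (by omega) (vr' h₉) (c0 _)) fun t₁ k₁ => ?_
  refine wp_call (ok.store_rec k₁ hK hiK (by omega) (by omega) (vr' k₁) (v44 k₁)) fun t₂ k₂ => ?_
  refine wp_call (ok.store_rec k₂ hK (by omega) (by omega) (by omega) (c0 _) (vr' k₂))
    fun t₃ k₃ => ?_
  have hTw : H.T + 1 < 2 ^ p.w := by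
    obtain ⟨Y, b1, b2, b3, b4, b5, b6, b7, b8, b9, b10⟩ := ok.bounds
    have h64 := ok.w_ge
    have hY : 64 * (64 * p.w) ≤ Y := le_trans (by nlinarith) b2
    omega
  refine wp_call (k₃.setT (val_add_of_lt _ _ _ (k₃.par (by omega) (by omega))
    (ok.val_small _ (by omega)) hTw)) fun t₄ k₄ => ?_
  have bF' : ∀ k < 40, F₃ k = F k := fun k hk => by
    rw [← hF₃, Function.update_of_ne (by omega), bF k hk]
  have e8 : val σ t₄ (Rg 8) = H.cur false := k₄.par (by omega) (by omega)
  have key : ∀ w', w' = (((((w.clearF p true i).clearF p false i).setRec 4 (v.rc 5 0) i).setRec 4 i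
      0).setRec 5 i (v.rc 5 0)).setRec 5 0 i → Inv p (H.touch i) w' (G.touch H.T i) := by
    rintro w' rfl
    refine ok.touch_inv hI hiK hi wcb wcw ?_ ?_ ?_ ?_ ?_ ?_
    · intro j x
      simp only [View.setRec, View.clearF, wfl]
      cases j <;> by_cases hx : x / p.w = i <;> simp [hx]
    · intro x
      rw [← w6]
      simp [View.setRec, View.clearF]
    · funext x; simp [View.setRec, View.clearF, wk]
    · funext x; simp [View.setRec, View.clearF, wk]
    · intro x
      simp [View.setRec, View.clearF, wk]
    · intro x
      simp only [View.setRec, View.clearF]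
      by_cases hx : x = 0
      · subst hx; simp [h0.symm]
      · simp [hx, wk]
  refine wp_ite (fun hb => ?_) fun hb => ?_
  · rw [holds_eq, e8, c0] at hb
    refine (k₄.setCur false (vr' k₄)).mono fun t₅ k₅ => ⟨_, F₃, ?_, bF', key _ rfl⟩
    have : H.touch i = { H with T := H.T + 1, cur := Function.update H.cur false i } := by
      simp [Hd.touch, hb]
    rw [this]
    exact k₅
  · rw [holds_eq, e8, c0] at hb
    refine wp_skip ⟨_, F₃, ?_, bF', key _ rfl⟩
    have : H.touch i = { H with T := H.T + 1 } := by simp [Hd.touch, hb]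
    rw [this]
    exact k₄

theorem Ok.wp_ensure (h : p.At H v F s) (hI : Inv p H v G) {r i : ℕ} (hr : 22 ≤ r) (hr' : r < 40)
    (hF : F r = i) (hiK : i < p.K) :
    wp σ m N (ensureP r) (fun s' => ∃ H' v' F' G', p.At H' v' F' s' ∧ (∀ k < 40, F' k = F k) ∧
      Inv p H' v' G' ∧ Quiet p H G H' G' ∧ G'.perm i < H'.T) s := by
  have c0 : ∀ t : State p.w, val σ t (.const 0) = 0 := fun t => ok.val_small _ (by omega)
  have er : val σ s (Rg r) = i := by rw [h.reg hr (by omega), hF]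
  refine wp_ite (fun hb => ?_) fun hb => ?_
  · rw [holds_eq, er, c0] at hb
    exact wp_skip ⟨H, v, F, G, h, fun _ _ => rfl, hI, Quiet.refl _ _ _, hb ▸ hI.base.zero⟩
  · rw [holds_eq, er, c0] at hb
    refine wp_call (ok.wp_piP h hI.base (by omega) (by omega) (by omega) hiK fun F' s' h' a' => by
      rw [h'.reg hr (by omega), a' _ (by omega) (by omega), hF]) ?_
    rintro s₁ ⟨F₁, h₁, q40, a₁⟩
    have aF : ∀ k < 40, F₁ k = F k := fun k hk => a₁ _ (by omega) (by omega)
    refine wp_ite (fun hb' => ?_) fun hb' => ?_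
    · rw [holds_lt, h₁.reg (by omega) (by omega), h₁.par (by omega) (by omega), q40] at hb'
      exact wp_skip ⟨H, v, F₁, G, h₁, aF, hI, Quiet.refl _ _ _, hb'⟩
    · rw [holds_lt, h₁.reg (by omega) (by omega), h₁.par (by omega) (by omega), q40] at hb'
      have hi : H.T ≤ G.perm i := not_lt.1 hb'
      refine (ok.wp_touch h₁ hI hr hr' ((aF r hr').trans hF) hiK hi).mono ?_
      rintro s₂ ⟨v', F', h₂, a₂, hI'⟩
      refine ⟨_, v', F', _, h₂, fun k hk => (a₂ k hk).trans (aF k hk), hI',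
        ok.touch_quiet hI hiK hi, ?_⟩
      exact ((hI.base.invol.join hi hiK hI.base.T_le).2.2 i).2 (Or.inr rfl)

theorem Ok.wp_pull (h : p.At H v F s) (hI : Inv p H v G) :
    wp σ m N pullP (fun s' => ∃ H' v' F' G', p.At H' v' F' s' ∧ (∀ k < 38, F' k = F k) ∧
      Inv p H' v' G' ∧ Quiet p H G H' G' ∧ Ready p H' G') s := by
  have eT : val σ s (Rg 4) = H.T := h.par (by omega) (by omega)
  have eK : val σ s (Rg 19) = p.K := h.par (by omega) (by omega)
  have hTp := hI.base.T_pos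
  refine wp_ite (fun hb => ?_) fun hb => ?_
  · rw [holds_lt, eT, eK] at hb
    refine wp_call (ok.wp_piP h hI.base (by omega) (by omega) (by omega) hb
      fun F' s' h' _ => h'.par (by omega) (by omega)) ?_
    rintro s₁ ⟨F₁, h₁, q40, a₁⟩
    refine wp_call (h₁.assign (h₁.reg (by omega) (by omega)) (by omega)) fun s₂ h₂ => ?_
    have hinv := hI.base.invol.inv H.T
    have hiK : G.perm H.T < p.K := by
      by_contra hc
      have := hI.base.invol.fix (G.perm H.T) (by omega)
      omega
    refine (ok.wp_touch (i := G.perm H.T) h₂ hI (by omega) (by omega) (by simp [q40]) hiK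
      hinv.ge).mono ?_
    rintro s₃ ⟨v', F', h₃, a₃, hI'⟩
    refine ⟨_, v', F', _, h₃, fun k hk => ?_, hI', ok.touch_quiet hI hiK hinv.ge, Or.inr ?_⟩
    · rw [a₃ k (by omega), Function.update_of_ne (by omega), a₁ _ (by omega) (by omega)]
    · have hbk : (G.touch H.T (G.perm H.T)).bk false = G.bk false ++ [G.perm H.T] := by
        simp [Gh.touch]
      rw [hbk]
      cases hc : G.bk false with
      | nil => exact Or.inr ⟨rfl, hI.base.fresh hb hc⟩
      | cons c l => left; simp
  · rw [holds_lt, eT, eK] at hb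
    have := hI.base.T_le
    exact wp_skip ⟨H, v, F, G, h, fun _ _ => rfl, hI, Quiet.refl _ _ _, Or.inl (by omega)⟩

end Par
end ChoiceDict

/-! ### Searching for elements -/

namespace ChoiceDict

open WordRAM

/-- Saves the result of a search. -/
def saveP (a b : ℕ) : Prog := .assign a (Rg 60) ;; .assign b (Rg 61)

/-- Searches chunk `reg 34` for its last element of color `j` or, if `reg 35` is not `1`, for the
last such element before `reg 36`. The success is reported in `reg 46` and the element in
`reg 47`. -/
def searchP (B : ℕ) (j : Bool) : Prog :=
  .assign 46 (.const 0) ;;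
  .ite (.eq (Rg 35) (.const 1))
    (scanF B j (Rg 34) ;; saveP 43 44)
    (blk (Rg 36) ;; .assign 45 (Rg 63) ;; prep (Rg 45) ;; scanCx B j (Rg 36) ;; saveP 46 47 ;;
      .ite (.eq (Rg 46) (.const 1)) (.assign 43 (.const 0))
        (scanFx B j (Rg 45) ;; saveP 43 44)) ;;
  .ite (.eq (Rg 43) (.const 1)) (prep (Rg 44) ;; scanC B j (Rg 44) ;; saveP 46 47) .skip

/-- Searches for the element of color `j` that its iteration should enumerate next. Every chunk in
the list contains an element, so that the search extends over at most two chunks. -/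
def seekP (B : ℕ) (j : Bool) : Prog :=
  pullP ;;
  .assign 34 (Rg (if j then 5 else 8)) ;; .assign 35 (Rg (if j then 7 else 10)) ;;
  .assign 36 (Rg (if j then 6 else 9)) ;; searchP B j ;;
  .ite (.eq (Rg 46) (.const 1)) .skip
    (.ite (.eq (Rg 34) (.const 0)) .skip
      (.load 34 (recE (kn j) (Rg 34)) ;; .assign (if j then 5 else 8) (Rg 34) ;;
        .assign (if j then 7 else 10) (.const 1) ;; .assign 35 (.const 1) ;; searchP B j))

/-- Determines in `reg 34` the first chunk in the list for color `j`. -/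
def headP (j : Bool) : Prog :=
  .assign 34 (.const 0) ;;
  .ite (.lt (.const 1) (Rg 19)) (.load 34 (recE (kn j) (.const 0))) .skip

/-- Searches for any element of color `j`, in the first chunk of the list or, if the list is empty,
in chunk `0`. -/
def anyP (B : ℕ) (j : Bool) : Prog := pullP ;; headP j ;; .assign 35 (.const 1) ;; searchP B j

/-- The outcome of the search for the last element of color `j` with the property `R`. -/
def Found (G : Gh) (j : Bool) (R : ℕ → Prop) (found e : ℕ) : Prop :=
  (found = 0 ∧ ∀ e, R e → ¬ G.Col j e) ∨
    (found = 1 ∧ R e ∧ G.Col j e ∧ ∀ e', R e' → e < e' → ¬ G.Col j e')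

namespace Par

variable {σ : ℕ → ℕ} {m N : ℕ} {p : Par} {A B : ℕ} {H : Hd} {v : View} {G : Gh} {F : ℕ → ℕ}
  {s : State p.w}

theorem At.save (h : p.At H v F s) {a b : ℕ} (ha : 22 ≤ a) (ha' : a < 60) (hb : 22 ≤ b) :
    wp σ m N (saveP a b)
      (p.At H v (Function.update (Function.update F a (s.rg 60)) b (s.rg 61))) s := by
  refine wp_assign_seq (val_reg _ _) fun x hx => ?_
  refine wp_assign (v := s.rg 61) (by rw [val_reg, rg_setR, if_neg (by omega)]) fun y hy => ?_
  refine ⟨(h.st.setR ha x).setR hb y, h.bd, h.vw, fun i hi hi' => ?_⟩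
  rw [rg_setR, rg_setR, Function.update_apply, Function.update_apply, hx, hy, h.loc i hi hi']

variable (ok : p.Ok σ A B m)
include ok

/-- Preparing a block of a touched chunk preserves the invariant and makes all bits of the block
correct. -/
theorem Ok.wp_prep_inv (h : p.At H v F s) (hI : Inv p H v G) (hN : p.u ≤ N) {e : Expr} {k : ℕ}
    (he : val σ s e = k) (hk : k < p.M) (ht : G.perm (k / p.w) < H.T) :
    wp σ m N (prep e) (fun s' => p.At H (v.prep p k) F s' ∧ Inv p H (v.prep p k) G ∧
      BlockOk p (v.prep p k) G k) s := by
  obtain ⟨h1, h2, h3⟩ := ok.prep_ok hI hk ht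
  exact (ok.wp_prep h hN he hk h1).mono fun s' hs' => ⟨hs', h2, h3⟩

theorem Ok.wp_search (hA : A ≤ N) (hN : p.u ≤ N) (h : p.At H v F s) (hI : Inv p H v G) (j : Bool)
    {c g x : ℕ} (h34 : F 34 = c) (h35 : F 35 = g) (hc : c < p.K) (hcT : G.perm c < H.T)
    (h36 : F 36 = x) (hx : g ≠ 1 → x < p.n ∧ p.chk x = c) :
    wp σ m N (searchP B j) (fun s' => ∃ v' F', p.At H v' F' s' ∧ (∀ k < 40, F' k = F k) ∧
      Inv p H v' G ∧
      Found G j (fun e => e < p.n ∧ p.chk e = c ∧ (g = 1 ∨ e < x)) (F' 46) (F' 47)) s := by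
  have hcol : ∀ (v : View) e, (v.cb e = true ↔ G.X e) → (v.cb e = j ↔ G.Col j e) := by
    intro v e hh
    unfold Gh.Col
    rw [← hh]
    cases j <;> simp
  have c0 : ∀ t : State p.w, val σ t (.const 0) = 0 := fun t => ok.val_small _ (by omega)
  have c1 : ∀ t : State p.w, val σ t (.const 1) = 1 := fun t => ok.val_small _ (by omega)
  refine wp_call (h.assign (c0 _) (by omega)) fun s₁ h₁ => ?_
  refine wp_call (R := fun s' => ∃ v' F', p.At H v' F' s' ∧ (∀ k < 40, F' k = F k) ∧ Inv p H v' G ∧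
    ((F' 43 = 0 ∧ Found G j (fun e => e < p.n ∧ p.chk e = c ∧ (g = 1 ∨ e < x)) (F' 46) (F' 47)) ∨
      (F' 43 = 1 ∧ F' 44 < p.M ∧ F' 44 / p.w = c ∧ v'.fl j (F' 44) = j ∧
        (∀ e < p.n, p.sub e = F' 44 → g = 1 ∨ e < x) ∧
        ∀ e < p.n, p.chk e = c → g = 1 ∨ e < x → F' 44 < p.sub e → ¬ G.Col j e))) ?_ ?_
  · have e35 : val σ s₁ (Rg 35) = g := by
      rw [h₁.reg (by omega) (by omega)]; simpa using h35
    refine wp_ite (fun hb => ?_) fun hb => ?_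
    · rw [holds_eq, e35, c1] at hb
      refine wp_call (ok.wp_scanF hA hN h₁ j ((h₁.reg (by omega) (by omega)).trans
        (by simpa using h34)) hc) ?_
      rintro s₂ ⟨f₂, r₂⟩
      refine ((h₁.frame f₂ le_rfl).save (by omega) (by omega) (by omega)).mono fun s₃ h₃ => ?_
      refine ⟨v, _, h₃, fun k hk => ?_, hI, ?_⟩
      · rw [Function.update_of_ne (by omega), Function.update_of_ne (by omega),
          Function.update_of_ne (by omega)]
      · have q46 : Function.update (Function.update (Function.update F 46 0) 43 (s₂.rg 60)) 44
            (s₂.rg 61) 46 = 0 := by simp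
        have q43 : Function.update (Function.update (Function.update F 46 0) 43 (s₂.rg 60)) 44
            (s₂.rg 61) 43 = s₂.rg 60 := by simp
        have q44 : Function.update (Function.update (Function.update F 46 0) 43 (s₂.rg 60)) 44
            (s₂.rg 61) 44 = s₂.rg 61 := by simp
        rw [q46, q43, q44]
        rcases r₂ with ⟨r1, r2⟩ | ⟨r1, r2, r3, r4⟩
        · refine Or.inl ⟨r1, Or.inl ⟨rfl, fun e ⟨he, hec, _⟩ hcl => ?_⟩⟩
          refine r2 (p.sub e) ⟨ok.sub_lt he, hec⟩ ?_
          exact ((hI.colr j).flags _ (ok.sub_lt he) (by rw [show p.sub e / p.w = c from hec]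
                                                        exact hcT)).2 ⟨e, he, rfl, hcl⟩
        · refine Or.inr ⟨r1, r2.1, r2.2, r3, fun _ _ _ => Or.inl hb, fun e he hec _ hlt hcl => ?_⟩
          refine r4 (p.sub e) ⟨ok.sub_lt he, hec⟩ hlt ?_
          exact ((hI.colr j).flags _ (ok.sub_lt he) (by rw [show p.sub e / p.w = c from hec]
                                                        exact hcT)).2 ⟨e, he, rfl, hcl⟩
    · rw [holds_eq, e35, c1] at hb
      obtain ⟨hxn, hxc⟩ := hx hb
      have hkM := ok.sub_lt hxn
      have hkT : G.perm (p.sub x / p.w) < H.T := by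
        rw [show p.sub x / p.w = c from hxc]; exact hcT
      refine wp_call (ok.wp_blk h₁ ((h₁.reg (by omega) (by omega)).trans
        (by simpa using h36)) hxn) ?_
      rintro s₂ ⟨f₂, -, -, -, r₂⟩
      refine wp_call ((h₁.frame f₂ le_rfl).assign ((val_reg _ _).trans r₂) (by omega)) fun s₃ h₃ => ?_
      refine wp_call (ok.wp_prep_inv h₃ hI hN ((h₃.reg (by omega) (by omega)).trans
        (by simp)) hkM hkT) ?_
      rintro s₄ ⟨h₄, hI', hbk⟩
      refine wp_call (ok.wp_scanCx hA hN h₄ j ((h₄.reg (by omega) (by omega)).trans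
        (by simpa using h36)) hxn) ?_
      rintro s₅ ⟨f₅, r₅⟩
      refine wp_call ((h₄.frame f₅ le_rfl).save (by omega) (by omega) (by omega)) fun s₆ h₆ => ?_
      have e46 : val σ s₆ (Rg 46) = s₅.rg 60 := (h₆.reg (by omega) (by omega)).trans (by simp)
      have e45 : val σ s₆ (Rg 45) = p.sub x := (h₆.reg (by omega) (by omega)).trans (by simp)
      have hcb : ∀ e < p.n, p.sub e = p.sub x → ((v.prep p (p.sub x)).cb e = j ↔ G.Col j e) :=
        fun e he hes => hcol _ _ (hbk e he hes)
      refine wp_ite (fun hb' => ?_) fun hb' => ?_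
      · rw [holds_eq, e46, c1] at hb'
        refine (h₆.assign (c0 _) (by omega)).mono fun s₇ h₇ => ?_
        refine ⟨_, _, h₇, fun k hk => ?_, hI', Or.inl ⟨by simp, ?_⟩⟩
        · iterate 5 rw [Function.update_of_ne (by omega)]
        · rcases r₅ with ⟨r1, r2⟩ | ⟨r1, ⟨r2, r2'⟩, r3, r4⟩
          · omega
          · have q46 : s₅.rg 60 = 1 := r1
            have hen : s₅.rg 61 < p.n := by omega
            simp only [Function.update_self, ne_eq, Nat.reduceEqDiff, not_false_eq_true,
              Function.update_of_ne]
            refine Or.inr ⟨q46, ⟨hen, ?_, Or.inr r2⟩, (hcb _ hen r2').1 r3,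
              fun e' ⟨he', hec', hx'⟩ hlt hcl => ?_⟩
            · rw [← hxc, chk, r2', chk]
            · have hx' := hx'.resolve_left hb
              have hs1 := ok.sub_mono hlt.le
              have hs2 := ok.sub_mono hx'.le
              have hse : p.sub e' = p.sub x := by omega
              exact r4 e' ⟨hx', hse⟩ hlt ((hcb _ he' hse).2 hcl)
      · rw [holds_eq, e46, c1] at hb'
        have r₅ : s₅.rg 60 = 0 ∧ ∀ e, e < x ∧ p.sub e = p.sub x → (v.prep p (p.sub x)).cb e ≠ j :=
          r₅.resolve_right fun r => hb' r.1
        refine wp_call (ok.wp_scanFx hA hN h₆ j e45 hkM) ?_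
        rintro s₇ ⟨f₇, r₇⟩
        refine ((h₆.frame f₇ le_rfl).save (by omega) (by omega) (by omega)).mono fun s₈ h₈ => ?_
        refine ⟨_, _, h₈, fun k hk => ?_, hI', ?_⟩
        · iterate 6 rw [Function.update_of_ne (by omega)]
        simp only [Function.update_self, ne_eq, Nat.reduceEqDiff, not_false_eq_true,
          Function.update_of_ne]
        have hno : ∀ e < p.n, e < x → p.sub e = p.sub x → ¬ G.Col j e := fun e he hex hes hcl =>
          r₅.2 e ⟨hex, hes⟩ ((hcb e he hes).2 hcl)
        have hfl : ∀ e < p.n, p.chk e = c → G.Col j e → (v.prep p (p.sub x)).fl j (p.sub e) = j :=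
          fun e he hec hcl => ((hI.colr j).flags _ (ok.sub_lt he)
            (by rw [show p.sub e / p.w = c from hec]; exact hcT)).2 ⟨e, he, rfl, hcl⟩
        rcases r₇ with ⟨r1, r2⟩ | ⟨r1, ⟨r2, r2'⟩, r3, r4⟩
        · refine Or.inl ⟨r1, Or.inl ⟨r₅.1, fun e ⟨he, hec, hex⟩ hcl => ?_⟩⟩
          have hex := hex.resolve_left hb
          have := ok.sub_mono hex.le
          by_cases hse : p.sub e = p.sub x
          · exact hno e he hex hse hcl
          · exact r2 (p.sub e) ⟨by omega, hec.trans hxc.symm⟩ (hfl e he hec hcl)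
        · refine Or.inr ⟨r1, by omega, r2'.trans hxc, r3, fun e he hes => Or.inr ?_,
            fun e he hec hex hlt hcl => ?_⟩
          · by_contra hxe
            have := ok.sub_mono (not_lt.1 hxe)
            omega
          · have hex := hex.resolve_left hb
            have := ok.sub_mono hex.le
            by_cases hse : p.sub e = p.sub x
            · exact hno e he hex hse hcl
            · exact r4 (p.sub e) ⟨by omega, hec.trans hxc.symm⟩ hlt (hfl e he hec hcl)
  rintro s₂ ⟨v₂, F₂, h₂, a₂, hI₂, hs₂⟩
  have e43 : val σ s₂ (Rg 43) = F₂ 43 := h₂.reg (by omega) (by omega)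
  refine wp_ite (fun hb => ?_) fun hb => ?_
  · rw [holds_eq, e43, c1] at hb
    obtain ⟨-, r1, r2, r3, r4, r5⟩ := hs₂.resolve_left fun hh => by omega
    have hkT : G.perm (F₂ 44 / p.w) < H.T := by rw [r2]; exact hcT
    have e44 : val σ s₂ (Rg 44) = F₂ 44 := h₂.reg (by omega) (by omega)
    refine wp_call (ok.wp_prep_inv h₂ hI₂ hN e44 r1 hkT) ?_
    rintro s₃ ⟨h₃, hI', hbk⟩
    refine wp_call (ok.wp_scanC hA hN h₃ j (h₃.reg (by omega) (by omega)) r1) ?_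
    rintro s₄ ⟨f₄, q₄⟩
    refine ((h₃.frame f₄ le_rfl).save (by omega) (by omega) (by omega)).mono fun s₅ h₅ => ?_
    refine ⟨_, _, h₅, fun k hk => ?_, hI', ?_⟩
    · iterate 2 rw [Function.update_of_ne (by omega)]
      exact a₂ k hk
    simp only [Function.update_self, ne_eq, Nat.reduceEqDiff, not_false_eq_true,
      Function.update_of_ne]
    obtain ⟨e₀, he₀, hs₀, hcl₀⟩ := ((hI₂.colr j).flags _ r1 hkT).1 r3
    rcases q₄ with ⟨q1, q2⟩ | ⟨q1, ⟨q2, q2'⟩, q3, q4⟩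
    · exact absurd ((hcol _ _ (hbk e₀ he₀ hs₀)).2 hcl₀) (q2 e₀ ⟨he₀, hs₀⟩)
    · refine Or.inr ⟨q1, ⟨q2, ?_, r4 _ q2 q2'⟩, (hcol _ _ (hbk _ q2 q2')).1 q3,
        fun e' ⟨he', hec', hx'⟩ hlt hcl => ?_⟩
      · rw [chk, q2', r2]
      · have := ok.sub_mono hlt.le
        by_cases hse : p.sub e' = F₂ 44
        · exact q4 e' ⟨he', hse⟩ hlt ((hcol _ _ (hbk e' he' hse)).2 hcl)
        · exact r5 e' he' hec' hx' (by omega) hcl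
  · rw [holds_eq, e43, c1] at hb
    exact wp_skip ⟨v₂, F₂, h₂, a₂, hI₂, (hs₂.resolve_right fun hh => hb hh.1).2⟩

end Par
end ChoiceDict

/-! ### Enumeration and choice -/

namespace ChoiceDict

open WordRAM

/-- The header after the iteration over color `j` advances to the start of the chunk `c`. -/
def Hd.move (H : Hd) (j : Bool) (c : ℕ) : Hd :=
  { H with cur := Function.update H.cur j c, g := Function.update H.g j 1 }

/-- The ghost state after the iteration over color `j` leaves the chunk `c`. -/
def Gh.move (G : Gh) (j : Bool) (c : ℕ) (l : List ℕ) : Gh :=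
  { G with fr := Function.update G.fr j (G.fr j ++ [c]), bk := Function.update G.bk j l }

/-- `e` is what the iteration over color `j` should enumerate. -/
def Next (p : Par) (H : Hd) (G : Gh) (j : Bool) (e : ℕ) : Prop :=
  (e < p.n ∧ p.chk e = H.cur j ∧ (H.g j = 1 ∨ e < H.x j)) ∧ G.Col j e ∧
    ∀ e', e' < p.n ∧ p.chk e' = H.cur j ∧ (H.g j = 1 ∨ e' < H.x j) → e < e' → ¬ G.Col j e'

theorem Ready.bk_ne {p : Par} {H : Hd} {G : Gh} (h : Ready p H G) (hT : H.T < p.K) :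
    G.bk false ≠ [] := by
  rintro hb
  rcases h with h | h | h
  · omega
  · simp [hb] at h
  · simp [hb] at h

namespace Par

variable {σ : ℕ → ℕ} {m N : ℕ} {p : Par} {A B : ℕ} {H : Hd} {v : View} {G : Gh} {F : ℕ → ℕ}
  {s : State p.w} (ok : p.Ok σ A B m)
include ok

/-- When no element of its color is ahead of it in its chunk, the iteration may proceed to the next
chunk. -/
theorem Ok.move_inv (h : Inv p H v G) {j : Bool} {c : ℕ} {l : List ℕ} (hb : G.bk j = c :: l)
    (hno : ∀ e, e < p.n ∧ p.chk e = c ∧ (H.g j = 1 ∨ e < H.x j) → ¬ G.Col j e) :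
    Inv p (H.move j (l.headD 0)) v (G.move j c l) ∧
      Quiet p H G (H.move j (l.headD 0)) (G.move j c l) := by
  have hcur : H.cur j = c := by rw [h.base.cur, hb]; rfl
  have hl : ∀ i, (G.move j c l).fr i ++ (G.move j c l).bk i = G.fr i ++ G.bk i := by
    intro i
    by_cases hi : i = j
    · subst hi; simp [Gh.move, hb]
    · simp [Gh.move, hi]
  refine ⟨⟨{ h.base with
      cur := fun i => ?_, g_le := fun i => ?_, x_chk := fun i hg => ?_, fresh := fun hT hf => ?_ },
    fun i => ⟨(h.colr i).flags, ?_, ?_⟩⟩, rfl, fun i e he => ?_⟩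
  · by_cases hi : i = j
    · subst hi; simp [Gh.move, Hd.move]
    · simp [Gh.move, Hd.move, hi, h.base.cur]
  · by_cases hi : i = j
    · subst hi; simp [Hd.move]
    · simp [Hd.move, hi, h.base.g_le]
  · by_cases hi : i = j
    · subst hi; simp [Hd.move] at hg
    · simp only [Hd.move, Function.update_of_ne hi] at hg ⊢
      exact h.base.x_chk i hg
  · by_cases hi : false = j
    · subst hi; simp [Hd.move]
    · simp only [Hd.move, Gh.move, Function.update_of_ne hi] at hf ⊢
      exact h.base.fresh hT hf
  · rw [hl]; exact (h.colr i).ring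
  · rw [hl]; exact (h.colr i).mem
  · by_cases hi : i = j
    · subst hi
      unfold Ahead
      have hno' := hno e
      rw [hb, hcur]
      simp only [Gh.move, Hd.move, Function.update_self, List.cons_append, List.tail_cons,
        true_or, and_true]
      have ht : ∀ x, x ∈ l ++ [0] ↔ x ∈ (l ++ [0]).tail ∨ x = l.headD 0 := by
        intro x; cases l <;> simp [or_comm]
      rw [ht]
      refine ⟨by tauto, fun hc _ => ?_⟩
      tauto
    · unfold Ahead
      simp only [Gh.move, Hd.move, Function.update_of_ne hi]
      exact ⟨id, fun _ _ => id⟩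

/-- After `pullP`, an iteration over color `j` that has come to the end of its list has no elements
left in untouched chunks. -/
theorem Ok.touched_of_col (h : Inv p H v G) (hR : Ready p H G) {j : Bool} {e : ℕ} (he : e < p.n)
    (hc : G.Col j e) (hbk : G.bk j = []) : G.perm (p.chk e) < H.T := by
  by_contra hT
  cases j with
  | true => exact h.base.unt e he (not_lt.1 hT) (by simpa [Gh.Col] using hc)
  | false =>
    have := ok.chk_lt he
    rcases hR with hR | hR | hR
    · have := h.base.invol.fix (G.perm (p.chk e)) (by omega)
      rw [h.base.invol.inv] at this
      omega
    · simp [hbk] at hR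
    · simp [hbk] at hR

/-- `seekP` finds the next element of an iteration, or shows that nothing is ahead of it. -/
theorem Ok.wp_seek (hA : A ≤ N) (hN : p.u ≤ N) (h : p.At H v F s) (hI : Inv p H v G) (j : Bool) :
    wp σ m N (seekP B j) (fun s' => ∃ H' v' F' G', p.At H' v' F' s' ∧ (∀ k < 34, F' k = F k) ∧
      Inv p H' v' G' ∧ Quiet p H G H' G' ∧
      ((F' 46 = 0 ∧ ∀ e < p.n, G'.Col j e → ¬ Ahead p H' G' j e) ∨
        (F' 46 = 1 ∧ Next p H' G' j (F' 47) ∧ (H'.T < p.K → G'.bk false ≠ [])))) s := by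
  have c0 : ∀ t : State p.w, val σ t (.const 0) = 0 := fun t => ok.val_small _ (by omega)
  have c1 : ∀ t : State p.w, val σ t (.const 1) = 1 := fun t => ok.val_small _ (by omega)
  refine wp_call (ok.wp_pull h hI) ?_
  rintro s₁ ⟨H₁, v₁, F₁, G₁, h₁, a₁, I₁, Q₁, R₁⟩
  have rd : ∀ (v : View) F (s : State p.w), p.At H₁ v F s →
      val σ s (Rg (if j then 5 else 8)) = H₁.cur j ∧ val σ s (Rg (if j then 7 else 10)) = H₁.g j ∧
      val σ s (Rg (if j then 6 else 9)) = H₁.x j := by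
    intro v F s h
    cases j <;>
      exact ⟨h.par (by simp) (by simp), h.par (by simp) (by simp), h.par (by simp) (by simp)⟩
  refine wp_call (h₁.assign (rd _ _ _ h₁).1 (by omega)) fun s₂ h₂ => ?_
  refine wp_call (h₂.assign (rd _ _ _ h₂).2.1 (by omega)) fun s₃ h₃ => ?_
  refine wp_call (h₃.assign (rd _ _ _ h₃).2.2 (by omega)) fun s₄ h₄ => ?_
  obtain ⟨ck, ct⟩ := ok.cur_lt I₁ j
  refine wp_call (ok.wp_search hA hN h₄ I₁ j (c := H₁.cur j) (g := H₁.g j) (x := H₁.x j) (by simp)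
    (by simp) ck ct (by simp) fun hg => ⟨I₁.base.x_lt j, I₁.base.x_chk j (by
      have := I₁.base.g_le j; omega)⟩) ?_
  rintro s₅ ⟨v₅, F₅, h₅, a₅, I₅, fd⟩
  have b34 : F₅ 34 = H₁.cur j := by rw [a₅ _ (by omega)]; simp
  have bF : ∀ k < 34, F₅ k = F k := fun k hk => by
    rw [a₅ _ (by omega)]
    iterate 3 rw [Function.update_of_ne (by omega)]
    exact a₁ k (by omega)
  have e46 : val σ s₅ (Rg 46) = F₅ 46 := h₅.reg (by omega) (by omega)
  have e34 : val σ s₅ (Rg 34) = H₁.cur j := (h₅.reg (by omega) (by omega)).trans b34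
  have hcr := I₅.base.cur j
  refine wp_ite (fun hb => ?_) fun hb => ?_
  · rw [holds_eq, e46, c1] at hb
    obtain ⟨q1, q2⟩ := fd.resolve_left fun hh => by omega
    exact wp_skip ⟨H₁, v₅, F₅, G₁, h₅, bF, I₅, Q₁, Or.inr ⟨q1, q2, R₁.bk_ne⟩⟩
  rw [holds_eq, e46, c1] at hb
  obtain ⟨q46, qno⟩ := fd.resolve_right fun hh => hb hh.1
  refine wp_ite (fun hb' => ?_) fun hb' => ?_
  -- in chunk `0` the iteration ends
  · rw [holds_eq, e34, c0] at hb'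
    have hbk : G₁.bk j = [] := by
      cases hl : G₁.bk j with
      | nil => rfl
      | cons c l =>
        rw [hl] at hcr
        exact absurd (hcr.symm.trans hb') (((I₅.colr j).mem c).1 (by simp [hl])).1
    refine wp_skip ⟨H₁, v₅, F₅, G₁, h₅, bF, I₅, Q₁, Or.inl ⟨q46, fun e he hc ha => ?_⟩⟩
    have := ok.touched_of_col I₅ R₁ he hc hbk
    rcases ha with ha | ha | ha
    · simp [hbk] at ha
    · exact qno e ⟨he, ha.1, ha.2⟩ hc
    · omega
  -- from another chunk the iteration proceeds to the next one
  · rw [holds_eq, e34, c0] at hb'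
    obtain ⟨c, l, hl⟩ : ∃ c l, G₁.bk j = c :: l := by
      cases hl : G₁.bk j with
      | nil => rw [hl] at hcr; exact absurd hcr hb'
      | cons c l => exact ⟨c, l, rfl⟩
    have hcc : H₁.cur j = c := by rw [hcr, hl]; rfl
    rw [hcc] at ck ct qno hb' e34
    have hnx : v₅.rc (kn j) c = l.headD 0 := by
      have := (I₅.colr j).ring
      rw [hl] at this
      exact this.nx_mem
    refine wp_call (ok.load_rec h₅ (by omega) ck (by unfold kn; split <;> omega)
      (by unfold kn; split <;> omega) e34 (by omega)) fun s₆ h₆ => ?_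
    rw [hnx] at h₆
    refine wp_call (h₆.setCur j (h₆.reg (by omega) (by omega))) fun s₇ h₇ => ?_
    refine wp_call (h₇.setG j (c1 _)) fun s₈ h₈ => ?_
    refine wp_call (h₈.assign (c1 _) (by omega)) fun s₉ h₉ => ?_
    obtain ⟨I₉, Q₉⟩ := ok.move_inv I₅ hl qno
    have e34' : Function.update F₅ 34 (l.headD 0) 34 = l.headD 0 := by simp
    have k₉ : p.At (H₁.move j (l.headD 0)) v₅
        (Function.update (Function.update F₅ 34 (l.headD 0)) 35 1) s₉ := by
      rw [e34'] at h₉; exact h₉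
    obtain ⟨ck', ct'⟩ := ok.cur_lt I₉ j
    have hcm : (H₁.move j (l.headD 0)).cur j = l.headD 0 := by simp [Hd.move]
    have hgm : (H₁.move j (l.headD 0)).g j = 1 := by simp [Hd.move]
    rw [hcm] at ck' ct'
    refine (ok.wp_search hA hN k₉ I₉ j (c := l.headD 0) (g := 1)
      (x := (H₁.move j (l.headD 0)).x j) (by simp) (by simp) ck' ct' ?_
      fun hg => absurd rfl hg).mono ?_
    · rw [Function.update_of_ne (by omega), Function.update_of_ne (by omega), a₅ _ (by omega)]
      simp [Hd.move]
    rintro t ⟨v', F', h', a', I', fd'⟩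
    refine ⟨_, v', F', _, h', fun k hk => ?_, I', Q₁.trans Q₉, ?_⟩
    · rw [a' k (by omega), Function.update_of_ne (by omega), Function.update_of_ne (by omega),
        bF k hk]
    · rcases fd' with ⟨f1, f2⟩ | f
      · refine Or.inl ⟨f1, fun e he hc ha => ?_⟩
        have hl0 : l = [] := by
          cases l with
          | nil => rfl
          | cons c' l' =>
            obtain ⟨-, -, -, e', he', hce', hcl'⟩ := ((I₅.colr j).mem c').1 (by simp [hl])
            exact absurd hcl' (f2 e' ⟨he', hce', Or.inl rfl⟩)
        subst hl0
        have hch : p.chk e ≠ 0 := fun hh => f2 e ⟨he, hh, Or.inl rfl⟩ hc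
        rcases ha with ha | ha | ha
        · simp [Gh.move] at ha
        · exact hch (ha.1.trans hcm)
        · -- If `p.chk e` were untouched, there would have been a chunk after `c`, or all of `c` was
          -- searched, although `c` contains an element of color `j`.
          have hT : G₁.perm (p.chk e) < H₁.T := by
            by_contra hT
            have hT := not_lt.1 hT
            cases j with
            | true => exact I₅.base.unt e he hT (by simpa [Gh.Col, Gh.move] using hc)
            | false =>
              rcases R₁ with hR | hR | hR
              · have := I₅.base.invol.fix (G₁.perm (p.chk e)) (by omega)
                rw [I₅.base.invol.inv] at this
                have := ok.chk_lt he
                omega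
              · simp [hl] at hR
              · obtain ⟨-, -, -, e', he', hce', hcl'⟩ := ((I₅.colr false).mem c).1 (by simp [hl])
                exact qno e' ⟨he', hce', Or.inl hR.2⟩ hcl'
          exact absurd hT (not_lt.2 ha)
      · refine Or.inr ⟨f.1, ?_, fun hT => ?_⟩
        · unfold Next
          rw [hcm, hgm]
          exact f.2
        · cases j with
          | true => simpa [Gh.move] using R₁.bk_ne hT
          | false =>
            simp only [Gh.move, Function.update_self]
            rintro rfl
            rcases R₁ with hR | hR | hR
            · exact absurd hR (ne_of_lt hT)
            · simp [hl] at hR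
            · obtain ⟨-, -, -, e', he', hce', hcl'⟩ := ((I₅.colr false).mem c).1 (by simp [hl])
              exact qno e' ⟨he', hce', Or.inl hR.2⟩ hcl'

theorem Ok.wp_head (h : p.At H v F s) (hI : Inv p H v G) (j : Bool) :
    wp σ m N (headP j) (p.At H v (Function.update F 34 ((G.fr j ++ G.bk j).headD 0))) s := by
  have c0 : ∀ t : State p.w, val σ t (.const 0) = 0 := fun t => ok.val_small _ (by omega)
  have c1 : ∀ t : State p.w, val σ t (.const 1) = 1 := fun t => ok.val_small _ (by omega)
  have hK := ok.K_pos
  refine wp_call (h.assign (c0 _) (by omega)) fun s₁ h₁ => ?_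
  have e19 : val σ s₁ (Rg 19) = p.K := h₁.par (by omega) (by omega)
  refine wp_ite (fun hb => ?_) fun hb => ?_
  · rw [holds_lt, c1, e19] at hb
    refine (ok.load_rec h₁ hb hK (by unfold kn; split <;> omega)
      (by unfold kn; split <;> omega) (c0 _) (by omega)).mono fun s₂ h₂ => ?_
    rw [Function.update_idem, (hI.colr j).ring.nx_zero] at h₂
    exact h₂
  · rw [holds_lt, c1, e19] at hb
    -- for a single chunk, the list is empty
    have : G.fr j ++ G.bk j = [] := by
      refine List.eq_nil_iff_forall_not_mem.2 fun c hc => ?_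
      have := ((hI.colr j).mem c).1 hc
      omega
    rw [this]
    exact wp_skip h₁

/-- `anyP` finds an element of color `j`, if there is one. -/
theorem Ok.wp_any (hA : A ≤ N) (hN : p.u ≤ N) (h : p.At H v F s) (hI : Inv p H v G) (j : Bool) :
    wp σ m N (anyP B j) (fun s' => ∃ H' v' F' G', p.At H' v' F' s' ∧
      Inv p H' v' G' ∧ Quiet p H G H' G' ∧
      ((F' 46 = 0 ∧ ∀ e < p.n, ¬ G.Col j e) ∨ (F' 46 = 1 ∧ F' 47 < p.n ∧ G.Col j (F' 47)))) s := by
  have c1 : ∀ t : State p.w, val σ t (.const 1) = 1 := fun t => ok.val_small _ (by omega)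
  refine wp_call (ok.wp_pull h hI) ?_
  rintro s₁ ⟨H₁, v₁, F₁, G₁, h₁, -, I₁, Q₁, R₁⟩
  refine wp_call (ok.wp_head h₁ I₁ j) fun s₂ h₂ => ?_
  refine wp_call (h₂.assign (c1 _) (by omega)) fun s₄ h₄ => ?_
  have hK := ok.K_pos
  have hc : (G₁.fr j ++ G₁.bk j).headD 0 < p.K ∧
      G₁.perm ((G₁.fr j ++ G₁.bk j).headD 0) < H₁.T := by
    cases hl : G₁.fr j ++ G₁.bk j with
    | nil => exact ⟨hK, I₁.base.zero⟩
    | cons c l =>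
      have := ((I₁.colr j).mem c).1 (by simp [hl])
      exact ⟨this.2.1, this.2.2.1⟩
  refine (ok.wp_search hA hN h₄ I₁ j (by simp) (by simp) hc.1 hc.2 rfl fun hg => absurd rfl hg).mono ?_
  rintro s₅ ⟨v', F', h', -, I', fd⟩
  refine ⟨H₁, v', F', G₁, h', I', Q₁, ?_⟩
  rcases fd with ⟨f1, f2⟩ | ⟨f1, f2, f3, -⟩
  · refine Or.inl ⟨f1, fun e he hc => ?_⟩
    have hc := (Q₁.col j e).2 hc
    cases hl : G₁.fr j ++ G₁.bk j with
    | nil =>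
      rw [hl] at f2
      have hT := ok.touched_of_col I₁ R₁ he hc (List.append_eq_nil_iff.1 hl).2
      by_cases hz : p.chk e = 0
      · exact f2 e ⟨he, hz, Or.inl rfl⟩ hc
      · have := ((I₁.colr j).mem (p.chk e)).2 ⟨hz, ok.chk_lt he, hT, e, he, rfl, hc⟩
        simp [hl] at this
    | cons c l =>
      rw [hl] at f2
      obtain ⟨-, -, -, e', he', hce', hcl'⟩ := ((I₁.colr j).mem c).1 (by simp [hl])
      exact f2 e' ⟨he', hce', Or.inl rfl⟩ hcl'
  · exact Or.inr ⟨f1, f2.1, (Q₁.col j _).1 f3⟩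

end Par
end ChoiceDict

/-! ### Changing the color of an element -/

namespace ChoiceDict

open WordRAM

/-- Inserts the chunk `reg 24` at the start of the list for color `j`, where it is not ahead of the
iteration. -/
def linkP (j : Bool) : Prog :=
  .load 27 (recE (kn j) (.const 0)) ;; .store (recE (kp j) (Rg 27)) (Rg 24) ;;
  .store (recE (kp j) (Rg 24)) (.const 0) ;; .store (recE (kn j) (.const 0)) (Rg 24) ;;
  .store (recE (kn j) (Rg 24)) (Rg 27)

/-- Removes the chunk `reg 24` from the list for color `j`. If the iteration over color `j` has
reached the chunk, it proceeds to the next one. -/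
def unlinkP (j : Bool) : Prog :=
  .load 27 (recE (kn j) (Rg 24)) ;; .load 28 (recE (kp j) (Rg 24)) ;;
  .store (recE (kn j) (Rg 28)) (Rg 27) ;; .store (recE (kp j) (Rg 27)) (Rg 28) ;;
  .ite (.eq (Rg (if j then 5 else 8)) (Rg 24))
    (.assign (if j then 5 else 8) (Rg 27) ;; .assign (if j then 7 else 10) (.const 1)) .skip

/-- Takes into account that an element of block `reg 23` and chunk `reg 24` has acquired color
`j`. -/
def gainP (B : ℕ) (j : Bool) : Prog :=
  scanF B j (Rg 24) ;; saveP 25 26 ;; getF j (Rg 23) ;;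
  .ite (.eq (Rg 63) (.const j.toNat)) .skip (flipF j (Rg 23)) ;;
  .ite (.eq (Rg 25) (.const 1)) .skip (.ite (.eq (Rg 24) (.const 0)) .skip (linkP j))

/-- Takes into account that an element of block `reg 23` and chunk `reg 24` has lost color `j`. -/
def loseP (B : ℕ) (j : Bool) : Prog :=
  scanC B j (Rg 23) ;;
  .ite (.eq (Rg 60) (.const 1)) .skip
    (flipF j (Rg 23) ;; scanF B j (Rg 24) ;;
      .ite (.eq (Rg 60) (.const 1)) .skip (.ite (.eq (Rg 24) (.const 0)) .skip (unlinkP j)))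

/-- Determines in `reg 23` and `reg 24` the block and the chunk of the element `reg 22`, and
prepares them for the operation. -/
def openP : Prog :=
  blk (Rg 22) ;; .assign 23 (Rg 63) ;; .assign 24 (Rg 23 / Rg 11) ;; ensureP 24 ;;
  prep (Rg 23) ;; getC (Rg 22)

/-- Gives the element `reg 22` the color `j`. -/
def setP (B : ℕ) (j : Bool) : Prog :=
  openP ;;
  .ite (.eq (Rg 63) (.const j.toNat)) .skip (flipC (Rg 22) ;; gainP B j ;; loseP B (!j))

/-- The ghost state after `e` has got color `j`. -/
def Gh.put (G : Gh) (j : Bool) (e : ℕ) : Gh :=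
  { G with X := fun e' => if e' = e then j = true else G.X e' }

theorem Gh.put_col (G : Gh) (j i : Bool) (e e' : ℕ) :
    (G.put j e).Col i e' ↔ if e' = e then i = j else G.Col i e' := by
  unfold Gh.Col Gh.put
  split <;> cases i <;> cases j <;> simp [*]

/-- The ghost state after the chunk `c` was removed from the list for color `j`. -/
def Gh.unlink (G : Gh) (j : Bool) (c : ℕ) : Gh :=
  { G with
    fr := Function.update G.fr j ((G.fr j).erase c)
    bk := Function.update G.bk j ((G.bk j).erase c) }

/-- The header after the chunk `c`, with successor `c'`, was removed from the list for color `j`. -/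
def Hd.unlink (H : Hd) (j : Bool) (c c' : ℕ) : Hd := if H.cur j = c then H.move j c' else H

namespace Par

variable {σ : ℕ → ℕ} {m N : ℕ} {p : Par} {A B : ℕ} {H : Hd} {v v' : View} {G G' : Gh} {F : ℕ → ℕ}
  {s : State p.w} {j : Bool} {e : ℕ}

/-- A view of the same client bits is as good, even if it has another flag for a correct block. -/
theorem _root_.ChoiceDict.Base.congr (h : Base p H v G) {k : ℕ} (hb : BlockOk p v G k)
    (hcb : v'.cb = v.cb) (hcw : v'.cw = v.cw) (h6 : v'.rc 6 = v.rc 6)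
    (hfl : ∀ x ≠ k, v'.fl true x = v.fl true x) : Base p H v' G :=
  { h with
    ptr := by rw [h6]; exact h.ptr
    honest := fun e he hh => by
      rw [hcb]
      by_cases hk : p.sub e = k
      · exact hb e he hk
      · rw [hcw, hfl _ hk] at hh
        exact h.honest e he hh }

/-- The effect on a list of a change of the color of `e`. -/
theorem _root_.ChoiceDict.Colr.change (h : Colr p H v G j)
    (hX : ∀ e', e' ≠ e → (G'.Col j e' ↔ G.Col j e')) (hp : G'.perm = G.perm)
    (hT : G.perm (p.chk e) < H.T) (he : e < p.n) (hc : p.chk e < p.K)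
    (hfl : ∀ x ≠ p.sub e, v'.fl j x = v.fl j x)
    (hs : v'.fl j (p.sub e) = j ↔ ∃ e' < p.n, p.sub e' = p.sub e ∧ G'.Col j e')
    (hr : Ring (v'.rc (kn j)) (v'.rc (kp j)) (G'.fr j ++ G'.bk j))
    (hm : ∀ c ≠ p.chk e, c ∈ G'.fr j ++ G'.bk j ↔ c ∈ G.fr j ++ G.bk j)
    (hm' : p.chk e ∈ G'.fr j ++ G'.bk j ↔
      p.chk e ≠ 0 ∧ ∃ e' < p.n, p.chk e' = p.chk e ∧ G'.Col j e') :
    Colr p H v' G' j := by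
  refine ⟨fun x hx hxT => ?_, hr, fun c => ?_⟩
  · by_cases hxs : x = p.sub e
    · subst hxs; exact hs
    · rw [hp] at hxT
      rw [hfl x hxs, h.flags x hx hxT]
      refine exists_congr fun e' => and_congr_right fun _ => and_congr_right fun h' => ?_
      rw [hX]
      rintro rfl
      exact hxs h'.symm
  · by_cases hcc : c = p.chk e
    · subst hcc
      rw [hm', hp]
      tauto
    · rw [hm c hcc, h.mem c, hp]
      refine and_congr_right fun _ => and_congr_right fun _ => and_congr_right fun _ =>
        exists_congr fun e' => and_congr_right fun _ => and_congr_right fun h' => ?_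
      rw [hX]
      rintro rfl
      exact hcc h'.symm

theorem _root_.ChoiceDict.BlockOk.col {k : ℕ} (h : BlockOk p v G k) {j : Bool} {e : ℕ} (he : e < p.n)
    (hk : p.sub e = k) : v.cb e = j ↔ G.Col j e := by
  unfold Gh.Col
  rw [← h e he hk]
  cases j <;> simp

variable (ok : p.Ok σ A B m)
include ok

theorem Ok.put_base (h : Base p H v G) (hb : BlockOk p v G (p.sub e)) (he : e < p.n)
    (hT : G.perm (p.chk e) < H.T) (hj : ¬ G.Col j e) :
    Base p H (v.flipC p e) (G.put j e) ∧ BlockOk p (v.flipC p e) (G.put j e) (p.sub e) := by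
  have hb' : BlockOk p (v.flipC p e) (G.put j e) (p.sub e) := by
    intro e' he' hs
    have h1 := hb e' he' hs
    simp only [View.flipC, Gh.put]
    by_cases hee : e' = e
    · subst hee
      have hj' : ¬ (G.X e' ↔ j = true) := hj
      rw [← h1] at hj'
      simp only [if_true]
      cases j <;> cases hc : v.cb e' <;> simp_all
    · rw [if_neg hee, if_neg hee]
      exact h1
  refine ⟨{ h with unt := fun e' he' hu => ?_, honest := fun e' he' hh => ?_ }, hb'⟩
  · have hee : e' ≠ e := by rintro rfl; exact absurd hT (not_lt.2 hu)
    simp only [Gh.put, if_neg hee]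
    exact h.unt e' he' hu
  · by_cases hs : p.sub e' = p.sub e
    · exact hb' e' he' hs
    · have hee : e' ≠ e := by rintro rfl; exact hs rfl
      simp only [View.flipC, Gh.put, if_neg hee] at hh ⊢
      refine h.honest e' he' (hh.imp_left fun h' => h'.resolve_right fun h'' => hs ?_)
      have h2 := h''.2
      rw [ok.pos_eq, Nat.add_assoc, Nat.add_assoc, Nat.add_comm, Nat.add_comm (p.h * p.w),
        Nat.add_mul_div_right _ _ ok.w_pos, Nat.add_mul_div_right _ _ ok.w_pos] at h2
      unfold sub
      rw [Nat.add_right_cancel h2]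

theorem Ok.headD_lt {l : List ℕ} (h : ∀ c ∈ l, c < p.K) : l.headD 0 < p.K ∧ l.getLastD 0 < p.K := by
  refine ⟨?_, ?_⟩
  · cases l with
    | nil => exact ok.K_pos
    | cons c l => exact h c (by simp)
  · rcases List.eq_nil_or_concat l with rfl | ⟨l', c, rfl⟩
    · exact ok.K_pos
    · simpa using h c (by simp)

theorem Ok.wp_link (h : p.At H v F s) {c : ℕ} {l : List ℕ} (h24 : F 24 = c) (hc : c < p.K) (h0 : c ≠ 0)
    (hr : Ring (v.rc (kn j)) (v.rc (kp j)) l) (hl : ∀ c ∈ l, c < p.K) (hcl : c ∉ l) :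
    wp σ m N (linkP j) (fun s' => ∃ v' F', p.At H v' F' s' ∧ (∀ k < 25, F' k = F k) ∧
      v'.cb = v.cb ∧ v'.cw = v.cw ∧ v'.fl = v.fl ∧
      (∀ k, k ≠ kn j → k ≠ kp j → v'.rc k = v.rc k) ∧
      Ring (v'.rc (kn j)) (v'.rc (kp j)) (c :: l)) s := by
  have c0 : ∀ t : State p.w, val σ t (.const 0) = 0 := fun t => ok.val_small _ (by omega)
  have hK : 1 < p.K := by omega
  have k1 : 2 ≤ kn j := by unfold kn; split <;> omega
  have k2 : kn j < 8 := by unfold kn; split <;> omega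
  have k3 : 2 ≤ kp j := by unfold kp; split <;> omega
  have k4 : kp j < 8 := by unfold kp; split <;> omega
  have k5 : kn j ≠ kp j := by unfold kn kp; split <;> omega
  refine wp_call (ok.load_rec h hK ok.K_pos k1 k2 (c0 _) (by omega)) fun s₁ h₁ => ?_
  generalize hF : Function.update F 27 (v.rc (kn j) 0) = F₁ at h₁
  have vc : ∀ {v' s'}, p.At H v' F₁ s' → val σ s' (Rg 24) = c := fun h' =>
    (h'.reg (by omega) (by omega)).trans (by rw [← hF]; simpa using h24)
  have vy : ∀ {v' s'}, p.At H v' F₁ s' → val σ s' (Rg 27) = v.rc (kn j) 0 := fun h' =>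
    (h'.reg (by omega) (by omega)).trans (by rw [← hF]; simp)
  have hy : v.rc (kn j) 0 < p.K := by rw [hr.nx_zero]; exact (ok.headD_lt hl).1
  refine wp_call (ok.store_rec h₁ hK hy k3 k4 (vy h₁) (vc h₁)) fun s₂ h₂ => ?_
  refine wp_call (ok.store_rec h₂ hK hc k3 k4 (vc h₂) (c0 _)) fun s₃ h₃ => ?_
  refine wp_call (ok.store_rec h₃ hK ok.K_pos k1 k2 (c0 _) (vc h₃)) fun s₄ h₄ => ?_
  refine (ok.store_rec h₄ hK hc k1 k2 (vc h₄) (vy h₄)).mono fun s₅ h₅ => ?_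
  refine ⟨_, F₁, h₅, fun k hk => by rw [← hF, Function.update_of_ne (by omega)], rfl, rfl, rfl,
    fun k h1 h2 => ?_, hr.insertHead h0 hcl (fun x => ?_) fun x => ?_⟩
  · simp [View.setRec, h1, h2]
  · simp [View.setRec, k5]
  · simp [View.setRec, k5.symm]

theorem Ok.wp_unlink (h : p.At H v F s) {c : ℕ} {l : List ℕ} (h24 : F 24 = c) (h0 : c ≠ 0)
    (hr : Ring (v.rc (kn j)) (v.rc (kp j)) l) (hl : ∀ c ∈ l, c < p.K) (hcl : c ∈ l) :
    wp σ m N (unlinkP j) (fun s' => ∃ v' F', p.At (H.unlink j c (v.rc (kn j) c)) v' F' s' ∧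
      v'.cb = v.cb ∧ v'.cw = v.cw ∧ v'.fl = v.fl ∧
      (∀ k, k ≠ kn j → k ≠ kp j → v'.rc k = v.rc k) ∧
      Ring (v'.rc (kn j)) (v'.rc (kp j)) (l.erase c)) s := by
  have c1 : ∀ t : State p.w, val σ t (.const 1) = 1 := fun t => ok.val_small _ (by omega)
  have hc := hl c hcl
  have hK : 1 < p.K := by omega
  have k1 : 2 ≤ kn j := by unfold kn; split <;> omega
  have k2 : kn j < 8 := by unfold kn; split <;> omega
  have k3 : 2 ≤ kp j := by unfold kp; split <;> omega
  have k4 : kp j < 8 := by unfold kp; split <;> omega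
  have k5 : kn j ≠ kp j := by unfold kn kp; split <;> omega
  obtain ⟨l₁, l₂, hl₁, rfl, her⟩ := List.exists_erase_eq hcl
  have hx : v.rc (kp j) c < p.K := by
    rw [hr.pv_mem]; exact (ok.headD_lt fun c hc => hl c (by simp [hc])).2
  have hy : v.rc (kn j) c < p.K := by
    rw [hr.nx_mem]; exact (ok.headD_lt fun c hc => hl c (by simp [hc])).1
  refine wp_call (ok.load_rec h hK hc k1 k2 ((h.reg (by omega) (by omega)).trans h24) (by omega))
    fun s₁ h₁ => ?_
  refine wp_call (ok.load_rec h₁ hK hc k3 k4 ((h₁.reg (by omega) (by omega)).trans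
    (by simpa using h24)) (by omega)) fun s₂ h₂ => ?_
  generalize hF : Function.update (Function.update F 27 (v.rc (kn j) c)) 28 (v.rc (kp j) c) = F₁
    at h₂
  have vc : ∀ {v' s'}, p.At H v' F₁ s' → val σ s' (Rg 24) = c := fun h' =>
    (h'.reg (by omega) (by omega)).trans (by rw [← hF]; simpa using h24)
  have vy : ∀ {H' v' s'}, p.At H' v' F₁ s' → val σ s' (Rg 27) = v.rc (kn j) c := fun h' =>
    (h'.reg (by omega) (by omega)).trans (by rw [← hF]; simp)
  have vx : ∀ {v' s'}, p.At H v' F₁ s' → val σ s' (Rg 28) = v.rc (kp j) c := fun h' =>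
    (h'.reg (by omega) (by omega)).trans (by rw [← hF]; simp)
  refine wp_call (ok.store_rec h₂ hK hx k1 k2 (vx h₂) (vy h₂)) fun s₃ h₃ => ?_
  refine wp_call (ok.store_rec h₃ hK hy k3 k4 (vy h₃) (vx h₃)) fun s₄ h₄ => ?_
  have key : ∀ v', v' = (v.setRec (kn j) (v.rc (kp j) c) (v.rc (kn j) c)).setRec (kp j)
      (v.rc (kn j) c) (v.rc (kp j) c) → v'.cb = v.cb ∧ v'.cw = v.cw ∧ v'.fl = v.fl ∧
      (∀ k, k ≠ kn j → k ≠ kp j → v'.rc k = v.rc k) ∧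
      Ring (v'.rc (kn j)) (v'.rc (kp j)) ((l₁ ++ c :: l₂).erase c) := by
    rintro v' rfl
    refine ⟨rfl, rfl, rfl, fun k h1 h2 => ?_, ?_⟩
    · simp [View.setRec, h1, h2]
    · rw [her]
      refine hr.remove (fun x _ => ?_) fun x _ => ?_
      · simp [View.setRec, k5]
      · simp [View.setRec, k5.symm]
  have ec : val σ s₄ (Rg (if j then 5 else 8)) = H.cur j := by
    cases j <;> exact h₄.par (by simp) (by simp)
  refine wp_ite (fun hb => ?_) fun hb => ?_
  · rw [holds_eq, ec, vc h₄] at hb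
    refine wp_call (h₄.setCur j (vy h₄)) fun s₅ h₅ => ?_
    refine (h₅.setG j (c1 _)).mono fun s₆ h₆ => ⟨_, F₁, ?_, key _ rfl⟩
    rw [Hd.unlink, if_pos hb]
    exact h₆
  · rw [holds_eq, ec, vc h₄] at hb
    refine wp_skip ⟨_, F₁, ?_, key _ rfl⟩
    rw [Hd.unlink, if_neg hb]
    exact h₄

/-- The invariant and the iterations tolerate the removal of a chunk without elements of the
color. -/
theorem Ok.unlink_base (h : Base p H v G) {c : ℕ} (hc0 : c ≠ 0) (hnd : (G.fr j ++ G.bk j).Nodup)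
    (h0 : 0 ∉ G.fr j ++ G.bk j) (hcl : c ∈ G.fr j ++ G.bk j) {nx : ℕ → ℕ} {pv : ℕ → ℕ}
    (hr : Ring nx pv (G.fr j ++ G.bk j))
    (hno : ∀ e < p.n, p.chk e = c → ¬ G.Col j e) :
    Base p (H.unlink j c (nx c)) v (G.unlink j c) ∧
      Quiet p H G (H.unlink j c (nx c)) (G.unlink j c) := by
  have hbk : ∀ i, i ≠ j → (G.unlink j c).bk i = G.bk i := fun i hi => by simp [Gh.unlink, hi]
  have hbj : (G.unlink j c).bk j = (G.bk j).erase c := by simp [Gh.unlink]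
  have hcur := h.cur j
  have hun : H.cur j ≠ c → H.unlink j c (nx c) = H := fun hh => by rw [Hd.unlink, if_neg hh]
  have hun' : H.cur j = c → H.unlink j c (nx c) = H.move j (nx c) := fun hh => by
    rw [Hd.unlink, if_pos hh]
  have hT : (H.unlink j c (nx c)).T = H.T := by
    unfold Hd.unlink; split <;> rfl
  have hx : (H.unlink j c (nx c)).x = H.x := by
    unfold Hd.unlink; split <;> rfl
  have hHi : ∀ i ≠ j, (H.unlink j c (nx c)).cur i = H.cur i ∧ (H.unlink j c (nx c)).g i = H.g i := by
    intro i hi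
    unfold Hd.unlink
    split
    · simp [Hd.move, hi]
    · exact ⟨rfl, rfl⟩
  -- either the iteration has reached `c`, or it stays where it is
  have hcase : (∃ l, G.bk j = c :: l ∧ (G.unlink j c).bk j = l ∧ H.cur j = c ∧ nx c = l.headD 0) ∨
      H.cur j ≠ c ∧ ((G.bk j).erase c).headD 0 = (G.bk j).headD 0 ∧
        ((G.bk j).erase c = [] → G.bk j = []) ∧
        ∀ x, x ∈ ((G.bk j).erase c ++ [0]).tail ↔ x ∈ (G.bk j ++ [0]).tail ∧ x ≠ c := by
    cases hb : G.bk j with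
    | nil =>
      right
      rw [hb] at hcur
      refine ⟨fun hh => hc0 (hh.symm.trans hcur), by simp, by simp, fun x => by simp⟩
    | cons b l =>
      rw [hb] at hcur hnd hr
      by_cases hbc : b = c
      · subst hbc
        exact Or.inl ⟨l, rfl, by rw [hbj, hb]; simp, hcur, hr.nx_mem⟩
      · right
        refine ⟨fun hh => hbc (hcur.symm.trans hh), by simp [hbc], by simp [hbc], fun x => ?_⟩
        have hnl : l.Nodup := (List.nodup_cons.1 (List.nodup_append.1 hnd).2.1).2
        rw [List.erase_cons_tail (by simpa using hbc)]
        simp only [List.cons_append, List.tail_cons, List.mem_append, hnl.mem_erase_iff,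
          List.mem_singleton]
        constructor
        · rintro (⟨a, b⟩ | rfl)
          · exact ⟨Or.inl b, a⟩
          · exact ⟨Or.inr rfl, hc0.symm⟩
        · rintro ⟨a | a, b⟩
          · exact Or.inl ⟨b, a⟩
          · exact Or.inr a
  refine ⟨{ h with
    T_pos := by rw [hT]; exact h.T_pos
    T_le := by rw [hT]; exact h.T_le
    invol := by rw [hT]; exact h.invol
    zero := by rw [hT]; exact h.zero
    ptr := by rw [hT]; exact h.ptr
    unt := by rw [hT]; exact h.unt
    honest := by rw [hT]; exact h.honest
    x_lt := by rw [hx]; exact h.x_lt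
    cur := fun i => ?_, g_le := fun i => ?_, x_chk := fun i hg => ?_, fresh := fun hTK hf => ?_ },
    rfl, fun i e he => ?_⟩
  · by_cases hi : i = j
    · subst hi
      rcases hcase with ⟨l, h1, h2, h3, h4⟩ | ⟨h1, h2, -⟩
      · rw [hun' h3, h2, ← h4]; simp [Hd.move]
      · rw [hun h1, hbj, h2, hcur]
    · rw [hbk i hi, (hHi i hi).1, h.cur]
  · by_cases hi : i = j
    · subst hi
      unfold Hd.unlink
      split
      · simp [Hd.move]
      · exact h.g_le i
    · rw [(hHi i hi).2]; exact h.g_le i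
  · rw [hx]
    by_cases hi : i = j
    · subst hi
      by_cases hcc : H.cur i = c
      · rw [hun' hcc] at hg; simp [Hd.move] at hg
      · rw [hun hcc] at hg ⊢; exact h.x_chk i hg
    · rw [(hHi i hi).2] at hg
      rw [(hHi i hi).1]; exact h.x_chk i hg
  · rw [hT] at hTK
    by_cases hi : false = j
    · subst hi
      rcases hcase with ⟨l, h1, h2, h3, h4⟩ | ⟨h1, -, h2, -⟩
      · rw [hun' h3]; simp [Hd.move]
      · rw [hun h1]
        exact h.fresh hTK (h2 (hbj ▸ hf))
    · rw [hbk _ hi] at hf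
      rw [(hHi _ hi).2]
      exact h.fresh hTK hf
  · unfold Ahead
    rw [hT, hx]
    by_cases hi : i = j
    · subst hi
      have hne : G.Col i e → p.chk e ≠ c := fun h1 h2 => hno e he h2 h1
      rcases hcase with ⟨l, h1, h2, h3, h4⟩ | ⟨h1, h2, -, h4⟩
      · rw [hun' h3, h2, h1, h4]
        have ht : ∀ x, x ∈ l ++ [0] ↔ x ∈ (l ++ [0]).tail ∨ x = l.headD 0 := by
          intro x; cases l <;> simp [or_comm]
        simp only [Hd.move, Function.update_self, List.cons_append, List.tail_cons, true_or,
          and_true, h3, ht]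
        refine ⟨fun hh => ?_, fun hc _ hh => ?_⟩
        · rcases hh with hh | hh | hh
          · exact Or.inl (Or.inl hh)
          · exact Or.inl (Or.inr hh)
          · exact Or.inr (Or.inr hh)
        · rcases hh with (hh | hh) | hh | hh
          · exact Or.inl hh
          · exact Or.inr (Or.inl hh)
          · exact absurd hh.1 (hne hc)
          · exact Or.inr (Or.inr hh)
      · rw [hun h1, hbj, h4]
        exact ⟨fun hh => hh.imp_left And.left, fun hc _ hh => hh.imp_left fun h' => ⟨h', hne hc⟩⟩
    · rw [hbk i hi, (hHi i hi).1, (hHi i hi).2]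
      exact ⟨id, fun _ _ => id⟩

end Par
end ChoiceDict

namespace ChoiceDict.Par

open WordRAM

variable {σ : ℕ → ℕ} {m N : ℕ} {p : Par} {A B : ℕ} {H : Hd} {v : View} {G G' : Gh} {F : ℕ → ℕ}
  {s : State p.w} {j : Bool} {e : ℕ} (ok : p.Ok σ A B m)
include ok

theorem Ok.found_iff (h : Colr p H v G j) {c : ℕ} (hT : G.perm c < H.T) {a b : ℕ}
    (hl : LastF v j (fun s => s < p.M ∧ s / p.w = c) a b) :
    a = 1 ↔ ∃ e < p.n, p.chk e = c ∧ G.Col j e := by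
  rcases hl with ⟨h1, h2⟩ | ⟨h1, ⟨h2, h2'⟩, h3, -⟩
  · refine ⟨fun h => by omega, fun ⟨e, he, hc, hcl⟩ => ?_⟩
    exact absurd ((h.flags _ (ok.sub_lt he) (by rw [show p.sub e / p.w = c from hc]; exact hT)).2
      ⟨e, he, rfl, hcl⟩) (h2 _ ⟨ok.sub_lt he, hc⟩)
  · refine ⟨fun _ => ?_, fun _ => h1⟩
    obtain ⟨e, he, hs, hcl⟩ := (h.flags _ h2 (by rw [h2']; exact hT)).1 h3
    exact ⟨e, he, by rw [chk, hs, h2'], hcl⟩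

theorem Ok.val_color (s : State p.w) (j : Bool) : val σ s (.const j.toNat) = j.toNat :=
  ok.val_small _ (by cases j <;> simp)

theorem Ok.list_lt (h : Colr p H v G j) : ∀ c ∈ G.fr j ++ G.bk j, c < p.K := fun c hc =>
  ((h.mem c).1 hc).2.1

/-- After the color of `e` has become `j`, `gainP` restores the flags and the list for `j`. -/
theorem Ok.wp_gain (hA : A ≤ N) (hN : p.u ≤ N) (h : p.At H v F s) (he : e < p.n)
    (h23 : F 23 = p.sub e) (h24 : F 24 = p.chk e) (hT : G.perm (p.chk e) < H.T)
    (hb : Base p H v (G.put j e)) (hbl : BlockOk p v (G.put j e) (p.sub e)) (hC : Colr p H v G j) :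
    wp σ m N (gainP B j) (fun s' => ∃ v' F' l, p.At H v' F' s' ∧ (∀ k < 25, F' k = F k) ∧
      Base p H v' (G.put j e) ∧ BlockOk p v' (G.put j e) (p.sub e) ∧
      Colr p H v' { G.put j e with fr := Function.update G.fr j l } j ∧
      v'.fl (!j) = v.fl (!j) ∧ v'.rc (kn !j) = v.rc (kn !j) ∧ v'.rc (kp !j) = v.rc (kp !j)) s := by
  have c0 : ∀ t : State p.w, val σ t (.const 0) = 0 := fun t => ok.val_small _ (by omega)
  have c1 : ∀ t : State p.w, val σ t (.const 1) = 1 := fun t => ok.val_small _ (by omega)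
  have hcK := ok.chk_lt he
  have hsM := ok.sub_lt he
  refine wp_call (ok.wp_scanF hA hN h j ((h.reg (by omega) (by omega)).trans h24) hcK) ?_
  rintro s₁ ⟨f₁, r₁⟩
  have hfd := ok.found_iff hC hT r₁
  refine wp_call ((h.frame f₁ le_rfl).save (by omega) (by omega) (by omega)) fun s₂ h₂ => ?_
  generalize hF : Function.update (Function.update F 25 (s₁.rg 60)) 26 (s₁.rg 61) = F₂ at h₂
  have b25 : F₂ 25 = s₁.rg 60 := by rw [← hF]; simp
  have bF : ∀ k < 25, F₂ k = F k := fun k hk => by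
    rw [← hF, Function.update_of_ne (by omega), Function.update_of_ne (by omega)]
  have v23 : ∀ {v' s'}, p.At H v' F₂ s' → val σ s' (Rg 23) = p.sub e := fun h' =>
    (h'.reg (by omega) (by omega)).trans ((bF _ (by omega)).trans h23)
  have v24 : ∀ {v' s'}, p.At H v' F₂ s' → val σ s' (Rg 24) = p.chk e := fun h' =>
    (h'.reg (by omega) (by omega)).trans ((bF _ (by omega)).trans h24)
  refine wp_call (ok.wp_getF h₂ j (v23 h₂) hsM) ?_
  rintro s₃ ⟨f₃, -, r₃⟩
  refine wp_call (R := fun s' => ∃ v', p.At H v' F₂ s' ∧ v'.cb = v.cb ∧ v'.cw = v.cw ∧ v'.rc = v.rc ∧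
    (∀ i x, v'.fl i x = if i = j ∧ x = p.sub e then j else v.fl i x)) ?_ ?_
  · have e63 : val σ s₃ (Rg 63) = (v.fl j (p.sub e)).toNat := (val_reg _ _).trans r₃
    refine wp_ite (fun hb => ?_) fun hb => ?_
    · rw [holds_eq, e63, ok.val_color] at hb
      refine wp_skip ⟨v, h₂.frame f₃ le_rfl, rfl, rfl, rfl, fun i x => ?_⟩
      split
      · rename_i hh
        rw [hh.1, hh.2]
        revert hb; cases v.fl j (p.sub e) <;> cases j <;> simp
      · rfl
    · rw [holds_eq, e63, ok.val_color] at hb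
      have h₃ := h₂.frame f₃ le_rfl
      refine (ok.wp_flipF h₃ j (v23 h₃) hsM).mono fun s₄ h₄ => ⟨_, h₄, rfl, rfl, rfl, fun i x => ?_⟩
      simp only [View.flipF]
      split
      · rename_i hh
        rw [hh.1, hh.2]
        revert hb; cases v.fl j (p.sub e) <;> cases j <;> simp
      · rfl
  rintro s₄ ⟨v₄, h₄, wcb, wcw, wrc, wfl⟩
  have hcol : ∀ e', e' ≠ e → ((G.put j e).Col j e' ↔ G.Col j e') := fun e' hne => by
    rw [G.put_col, if_neg hne]
  have hcole : (G.put j e).Col j e := by rw [G.put_col, if_pos rfl]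
  have base : ∀ v' : View, v'.cb = v.cb → v'.cw = v.cw → (∀ k, k ≠ kn j → k ≠ kp j → v'.rc k = v.rc k) →
      v'.fl = v₄.fl → Base p H v' (G.put j e) ∧ BlockOk p v' (G.put j e) (p.sub e) ∧
        v'.fl (!j) = v.fl (!j) ∧ v'.rc (kn !j) = v.rc (kn !j) ∧
        v'.rc (kp !j) = v.rc (kp !j) := by
    intro v' h1 h2 h3 h4
    refine ⟨hb.congr hbl h1 h2 (h3 _ (by unfold kn; split <;> omega) (by unfold kp; split <;> omega))
      fun x hx => ?_, fun e' he' hs => ?_, ?_, ?_, ?_⟩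
    · rw [h4, wfl, if_neg fun hh => hx hh.2]
    · rw [h1]; exact hbl e' he' hs
    · funext x
      rw [h4, wfl, if_neg]
      cases j <;> simp
    · exact h3 _ (by cases j <;> simp [kn]) (by cases j <;> simp [kn, kp])
    · exact h3 _ (by cases j <;> simp [kn, kp]) (by cases j <;> simp [kp])
  have colr : ∀ (v' : View) (l : List ℕ), v'.fl = v₄.fl →
      Ring (v'.rc (kn j)) (v'.rc (kp j)) (l ++ G.bk j) →
      (∀ c ≠ p.chk e, c ∈ l ++ G.bk j ↔ c ∈ G.fr j ++ G.bk j) →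
      (p.chk e ∈ l ++ G.bk j ↔ p.chk e ≠ 0) →
      Colr p H v' { G.put j e with fr := Function.update G.fr j l } j := by
    intro v' l h1 h2 h3 h4
    have hl : ({ G.put j e with fr := Function.update G.fr j l } : Gh).fr j ++
        ({ G.put j e with fr := Function.update G.fr j l } : Gh).bk j = l ++ G.bk j := by
      simp [Gh.put]
    refine hC.change (e := e) hcol rfl hT he hcK (fun x hx => ?_) ?_ ?_ ?_ ?_
    · rw [h1, wfl, if_neg fun hh => hx hh.2]
    · rw [h1, wfl, if_pos ⟨rfl, rfl⟩]
      exact ⟨fun _ => ⟨e, he, rfl, hcole⟩, fun _ => rfl⟩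
    · rw [hl]; exact h2
    · rw [hl]; exact h3
    · rw [hl, h4]
      exact ⟨fun hh => ⟨hh, e, he, rfl, hcole⟩, And.left⟩
  have e25 : val σ s₄ (Rg 25) = s₁.rg 60 := (h₄.reg (by omega) (by omega)).trans b25
  have wr := hC.ring
  rw [← wrc] at wr
  have hmem := hC.mem (p.chk e)
  refine wp_ite (fun hb' => ?_) fun hb' => ?_
  · rw [holds_eq, e25, c1, hfd] at hb'
    obtain ⟨b1, b2, b3⟩ := base v₄ wcb wcw (fun _ _ _ => by rw [wrc]) rfl
    refine wp_skip ⟨v₄, F₂, G.fr j, h₄, bF, b1, b2, colr v₄ _ rfl wr (fun _ _ => Iff.rfl) ?_, b3⟩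
    rw [hmem]
    exact ⟨And.left, fun hh => ⟨hh, hcK, hT, hb'⟩⟩
  rw [holds_eq, e25, c1, hfd] at hb'
  have hnm : p.chk e ∉ G.fr j ++ G.bk j := fun hh => hb' (hmem.1 hh).2.2.2
  refine wp_ite (fun hb'' => ?_) fun hb'' => ?_
  · rw [holds_eq, v24 h₄, c0] at hb''
    obtain ⟨b1, b2, b3⟩ := base v₄ wcb wcw (fun _ _ _ => by rw [wrc]) rfl
    refine wp_skip ⟨v₄, F₂, G.fr j, h₄, bF, b1, b2, colr v₄ _ rfl wr (fun _ _ => Iff.rfl) ?_, b3⟩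
    exact ⟨fun hh => absurd hh hnm, fun hh => absurd hb'' hh⟩
  · rw [holds_eq, v24 h₄, c0] at hb''
    refine (ok.wp_link h₄ (((bF _ (by omega)).trans h24)) hcK hb'' wr (ok.list_lt hC) hnm).mono ?_
    rintro s₅ ⟨v', F', h', a', q1, q2, q3, q4, q5⟩
    obtain ⟨b1, b2, b3⟩ := base v' (q1.trans wcb) (q2.trans wcw)
      (fun k h1 h2 => by rw [q4 k h1 h2, wrc]) q3
    refine ⟨v', F', p.chk e :: G.fr j, h', fun k hk => (a' k hk).trans (bF k hk), b1, b2,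
      colr v' _ q3 q5 (fun c hc => ?_) ?_, b3⟩
    · simp [hc]
    · simp [hb'']

/-- After the color of `e` has changed from `j`, `loseP` restores the flags and the list for `j`. -/
theorem Ok.wp_lose (hA : A ≤ N) (hN : p.u ≤ N) (h : p.At H v F s) (he : e < p.n)
    (h23 : F 23 = p.sub e) (h24 : F 24 = p.chk e) (hT : G.perm (p.chk e) < H.T)
    (hb : Base p H v G') (hbl : BlockOk p v G' (p.sub e)) (hC : Colr p H v G j)
    (hX : ∀ e', e' ≠ e → (G'.Col j e' ↔ G.Col j e')) (hj : G.Col j e) (hj' : ¬ G'.Col j e)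
    (hp : G'.perm = G.perm) (hfr : G'.fr j = G.fr j) (hbk : G'.bk j = G.bk j) :
    wp σ m N (loseP B j) (fun s' => ∃ H' v' F' G'', p.At H' v' F' s' ∧ Base p H' v' G'' ∧
      Colr p H' v' G'' j ∧ Quiet p H G' H' G'' ∧ H'.T = H.T ∧
      G''.perm = G'.perm ∧ G''.fr (!j) = G'.fr (!j) ∧ G''.bk (!j) = G'.bk (!j) ∧
      v'.fl (!j) = v.fl (!j) ∧ v'.rc (kn !j) = v.rc (kn !j) ∧ v'.rc (kp !j) = v.rc (kp !j)) s := by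
  have c0 : ∀ t : State p.w, val σ t (.const 0) = 0 := fun t => ok.val_small _ (by omega)
  have c1 : ∀ t : State p.w, val σ t (.const 1) = 1 := fun t => ok.val_small _ (by omega)
  have hcK := ok.chk_lt he
  have hsM := ok.sub_lt he
  have v23 : ∀ {v' s'}, p.At H v' F s' → val σ s' (Rg 23) = p.sub e := fun h' =>
    (h'.reg (by omega) (by omega)).trans h23
  have v24 : ∀ {v' s'}, p.At H v' F s' → val σ s' (Rg 24) = p.chk e := fun h' =>
    (h'.reg (by omega) (by omega)).trans h24
  have hmem := hC.mem (p.chk e)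
  have hflag : v.fl j (p.sub e) = j := (hC.flags _ hsM hT).2 ⟨e, he, rfl, hj⟩
  refine wp_call (ok.wp_scanC hA hN h j (v23 h) hsM) ?_
  rintro s₁ ⟨f₁, r₁⟩
  have h₁ := h.frame f₁ le_rfl
  have e60 : val σ s₁ (Rg 60) = s₁.rg 60 := val_reg _ _
  -- the block may still contain an element of color `j`
  refine wp_ite (fun hb' => ?_) fun hb' => ?_
  · rw [holds_eq, e60, c1] at hb'
    obtain ⟨-, ⟨q1, q2⟩, q3, -⟩ := r₁.resolve_left fun hh => by omega
    have q4 := (hbl.col q1 q2).1 q3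
    have q5 : ∃ e' < p.n, p.chk e' = p.chk e ∧ G'.Col j e' := ⟨_, q1, by rw [chk, q2, chk], q4⟩
    refine wp_skip ⟨H, v, F, G', h₁, hb, hC.change hX hp hT he hcK (fun _ _ => rfl) ?_ ?_ ?_ ?_,
      Quiet.refl _ _ _, rfl, rfl, rfl, rfl, rfl, rfl, rfl⟩
    · exact ⟨fun _ => ⟨_, q1, q2, q4⟩, fun _ => hflag⟩
    · rw [hfr, hbk]; exact hC.ring
    · rw [hfr, hbk]; exact fun _ _ => Iff.rfl
    · rw [hfr, hbk, hmem]
      exact ⟨fun hh => ⟨hh.1, q5⟩, fun hh => ⟨hh.1, hcK, hT, e, he, rfl, hj⟩⟩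
  rw [holds_eq, e60, c1] at hb'
  have hno : ∀ e' < p.n, p.sub e' = p.sub e → ¬ G'.Col j e' := by
    intro e' he' hs hc
    rcases r₁ with ⟨-, r⟩ | ⟨r, -⟩
    · exact r e' ⟨he', hs⟩ ((hbl.col he' hs).2 hc)
    · exact hb' r
  refine wp_call (ok.wp_flipF h₁ j (v23 h₁) hsM) fun s₂ h₂ => ?_
  have wfl : ∀ i x, ¬ (i = j ∧ x = p.sub e) → (v.flipF j (p.sub e)).fl i x = v.fl i x :=
    fun i x hh => by simp only [View.flipF]; rw [if_neg hh]
  have wfj : (v.flipF j (p.sub e)).fl j (p.sub e) ≠ j := by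
    simp only [View.flipF, and_self, if_true]
    rw [hflag]; cases j <;> simp
  have wfo : (v.flipF j (p.sub e)).fl (!j) = v.fl (!j) := by
    funext x; rw [wfl]; cases j <;> simp
  have hb₂ : Base p H (v.flipF j (p.sub e)) G' := hb.congr hbl rfl rfl rfl fun x hx =>
    wfl _ _ fun hh => hx hh.2
  refine wp_call (ok.wp_scanF hA hN h₂ j (v24 h₂) hcK) ?_
  rintro s₃ ⟨f₃, r₃⟩
  have h₃ := h₂.frame f₃ le_rfl
  have e60 : val σ s₃ (Rg 60) = s₃.rg 60 := val_reg _ _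
  -- the flags are correct for the new ghost state, whether or not the list is
  have hfl₂ : ∀ x < p.M, G'.perm (x / p.w) < H.T → ((v.flipF j (p.sub e)).fl j x = j ↔
      ∃ e' < p.n, p.sub e' = x ∧ G'.Col j e') := by
    intro x hx hxT
    by_cases hxs : x = p.sub e
    · subst hxs
      exact ⟨fun hh => absurd hh wfj, fun ⟨e', h1, h2, h3⟩ => absurd h3 (hno e' h1 h2)⟩
    · rw [wfl _ _ fun hh => hxs hh.2, hC.flags x hx (by rw [← hp]; exact hxT)]
      refine exists_congr fun e' => and_congr_right fun _ => and_congr_right fun h' => ?_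
      rw [hX]
      rintro rfl
      exact hxs h'.symm
  have hfd : s₃.rg 60 = 1 ↔ ∃ e' < p.n, p.chk e' = p.chk e ∧ G'.Col j e' := by
    rcases r₃ with ⟨h1, h2⟩ | ⟨h1, ⟨h2, h2'⟩, h3, -⟩
    · refine ⟨fun h => by omega, fun ⟨e', he', hc, hcl⟩ => ?_⟩
      refine absurd ((hfl₂ _ (ok.sub_lt he') ?_).2 ⟨e', he', rfl, hcl⟩) (h2 _ ⟨ok.sub_lt he', hc⟩)
      rw [show p.sub e' / p.w = p.chk e from hc, hp]; exact hT
    · refine ⟨fun _ => ?_, fun _ => h1⟩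
      obtain ⟨e', he', hs, hcl⟩ := (hfl₂ _ h2 (by rw [h2', hp]; exact hT)).1 h3
      exact ⟨e', he', by rw [chk, hs, h2'], hcl⟩
  have hs₂ : (v.flipF j (p.sub e)).fl j (p.sub e) = j ↔
      ∃ e' < p.n, p.sub e' = p.sub e ∧ G'.Col j e' := hfl₂ _ hsM (by rw [hp]; exact hT)
  -- the chunk may still contain an element of color `j`
  refine wp_ite (fun hb'' => ?_) fun hb'' => ?_
  · rw [holds_eq, e60, c1, hfd] at hb''
    refine wp_skip ⟨H, _, F, G', h₃, hb₂, hC.change hX hp hT he hcK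
      (fun x hx => wfl _ _ fun hh => hx hh.2) hs₂ ?_ ?_ ?_,
      Quiet.refl _ _ _, rfl, rfl, rfl, rfl, wfo, rfl, rfl⟩
    · rw [hfr, hbk]; exact hC.ring
    · rw [hfr, hbk]; exact fun _ _ => Iff.rfl
    · rw [hfr, hbk, hmem]
      exact ⟨fun hh => ⟨hh.1, hb''⟩, fun hh => ⟨hh.1, hcK, hT, e, he, rfl, hj⟩⟩
  rw [holds_eq, e60, c1, hfd] at hb''
  refine wp_ite (fun hz => ?_) fun hz => ?_
  · rw [holds_eq, v24 h₃, c0] at hz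
    refine wp_skip ⟨H, _, F, G', h₃, hb₂, hC.change hX hp hT he hcK
      (fun x hx => wfl _ _ fun hh => hx hh.2) hs₂ ?_ ?_ ?_,
      Quiet.refl _ _ _, rfl, rfl, rfl, rfl, wfo, rfl, rfl⟩
    · rw [hfr, hbk]; exact hC.ring
    · rw [hfr, hbk]; exact fun _ _ => Iff.rfl
    · rw [hfr, hbk, hmem]
      exact ⟨fun hh => absurd hz hh.1, fun hh => absurd hz hh.1⟩
  · rw [holds_eq, v24 h₃, c0] at hz
    have hin : p.chk e ∈ G.fr j ++ G.bk j := hmem.2 ⟨hz, hcK, hT, e, he, rfl, hj⟩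
    refine (ok.wp_unlink h₃ h24 hz hC.ring (ok.list_lt hC) hin).mono ?_
    rintro s₄ ⟨v', F', h', q1, q2, q3, q4, q5⟩
    have hb₄ : Base p H v' G' := hb₂.congr (k := p.sub e) (fun e' he' hs => hbl e' he' hs) q1 q2
      (q4 _ (by unfold kn; split <;> omega) (by unfold kp; split <;> omega)) fun x _ => by rw [q3]
    have hr := hC.ring
    have hfb : G'.fr j ++ G'.bk j = G.fr j ++ G.bk j := by rw [hfr, hbk]
    obtain ⟨u1, u2⟩ := ok.unlink_base (j := j) (c := p.chk e) hb₄ hz (by rw [hfb]; exact hr.nodup)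
      (by rw [hfb]; exact hr.zero) (by rw [hfb]; exact hin) (by rw [hfb]; exact hr)
      fun e' he' hc hcl => hb'' ⟨e', he', hc, hcl⟩
    have hl : (G'.unlink j (p.chk e)).fr j ++ (G'.unlink j (p.chk e)).bk j =
        (G.fr j ++ G.bk j).erase (p.chk e) := by
      simp only [Gh.unlink, Function.update_self, hfr, hbk]
      rw [List.erase_append]
      split
      · rename_i hcf
        rw [List.erase_of_not_mem fun hcb => (List.nodup_append.1 hr.nodup).2.2 _ hcf _ hcb rfl]
      · rename_i hcf
        rw [List.erase_of_not_mem hcf]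
    have hTe : (H.unlink j (p.chk e) (v.rc (kn j) (p.chk e))).T = H.T := by
      unfold Hd.unlink; split <;> rfl
    have hne : (!j) ≠ j := by cases j <;> simp
    refine ⟨H.unlink j (p.chk e) (v.rc (kn j) (p.chk e)), v', F', _, h', u1, ?_, u2, hTe, rfl,
      by simp [Gh.unlink, hne], by simp [Gh.unlink, hne], by rw [q3, wfo], ?_, ?_⟩
    · have hC' : Colr p H v' (G'.unlink j (p.chk e)) j := by
        refine hC.change (e := e) hX hp hT he hcK (fun x hx => ?_) ?_ ?_ ?_ ?_
        · rw [q3]; exact wfl _ _ fun hh => hx hh.2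
        · rw [q3]; exact hs₂
        · rw [hl]; exact q5
        · rw [hl]
          exact fun c hc => by rw [hr.nodup.mem_erase_iff]; simp [hc]
        · rw [hl, hr.nodup.mem_erase_iff]
          exact ⟨fun hh => absurd rfl hh.1, fun hh => absurd hh.2 hb''⟩
      exact ⟨by rw [hTe]; exact hC'.flags, hC'.ring, by rw [hTe]; exact hC'.mem⟩
    · exact q4 _ (by cases j <;> simp [kn]) (by cases j <;> simp [kn, kp])
    · exact q4 _ (by cases j <;> simp [kn, kp]) (by cases j <;> simp [kp])

theorem Ok.wp_open (hN : p.u ≤ N) (h : p.At H v F s) (hI : Inv p H v G) (he : e < p.n)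
    (h22 : F 22 = e) :
    wp σ m N openP (fun s' => ∃ H' v' F' G', p.At H' v' F' s' ∧ Inv p H' v' G' ∧ Quiet p H G H' G' ∧
      BlockOk p v' G' (p.sub e) ∧ G'.perm (p.chk e) < H'.T ∧ F' 22 = e ∧ F' 23 = p.sub e ∧
      F' 24 = p.chk e ∧ s'.rg 63 = (v'.cb e).toNat) s := by
  have hsM := ok.sub_lt he
  refine wp_call (ok.wp_blk h ((h.reg (by omega) (by omega)).trans h22) he) ?_
  rintro s₁ ⟨f₁, -, -, -, r63⟩
  refine wp_call ((h.frame f₁ le_rfl).assign ((val_reg _ _).trans r63) (by omega)) fun s₂ h₂ => ?_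
  have e23 : val σ s₂ (Rg 23) = p.sub e := (h₂.reg (by omega) (by omega)).trans (by simp)
  have e11 : val σ s₂ (Rg 11) = p.w := h₂.par (by omega) (by omega)
  refine wp_call (h₂.assign (x := p.chk e) (by rw [val_div, e23, e11, chk]) (by omega)) fun s₃ h₃ => ?_
  refine wp_call (ok.wp_ensure h₃ hI (r := 24) (by omega) (by omega) (by simp) (ok.chk_lt he)) ?_
  rintro s₄ ⟨H₄, v₄, F₄, G₄, h₄, a₄, I₄, Q₄, T₄⟩
  have b22 : F₄ 22 = e := by rw [a₄ _ (by omega)]; simpa using h22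
  have b23 : F₄ 23 = p.sub e := by rw [a₄ _ (by omega)]; simp
  have b24 : F₄ 24 = p.chk e := by rw [a₄ _ (by omega)]; simp
  refine wp_call (ok.wp_prep_inv h₄ I₄ hN ((h₄.reg (by omega) (by omega)).trans b23) hsM T₄) ?_
  rintro s₅ ⟨h₅, I₅, bl₅⟩
  refine (ok.wp_getC h₅ ((h₅.reg (by omega) (by omega)).trans b22) he).mono ?_
  rintro s₆ ⟨f₆, r₆⟩
  exact ⟨H₄, _, F₄, G₄, h₅.frame f₆ le_rfl, I₅, Q₄, bl₅, T₄, b22, b23, b24, r₆⟩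

/-- `setP` gives `e` the color `j` without affecting the iterations otherwise. -/
theorem Ok.wp_set (hA : A ≤ N) (hN : p.u ≤ N) (h : p.At H v F s) (hI : Inv p H v G) (he : e < p.n)
    (h22 : F 22 = e) :
    wp σ m N (setP B j) (fun s' => ∃ H' v' F' G', p.At H' v' F' s' ∧ Inv p H' v' G' ∧
      G'.X = (G.put j e).X ∧ Evol p H G H' G') s := by
  refine wp_call (ok.wp_open hN h hI he h22) ?_
  rintro s₁ ⟨H₁, v₁, F₁, G₁, h₁, I₁, Q₁, bl₁, hT, b22, b23, b24, r63⟩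
  have e63 : val σ s₁ (Rg 63) = (v₁.cb e).toNat := (val_reg _ _).trans r63
  have hput : (G₁.put j e).X = (G.put j e).X := by simp only [Gh.put, Q₁.1]
  refine wp_ite (fun hb => ?_) fun hb => ?_
  · rw [holds_eq, e63, ok.val_color] at hb
    have hc : v₁.cb e = j := by revert hb; cases v₁.cb e <;> cases j <;> simp
    rw [bl₁.col he rfl] at hc
    refine wp_skip ⟨H₁, v₁, F₁, G₁, h₁, I₁, ?_, Q₁.2⟩
    rw [← hput]
    funext e'
    simp only [Gh.put]
    split
    · rename_i hh; rw [hh]; exact propext hc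
    · rfl
  · rw [holds_eq, e63, ok.val_color] at hb
    have hc : ¬ G₁.Col j e := by
      rw [← bl₁.col (j := j) he rfl]
      exact fun hh => hb (by rw [hh])
    refine wp_call (ok.wp_flipC h₁ ((h₁.reg (by omega) (by omega)).trans b22) he) fun s₂ h₂ => ?_
    obtain ⟨bs, bl₂⟩ := ok.put_base I₁.base bl₁ he hT hc
    have hco : ∀ i, Colr p H₁ (v₁.flipC p e) G₁ i := fun i =>
      ⟨(I₁.colr i).flags, (I₁.colr i).ring, (I₁.colr i).mem⟩
    refine wp_call (ok.wp_gain hA hN h₂ he b23 b24 hT bs bl₂ (hco j)) ?_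
    rintro s₃ ⟨v₃, F₃, l, h₃, a₃, bs₃, bl₃, C₃, q1, q2, q3⟩
    have hne : (!j) ≠ j := by cases j <;> simp
    have C₃' : Colr p H₁ v₃ G₁ (!j) :=
      ⟨by rw [q1]; exact (hco _).flags, by rw [q2, q3]; exact (hco _).ring, (hco _).mem⟩
    have hj' : ¬ (G₁.put j e).Col (!j) e := by rw [G₁.put_col, if_pos rfl]; exact hne
    refine (ok.wp_lose (j := !j) (G' := { G₁.put j e with fr := Function.update G₁.fr j l })
      hA hN h₃ he ((a₃ _ (by omega)).trans b23) ((a₃ _ (by omega)).trans b24) hT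
      { bs₃ with } bl₃ C₃' (fun e' hne' => ?_) ((G₁.col_not j e).2 hc) hj' rfl
      (Function.update_of_ne hne _ _) rfl).mono ?_
    · show (G₁.put j e).Col _ e' ↔ _
      rw [G₁.put_col, if_neg hne']
    rintro s₄ ⟨H', v', F', G'', h', b', C', Q', t1, t2, t3, t4, t5, t6, t7⟩
    rw [Bool.not_not] at t3 t4 t5 t6 t7
    have hcolX : ∀ i e', G''.Col i e' ↔ (G₁.put j e).Col i e' := fun i e' => Q'.col i e'
    have Cj : Colr p H' v' G'' j := by
      refine ⟨?_, by rw [t3, t4, t6, t7]; exact C₃.ring, ?_⟩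
      · rw [t1, t2, t5]
        simp only [hcolX]
        exact C₃.flags
      · rw [t1, t2, t3, t4]
        simp only [hcolX]
        exact C₃.mem
    refine ⟨H', v', F', G'', h', ⟨b', fun i => ?_⟩, Q'.1.trans hput, Q₁.evol fun i e' he' => ?_⟩
    · by_cases hi : i = j
      · rw [hi]; exact Cj
      · have : i = !j := by revert hi; cases i <;> cases j <;> simp
        rw [this]; exact C'
    · exact ⟨(Q'.2 i e' he').1, fun _ hc' =>
        (Q'.2 i e' he').2 ((hcolX i e').1 hc') hc'⟩

end ChoiceDict.Par

/-! ### The operations -/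

namespace ChoiceDict

open WordRAM

/-- Executes `body` between the loading and the storing of the header. The argument of the
operation is translated to the index of a client bit, in `reg 22`. -/
def withHdr (B : ℕ) (body : Prog) : Prog :=
  .assign 22 (Rg 0 - 1) ;; loadHdr ;; envA B ;; envB ;; body ;; storeHdr

/-- Returns the integer `reg r`. -/
def retP (r : ℕ) : Prog := .assign 0 (Rg r) ;; .assign 1 (.const 0)

/-- Returns the element found by a search, or zero. The element `2 ^ w` takes two words. -/
def retElemP : Prog :=
  .ite (.eq (Rg 46) (.const 1))
    (.assign 0 (Rg 47 + .const 1) ;;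
      .ite (.eq (Rg 0) (.const 0)) (.assign 1 (.const 1)) (.assign 1 (.const 0)))
    (.assign 0 (.const 0) ;; .assign 1 (.const 0))

/-- The operations that insert an element in the set of color `j`: `insert` for the client set and
`delete` for its complement. -/
def setOp (B : ℕ) (j : Bool) : Prog := withHdr B (setP B j)

/-- The operation `contains`. -/
def containsOp (B : ℕ) : Prog := withHdr B (openP ;; .assign 46 (Rg 63)) ;; retP 46

/-- The operation `choice` for the set of color `j`. -/
def choiceOp (B : ℕ) (j : Bool) : Prog := withHdr B (anyP B j) ;; retElemP

/-- The operation `iterate.init` for the set of color `j`. -/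
def initOp (B : ℕ) (j : Bool) : Prog :=
  withHdr B (headP j ;; .assign (if j then 5 else 8) (Rg 34) ;;
    .assign (if j then 7 else 10) (.const 1))

/-- The operation `iterate.next` for the set of color `j`. -/
def nextOp (B : ℕ) (j : Bool) : Prog :=
  withHdr B (seekP B j ;;
    .ite (.eq (Rg 46) (.const 1))
      (.assign (if j then 6 else 9) (Rg 47) ;; .assign (if j then 7 else 10) (.const 0)) .skip) ;;
  retElemP

/-- The operation `iterate.more` for the set of color `j`. -/
def moreOp (B : ℕ) (j : Bool) : Prog := withHdr B (seekP B j) ;; retP 46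

/-- The invariant between the executions of operations. -/
structure Rest (p : Par) (H : Hd) (G : Gh) (mem : ℕ → BitVec p.w) (wr : Set ℕ) : Prop where
  hdr : p.HdOk H mem
  bd : p.Bd wr
  inv : Inv p H (p.view mem wr) G

/-- The ghost state at the start of an iteration over color `j`. -/
def Gh.restart (G : Gh) (j : Bool) : Gh :=
  { G with
    fr := Function.update G.fr j []
    bk := Function.update G.bk j (G.fr j ++ G.bk j) }

/-- The header after the enumeration of `e`. -/
def Hd.emit (H : Hd) (j : Bool) (e : ℕ) : Hd :=
  { H with x := Function.update H.x j e, g := Function.update H.g j 0 }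

namespace Par

variable {σ : ℕ → ℕ} {m N : ℕ} {p : Par} {A B : ℕ} {H : Hd} {v : View} {G : Gh} {F : ℕ → ℕ}
  {s : State p.w} {j : Bool} {e : ℕ} (ok : p.Ok σ A B m)
include ok

theorem Ok.wp_withHdr (hA : A ≤ N) {s : State p.w} (hR : Rest p H G s.mem s.written) {body : Prog}
    {Post : Hd → Gh → (ℕ → ℕ) → Prop}
    (hb : ∀ v F s', p.At H v F s' → Inv p H v G → F 22 = (2 ^ p.w - 1 + s.rg 0) % 2 ^ p.w →
      wp σ m N body (fun s'' => ∃ H' v' F' G', p.At H' v' F' s'' ∧ Inv p H' v' G' ∧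
        Post H' G' F') s') :
    wp σ m N (withHdr B body) (fun s' => ∃ H' G' F', Rest p H' G' s'.mem s'.written ∧
      Post H' G' F' ∧ ∀ i, 22 ≤ i → i < 60 → s'.rg i = F' i) s := by
  have hrv := ok.rv_le hR.inv.base fun j => (ok.cur_lt hR.inv j).1
  have h1 : val σ s (1 : Expr) = 1 := ok.val_small s (by omega : 1 ≤ 4096)
  refine wp_assign_seq (v := (2 ^ p.w - 1 + s.rg 0) % 2 ^ p.w) (by rw [val_sub, h1, val_reg])
    fun x hx => ?_
  refine wp_call (ok.wp_loadHdr hrv _ hR.hdr) ?_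
  rintro s₁ ⟨m₁, w₁, r₁⟩
  rw [mem_setR] at m₁
  rw [written_setR] at w₁
  have r2 : s₁.rg 2 = p.n - 1 := by rw [r₁ _ (by omega), if_pos (by omega)]; rfl
  have r3 : s₁.rg 3 = p.t - 1 := by rw [r₁ _ (by omega), if_pos (by omega)]; rfl
  have r22 : s₁.rg 22 = (2 ^ p.w - 1 + s.rg 0) % 2 ^ p.w := by
    rw [r₁ _ (by omega), if_neg (by omega), rg_setR, if_pos rfl, hx]
  refine wp_call (ok.wp_envA hA s₁ r2) ?_
  rintro s₂ ⟨m₂, w₂, q11, q21, r₂⟩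
  refine wp_call (ok.wp_envB (H := H) s₂ (by rw [r₂ _ (by omega) (by omega) (by omega), r2])
    (by rw [r₂ _ (by omega) (by omega) (by omega), r3]) q11 q21) ?_
  rintro s₃ ⟨m₃, w₃, q, r₃⟩
  have hat : p.At H (p.view s.mem s.written) (fun i => s₃.rg i) s₃ := by
    refine ⟨fun i h1 h2 => ?_, by rw [w₃, w₂, w₁]; exact hR.bd, by rw [m₃, m₂, m₁, w₃, w₂, w₁],
      fun i _ _ => rfl⟩
    by_cases hi : i ≤ 10
    · rw [r₃ i (by omega) (by omega), r₂ i (by omega) (by omega) (by omega), r₁ i (by omega),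
        if_pos ⟨h1, hi⟩]
    · by_cases h11 : i = 11
      · subst h11; rw [r₃ _ (by omega) (by omega), q11]; rfl
      · by_cases h21 : i = 21
        · subst h21; rw [r₃ _ (by omega) (by omega), q21]; rfl
        · exact q i (by omega) (by omega)
  refine wp_call (hb _ _ s₃ hat hR.inv (by
    show s₃.rg 22 = _
    rw [r₃ _ (by omega) (by omega), r₂ _ (by omega) (by omega) (by omega), r22])) ?_
  rintro s₄ ⟨H', v', F', G', h', I', P'⟩
  refine (ok.wp_storeHdr (ok.rv_le I'.base fun j => (ok.cur_lt I' j).1) s₄ h'.st h'.bd).mono ?_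
  rintro s₅ ⟨f1, f2, f3, f4⟩
  exact ⟨H', G', F', ⟨f2, f3, by rw [f4, h'.vw]; exact I'⟩, P', fun i h1 h2 => by
    rw [f1 i h2, h'.loc i h1 h2]⟩

theorem Ok.wp_ret (s : State p.w) (r : ℕ) :
    wp σ m N (retP r) (fun s' => s'.mem = s.mem ∧ s'.written = s.written ∧
      s'.result = s.rg r) s := by
  refine wp_assign_seq (val_reg _ _) fun x hx => ?_
  refine wp_assign (ok.val_small _ (by omega)) fun y hy => ⟨rfl, rfl, ?_⟩
  have : ((s.setR 0 x).setR 1 y).result = ((s.setR 0 x).setR 1 y).rg 0 +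
    2 ^ p.w * ((s.setR 0 x).setR 1 y).rg 1 := rfl
  rw [this]
  simp [hx, hy]

theorem Ok.wp_retElem {s : State p.w} (h : s.rg 46 = 1 → s.rg 47 < p.n) :
    wp σ m N retElemP (fun s' => s'.mem = s.mem ∧ s'.written = s.written ∧
      s'.result = if s.rg 46 = 1 then s.rg 47 + 1 else 0) s := by
  have hres : ∀ t : State p.w, t.result = t.rg 0 + 2 ^ p.w * t.rg 1 := fun _ => rfl
  have c0 : ∀ t : State p.w, val σ t (.const 0) = 0 := fun t => ok.val_small _ (by omega)
  have c1 : ∀ t : State p.w, val σ t (.const 1) = 1 := fun t => ok.val_small _ (by omega)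
  refine wp_ite (fun hb => ?_) fun hb => ?_
  · rw [holds_eq, val_reg, c1] at hb
    have hn := h hb
    have hn' := ok.n_le
    refine wp_assign_seq (by rw [val_add, val_reg, c1]) fun x hx => ?_
    refine wp_ite (fun hb' => ?_) fun hb' => ?_
    · rw [holds_eq, val_reg, c0, rg_setR, if_pos rfl, hx] at hb'
      refine wp_assign (c1 _) fun y hy => ⟨rfl, rfl, ?_⟩
      have : s.rg 47 + 1 = 2 ^ p.w := by
        by_contra hne
        rw [Nat.mod_eq_of_lt (by omega)] at hb'
        omega
      rw [hres, if_pos hb]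
      simp [hx, hy, this]
    · rw [holds_eq, val_reg, c0, rg_setR, if_pos rfl, hx] at hb'
      refine wp_assign (c0 _) fun y hy => ⟨rfl, rfl, ?_⟩
      have : s.rg 47 + 1 < 2 ^ p.w := by
        by_contra hne
        rw [show s.rg 47 + 1 = 2 ^ p.w by omega, Nat.mod_self] at hb'
        omega
      rw [hres, if_pos hb]
      simp [hx, hy, Nat.mod_eq_of_lt this]
  · rw [holds_eq, val_reg, c1] at hb
    refine wp_assign_seq (c0 _) fun x hx => ?_
    refine wp_assign (c0 _) fun y hy => ⟨rfl, rfl, ?_⟩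
    rw [hres, if_neg hb]
    simp [hx, hy]

theorem Ok.wp_setOp (hA : A ≤ N) (hN : p.u ≤ N) {s : State p.w} (hR : Rest p H G s.mem s.written)
    (he : e < p.n) (h0 : (2 ^ p.w - 1 + s.rg 0) % 2 ^ p.w = e) :
    wp σ m N (setOp B j) (fun s' => ∃ H' G', Rest p H' G' s'.mem s'.written ∧
      G'.X = (G.put j e).X ∧ Evol p H G H' G') s := by
  refine (ok.wp_withHdr hA hR (Post := fun H' G' _ => G'.X = (G.put j e).X ∧ Evol p H G H' G')
    fun v F s' hat hI h22 => ?_).mono ?_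
  · exact ok.wp_set hA hN hat hI he (h22.trans h0)
  · rintro s' ⟨H', G', F', hr, hp, -⟩
    exact ⟨H', G', hr, hp⟩

theorem Ok.wp_containsOp (hA : A ≤ N) (hN : p.u ≤ N) {s : State p.w}
    (hR : Rest p H G s.mem s.written)
    (he : e < p.n) (h0 : (2 ^ p.w - 1 + s.rg 0) % 2 ^ p.w = e) :
    wp σ m N (containsOp B) (fun s' => ∃ H' G', Rest p H' G' s'.mem s'.written ∧
      Quiet p H G H' G' ∧ (G.X e ∧ s'.result = 1 ∨ ¬ G.X e ∧ s'.result = 0)) s := by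
  refine wp_call (ok.wp_withHdr hA hR (Post := fun H' G' F' => Quiet p H G H' G' ∧
    (G.X e ∧ F' 46 = 1 ∨ ¬ G.X e ∧ F' 46 = 0)) fun v F s' hat hI h22 => ?_) ?_
  · refine wp_call (ok.wp_open hN hat hI he (h22.trans h0)) ?_
    rintro s₁ ⟨H', v', F', G', h', I', Q', bl, -, -, -, -, r63⟩
    refine (h'.assign ((val_reg _ _).trans r63) (by omega)).mono fun s₂ h₂ => ?_
    refine ⟨H', v', _, G', h₂, I', Q', ?_⟩
    have := bl e he rfl
    rw [Q'.1] at this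
    rw [Function.update_self, ← this]
    cases v'.cb e <;> simp
  · rintro s' ⟨H', G', F', hr, hp, hF⟩
    refine (ok.wp_ret s' 46).mono ?_
    rintro s'' ⟨h1, h2, h3⟩
    rw [hF _ (by omega) (by omega)] at h3
    exact ⟨H', G', by rw [h1, h2]; exact hr, hp.1, by rw [h3]; exact hp.2⟩

theorem Ok.wp_choiceOp (hA : A ≤ N) (hN : p.u ≤ N) {s : State p.w}
    (hR : Rest p H G s.mem s.written) :
    wp σ m N (choiceOp B j) (fun s' => ∃ H' G', Rest p H' G' s'.mem s'.written ∧
      Quiet p H G H' G' ∧ ((s'.result = 0 ∧ ∀ e < p.n, ¬ G.Col j e) ∨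
        ∃ e < p.n, s'.result = e + 1 ∧ G.Col j e)) s := by
  refine wp_call (ok.wp_withHdr hA hR (Post := fun H' G' F' => Quiet p H G H' G' ∧
    ((F' 46 = 0 ∧ ∀ e < p.n, ¬ G.Col j e) ∨ (F' 46 = 1 ∧ F' 47 < p.n ∧ G.Col j (F' 47))))
    fun v F s' hat hI _ => ?_) ?_
  · exact ok.wp_any hA hN hat hI j
  · rintro s' ⟨H', G', F', hr, ⟨hq, hp⟩, hF⟩
    have e46 := hF 46 (by omega) (by omega)
    have e47 := hF 47 (by omega) (by omega)
    refine (ok.wp_retElem (s := s') ?_).mono ?_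
    · rcases hp with hp | hp
      · intro hh; omega
      · intro _; rw [e47]; exact hp.2.1
    rintro s'' ⟨h1, h2, h3⟩
    refine ⟨H', G', by rw [h1, h2]; exact hr, hq, ?_⟩
    rw [h3, e46, e47]
    rcases hp with hp | hp
    · exact Or.inl ⟨by simp [hp.1], hp.2⟩
    · exact Or.inr ⟨_, hp.2.1, by simp [hp.1], hp.2.2⟩

theorem Ok.restart_inv (hI : Inv p H v G) :
    Inv p (H.move j ((G.fr j ++ G.bk j).headD 0)) v (G.restart j) ∧
      (∀ e < p.n, G.Col j e → Ahead p (H.move j ((G.fr j ++ G.bk j).headD 0)) (G.restart j) j e) ∧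
      ∀ i ≠ j, ∀ e, Ahead p (H.move j ((G.fr j ++ G.bk j).headD 0)) (G.restart j) i e ↔
        Ahead p H G i e := by
  have hl : ∀ i, (G.restart j).fr i ++ (G.restart j).bk i = G.fr i ++ G.bk i := by
    intro i
    by_cases hi : i = j
    · subst hi; simp [Gh.restart]
    · simp [Gh.restart, hi]
  refine ⟨⟨{ hI.base with
    cur := fun i => ?_, g_le := fun i => ?_, x_chk := fun i hg => ?_, fresh := fun hT hf => ?_ },
    fun i => ⟨(hI.colr i).flags, by rw [hl]; exact (hI.colr i).ring,
      by rw [hl]; exact (hI.colr i).mem⟩⟩, fun e he hc => ?_, fun i hi e => ?_⟩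
  · by_cases hi : i = j
    · subst hi; simp [Gh.restart, Hd.move]
    · simp [Gh.restart, Hd.move, hi, hI.base.cur]
  · by_cases hi : i = j
    · subst hi; simp [Hd.move]
    · simp [Hd.move, hi, hI.base.g_le]
  · by_cases hi : i = j
    · subst hi; simp [Hd.move] at hg
    · simp only [Hd.move, Function.update_of_ne hi] at hg ⊢
      exact hI.base.x_chk i hg
  · by_cases hi : false = j
    · subst hi; simp [Hd.move]
    · simp only [Hd.move, Gh.restart, Function.update_of_ne hi] at hf ⊢
      exact hI.base.fresh hT hf
  · unfold Ahead
    simp only [Gh.restart, Hd.move, Function.update_self, true_or, and_true]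
    by_cases hT : H.T ≤ G.perm (p.chk e)
    · exact Or.inr (Or.inr hT)
    · have hin : p.chk e ∈ (G.fr j ++ G.bk j) ++ [0] := by
        by_cases hz : p.chk e = 0
        · simp [hz]
        · exact List.mem_append_left _ (((hI.colr j).mem _).2
            ⟨hz, ok.chk_lt he, not_le.1 hT, e, he, rfl, hc⟩)
      revert hin
      generalize G.fr j ++ G.bk j = l
      cases l
      · simp; tauto
      · simp; tauto
  · unfold Ahead
    simp only [Gh.restart, Hd.move, Function.update_of_ne hi]

theorem Ok.wp_initOp (hA : A ≤ N) {s : State p.w} (hR : Rest p H G s.mem s.written) :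
    wp σ m N (initOp B j) (fun s' => ∃ H' G', Rest p H' G' s'.mem s'.written ∧ G'.X = G.X ∧
      (∀ e < p.n, G.Col j e → Ahead p H' G' j e) ∧
      ∀ i ≠ j, ∀ e, Ahead p H' G' i e ↔ Ahead p H G i e) s := by
  refine (ok.wp_withHdr hA hR (Post := fun H' G' _ => G'.X = G.X ∧
    (∀ e < p.n, G.Col j e → Ahead p H' G' j e) ∧
    ∀ i ≠ j, ∀ e, Ahead p H' G' i e ↔ Ahead p H G i e) fun v F s' hat hI _ => ?_).mono ?_
  · obtain ⟨q1, q2⟩ := ok.restart_inv (j := j) hI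
    refine wp_call (ok.wp_head hat hI j) fun s₁ h₁ => ?_
    refine wp_call (h₁.setCur j (h₁.reg (by omega) (by omega))) fun s₂ h₂ => ?_
    refine (h₂.setG j (ok.val_small _ (by omega))).mono fun s₃ h₃ => ?_
    rw [Function.update_self] at h₃
    exact ⟨_, _, _, _, h₃, q1, rfl, q2⟩
  · rintro s' ⟨H', G', F', hr, hp, -⟩
    exact ⟨H', G', hr, hp⟩

theorem Ok.emit_inv (hI : Inv p H v G) (hn : Next p H G j e) (hf : H.T < p.K → G.bk false ≠ []) :
    Inv p (H.emit j e) v G ∧ Ahead p H G j e ∧ ¬ Ahead p (H.emit j e) G j e ∧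
      (∀ i, ∀ e' < p.n, Ahead p (H.emit j e) G i e' → Ahead p H G i e') ∧
      (∀ e' < p.n, G.Col j e' → e' ≠ e → Ahead p H G j e' → Ahead p (H.emit j e) G j e') ∧
      ∀ i ≠ j, ∀ e', Ahead p (H.emit j e) G i e' ↔ Ahead p H G i e' := by
  obtain ⟨⟨h1, h2, h3⟩, h4, h5⟩ := hn
  have hct := (ok.cur_lt hI j).2
  have hoth : ∀ i ≠ j, ∀ e', Ahead p (H.emit j e) G i e' ↔ Ahead p H G i e' := fun i hi e' => by
    unfold Ahead
    simp only [Hd.emit, Function.update_of_ne hi]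
  have hj : ∀ e', Ahead p (H.emit j e) G j e' ↔ p.chk e' ∈ (G.bk j ++ [0]).tail ∨
      p.chk e' = H.cur j ∧ e' < e ∨ H.T ≤ G.perm (p.chk e') := fun e' => by
    unfold Ahead
    simp [Hd.emit]
  have hback : ∀ e' < p.n, Ahead p (H.emit j e) G j e' → Ahead p H G j e' := fun e' he' hh => by
    rw [hj] at hh
    rcases hh with hh | hh | hh
    · exact Or.inl hh
    · exact Or.inr (Or.inl ⟨hh.1, h3.imp id fun h => by omega⟩)
    · exact Or.inr (Or.inr hh)
  refine ⟨⟨{ hI.base with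
    g_le := fun i => ?_, x_lt := fun i => ?_, x_chk := fun i hg => ?_, fresh := fun hT hb => ?_ },
    fun i => ⟨(hI.colr i).flags, (hI.colr i).ring, (hI.colr i).mem⟩⟩,
    Or.inr (Or.inl ⟨h2, h3⟩), ?_, fun i => ?_, fun e' he' hc hne hh => ?_, hoth⟩
  · by_cases hi : i = j
    · subst hi; simp [Hd.emit]
    · simp [Hd.emit, hi, hI.base.g_le]
  · by_cases hi : i = j
    · subst hi; simpa [Hd.emit] using h1
    · simp [Hd.emit, hi, hI.base.x_lt]
  · by_cases hi : i = j
    · subst hi; simpa [Hd.emit] using h2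
    · simp only [Hd.emit, Function.update_of_ne hi] at hg ⊢
      exact hI.base.x_chk i hg
  · exact absurd hb (hf hT)
  · rw [hj]
    rintro (hh | hh | hh)
    · have hcur := hI.base.cur j
      cases hb : G.bk j with
      | nil => simp [hb] at hh
      | cons c l =>
        rw [hb] at hh hcur
        have hr := (hI.colr j).ring
        rw [hb] at hr
        have hnd := List.nodup_cons.1 (List.nodup_append.1 hr.nodup).2.1
        have hz := hr.zero
        rw [h2, hcur] at hh
        simp only [List.headD_cons, List.cons_append, List.tail_cons, List.mem_append,
          List.mem_singleton] at hh
        rcases hh with hh | rfl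
        · exact hnd.1 hh
        · exact hz (by simp)
    · omega
    · rw [h2] at hh; omega
  · by_cases hi : i = j
    · subst hi; exact hback
    · exact fun e' _ hh => (hoth i hi e').1 hh
  · rw [hj]
    rcases hh with hh | hh | hh
    · exact Or.inl hh
    · refine Or.inr (Or.inl ⟨hh.1, ?_⟩)
      by_contra hlt
      exact h5 e' ⟨he', hh⟩ (by omega) hc
    · exact Or.inr (Or.inr hh)

theorem Ok.wp_nextOp (hA : A ≤ N) (hN : p.u ≤ N) {s : State p.w}
    (hR : Rest p H G s.mem s.written) :
    wp σ m N (nextOp B j) (fun s' => ∃ H₁ H' G', Rest p H' G' s'.mem s'.written ∧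
      Quiet p H G H₁ G' ∧
      ((s'.result = 0 ∧ H' = H₁ ∧ ∀ e < p.n, G'.Col j e → ¬ Ahead p H' G' j e) ∨
        ∃ e < p.n, s'.result = e + 1 ∧ G'.Col j e ∧ Ahead p H₁ G' j e ∧ ¬ Ahead p H' G' j e ∧
          (∀ i, ∀ e' < p.n, Ahead p H' G' i e' → Ahead p H₁ G' i e') ∧
          (∀ e' < p.n, G'.Col j e' → e' ≠ e → Ahead p H₁ G' j e' → Ahead p H' G' j e') ∧
          ∀ i ≠ j, ∀ e', Ahead p H' G' i e' ↔ Ahead p H₁ G' i e')) s := by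
  refine wp_call (ok.wp_withHdr hA hR (Post := fun H' G' F' => ∃ H₁, Quiet p H G H₁ G' ∧
    ((F' 46 = 0 ∧ H' = H₁ ∧ ∀ e < p.n, G'.Col j e → ¬ Ahead p H' G' j e) ∨
      (F' 46 = 1 ∧ F' 47 < p.n ∧ G'.Col j (F' 47) ∧
        Ahead p H₁ G' j (F' 47) ∧ ¬ Ahead p H' G' j (F' 47) ∧
          (∀ i, ∀ e' < p.n, Ahead p H' G' i e' → Ahead p H₁ G' i e') ∧
          (∀ e' < p.n, G'.Col j e' → e' ≠ F' 47 → Ahead p H₁ G' j e' → Ahead p H' G' j e') ∧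
          ∀ i ≠ j, ∀ e', Ahead p H' G' i e' ↔ Ahead p H₁ G' i e')))
    fun v F s' hat hI _ => ?_) ?_
  · refine wp_call (ok.wp_seek hA hN hat hI j) ?_
    rintro s₁ ⟨H₁, v₁, F₁, G₁, h₁, -, I₁, Q₁, hp⟩
    have e46 : val σ s₁ (Rg 46) = F₁ 46 := h₁.reg (by omega) (by omega)
    refine wp_ite (fun hb => ?_) fun hb => ?_
    · rw [holds_eq, e46, ok.val_small _ (by omega)] at hb
      obtain ⟨-, q1, q2⟩ := hp.resolve_left fun hh => by omega
      obtain ⟨I₂, q3⟩ := ok.emit_inv I₁ q1 q2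
      refine wp_call (h₁.setX j (h₁.reg (by omega) (by omega))) fun s₂ h₂ => ?_
      refine (h₂.setG j (ok.val_small _ (by omega))).mono fun s₃ h₃ => ?_
      exact ⟨H₁.emit j (F₁ 47), v₁, F₁, G₁, h₃, I₂, H₁, Q₁, Or.inr ⟨hb, q1.1.1, q1.2.1, q3⟩⟩
    · rw [holds_eq, e46, ok.val_small _ (by omega)] at hb
      obtain ⟨q1, q2⟩ := hp.resolve_right fun hh => hb hh.1
      exact wp_skip ⟨H₁, v₁, F₁, G₁, h₁, I₁, H₁, Q₁, Or.inl ⟨q1, rfl, q2⟩⟩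
  · rintro s' ⟨H', G', F', hr, ⟨H₁, hq, hp⟩, hF⟩
    have e46 := hF 46 (by omega) (by omega)
    have e47 := hF 47 (by omega) (by omega)
    refine (ok.wp_retElem (s := s') ?_).mono ?_
    · rcases hp with hp | hp
      · intro hh; omega
      · intro _; rw [e47]; exact hp.2.1
    rintro s'' ⟨h1, h2, h3⟩
    refine ⟨H₁, H', G', by rw [h1, h2]; exact hr, hq, ?_⟩
    rw [h3, e46, e47]
    rcases hp with hp | hp
    · exact Or.inl ⟨by simp [hp.1], hp.2⟩
    · exact Or.inr ⟨_, hp.2.1, by simp [hp.1], hp.2.2⟩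

theorem Ok.wp_moreOp (hA : A ≤ N) (hN : p.u ≤ N) {s : State p.w}
    (hR : Rest p H G s.mem s.written) :
    wp σ m N (moreOp B j) (fun s' => ∃ H' G', Rest p H' G' s'.mem s'.written ∧
      Quiet p H G H' G' ∧
      ((s'.result = 0 ∧ ∀ e < p.n, G'.Col j e → ¬ Ahead p H' G' j e) ∨
        s'.result = 1 ∧ ∃ e < p.n, G'.Col j e ∧ Ahead p H' G' j e)) s := by
  refine wp_call (ok.wp_withHdr hA hR (Post := fun H' G' F' => Quiet p H G H' G' ∧
    ((F' 46 = 0 ∧ ∀ e < p.n, G'.Col j e → ¬ Ahead p H' G' j e) ∨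
      F' 46 = 1 ∧ ∃ e < p.n, G'.Col j e ∧ Ahead p H' G' j e)) fun v F s' hat hI _ => ?_) ?_
  · refine (ok.wp_seek hA hN hat hI j).mono ?_
    rintro s₁ ⟨H₁, v₁, F₁, G₁, h₁, -, I₁, Q₁, hp⟩
    refine ⟨H₁, v₁, F₁, G₁, h₁, I₁, Q₁, hp.imp id fun hh => ⟨hh.1, _, hh.2.1.1.1, hh.2.1.2.1, ?_⟩⟩
    exact Or.inr (Or.inl hh.2.1.1.2)
  · rintro s' ⟨H', G', F', hr, ⟨hq, hp⟩, hF⟩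
    refine (ok.wp_ret s' 46).mono ?_
    rintro s'' ⟨h1, h2, h3⟩
    rw [hF _ (by omega) (by omega)] at h3
    exact ⟨H', G', by rw [h1, h2]; exact hr, hq, by rw [h3]; exact hp⟩

end Par
end ChoiceDict

/-! ### The initialization -/

namespace ChoiceDict

open WordRAM

/-- The bitwise disjunction of the `k` registers from `r`. -/
def orE : ℕ → ℕ → Expr
  | _, 0 => .const 0
  | r, k + 1 => Rg r ||| orE (r + 1) k

/-- Fills the words from address `reg 61` up to, but not including, `reg 62` with zeros. -/
def zeroP : Prog :=
  .loop (.lt (Rg 61) (Rg 62)) (.store (Rg 61) (.const 0) ;; .assign 61 (Rg 61 + .const 1))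

/-- The initialization. A tradeoff parameter that exceeds `(n - 1) / w + 1` is replaced by that number,
so that it fits into the header. Beyond the header, zeros are stored only in the words at the two
ends of the client bits, in the flags of the first chunk, and in its record. -/
def initP (κ B : ℕ) : Prog :=
  .assign 0 (Rg 0 - 1) ;; .assign 1 (orE 3 (κ - 1)) ;; .assign 3 (Rg 2 - 1) ;; .assign 2 (Rg 0) ;;
  envA B ;; .assign 0 (Rg 2 / Rg 11) ;;
  .ite (.eq (Rg 1) (.const 0)) (.ite (.lt (Rg 3) (Rg 0)) .skip (.assign 3 (Rg 0)))
    (.assign 3 (Rg 0)) ;;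
  envB ;;
  .assign 61 (.const 0) ;; .assign 62 (Rg 12 + .const 1) ;; zeroP ;;
  .assign 61 (Rg 14) ;;
  .ite (.eq (Rg 19) (.const 1))
    (.assign 62 (Rg 14 + (Rg 15 + .const 2 * Rg 17 - .const 1) / Rg 11 + .const 1))
    (.assign 62 (Rg 14 + .const 11)) ;;
  zeroP ;;
  .assign 4 (.const 1) ;; .assign 5 (.const 0) ;; .assign 6 (.const 0) ;; .assign 7 (.const 1) ;;
  .assign 8 (.const 0) ;; .assign 9 (.const 0) ;; .assign 10 (.const 1) ;; storeHdr

theorem val_orE {w : ℕ} {σ : ℕ → ℕ} (s : State w) : ∀ r k : ℕ, val σ s (orE r k) = 0 ↔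
    ∀ i, r ≤ i → i < r + k → s.rg i = 0
  | r, 0 => by simp [orE, val_const]; intros; omega
  | r, k + 1 => by
    have h := val_orE (σ := σ) s (r + 1) k
    have h1 : val σ s (orE r (k + 1)) = s.rg r ||| val σ s (orE (r + 1) k) := by
      rw [orE, val_or, val_reg]
    rw [h1, Nat.or_eq_zero_iff, h]
    refine ⟨fun ⟨h1, h2⟩ i hi hi' => ?_, fun hh => ⟨hh r (by omega) (by omega),
      fun i hi hi' => hh i (by omega) (by omega)⟩⟩
    by_cases hr : i = r
    · rw [hr, h1]
    · exact h2 i (by omega) (by omega)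

theorem wp_zero {w : ℕ} {σ : ℕ → ℕ} {m N : ℕ} (hw : 1 ≤ w) (s : State w) {a b : ℕ}
    (h61 : s.rg 61 = a) (h62 : s.rg 62 = b)
    (hab : a ≤ b) (hN : b - a ≤ N) (hm : ∀ x, a ≤ x → x < b → x < m) :
    wp σ m N zeroP (fun s' => (∀ i < 60, s'.rg i = s.rg i) ∧
      (∀ x, s'.mem x = if a ≤ x ∧ x < b then 0 else s.mem x) ∧
      ∀ x, x ∈ s'.written ↔ (a ≤ x ∧ x < b) ∨ x ∈ s.written) s := by
  have hb : b < 2 ^ w := by rw [← h62]; exact (s.reg 62).isLt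
  have h2w : 2 ≤ 2 ^ w := by
    calc 2 = 2 ^ 1 := rfl
      _ ≤ 2 ^ w := Nat.pow_le_pow_right (by omega) hw
  refine wp_loop rfl (fun k s' => k ≤ b - a ∧ s'.rg 61 = b - k ∧ s'.rg 62 = b ∧
    (∀ i < 60, s'.rg i = s.rg i) ∧
      (∀ x, s'.mem x = if a ≤ x ∧ x < b - k then 0 else s.mem x) ∧
      ∀ x, x ∈ s'.written ↔ (a ≤ x ∧ x < b - k) ∨ x ∈ s.written) ?_ ?_ (b - a) hN ?_
  · rintro k s' ⟨hk, r1, r2, r3, r4, r5⟩ ht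
    rw [holds_lt, val_reg, val_reg, r1, r2] at ht
    obtain ⟨k, rfl⟩ : ∃ k', k = k' + 1 := ⟨k - 1, by omega⟩
    refine ⟨k, rfl, wp_store_seq (a := b - (k + 1)) (v := 0) ((val_reg _ _).trans r1)
      (val_const_of_lt _ _ (Nat.two_pow_pos w)) (hm _ (by omega) (by omega)) fun x hx => ?_⟩
    obtain rfl : x = 0 := BitVec.eq_of_toNat_eq (by simp [hx])
    refine wp_assign (v := b - k) ?_ fun y hy => ⟨by omega, ?_, ?_, fun i hi => ?_, fun x => ?_,
      fun x => ?_⟩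
    · refine (val_add_of_lt (x := b - (k + 1)) (y := 1) _ _ _
        (by rw [val_reg, rg_setM, r1]) (val_const_of_lt _ _ (by omega)) (by omega)).trans ?_
      omega
    · rw [rg_setR, if_pos rfl, hy]
    · rw [rg_setR, if_neg (by omega), rg_setM, r2]
    · rw [rg_setR, if_neg (by omega), rg_setM, r3 i hi]
    · rw [mem_setR, mem_setM, Function.update_apply, r4]
      split_ifs <;> first | rfl | omega
    · rw [written_setR, written_setM, Set.mem_insert_iff, r5]
      constructor
      · rintro (rfl | h | h)
        · left; omega
        · left; omega
        · exact Or.inr h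
      · rintro (h | h)
        · by_cases hx : x = b - (k + 1)
          · exact Or.inl hx
          · right; left; omega
        · exact Or.inr (Or.inr h)
  · rintro k s' ⟨hk, r1, r2, r3, r4, r5⟩ ht
    rw [holds_lt, val_reg, val_reg, r1, r2] at ht
    have : b - k = b := by omega
    rw [this] at r4 r5
    exact ⟨r3, r4, r5⟩
  · refine ⟨le_rfl, by rw [h61]; omega, h62, fun _ _ => rfl, fun x => ?_, fun x => ?_⟩
    · rw [if_neg (by omega)]
    · constructor
      · exact Or.inr
      · rintro (h | h)
        · omega
        · exact h

/-- The header after the initialization. -/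
def Hd.initial : Hd where
  T := 1
  cur := fun _ => 0
  x := fun _ => 0
  g := fun _ => 1

/-- The ghost state after the initialization: there are no clients, and only chunk `0` is touched. -/
def Gh.initial : Gh where
  X := fun _ => False
  perm := id
  fr := fun _ => []
  bk := fun _ => []

namespace Par

variable {σ : ℕ → ℕ} {m N : ℕ} {p : Par} {A B : ℕ} (ok : p.Ok σ A B m)
include ok

theorem Ok.initial_inv {mem : ℕ → BitVec p.w} {wr : Set ℕ} (hz : ∀ a ∈ wr, mem a = 0)
    (hf : ∀ j, ∀ s < p.M0, p.flagPos j s / p.w ∈ wr) (hr : 1 < p.K → ∀ k < 8, p.Q + k ∈ wr) :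
    Inv p Hd.initial (p.view mem wr) Gh.initial := by
  have hbit : ∀ q, q / p.w ∈ wr → memBit mem q = false := fun q hq => by
    unfold memBit
    rw [hz _ hq]
    simp
  have hfl : ∀ j s, s < p.M → s / p.w < 1 → (p.view mem wr).fl j s = false := fun j s hs hs' => by
    simp only [view, hbit _ (hf j s ((ok.lt_M0 hs).1 (Nat.lt_one_iff.1 hs'))), Bool.and_false]
  have hrc : ∀ k, (p.view mem wr).rc k 0 = 0 := fun k => by
    simp only [view]
    split
    · rename_i h
      rw [Nat.mul_zero, Nat.add_zero, hz _ (hr h.2.2.2 k h.2.1)]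
      simp
    · rfl
  have hK := ok.K_pos
  refine ⟨⟨le_rfl, hK, ⟨fun _ => rfl, fun x hx => absurd rfl hx, fun _ _ => rfl⟩, Nat.one_pos,
    fun x _ hx => ?_, fun _ _ _ => id, fun e he hh => ?_, fun _ => rfl, fun _ => le_rfl,
    fun _ => ok.n_pos, fun _ hg => absurd hg (by simp [Hd.initial]), fun _ _ => rfl⟩, fun j =>
    ⟨fun s hs hT => ?_, ⟨⟨hrc _, trivial⟩, ⟨hrc _, trivial⟩, List.nodup_nil, by simp [Gh.initial]⟩,
      fun c => ?_⟩⟩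
  · obtain rfl : x = 0 := by simp [Hd.initial, Gh.initial] at hx; exact hx
    exact hrc 6
  · have hcb : (p.view mem wr).cb e = false := by
      rcases hh with hh | hh
      · simp only [view, hbit _ hh.2, Bool.and_false]
      · rw [hfl true _ (ok.sub_lt he) hh.1] at hh
        exact absurd hh.2 (by simp)
    simp [hcb, Gh.initial]
  · rw [hfl j s hs hT]
    obtain ⟨e, he, hes⟩ := ok.sub_surj hs
    cases j
    · simp only [true_iff]
      exact ⟨e, he, hes, by simp [Gh.Col, Gh.initial]⟩
    · simp [Gh.Col, Gh.initial]
  · simp only [Gh.initial, Hd.initial, List.append_nil, List.not_mem_nil, false_iff, id]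
    omega

theorem Ok.wp_initP (hA : A ≤ N) (hN : 131 ≤ N) {κ : ℕ} {s : State p.w} (hwr : s.written = ∅)
    (h0 : (2 ^ p.w - 1 + s.rg 0) % 2 ^ p.w = p.n - 1)
    (ht : (∀ i, 3 ≤ i → i < 3 + (κ - 1) → s.rg i = 0) →
      1 ≤ s.rg 2 ∧ p.t - 1 = min (s.rg 2 - 1) ((p.n - 1) / p.w))
    (ht' : ¬ (∀ i, 3 ≤ i → i < 3 + (κ - 1) → s.rg i = 0) → p.t - 1 = (p.n - 1) / p.w) :
    wp σ m N (initP κ B) (fun s' => Rest p Hd.initial Gh.initial s'.mem s'.written) s := by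
  obtain ⟨Y, b1, b2, b3, b4, b5, b6, b7, b8, b9, b10⟩ := ok.bounds
  have h64 := ok.w_ge
  have hY : 64 * (64 * p.w) ≤ Y := le_trans (by nlinarith) b2
  have c0 : ∀ t : State p.w, val σ t (.const 0) = 0 := fun t => ok.val_small _ (by omega)
  have c1 : ∀ t : State p.w, val σ t (.const 1) = 1 := fun t => ok.val_small _ (by omega)
  have c1' : ∀ t : State p.w, val σ t (1 : Expr) = 1 := c1
  have hPe := ok.P_eq
  have hpos := ok.pos_eq
  have hPw := ok.P_le_b
  have hpo := ok.po_lt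
  have hMp := ok.M_pos
  refine wp_assign_seq (v := p.n - 1) (by rw [val_sub, c1', val_reg, h0]) fun x hx => ?_
  refine wp_assign_seq rfl fun y hy => ?_
  have hy0 : y.toNat = 0 ↔ ∀ i, 3 ≤ i → i < 3 + (κ - 1) → s.rg i = 0 := by
    rw [hy, val_orE]
    refine forall_congr' fun i => imp_congr_right fun hi => ?_
    rw [rg_setR, if_neg (by omega)]
  rw [← hy0] at ht ht'
  refine wp_assign_seq rfl fun z hz => ?_
  have hz' : 1 ≤ s.rg 2 → z.toNat = s.rg 2 - 1 := fun h1 => by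
    rw [hz]
    exact val_sub_of_le _ _ _ (by rw [val_reg, rg_setR, if_neg (by omega), rg_setR,
      if_neg (by omega)]) (c1' _) h1
  refine wp_assign_seq (v := p.n - 1) (by
    rw [val_reg, rg_setR, if_neg (by omega), rg_setR, if_neg (by omega), rg_setR, if_pos rfl, hx])
    fun x' hx' => ?_
  generalize hs₁ : (((s.setR 0 x).setR 1 y).setR 3 z).setR 2 x' = s₁
  have q1 : s₁.rg 1 = y.toNat := by simp [← hs₁]
  have q2 : s₁.rg 2 = p.n - 1 := by simp [← hs₁, hx']
  have q3 : s₁.rg 3 = z.toNat := by simp [← hs₁]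
  have qw : s₁.written = ∅ := by simp [← hs₁, hwr]
  clear hs₁
  refine wp_call (ok.wp_envA hA s₁ q2) ?_
  rintro s₂ ⟨-, w₂, r11, r21, a₂⟩
  refine wp_assign_seq (v := (p.n - 1) / p.w) (by
    rw [val_div, val_reg, val_reg, r11, a₂ _ (by omega) (by omega) (by omega), q2]) fun u hu => ?_
  have e1 : val σ (s₂.setR 0 u) (Rg 1) = y.toNat := by
    rw [val_reg, rg_setR, if_neg (by omega), a₂ _ (by omega) (by omega) (by omega), q1]
  have e3 : val σ (s₂.setR 0 u) (Rg 3) = z.toNat := by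
    rw [val_reg, rg_setR, if_neg (by omega), a₂ _ (by omega) (by omega) (by omega), q3]
  have e0 : val σ (s₂.setR 0 u) (Rg 0) = (p.n - 1) / p.w := by
    rw [val_reg, rg_setR, if_pos rfl, hu]
  refine wp_call (R := fun s' => s'.written = ∅ ∧ s'.rg 3 = p.t - 1 ∧ s'.rg 2 = p.n - 1 ∧
    s'.rg 11 = p.w ∧ s'.rg 21 = p.l1) ?_ ?_
  · have hset : p.t - 1 = (p.n - 1) / p.w → wp σ m N (.assign 3 (Rg 0)) (fun s' =>
        s'.written = ∅ ∧ s'.rg 3 = p.t - 1 ∧ s'.rg 2 = p.n - 1 ∧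
          s'.rg 11 = p.w ∧ s'.rg 21 = p.l1) (s₂.setR 0 u) := fun hh => by
      refine wp_assign e0 fun x hx => ⟨by simp [w₂, qw], by simp [hx, hh], ?_, ?_, ?_⟩
      · simp [a₂ 2 (by omega) (by omega) (by omega), q2]
      · simp [r11]
      · simp [r21]
    refine wp_ite (fun hb => ?_) fun hb => ?_
    · rw [holds_eq, e1, c0] at hb
      obtain ⟨t1, t2⟩ := ht hb
      refine wp_ite (fun hb' => ?_) fun hb' => ?_
      · rw [holds_lt, e3, e0, hz' t1] at hb'
        refine wp_skip ⟨by simp [w₂, qw], ?_, ?_, ?_, ?_⟩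
        · rw [← val_reg (σ := σ), e3, hz' t1, t2, min_eq_left hb'.le]
        · simp [a₂ 2 (by omega) (by omega) (by omega), q2]
        · simp [r11]
        · simp [r21]
      · rw [holds_lt, e3, e0, hz' t1] at hb'
        exact hset (by rw [t2, min_eq_right (not_lt.1 hb')])
    · rw [holds_eq, e1, c0] at hb
      exact hset (ht' hb)
  rintro s₃ ⟨w₃, r3, r2, r11, r21⟩
  refine wp_call (ok.wp_envB (H := Hd.initial) s₃ r2 r3 r11 r21) ?_
  rintro s₄ ⟨-, w₄, q, a₄⟩
  have k12 : s₄.rg 12 = p.h := q 12 (by omega) (by omega)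
  refine wp_assign_seq (c0 _) fun x₁ hx₁ => ?_
  refine wp_assign_seq (v := p.h + 1) (val_add_of_lt _ _ _ (by rw [val_reg]; simpa using k12) (c1 _)
    (by omega)) fun x₂ hx₂ => ?_
  refine wp_call (wp_zero (a := 0) (b := p.h + 1) (by omega) _ (by simp [hx₁]) (by simp [hx₂])
    (by omega) (by omega) fun x _ hx => ok.lt_m ?_) ?_
  · have : x * p.w ≤ p.h * p.w := Nat.mul_le_mul_right _ (by omega)
    have : p.pos < p.P := by have := ok.n_pos; unfold P; omega
    omega
  rintro s₅ ⟨a₅, m₅, w₅⟩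
  have St₅ : ∀ i, 11 ≤ i → i ≤ 21 → s₅.rg i = p.rv Hd.initial i := fun i h1 h2 => by
    rw [a₅ i (by omega), rg_setR, if_neg (by omega), rg_setR, if_neg (by omega)]
    by_cases h11 : i = 11
    · subst h11; rw [a₄ _ (by omega) (by omega), r11]; rfl
    · by_cases h21 : i = 21
      · subst h21; rw [a₄ _ (by omega) (by omega), r21]; rfl
      · exact q i (by omega) (by omega)
  have k23 : s₅.rg 2 = p.n - 1 ∧ s₅.rg 3 = p.t - 1 := by
    constructor
    · rw [a₅ _ (by omega), rg_setR, if_neg (by omega), rg_setR, if_neg (by omega),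
        a₄ _ (by omega) (by omega), r2]
    · rw [a₅ _ (by omega), rg_setR, if_neg (by omega), rg_setR, if_neg (by omega),
        a₄ _ (by omega) (by omega), r3]
  have k11 : s₅.rg 11 = p.w := St₅ 11 (by omega) (by omega)
  have k14 : s₅.rg 14 = p.pw := St₅ 14 (by omega) (by omega)
  have k15 : s₅.rg 15 = p.po := St₅ 15 (by omega) (by omega)
  have k17 : s₅.rg 17 = p.M := St₅ 17 (by omega) (by omega)
  have k19 : s₅.rg 19 = p.K := St₅ 19 (by omega) (by omega)
  simp only [written_setR, w₄, w₃, Set.mem_empty_iff_false, or_false, Nat.zero_le, true_and] at w₅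
  simp only [Nat.zero_le, true_and] at m₅
  refine wp_assign_seq ((val_reg _ _).trans k14) fun x₃ hx₃ => ?_
  -- the end of the flags of the first chunk or, if there are more chunks, of its record
  refine wp_call (R := fun s' => s'.mem = s₅.mem ∧ s'.written = s₅.written ∧
    (∀ i < 60, s'.rg i = s₅.rg i) ∧ s'.rg 61 = p.pw ∧ ∃ e, s'.rg 62 = e ∧ p.pw < e ∧ e ≤ p.pw + 11 ∧
      (∀ x < e, x * p.w < p.b) ∧
      (∀ j, ∀ s < p.M0, p.flagPos j s / p.w < e) ∧ (1 < p.K → e = p.pw + 11)) ?_ ?_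
  · have r : ∀ i < 60, val σ (s₅.setR 61 x₃) (Rg i) = s₅.rg i := fun i hi => by
      rw [val_reg, rg_setR, if_neg (by omega)]
    refine wp_ite (fun hb => ?_) fun hb => ?_
    · rw [holds_eq, r _ (by omega), c1, k19] at hb
      have hM0 : p.M0 = p.M ∧ p.M ≤ p.w := by
        have h1 : (p.M - 1) / p.w = 0 := by unfold K at hb; omega
        rw [Nat.div_eq_zero_iff] at h1
        have : p.M ≤ p.w := by omega
        exact ⟨min_eq_left this, this⟩
      have hd : (p.po + 2 * p.M - 1) / p.w ≤ 2 := by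
        rw [← Nat.lt_add_one_iff, Nat.div_lt_iff_lt_mul (by omega)]; omega
      have hbb : p.b = p.P + 2 * p.M := by rw [b, if_pos hb]
      have hde : (p.P + 2 * p.M - 1) / p.w = p.pw + (p.po + 2 * p.M - 1) / p.w := by
        rw [hPe, show p.pw * p.w + p.po + 2 * p.M - 1 = p.po + 2 * p.M - 1 + p.pw * p.w by omega,
          Nat.add_mul_div_right _ _ (by omega), Nat.add_comm]
      refine wp_assign (v := p.pw + (p.po + 2 * p.M - 1) / p.w + 1) ?_ fun y hy =>
        ⟨rfl, rfl, fun i hi => ?_, ?_, p.pw + (p.po + 2 * p.M - 1) / p.w + 1,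
          by rw [rg_setR, if_pos rfl, hy], Nat.lt_succ_of_le (Nat.le_add_right _ _), by omega,
          fun x hx => ?_, fun j s hs => ?_, fun hh => by omega⟩
      · refine val_add_of_lt _ _ _ (val_add_of_lt _ _ _ ((r _ (by omega)).trans k14) ?_ ?_) (c1 _)
          (by omega)
        · rw [val_div, r _ (by omega), k11, val_sub_of_le (x := p.po + 2 * p.M) (y := 1) _ _ _
            (val_add_of_lt _ _ _ ((r _ (by omega)).trans k15)
              (val_mul_of_lt _ _ _ (ok.val_small _ (by omega)) ((r _ (by omega)).trans k17)
                (by omega)) (by omega)) (c1 _) (by omega)]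
        · omega
      · rw [rg_setR, if_neg (by omega), rg_setR, if_neg (by omega)]
      · simp [hx₃]
      · rw [← hde] at hx
        have h1 : x ≤ (p.P + 2 * p.M - 1) / p.w := by omega
        rw [Nat.le_div_iff_mul_le (by omega)] at h1
        omega
      · rw [← hde]
        refine Nat.lt_succ_of_le (Nat.div_le_div_right ?_)
        rw [ok.flagPos_zero hs]
        split <;> omega
    · rw [holds_eq, r _ (by omega), c1, k19] at hb
      have hK : 1 < p.K := by have := ok.K_pos; omega
      refine wp_assign (v := p.pw + 11) (val_add_of_lt _ _ _ ((r _ (by omega)).trans k14)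
        (ok.val_small _ (by omega)) (by omega)) fun y hy =>
        ⟨rfl, rfl, fun i hi => ?_, ?_, _, by rw [rg_setR, if_pos rfl, hy], by omega, le_rfl,
          fun x hx => ?_, fun j s hs => ?_, fun _ => rfl⟩
      · rw [rg_setR, if_neg (by omega), rg_setR, if_neg (by omega)]
      · simp [hx₃]
      · have h1 := ok.rec_lt hK ok.K_pos (k := 7) (by omega)
        have h2 : x * p.w ≤ (p.Q + 7) * p.w := Nat.mul_le_mul_right _ (by unfold Q; omega)
        rw [show p.Q + 8 * 0 + 7 + 1 = p.Q + 7 + 1 by omega, Nat.add_mul _ 1] at h1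
        omega
      · have := ok.flagPos_div_zero hs j
        unfold Q at this
        omega
  rintro s₆ ⟨m₆, w₆, a₆, k61, e, k62, e1, e2, e3, e4, e5⟩
  refine wp_call (wp_zero (by omega) s₆ k61 k62 e1.le (by omega)
    fun x _ hx => ok.lt_m (e3 x hx)) ?_
  rintro s₇ ⟨a₇, m₇, w₇⟩
  rw [w₆] at w₇
  rw [m₆] at m₇
  simp only [w₅] at w₇
  simp only [m₅] at m₇
  iterate 7 refine wp_assign_seq (by first | exact c0 _ | exact c1 _) fun _ _ => ?_
  have hbd : p.Bd s₇.written := ⟨(w₇ _).2 (Or.inl ⟨le_rfl, e1⟩), fun a ha =>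
    (w₇ _).2 (Or.inr (by omega))⟩
  have hinv : Inv p Hd.initial (p.view s₇.mem s₇.written) Gh.initial := by
    refine ok.initial_inv (fun a ha => ?_) (fun j s hs => ?_) fun hK k hk => ?_
    · rw [w₇] at ha
      rw [m₇]
      split_ifs <;> first | rfl | omega
    · rw [w₇]
      refine Or.inl ⟨Nat.div_le_div_right (ok.flagPos_ge j s), e4 j s hs⟩
    · rw [w₇, e5 hK]
      left; unfold Q; omega
  refine (ok.wp_storeHdr (H := Hd.initial) (ok.rv_le hinv.base fun j => (ok.cur_lt hinv j).1) _
    (fun i h1 h2 => ?_) (by simpa using hbd)).mono ?_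
  · have h27 : i < 11 ∨ s₇.rg i = p.rv Hd.initial i := by
      by_cases h : i < 11
      · exact Or.inl h
      · right; rw [a₇ i (by omega), a₆ i (by omega), St₅ i (by omega) h2]
    have k2 : s₇.rg 2 = p.n - 1 := by rw [a₇ _ (by omega), a₆ _ (by omega), k23.1]
    have k3 : s₇.rg 3 = p.t - 1 := by rw [a₇ _ (by omega), a₆ _ (by omega), k23.2]
    simp only [rg_setR]
    interval_cases i <;> first
      | exact k2
      | exact k3
      | exact h27.resolve_left (by omega)
      | (simp only [rv, Hd.initial]; simp; assumption)
  · rintro s₈ ⟨-, f2, f3, f4⟩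
    refine ⟨f2, f3, ?_⟩
    rw [f4]
    simpa using hinv

end Par
end ChoiceDict

/-! ### Correct behavior -/

namespace ChoiceDict

open WordRAM

/-- The data structure. The constant `B` relates the machine constant to the square root of the word
length. -/
def impl (κ B : ℕ) : Implementation where
  init := initP κ B
  insert := setOp B true
  delete := setOp B false
  contains := containsOp B
  choice := choiceOp B
  iterInit := initOp B
  iterNext := nextOp B
  iterMore := moreOp B

/-- The header and the ghost state represent the state `a` of the data type. The elements that remain
to be enumerated by an iteration are those of its color that are ahead of it. -/
structure Sem (p : Par) (H : Hd) (G : Gh) (a : AbsState) : Prop where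
  client : ∀ l, l ∈ a.client ↔ l ∈ Set.Icc 1 p.n ∧ G.X (l - 1)
  iter : ∀ j x, a.iter j = some x →
    (∀ l, l ∈ x.pending ↔ l ∈ a.colorSet p.n j ∧ Ahead p H G j (l - 1)) ∧
      x.certain ⊆ x.pending ∧
      ∀ l ∈ x.enumerated, l ∈ Set.Icc 1 p.n ∧ ¬ Ahead p H G j (l - 1)

theorem Step.isSome {n r : ℕ} {a a' : AbsState} {o : Op} (h : Step n a o r a') (j : Bool)
    (ha : (a.iter j).isSome) : (a'.iter j).isSome := by
  have hrel : a.Adapts n a' → (a'.iter j).isSome := fun h => by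
    have := h j
    cases hx : a.iter j with
    | none => simp [hx] at ha
    | some x =>
      rw [hx] at this
      generalize a'.iter j = y at this
      cases this
      simp
  have hupd : ∀ (i : Bool) (y : Iteration),
      (Function.update a.iter i (some y) j).isSome := fun i y => by
    by_cases hi : j = i
    · subst hi; simp
    · simp [hi, ha]
  cases o with
  | insert l => exact hrel h.2
  | delete l => exact hrel h.2
  | contains l => rw [h.1]; exact ha
  | choice i => rw [h.1]; exact ha
  | iterInit i =>
    have h : a' = _ := h
    rw [h]; exact hupd _ _
  | iterNext i =>
    obtain ⟨x, -, h | h⟩ := h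
    · rw [h.2]; exact hupd _ _
    · rw [h.2.2]; exact ha
  | iterMore i =>
    obtain ⟨x, -, h, -⟩ := h
    rw [h]; exact ha

theorem Behaves.started {n : ℕ} {h : List (Op × ℕ)} {a : AbsState} (hb : Behaves n h a) {j : Bool}
    (hj : ∃ r, (Op.iterInit j, r) ∈ h) : (a.iter j).isSome := by
  induction hb with
  | nil => simp at hj
  | snoc hb hs ih =>
    obtain ⟨r, hr⟩ := hj
    rcases List.mem_append.1 hr with hr | hr
    · exact hs.isSome j (ih ⟨r, hr⟩)
    · simp only [List.mem_singleton, Prod.mk.injEq] at hr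
      obtain ⟨rfl, rfl⟩ := hr
      have hs : _ = _ := hs
      rw [hs]
      simp

variable {p : Par} {H H' : Hd} {G G' : Gh} {a : AbsState}

theorem mem_colorSet {a : AbsState} (h : ∀ l, l ∈ a.client ↔ l ∈ Set.Icc 1 p.n ∧ G.X (l - 1))
    (j : Bool) (l : ℕ) : l ∈ a.colorSet p.n j ↔ l ∈ Set.Icc 1 p.n ∧ G.Col j (l - 1) := by
  cases j
  · simp only [AbsState.colorSet, Set.mem_sdiff, h, Gh.Col]
    simp
    tauto
  · simp only [AbsState.colorSet, h, Gh.Col]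
    simp

theorem lt_of_mem_Icc {l n : ℕ} (h : l ∈ Set.Icc 1 n) : l - 1 < n := by
  have := h.1; have := h.2; omega

theorem Sem.quiet (h : Sem p H G a) (hq : Quiet p H G H' G') : Sem p H' G' a := by
  have hc : ∀ l, l ∈ a.client ↔ l ∈ Set.Icc 1 p.n ∧ G'.X (l - 1) := by rw [hq.1]; exact h.client
  refine ⟨hc, fun j x hx => ?_⟩
  obtain ⟨h1, h2, h3⟩ := h.iter j x hx
  refine ⟨fun l => ?_, h2, fun l hl => ⟨(h3 l hl).1, fun ha => (h3 l hl).2 ?_⟩⟩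
  · rw [h1, mem_colorSet h.client]
    refine and_congr_right fun hl => ?_
    have hE := hq.2 j (l - 1) (lt_of_mem_Icc hl.1)
    exact ⟨hE.2 hl.2 ((hq.col j _).2 hl.2), hE.1⟩
  · exact (hq.2 j (l - 1) (lt_of_mem_Icc (h3 l hl).1)).1 ha

/-- The iterations adapt to a change of the client set. -/
theorem Sem.evolve (h : Sem p H G a) (hE : Evol p H G H' G') {S : Set ℕ}
    (hS : ∀ l, l ∈ S ↔ l ∈ Set.Icc 1 p.n ∧ G'.X (l - 1)) :
    ∃ a', a'.client = S ∧ a.Adapts p.n a' ∧ Sem p H' G' a' := by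
  let C : Bool → Set ℕ := fun j => (⟨S, a.iter⟩ : AbsState).colorSet p.n j
  let f : Bool → Iteration → Iteration := fun j x =>
    ⟨x.certain ∩ C j, x.enumerated, {l | l ∈ C j ∧ Ahead p H' G' j (l - 1)}⟩
  have hC : ∀ j l, l ∈ C j ↔ l ∈ Set.Icc 1 p.n ∧ G'.Col j (l - 1) := fun j l =>
    mem_colorSet (a := ⟨S, a.iter⟩) hS j l
  have hcol : ∀ j, AbsState.colorSet p.n ⟨S, fun j => (a.iter j).map (f j)⟩ j = C j := fun j => by
    cases j <;> rfl
  have hcert : ∀ j x, a.iter j = some x → (f j x).certain ⊆ (f j x).pending := by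
    rintro j x hx l ⟨hl, hlC⟩
    obtain ⟨h1, h2, -⟩ := h.iter j x hx
    obtain ⟨h4, h5⟩ := (h1 l).1 (h2 hl)
    rw [mem_colorSet h.client] at h4
    exact ⟨hlC, (hE j (l - 1) (lt_of_mem_Icc h4.1)).2 h4.2 ((hC j l).1 hlC).2 h5⟩
  refine ⟨⟨S, fun j => (a.iter j).map (f j)⟩, rfl, fun j => ?_, hS, fun j y hy => ?_⟩
  · rw [hcol]
    show Option.Rel _ (a.iter j) ((a.iter j).map (f j))
    cases hx : a.iter j with
    | none => exact Option.Rel.none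
    | some x =>
      refine Option.Rel.some ?_
      have hcx := hcert j x hx
      obtain ⟨h1, h2, h3⟩ := h.iter j x hx
      unfold Iteration.Adapts
      split
      · rename_i hCe
        have e1 : x.certain ∩ C j = x.certain := Set.inter_eq_left.2 fun l hl => by
          rw [hCe]; exact ((h1 l).1 (h2 hl)).1
        have e2 : {l | l ∈ C j ∧ Ahead p H' G' j (l - 1)} = x.pending := by
          ext l
          rw [h1, Set.mem_ofPred_eq, hCe]
          refine and_congr_right fun hl => ?_
          have hl' := (mem_colorSet h.client j l).1 hl
          have := hE j (l - 1) (lt_of_mem_Icc hl'.1)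
          rw [← hCe] at hl
          exact ⟨this.1, this.2 hl'.2 ((hC j l).1 hl).2⟩
        show (⟨x.certain ∩ C j, x.enumerated, _⟩ : Iteration) = x
        rw [e1, e2]
      · refine ⟨rfl, rfl, hcx, fun l hl => ⟨hl.1, fun hle => (h3 l hle).2 ?_⟩⟩
        exact (hE j (l - 1) (lt_of_mem_Icc (h3 l hle).1)).1 hl.2
  · obtain ⟨x, hx, rfl⟩ := Option.map_eq_some_iff.1 hy
    obtain ⟨h1, h2, h3⟩ := h.iter j x hx
    rw [hcol]
    refine ⟨fun l => Iff.rfl, hcert j x hx, fun l hl => ⟨(h3 l hl).1, fun ha => (h3 l hl).2 ?_⟩⟩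
    exact (hE j (l - 1) (lt_of_mem_Icc (h3 l hl).1)).1 ha

/-- A state in which a single iteration is replaced. -/
theorem Sem.update (h : Sem p H G a) {j : Bool} {x : Iteration} (hX : G'.X = G.X)
    (hx : (∀ l, l ∈ x.pending ↔ l ∈ a.colorSet p.n j ∧ Ahead p H' G' j (l - 1)) ∧
      x.certain ⊆ x.pending ∧
      ∀ l ∈ x.enumerated, l ∈ Set.Icc 1 p.n ∧ ¬ Ahead p H' G' j (l - 1))
    (ho : ∀ i ≠ j, ∀ e, Ahead p H' G' i e ↔ Ahead p H G i e) :
    Sem p H' G' { a with iter := Function.update a.iter j (some x) } := by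
  refine ⟨by rw [hX]; exact h.client, fun i y hy => ?_⟩
  have hcs : ({ a with iter := Function.update a.iter j (some x) } : AbsState).colorSet p.n i =
      a.colorSet p.n i := by cases i <;> rfl
  rw [hcs]
  by_cases hi : i = j
  · subst hi
    simp only [Function.update_self, Option.some.injEq] at hy
    rw [← hy]
    exact hx
  · simp only [Function.update_of_ne hi] at hy
    simp only [ho i hi]
    exact h.iter i y hy

theorem words_getD (w k x i : ℕ) :
    (words w k x).getD i 0 = if i < k then BitVec.ofNat w (x / 2 ^ (w * i)) else 0 := by
  unfold words
  split
  · rename_i h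
    rw [List.getD_eq_getElem _ _ (by simpa using h)]
    simp
  · rename_i h
    rw [List.getD_eq_default _ _ (by simpa using h)]

namespace Par

variable {σ : ℕ → ℕ} {m N : ℕ} {A B : ℕ} (ok : p.Ok σ A B m)
include ok

theorem Ok.arg {l : ℕ} (hl : l ∈ Set.Icc 1 p.n) (mem : ℕ → BitVec p.w) (wr : Set ℕ) :
    (2 ^ p.w - 1 + (callState (words p.w 2 l) mem wr).rg 0) % 2 ^ p.w = l - 1 := by
  have h : (callState (words p.w 2 l) mem wr).rg 0 = l % 2 ^ p.w := by
    show ((words p.w 2 l).getD 0 0).toNat = _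
    rw [words_getD, if_pos (by omega)]
    simp
  rw [h]
  have h1 := hl.1
  have h2 := hl.2
  have h3 := ok.n_le
  by_cases hlt : l < 2 ^ p.w
  · rw [Nat.mod_eq_of_lt hlt, show 2 ^ p.w - 1 + l = l - 1 + 2 ^ p.w by omega, Nat.add_mod_right,
      Nat.mod_eq_of_lt (by omega)]
  · rw [show l = 2 ^ p.w by omega, Nat.mod_self, Nat.add_zero, Nat.mod_eq_of_lt (by omega)]

/-- Every operation preserves the invariant and returns what the data type demands. -/
theorem Ok.wp_code (hA : A ≤ N) (hN : p.u ≤ N) {mem : ℕ → BitVec p.w} {wr : Set ℕ} {κ : ℕ}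
    {h : List (Op × ℕ)} {o : Op} (hl : Legal p.n h o) (hR : Rest p H G mem wr)
    (hS : Sem p H G a) (hB : Behaves p.n h a) :
    wp σ m N ((impl κ B).code o) (fun s' => ∃ H' G' a', Rest p H' G' s'.mem s'.written ∧
      Sem p H' G' a' ∧ Step p.n a o s'.result a') (callState (o.args p.w) mem wr) := by
  have hR' : ∀ l, Rest p H G (callState (w := p.w) l mem wr).mem
    (callState (w := p.w) l mem wr).written := fun _ => hR
  have hset : ∀ j l, l ∈ Set.Icc 1 p.n →
      wp σ m N (setOp B j) (fun s' => ∃ H' G' a', Rest p H' G' s'.mem s'.written ∧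
        Sem p H' G' a' ∧ a'.client = (if j then a.client ∪ {l} else a.client \ {l}) ∧
        a.Adapts p.n a') (callState (words p.w 2 l) mem wr) := by
    intro j l hl
    refine (ok.wp_setOp (j := j) hA hN (hR' _) (lt_of_mem_Icc hl) (ok.arg hl mem wr)).mono ?_
    rintro s' ⟨H', G', r, hX, hE⟩
    obtain ⟨a', h1, h2, h3⟩ := hS.evolve hE
      (S := if j then a.client ∪ {l} else a.client \ {l}) fun l' => by
        have hll : l' ∈ Set.Icc 1 p.n → (l' = l ↔ l' - 1 = l - 1) := fun h' => by
          have h1 := h'.1; have h2 := hl.1; omega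
        have hc := hS.client l'
        rw [hX]
        simp only [Gh.put]
        by_cases he : l' = l
        · subst he
          cases j
          · simp
          · simpa using hl
        · have : l' ∈ Set.Icc 1 p.n → ¬ l' - 1 = l - 1 := fun h' => (hll h').not.1 he
          split_ifs <;> cases j <;> simp_all
    exact ⟨H', G', a', r, h3, h1, h2⟩
  cases o with
  | insert l => exact (hset true l hl).mono fun s' ⟨H', G', a', h1, h2, h3⟩ => ⟨H', G', a', h1, h2, h3⟩
  | delete l => exact (hset false l hl).mono fun s' ⟨H', G', a', h1, h2, h3⟩ => ⟨H', G', a', h1, h2, h3⟩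
  | contains l =>
    refine (ok.wp_containsOp hA hN (hR' _) (lt_of_mem_Icc hl) (ok.arg hl mem wr)).mono ?_
    rintro s' ⟨H', G', r, q, hr⟩
    refine ⟨H', G', a, r, hS.quiet q, rfl, ?_⟩
    rw [hS.client]
    have hl : l ∈ Set.Icc 1 p.n := hl
    simp only [hl, true_and]
    exact hr
  | choice j =>
    refine (ok.wp_choiceOp (j := j) hA hN (hR' _)).mono ?_
    rintro s' ⟨H', G', r, q, hr⟩
    refine ⟨H', G', a, r, hS.quiet q, rfl, ?_⟩
    rcases hr with ⟨h1, h2⟩ | ⟨e, he, h1, h2⟩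
    · refine Or.inr ⟨Set.eq_empty_iff_forall_notMem.2 fun l hl => ?_, h1⟩
      rw [mem_colorSet hS.client] at hl
      exact h2 _ (lt_of_mem_Icc hl.1) hl.2
    · left
      rw [mem_colorSet hS.client, h1]
      exact ⟨⟨by omega, by omega⟩, h2⟩
  | iterInit j =>
    refine (ok.wp_initOp (j := j) hA (hR' _)).mono ?_
    rintro s' ⟨H', G', r, hX, h1, h2⟩
    refine ⟨H', G', _, r, hS.update (x := ⟨a.colorSet p.n j, ∅, a.colorSet p.n j⟩) hX
      ⟨fun l => ⟨fun hl => ⟨hl, ?_⟩, And.left⟩, subset_rfl, fun l hl => absurd hl (by simp)⟩ h2, rfl⟩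
    rw [mem_colorSet hS.client] at hl
    exact h1 _ (lt_of_mem_Icc hl.1) hl.2
  | iterNext j =>
    obtain ⟨x, hx⟩ := Option.isSome_iff_exists.1 (hB.started hl)
    refine (ok.wp_nextOp (j := j) hA hN (hR' _)).mono ?_
    rintro s' ⟨H₁, H', G', r, q, hr⟩
    have hS₁ := hS.quiet q
    obtain ⟨i1, i2, i3⟩ := hS₁.iter j x hx
    rcases hr with ⟨h1, rfl, h2⟩ | ⟨e, he, h1, h2, h3, h4, h5, h6, h7⟩
    · refine ⟨H', G', a, r, hS₁, x, hx, Or.inr ⟨?_, h1, rfl⟩⟩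
      refine Set.eq_empty_iff_forall_notMem.2 fun l hl => ?_
      rw [i1, mem_colorSet hS₁.client] at hl
      exact h2 _ (lt_of_mem_Icc hl.1.1) hl.1.2 hl.2
    · have hmem : e + 1 ∈ x.pending := by
        rw [i1, mem_colorSet hS₁.client]
        exact ⟨⟨⟨by omega, by omega⟩, h2⟩, h3⟩
      refine ⟨H', G', _, r, hS₁.update (x := ⟨x.certain \ {e + 1}, x.enumerated ∪ {e + 1},
        x.pending \ {e + 1}⟩) rfl ⟨fun l => ?_, Set.sdiff_subset_sdiff_left i2, fun l hl => ?_⟩ h7,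
        x, hx, Or.inl ?_⟩
      · show l ∈ x.pending ∧ l ≠ e + 1 ↔ _
        rw [i1, and_assoc]
        refine and_congr_right fun hl => ?_
        rw [mem_colorSet hS₁.client] at hl
        have hl1 := hl.1.1
        constructor
        · rintro ⟨ha, hne⟩
          exact h6 _ (lt_of_mem_Icc hl.1) hl.2 (by omega) ha
        · intro ha
          refine ⟨h5 j _ (lt_of_mem_Icc hl.1) ha, ?_⟩
          rintro rfl
          exact h4 ha
      · rcases hl with hl | rfl
        · exact ⟨(i3 l hl).1, fun ha => (i3 l hl).2 (h5 j _ (lt_of_mem_Icc (i3 l hl).1) ha)⟩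
        · exact ⟨⟨by omega, by omega⟩, h4⟩
      · rw [h1]
        exact ⟨hmem, rfl⟩
  | iterMore j =>
    obtain ⟨x, hx⟩ := Option.isSome_iff_exists.1 (hB.started hl)
    refine (ok.wp_moreOp (j := j) hA hN (hR' _)).mono ?_
    rintro s' ⟨H', G', r, q, hr⟩
    have hS₁ := hS.quiet q
    obtain ⟨i1, -, -⟩ := hS₁.iter j x hx
    refine ⟨H', G', a, r, hS₁, x, hx, rfl, ?_⟩
    rcases hr with ⟨h1, h2⟩ | ⟨h1, e, he, h2, h3⟩
    · refine Or.inr ⟨Set.eq_empty_iff_forall_notMem.2 fun l hl => ?_, h1⟩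
      rw [i1, mem_colorSet hS₁.client] at hl
      exact h2 _ (lt_of_mem_Icc hl.1.1) hl.1.2 hl.2
    · refine Or.inl ⟨⟨e + 1, ?_⟩, h1⟩
      rw [i1, mem_colorSet hS₁.client]
      exact ⟨⟨⟨by omega, by omega⟩, h2⟩, h3⟩

theorem Ok.wp_init_call (hA : A ≤ N) (hN : 131 ≤ N) {κ t : ℕ} (ht : 1 ≤ t)
    (htκ : t < 2 ^ (κ * p.w)) (hpt : p.t = min t ((p.n - 1) / p.w + 1)) (mem : ℕ → BitVec p.w) :
    wp σ m N (impl κ B).init (fun s' => Rest p Hd.initial Gh.initial s'.mem s'.written)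
      (callState (initArgs p.w κ p.n t) mem ∅) := by
  have hn := ok.n_pos
  have hnl := ok.n_le
  have hd := Nat.div_le_self (p.n - 1) p.w
  have hw2 : 0 < 2 ^ p.w := Nat.two_pow_pos _
  have hκ : 1 ≤ κ := by
    by_contra hk
    rw [show κ = 0 by omega, Nat.zero_mul, pow_zero] at htκ
    omega
  have hlen : (words p.w 2 p.n).length = 2 := by simp [words]
  have r0 : (callState (initArgs p.w κ p.n t) mem ∅).rg 0 =
      (callState (words p.w 2 p.n) mem ∅).rg 0 := by
    show ((initArgs p.w κ p.n t).getD 0 0).toNat = ((words p.w 2 p.n).getD 0 0).toNat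
    rw [initArgs, List.getD_append _ _ _ _ (by omega)]
  have rt : ∀ i < κ, (callState (initArgs p.w κ p.n t) mem ∅).rg (2 + i) =
      t / 2 ^ (p.w * i) % 2 ^ p.w := fun i hi => by
    show ((initArgs p.w κ p.n t).getD (2 + i) 0).toNat = _
    rw [initArgs, List.getD_append_right _ _ _ _ (by omega), hlen, Nat.add_sub_cancel_left,
      words_getD, if_pos hi]
    simp
  refine ok.wp_initP hA hN rfl ?_ (fun hz => ?_) fun hz => ?_
  · rw [r0]
    exact ok.arg ⟨hn, le_rfl⟩ mem ∅
  · have hlt : ∀ k, 1 ≤ k → k ≤ κ → t < 2 ^ (k * p.w) → t < 2 ^ p.w := by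
      intro k hk
      induction k, hk using Nat.le_induction with
      | base => intro _ h; simpa using h
      | succ k hk ih =>
        intro hkκ h
        refine ih (by omega) ?_
        have h1 := hz (2 + k) (by omega) (by omega)
        rw [rt k (by omega), Nat.mod_eq_of_lt] at h1
        · rw [Nat.mul_comm]
          exact (Nat.div_eq_zero_iff_lt (by positivity)).1 h1
        · rw [Nat.div_lt_iff_lt_mul (by positivity), ← pow_add, Nat.mul_comm p.w, Nat.add_comm,
            ← Nat.succ_mul]
          exact h
    have ht2 := hlt κ hκ le_rfl htκ
    have r2 := rt 0 (by omega)
    rw [Nat.mul_zero, pow_zero, Nat.div_one, Nat.mod_eq_of_lt ht2] at r2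
    rw [show 2 + 0 = 2 from rfl] at r2
    rw [r2]
    refine ⟨ht, ?_⟩
    generalize (p.n - 1) / p.w = d at *
    omega
  · have : 2 ^ p.w ≤ t := by
      by_contra hlt
      refine hz fun i hi hi' => ?_
      have := rt (i - 2) (by omega)
      rw [show 2 + (i - 2) = i by omega] at this
      rw [this, Nat.div_eq_of_lt, Nat.zero_mod]
      refine (not_le.1 hlt).trans_le (Nat.pow_le_pow_right (by omega) ?_)
      exact Nat.le_mul_of_pos_right _ (by omega)
    generalize (p.n - 1) / p.w = d at *
    omega

/-- Only the bits of the data structure matter. -/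
theorem Ok.rest_congr {mem mem' : ℕ → BitVec p.w} {wr : Set ℕ} (hR : Rest p H G mem wr)
    (hm : ∀ q < p.b, memBit mem' q = memBit mem q) : Rest p H G mem' wr := by
  have hw := ok.w_pos
  have hpb : p.pos < p.b := ok.client_lt_b (e := 0) ok.n_pos
  have hbit : ∀ k i, i < p.w → k * p.w + i < p.b → (mem' k).toNat.testBit i = (mem k).toNat.testBit i := by
    intro k i hi hk
    have := hm (k * p.w + i) hk
    rwa [memBit_eq _ hi, memBit_eq _ hi] at this
  refine ⟨?_, hR.bd, ?_⟩
  · have := hR.hdr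
    unfold HdOk at this ⊢
    split
    · rename_i hl
      rw [if_pos hl] at this
      rw [← this]
      refine Nat.eq_of_testBit_eq fun i => ?_
      rw [Nat.testBit_mod_two_pow, Nat.testBit_mod_two_pow]
      by_cases hi : i < 10 * p.l1
      · rw [hbit 0 i (by omega) (by unfold pos at hpb; omega)]
      · simp [hi]
    · rename_i hl
      rw [if_neg hl] at this
      have he : ∀ k ≤ 9, mem' k = mem k := fun k hk => by
        refine BitVec.eq_of_getLsbD_eq fun i hi => ?_
        have hk9 : k * p.w ≤ 9 * p.w := Nat.mul_le_mul_right _ hk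
        exact hbit k i hi (by unfold pos at hpb; omega)
      exact ⟨by rw [he 0 (by omega)]; exact this.1, fun k h1 h2 => by rw [he k h2, this.2 k h1 h2]⟩
  · rw [ok.view_congr (fun q _ hq => hm q hq) fun _ _ => Iff.rfl]
    exact hR.inv

/-- All histories that can occur are correct, and between operations the invariant holds. -/
theorem Ok.reach {κ t : ℕ} (ht : 1 ≤ t) (htκ : t < 2 ^ (κ * p.w))
    (hpt : p.t = min t ((p.n - 1) / p.w + 1)) {mem : ℕ → BitVec p.w} {wr : Set ℕ}
    {h : List (Op × ℕ)} (hr : Reach (impl κ B) σ p.w κ p.n t p.b mem wr h) :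
    ∃ H G a, Rest p H G mem wr ∧ Sem p H G a ∧ Behaves p.n h a := by
  obtain rfl := ok.m_eq
  induction hr with
  | init he =>
    obtain ⟨s', c', he', -, hR⟩ := ok.wp_init_call (N := A + 131) (by omega) (by omega) ht htκ hpt _
    obtain ⟨rfl, -⟩ := he.det he'
    refine ⟨_, _, AbsState.initial, hR, ⟨fun l => ?_, fun j x hx => ?_⟩, .nil⟩
    · simp [AbsState.initial, Gh.initial]
    · simp [AbsState.initial] at hx
  | forget _ hm ih =>
    obtain ⟨H, G, a, h1, h2⟩ := ih
    exact ⟨H, G, a, ok.rest_congr h1 hm, h2⟩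
  | call _ hl he ih =>
    obtain ⟨H, G, a, h1, h2, h3⟩ := ih
    obtain ⟨s', c', he', -, H', G', a', q1, q2, q3⟩ :=
      ok.wp_code (N := A + p.u) (κ := κ) (by omega) (by omega) hl h1 h2 h3
    obtain ⟨rfl, -⟩ := he.det he'
    exact ⟨H', G', a', q1, q2, .snoc h3 q3⟩

theorem Ok.isSystematic {κ t c₀ c₁ : ℕ} (ht : 1 ≤ t) (htκ : t < 2 ^ (κ * p.w))
    (hpt : p.t = min t ((p.n - 1) / p.w + 1))
    (h₀ : (impl κ B).init.c0 + (A + 131) * (impl κ B).init.c1 ≤ c₀)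
    (h₁ : ∀ o, ((impl κ B).code o).c0 + (A + p.u) * ((impl κ B).code o).c1 ≤ c₁) :
    IsSystematic (impl κ B) σ p.w κ p.n t p.b p.pos c₀ c₁ := by
  have hm := ok.m_eq
  refine ⟨fun mem => ?_, fun mem wr h o hr hl => ?_, by
    have := ok.P_le_b; unfold P at this; omega,
    fun mem wr h hr => ?_⟩
  · obtain ⟨s, c, h1, h2, -⟩ := ok.wp_init_call (N := A + 131) (by omega) (by omega) ht htκ hpt mem
    exact ⟨s, c, hm ▸ h1, h2.trans h₀⟩
  · obtain ⟨H, G, a, q1, q2, q3⟩ := ok.reach ht htκ hpt hr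
    obtain ⟨s, c, h1, h2, -⟩ := ok.wp_code (N := A + p.u) (κ := κ) (by omega) (by omega) hl q1 q2 q3
    exact ⟨s, c, hm ▸ h1, h2.trans (h₁ o)⟩
  · obtain ⟨H, G, a, q1, q2, q3⟩ := ok.reach ht htκ hpt hr
    refine ⟨a, q3, fun l hl hlw => ?_⟩
    have he := lt_of_mem_Icc hl
    have := q1.inv.base.honest (l - 1) he (Or.inl ⟨he, hlw⟩)
    rw [q2.client, ← this]
    simp [view, he, hl]

end Par
end ChoiceDict

/-! ### Space, and the choice of the constants -/

namespace ChoiceDict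

open WordRAM

/-- The number of bits, up to the number of blocks. -/
theorem Par.b_le_of (p : Par) (hw : 1 ≤ p.w) : p.b ≤ p.P + 2 + 19 * (p.M - 1) := by
  have hM : p.M - 1 + 1 = p.M := by unfold M; omega
  unfold b
  split
  · omega
  · rename_i hK
    have hd : 1 ≤ (p.M - 1) / p.w := by
      unfold K at hK
      generalize (p.M - 1) / p.w = d at *
      omega
    have h1 : p.w ≤ p.M - 1 := by
      have := (Nat.le_div_iff_mul_le (by omega)).1 hd
      omega
    have h2 : p.w * p.pw ≤ p.P := Nat.mul_div_le _ _
    have h3 : p.w * ((p.M - 1) / p.w) ≤ p.M - 1 := Nat.mul_div_le _ _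
    calc p.w * (p.Q + 8 * p.K) = p.w * p.pw + 8 * (p.w * ((p.M - 1) / p.w)) + 11 * p.w := by
          unfold Q K; ring
      _ ≤ _ := by omega

theorem size_le_logb {n : ℕ} (hn : 1 ≤ n) : (Nat.size (n - 1) : ℝ) ≤ Real.logb 2 (n + 1) + 1 := by
  have hl : (0 : ℝ) ≤ Real.logb 2 (n + 1) :=
    Real.logb_nonneg (by norm_num) (by linarith [(Nat.cast_nonneg n : (0 : ℝ) ≤ n)])
  cases hs : Nat.size (n - 1) with
  | zero => simp; linarith
  | succ k =>
    have h1 : 2 ^ k ≤ n - 1 := Nat.lt_size.1 (by omega)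
    have h2 : (2 : ℝ) ^ k ≤ n + 1 := by exact_mod_cast (by omega : 2 ^ k ≤ n + 1)
    have : (k : ℝ) ≤ Real.logb 2 (n + 1) := by
      rw [Real.le_logb_iff_rpow_le (by norm_num) (by positivity), Real.rpow_natCast]
      exact h2
    push_cast
    linarith

theorem one_le_logb {n : ℕ} (hn : 1 ≤ n) : 1 ≤ Real.logb 2 (n + 1) := by
  rw [Real.le_logb_iff_rpow_le (by norm_num) (by positivity), Real.rpow_one]
  have : (1 : ℝ) ≤ n := by exact_mod_cast hn
  linarith

/-- The number of bits. If there is more than one chunk, a block takes at most `19` bits in addition to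
the client bits: eight for its share of a record, and the rest to make up for rounding. A bound of
`n / (t * w)` amounts to `32` bits for each block of `32 * t` words. -/
theorem space_le {w n t : ℕ} (hw : 1 ≤ w) (hn : 1 ≤ n) (ht : 1 ≤ t) :
    ((⟨w, n, min t ((n - 1) / w + 1)⟩ : Par).b : ℝ) ≤
      n + n / (t * w) + 388 * Real.logb 2 (n + 1) := by
  set t' := min t ((n - 1) / w + 1) with ht'
  have h1 := Par.b_le_of ⟨w, n, t'⟩ hw
  have hM : (⟨w, n, t'⟩ : Par).M - 1 = ((⟨w, n, t'⟩ : Par).ph + (n - 1)) / (w * (32 * t')) := by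
    rw [← Nat.div_div_eq_div_mul]; rfl
  have hph : (⟨w, n, t'⟩ : Par).ph < w := Nat.mod_lt _ hw
  have hP : (⟨w, n, t'⟩ : Par).P = 128 * (Nat.size (n - 1) + 1) + n := rfl
  have ht1 : 1 ≤ t' := le_min ht (Nat.le_add_left 1 _)
  have hwr : (0 : ℝ) < w := by exact_mod_cast hw
  have htr : (1 : ℝ) ≤ t' := by exact_mod_cast ht1
  have htr' : (0 : ℝ) < t := by exact_mod_cast ht
  have hnr : (0 : ℝ) ≤ n := Nat.cast_nonneg n
  have h2 : (((⟨w, n, t'⟩ : Par).M - 1 : ℕ) : ℝ) ≤ (n / (t' * w) + 1) / 32 := by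
    rw [hM]
    refine Nat.cast_div_le.trans ?_
    have h3 : (((⟨w, n, t'⟩ : Par).ph + (n - 1) : ℕ) : ℝ) ≤ n + w := by
      exact_mod_cast (by omega : (⟨w, n, t'⟩ : Par).ph + (n - 1) ≤ n + w)
    have h4 : (n + w : ℝ) ≤ n + t' * w := by nlinarith
    push_cast
    calc _ ≤ (n + t' * w : ℝ) / (w * (32 * t')) := by
          push_cast at h3
          exact div_le_div_of_nonneg_right (h3.trans h4) (by positivity)
      _ = _ := by field_simp
  have h3 : (n : ℝ) / (t' * w) ≤ n / (t * w) + 1 := by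
    rcases min_choice t ((n - 1) / w + 1) with h | h
    · rw [ht', h]; linarith
    · have h5 : n ≤ t' * w := by
        rw [ht', h]
        have := Nat.lt_div_mul_add (a := n - 1) (b := w) (by omega)
        rw [Nat.add_mul]; omega
      have h6 : (n : ℝ) ≤ t' * w := by exact_mod_cast h5
      have h7 : (n : ℝ) / (t' * w) ≤ 1 := div_le_one_of_le₀ h6 (by positivity)
      have : (0 : ℝ) ≤ n / (t * w) := by positivity
      linarith
  have h4 : ((⟨w, n, t'⟩ : Par).b : ℝ) ≤
      128 * (Nat.size (n - 1) + 1) + n + 2 + 19 * (((⟨w, n, t'⟩ : Par).M - 1 : ℕ) : ℝ) := by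
    rw [hP] at h1
    exact_mod_cast h1
  have h5 := size_le_logb hn
  have h6 := one_le_logb hn
  have h7 : (0 : ℝ) ≤ n / (t * w) := by positivity
  linarith

/-- The machine constant yields fields of a suitable width on all but finitely many machines. -/
theorem exists_wordOK {σ : ℕ → ℕ} {α β : ℝ} (hα : 0 < α)
    (hσ : ∀ w : ℕ, 1 ≤ w → α * Real.sqrt w ≤ σ w ∧ (σ w : ℝ) ≤ β * Real.sqrt w) :
    ∃ A B w₀ : ℕ, ∀ w, w₀ ≤ w → WordOK σ A B w := by
  obtain ⟨B, hB⟩ := exists_nat_ge (2 * β + 1)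
  have hβ : α ≤ β := by
    have := hσ 1 le_rfl
    simp at this
    linarith
  have hB0 : (0 : ℝ) < B := by linarith
  obtain ⟨A, hA⟩ := exists_nat_ge (2 * (B / α) ^ 2)
  obtain ⟨k, hk⟩ := exists_nat_ge ((9 * B / α) ^ 2)
  refine ⟨A, B, 64 + B + k, fun w hw => ?_⟩
  obtain ⟨h1, h2⟩ := hσ w (by omega)
  set r := Real.sqrt w with hr
  have hrr : r * r = w := Real.mul_self_sqrt (Nat.cast_nonneg w)
  have hr0 : 0 ≤ r := Real.sqrt_nonneg _
  have hw64 : (64 : ℝ) ≤ w := by exact_mod_cast (by omega : 64 ≤ w)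
  have hr8 : 8 ≤ r := Real.le_sqrt_of_sq_le (by norm_num; linarith)
  have hkw : (9 * B / α) ^ 2 ≤ w := hk.trans (by exact_mod_cast (by omega : k ≤ w))
  have hr9 : 9 * B / α ≤ r := Real.le_sqrt_of_sq_le hkw
  have hr9' : 9 * B ≤ α * r := by
    rw [div_le_iff₀ hα] at hr9; linarith
  have hBn : 0 < B := by exact_mod_cast hB0
  have hpow := Par.pow_ge (w := w) (by omega)
  have hww : w ≤ w * w := Nat.le_mul_self w
  set f := σ w / B with hf
  have f1 : (f : ℝ) * B ≤ σ w := by exact_mod_cast Nat.div_mul_le_self _ _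
  have f2 : (σ w : ℝ) < (f + 1) * B := by
    exact_mod_cast (by rw [Nat.add_mul, Nat.one_mul]; exact Nat.lt_div_mul_add hBn :
      σ w < (f + 1) * B)
  have f3 : α * r < (f + 1) * B := h1.trans_lt f2
  have f8 : 8 ≤ f := by
    have : (9 : ℝ) < f + 1 := by
      by_contra hc
      have := mul_le_mul_of_nonneg_right (not_lt.1 hc) hB0.le
      linarith
    have : 9 < f + 1 := by exact_mod_cast this
    omega
  have f8' : (8 : ℝ) ≤ f := by exact_mod_cast f8
  -- the fields have at most `√w / 2` bits
  have f4 : 2 * (f : ℝ) ≤ r := by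
    have h3 : 2 * (f : ℝ) * B ≤ r * B := by nlinarith
    exact le_of_mul_le_mul_right h3 hB0
  refine ⟨?_, ?_, hBn, f8, ?_, ?_, by omega⟩
  · have h3 : (σ w : ℝ) ≤ (B * w : ℕ) := by
      push_cast
      have : r ≤ w := by nlinarith
      nlinarith
    have h4 : σ w ≤ B * w := by exact_mod_cast h3
    have h5 : B * w ≤ w * w := Nat.mul_le_mul_right _ (by omega)
    have : 0 < w := by omega
    nlinarith
  · nlinarith
  · have : (f : ℝ) * (f + 2) < w := by nlinarith
    exact_mod_cast this
  · have h3 : ((f - 2 : ℕ) : ℝ) = f - 2 := by rw [Nat.cast_sub (by omega)]; norm_num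
    have h4 : (f : ℝ) * (f - 2) * 2 ≥ (f + 1) * (f + 1) := by nlinarith
    have h5 : (α * r) * (α * r) ≤ ((f + 1) * B) * ((f + 1) * B) :=
      mul_self_le_mul_self (by positivity) f3.le
    have h6 : α ^ 2 * w ≤ 2 * (f * (f - 2)) * (B : ℝ) ^ 2 := by
      calc α ^ 2 * w = (α * r) * (α * r) := by rw [← hrr]; ring
        _ ≤ _ := h5
        _ = (f + 1) * (f + 1) * (B : ℝ) ^ 2 := by ring
        _ ≤ _ := by
          have := mul_le_mul_of_nonneg_right h4 (sq_nonneg (B : ℝ))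
          linarith
    have h7 : (w : ℝ) ≤ 2 * (B / α) ^ 2 * (f * (f - 2)) := by
      rw [div_pow, ← mul_div_assoc, div_mul_eq_mul_div, le_div_iff₀ (by positivity)]
      linarith
    have h8 : (w : ℝ) ≤ A * (f * (f - 2)) :=
      h7.trans (mul_le_mul_of_nonneg_right hA (by nlinarith))
    rw [← h3] at h8
    exact_mod_cast h8

/-- The times of the operations, up to a factor of the tradeoff parameter. -/
theorem exists_cost (κ A B : ℕ) : ∃ C, ∀ o,
    ((impl κ B).code o).c0 + (A + 32) * ((impl κ B).code o).c1 ≤ C := by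
  let f : Prog → ℕ := fun P => P.c0 + (A + 32) * P.c1
  let D := impl κ B
  refine ⟨f D.insert + f D.delete + f D.contains + (f (D.choice true) + f (D.choice false)) +
    (f (D.iterInit true) + f (D.iterInit false)) + (f (D.iterNext true) + f (D.iterNext false)) +
    (f (D.iterMore true) + f (D.iterMore false)), fun o => ?_⟩
  show f (D.code o) ≤ _
  rcases o with l | l | l | j | j | j | j
  · show f D.insert ≤ _; omega
  · show f D.delete ≤ _; omega
  · show f D.contains ≤ _; omega
  · show f (D.choice j) ≤ _; cases j <;> omega
  · show f (D.iterInit j) ≤ _; cases j <;> omega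
  · show f (D.iterNext j) ≤ _; cases j <;> omega
  · show f (D.iterMore j) ≤ _; cases j <;> omega

end ChoiceDict

theorem mainTheorem2 (σ : ℕ → ℕ) (α β : ℝ) (hα : 0 < α)
    (hσ : ∀ w : ℕ, 1 ≤ w → α * Real.sqrt w ≤ σ w ∧ (σ w : ℝ) ≤ β * Real.sqrt w) (κ : ℕ) :
    ∃ (D : ChoiceDict.Implementation) (pos : ℕ → ℕ) (space : ℕ → ℕ → ℕ → ℕ) (C : ℕ),
      ∀ w n t : ℕ, 1 ≤ w → 1 ≤ n → n ≤ 2 ^ w → 1 ≤ t → t < 2 ^ (κ * w) →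
        (space w n t : ℝ) ≤ n + n / (t * w) +
          C * (n / ((t : ℝ) * w) ^ 2 + Real.logb 2 (n + 1)) ∧
        (space w n t ≤ w * 2 ^ w →
          ChoiceDict.IsSystematic D σ w κ n t (space w n t) (pos n) C (C * t)) := by
  obtain ⟨A, B, w₀, hw₀⟩ := ChoiceDict.exists_wordOK hα hσ
  obtain ⟨C₁, hC₁⟩ := ChoiceDict.exists_cost κ A B
  obtain ⟨C₀, hC₀⟩ : ∃ C₀, (ChoiceDict.impl κ B).init.c0 +
      (A + 131) * (ChoiceDict.impl κ B).init.c1 = C₀ := ⟨_, rfl⟩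
  -- For `w < w₀`, the number of bits is a constant that exceeds the addressable memory.
  refine ⟨ChoiceDict.impl κ B, fun n => 128 * (Nat.size (n - 1) + 1),
    fun w n t => if w < w₀ then w * 2 ^ w + 1
      else (⟨w, n, min t ((n - 1) / w + 1)⟩ : ChoiceDict.Par).b,
    w₀ * 2 ^ w₀ + 1 + 388 + C₀ + C₁, fun w n t hw hn hnw ht htκ => ⟨?_, fun hs => ?_⟩⟩
  · have h1 := ChoiceDict.one_le_logb hn
    have h2 : (0 : ℝ) ≤ n / (t * w) := by positivity
    have h3 : (0 : ℝ) ≤ n / ((t : ℝ) * w) ^ 2 := by positivity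
    have h4 : (0 : ℝ) ≤ n := Nat.cast_nonneg n
    set L := Real.logb 2 ((n : ℝ) + 1)
    set c := w₀ * 2 ^ w₀ + 1 + 388 + C₀ + C₁ with hc
    have hcL : ∀ x : ℕ, x ≤ c → (x : ℝ) * L ≤ c * (n / ((t : ℝ) * w) ^ 2 + L) := fun x hx => by
      have : (x : ℝ) ≤ c := by exact_mod_cast hx
      exact mul_le_mul this (by linarith) (by linarith) (by positivity)
    beta_reduce
    split
    · rename_i hlt
      have h5 : w * 2 ^ w ≤ w₀ * 2 ^ w₀ :=
        Nat.mul_le_mul hlt.le (Nat.pow_le_pow_right (by norm_num) hlt.le)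
      have h6 := hcL (w * 2 ^ w + 1) (by omega)
      have h7 : ((w * 2 ^ w + 1 : ℕ) : ℝ) ≤ ((w * 2 ^ w + 1 : ℕ) : ℝ) * L :=
        le_mul_of_one_le_right (Nat.cast_nonneg _) h1
      linarith
    · have h5 := ChoiceDict.space_le (w := w) hw hn ht
      have h6 := hcL 388 (by omega)
      push_cast at h6
      linarith
  · beta_reduce at hs ⊢
    split at hs
    · omega
    · rename_i hlt
      rw [if_neg hlt]
      have ok : (⟨w, n, min t ((n - 1) / w + 1)⟩ : ChoiceDict.Par).Ok σ A B
          (ChoiceDict.numWords w (⟨w, n, min t ((n - 1) / w + 1)⟩ : ChoiceDict.Par).b) :=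
        ⟨hw₀ w (not_lt.1 hlt), hn, hnw, le_min ht (Nat.le_add_left 1 _), min_le_right _ _, rfl, hs⟩
      refine ok.isSystematic ht htκ rfl (hC₀.le.trans (by omega)) fun o => ?_
      have h1 := hC₁ o
      have h2 : min t ((n - 1) / w + 1) ≤ t := min_le_left _ _
      have h3 : (⟨w, n, min t ((n - 1) / w + 1)⟩ : ChoiceDict.Par).u ≤ 32 * t :=
        Nat.mul_le_mul_left _ h2
      have h4 : (A + (⟨w, n, min t ((n - 1) / w + 1)⟩ : ChoiceDict.Par).u) ≤ (A + 32) * t := by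
        have := Nat.mul_le_mul_left A ht
        rw [Nat.add_mul]; omega
      set P := (ChoiceDict.impl κ B).code o
      calc _ ≤ P.c0 + (A + 32) * t * P.c1 := by gcongr
        _ ≤ P.c0 * t + (A + 32) * t * P.c1 := by
          gcongr
          exact Nat.le_mul_of_pos_right _ ht
        _ = (P.c0 + (A + 32) * P.c1) * t := by ring
        _ ≤ _ := Nat.mul_le_mul_right _ (h1.trans (by omega))
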